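/- **Setting.** Let $\ell,b\ge 1$ and $d=\ell b$, so $\ell=d/b$. A sketch of $v\in\mathbb R^n$ consists of $d$ linear measurements (buckets) $c_t=\langle\mu_t,v\rangle$ with random $\mu_t\in\{-1,0,1\}^n$. In *CountSketch* the buckets are pairs $t=(r,j)\in[\ell]\times[b]$ and $\mu_{(r,j)}[i]=\mathbf 1\{h_r(i)=j\}\,s_r(i)$ with fully independent uniform $h_r(i)\in[b]$, $s_r(i)\in\{\pm1\}$. In *BCountSketch* all entries $\mu_t[i]$ are independent, equal to $0$ with probability $1-1/b$ and to $\pm1$ with probability $1/(2b)$ each. Let $T_i=\{t:\mu_t[i]\ne0\}$. A key $i$ is a *$k$-heavy hitter* of $v$ if $v[i]^2>\frac1k\|v_{\mathrm{tail}[k]}\|_2^2$, where $v_{\mathrm{tail}[k]}$ is $v$ with its $k$ entries of largest magnitude replaced by $0$. An estimator answers a query $v$ from the sketch of $v$ (and the $\mu_t$) by a set of keys; the answer is *wrong* if it misses a $k$-heavy hitter of $v$. An *attack with $Q$ queries and success probability $p$* is an analyst, fixed independently of the randomness of the sketch and of the estimator, who adaptively poses at most $Q$ queries, each depending on the previous answers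 only, such that with probability at least $p$ the answer to the last query posed is wrong. **Estimators.** * *Median estimator*: $\hat v[i]$ is the median of $\{\mu_t[i]c_t: t\in T_i\}$; report $k'$ keys with largest $|\hat v[i]|$ (any tie-breaking). * *Basic threshold sign-alignment estimator* with threshold $\tau$: report $i$ if $\max(\hat p^+,\hat p^-)\ge\tau$, where $\hat p^{\sigma}=\frac1\ell\,|\{t:\sigma\,\mu_t[i]\,c_t>0\}|$. * *Robust threshold sign-alignment estimator* with threshold $\tau$, access limit $L$, query bound $m\ge L\ge1$ and constants $C_1,C_2$: put $\varepsilon=C_1/\sqrt L$, $\delta=C_2/(nmbL)$, $B=\frac1\varepsilon\log\frac1\delta$, $\Delta=B\log B$. Each bucket has an access count, initially $0$ and kept between queries; a bucket is active while its count is $<L$. For each query and each key $i=1,\dots,n$, and for $\sigma=+$ and then $\sigma=-$, let $N$ be the number of active buckets with $\sigma\mu_t[i]c_t>0$, draw fresh independent noise $x\sim\mathrm{Lap}(10\Delta)$, $y\sim\mathrm{Lap}(B)$, and test whether $N+x+\min\{\Delta,y\}\ge\ell\tau$; if so, the counts of these $N$ buckets are increased by one. Key $i$ is reported if at least one of its two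 tests is positive. **Theorem.** Each of the following holds for both CountSketch and BCountSketch. 1. *(Median.)* For all $\kappa\in\mathbb R$ and $c>0$ there are $C>0$ and $\ell_0$ such that for all $\ell\ge\ell_0$, $b,k\ge1$, $k'\ge 0$, $n$ with $3k'\le b\le\kappa k$, $n\ge C b\ell^3$ and $\ell\ge C\log n$, the median estimator admits an attack with at most $C\ell$ queries and success probability at least $1-\ell^{-c}$. 2. *(Basic threshold.)* For all $\tau\in(\frac12,1)$, $\kappa\in\mathbb R$ and $c>0$ there are $C>0$ and $\ell_0$ such that for all $\ell\ge\ell_0$, $b,k\ge1$, $n$ with $b\le\kappa k$ and $n\ge C b\ell^3$, the basic threshold estimator with threshold $\tau$ admits an attack with at most $C\ell$ queries and success probability at least $1-\ell^{-c}$. 3. *(Robust threshold.)* For all $C_1,C_2>0$, $\tau\in(\frac12,1)$ and $c>0$ there are $C>0$ and $\ell_0$ such that for all $\ell\ge\ell_0$, $b,k\ge1$, $n\ge\ell$ and $m\ge L\ge1$, the robust threshold estimator with these parameters admits an attack with at most $C\ell^2$ queries and success probability at least $1-\ell^{-c}$. -/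

import Mathlib

open MeasureTheory ProbabilityTheory Finset

noncomputable section

namespace SketchAttack

/-! ## Heavy hitters -/

/-- `S` consists of the `k` entries of `f` of largest magnitude (all entries if `n ≤ k`), ties being
broken in some way. -/
def IsTopSet {n : ℕ} (f : Fin n → ℝ) (k : ℕ) (S : Finset (Fin n)) : Prop :=
  S.card = min k n ∧ ∀ i ∈ S, ∀ j ∉ S, |f j| ≤ |f i|

/-- Key `i` is an `ℓ₂`-`k`-heavy hitter of `v`: `v[i]² > (1/k) ‖v_tail[k]‖²`, where the `k`-tail is
obtained by zeroing the `k` entries of largest magnitude. The norm of the tail does not depend on how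
ties are broken. -/
def IsHeavyHitter {n : ℕ} (k : ℕ) (v : Fin n → ℝ) (i : Fin n) : Prop :=
  ∃ S : Finset (Fin n), IsTopSet v k S ∧ (1 / (k : ℝ)) * ∑ j ∈ Sᶜ, v j ^ 2 < v i ^ 2

/-- A reported set `K` is wrong for `v` if it misses a heavy hitter. -/
def IsWrong {n : ℕ} (k : ℕ) (v : Fin n → ℝ) (K : Finset (Fin n)) : Prop :=
  ∃ i, IsHeavyHitter k v i ∧ i ∉ K

/-! ## CountSketch and BCountSketch

There are `d = ℓ * b` buckets, indexed by `Fin ℓ × Fin b`. -/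

/-- The index set of the `d = ℓ * b` buckets. -/
abbrev Bucket (ℓ b : ℕ) : Type := Fin ℓ × Fin b

/-- The measurement vectors `μ_t ∈ {-1, 0, 1}ⁿ`. -/
abbrev Measurements (n ℓ b : ℕ) : Type := Bucket ℓ b → Fin n → ℤ

/-- A random sign. -/
def sgn (s : Bool) : ℤ := if s then 1 else -1

inductive SketchKind
  | countSketch
  | bCountSketch

/-- The measurement vectors of `CountSketch`: in row `r`, key `i` participates only in the bucket
`h_r(i)`, with the sign `s_r(i)`. -/
def countMeasurements {n ℓ b : ℕ} (hs : Fin ℓ → Fin n → Fin b × Bool) : Measurements n ℓ b :=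
  fun t i => if (hs t.1 i).1 = t.2 then sgn (hs t.1 i).2 else 0

/-- The measurement vectors of `BCountSketch`: `μ_t[i] = h_t(i) s_t(i)`. -/
def bCountMeasurements {n ℓ b : ℕ} (hs : Bucket ℓ b → Fin n → Bool × Bool) : Measurements n ℓ b :=
  fun t i => if (hs t i).1 then sgn (hs t i).2 else 0

/-- The Bernoulli distribution that selects (`true`) with probability `1/b`. -/
def selectLaw (b : ℕ) : Measure Bool :=
  ENNReal.ofReal (1 / b) • Measure.dirac true + ENNReal.ofReal (1 - 1 / b) • Measure.dirac false

/-- The joint law of the measurement vectors, all hash functions being fully independent. -/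
def measurementLaw (kind : SketchKind) (n ℓ b : ℕ) : Measure (Measurements n ℓ b) :=
  match kind with
  | .countSketch =>
      (Measure.pi fun _ : Fin ℓ => Measure.pi fun _ : Fin n =>
        uniformOn (Set.univ : Set (Fin b × Bool))).map countMeasurements
  | .bCountSketch =>
      (Measure.pi fun _ : Bucket ℓ b => Measure.pi fun _ : Fin n =>
        (selectLaw b).prod (uniformOn (Set.univ : Set Bool))).map bCountMeasurements

/-- The sketch `c_t(v) = ⟨μ_t, v⟩` of the vector `v`. -/
def sketch {n ℓ b : ℕ} (μ : Measurements n ℓ b) (v : Fin n → ℝ) : Bucket ℓ b → ℝ :=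
  fun t => ∑ i, (μ t i : ℝ) * v i

/-! ## The adaptive game -/

/-- An analyst who does not know the internal randomness: given the answers received so far, he
poses the next query or (`none`) stops. -/
abbrev Analyst (n : ℕ) : Type := List (Finset (Fin n)) → Option (Fin n → ℝ)

/-- The queries and answers of the first `Q` rounds of the game. The estimator `respond` is given
the sketches of all queries up to and including the current one. -/
def transcript {n ℓ b : ℕ} (μ : Measurements n ℓ b)
    (respond : List (Bucket ℓ b → ℝ) → Finset (Fin n)) (A : Analyst n) :
    ℕ → List ((Fin n → ℝ) × Finset (Fin n))
  | 0 => []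
  | Q + 1 =>
    let past := transcript μ respond A Q
    match A (past.map Prod.snd) with
    | none => past
    | some v => past ++ [(v, respond (past.map (fun x => sketch μ x.1) ++ [sketch μ v]))]

/-- The answer to the last query posed is wrong (in particular, some query was posed). -/
def LastAnswerWrong {n : ℕ} (k : ℕ) (tr : List ((Fin n → ℝ) × Finset (Fin n))) : Prop :=
  ∃ x ∈ tr.getLast?, IsWrong k x.1 x.2

/-- Some analyst, fixed before the randomness `ω ∼ P` is drawn, poses at most `Q` queries, and with
probability at least `p` the answer to his last query is wrong. -/
def AdmitsAttack {n ℓ b : ℕ} {Ω : Type} [MeasurableSpace Ω] (P : Measure Ω)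
    (μ : Ω → Measurements n ℓ b) (respond : Ω → List (Bucket ℓ b → ℝ) → Finset (Fin n))
    (k Q : ℕ) (p : ℝ) : Prop :=
  ∃ A : Analyst n,
    ENNReal.ofReal p ≤ P {ω | LastAnswerWrong k (transcript (μ ω) (respond ω) A Q)}

/-- An estimator that answers each query from the measurement vectors and the sketch of that query
alone. -/
abbrev Estimator (n ℓ b : ℕ) : Type :=
  Measurements n ℓ b → (Bucket ℓ b → ℝ) → Finset (Fin n)

/-- The answers of such an estimator in the adaptive game. -/
def Estimator.respond {n ℓ b : ℕ} (M : Estimator n ℓ b) (μ : Measurements n ℓ b)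
    (cs : List (Bucket ℓ b → ℝ)) : Finset (Fin n) :=
  match cs.getLast? with
  | none => ∅
  | some c => M μ c

/-! ## The median estimator -/

/-- The median of a finite multiset of reals: the middle element of the sorted list, or the mean of
the two middle elements (and `0` for the empty multiset). -/
def median (V : Multiset ℝ) : ℝ :=
  let s := V.sort (· ≤ ·)
  (s.getD ((s.length - 1) / 2) 0 + s.getD (s.length / 2) 0) / 2

/-- `v̂[i]`, the median of the values `μ_t[i] c_t` over the buckets `t` in which `i` participates. -/
def medianEstimate {n ℓ b : ℕ} (μ : Measurements n ℓ b) (c : Bucket ℓ b → ℝ) (i : Fin n) : ℝ :=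
  median ((univ.filter fun t => μ t i ≠ 0).val.map fun t => (μ t i : ℝ) * c t)

/-- `M` reports the `k'` keys whose median estimates are largest in magnitude (with any rule for
breaking ties). -/
def IsMedianEstimator {n ℓ b : ℕ} (k' : ℕ) (M : Estimator n ℓ b) : Prop :=
  ∀ μ c, IsTopSet (medianEstimate μ c) k' (M μ c)

/-! ## The basic threshold sign-alignment estimator -/

/-- The buckets in which `i` participates with the sign of `μ_t[i] c_t` being positive
(`σ = true`), resp. negative (`σ = false`). -/
def aligned {n ℓ b : ℕ} (μ : Measurements n ℓ b) (c : Bucket ℓ b → ℝ) (i : Fin n) (σ : Bool) :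
    Finset (Bucket ℓ b) :=
  univ.filter fun t => 0 < (μ t i : ℝ) * c t * (sgn σ : ℝ)

/-- The basic estimate `p̂^σ(v, i)`: `b / d = 1 / ℓ` times the number of aligned buckets. -/
def basicEstimate {n ℓ b : ℕ} (μ : Measurements n ℓ b) (c : Bucket ℓ b → ℝ) (i : Fin n)
    (σ : Bool) : ℝ :=
  (1 / (ℓ : ℝ)) * ((aligned μ c i σ).card : ℝ)

/-- The basic threshold estimator: report the keys with `max (p̂⁺, p̂⁻) ≥ τ`. -/
def basicThresholdEstimator (n ℓ b : ℕ) (τ : ℝ) : Estimator n ℓ b :=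
  fun μ c => univ.filter fun i => τ ≤ max (basicEstimate μ c i true) (basicEstimate μ c i false)

/-! ## The robust threshold sign-alignment estimator -/

/-- The Laplace distribution `Lap(1)`, with density `exp(-|x|) / 2`. -/
def laplace : Measure ℝ :=
  volume.withDensity fun x => ENNReal.ofReal (Real.exp (-|x|) / 2)

instance : IsProbabilityMeasure laplace := by
  have h1 : ∫ x : ℝ, Real.exp (-|x|) / 2 = 1 := by
    rw [integral_div, integral_comp_abs (f := fun x => Real.exp (-x)), integral_exp_neg_Ioi_zero]
    norm_num
  have hint : Integrable fun x : ℝ => Real.exp (-|x|) / 2 := by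
    by_contra h
    rw [integral_undef h] at h1
    norm_num at h1
  refine ⟨?_⟩
  rw [laplace, withDensity_apply _ MeasurableSet.univ, Measure.restrict_univ,
    ← ofReal_integral_eq_lintegral_ofReal hint (Filter.Eventually.of_forall fun x => by positivity),
    h1, ENNReal.ofReal_one]

/-- Parameters of the robust estimator: privacy parameters, access limit, and the threshold to which
noisy counts are compared. -/
structure RobustParams where
  ε : ℝ
  δ : ℝ
  L : ℕ
  threshold : ℝ

/-- `(1/ε) log (1/δ)`. -/
def RobustParams.B (p : RobustParams) : ℝ := (1 / p.ε) * Real.log (1 / p.δ)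

/-- `Δ = (1/ε) log (1/δ) log ((1/ε) log (1/δ))`. -/
def RobustParams.Δ (p : RobustParams) : ℝ := p.B * Real.log p.B

/-- The noise `a + min (Δ, b)` with `a ∼ Lap(10 Δ)` and `b ∼ Lap((1/ε) log (1/δ))`, produced by
scaling two independent `Lap(1)` variables. -/
def RobustParams.noise (p : RobustParams) (ξ : ℝ × ℝ) : ℝ :=
  10 * p.Δ * ξ.1 + min p.Δ (p.B * ξ.2)

/-- The buckets that are still active (not deleted), given the access counts. -/
def active {ℓ b : ℕ} (L : ℕ) (cnt : Bucket ℓ b → ℕ) : Finset (Bucket ℓ b) :=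
  univ.filter fun t => cnt t < L

/-- Does `ThresholdMonitor` output `⊤` for the (positive) query of the predicate `f`? -/
def tmTop {ℓ b : ℕ} (p : RobustParams) (ξ : ℝ × ℝ) (f : Finset (Bucket ℓ b))
    (cnt : Bucket ℓ b → ℕ) : Prop :=
  p.threshold ≤ ((active p.L cnt ∩ f).card : ℝ) + p.noise ξ

open Classical in
/-- The access counts after this query: on `⊤`, the active buckets satisfying `f` are charged. -/
def tmCharge {ℓ b : ℕ} (p : RobustParams) (ξ : ℝ × ℝ) (f : Finset (Bucket ℓ b))
    (cnt : Bucket ℓ b → ℕ) : Bucket ℓ b → ℕ :=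
  fun t => if tmTop p ξ f cnt ∧ t ∈ active p.L cnt ∩ f then cnt t + 1 else cnt t

open Classical in
/-- Processing of one key: the two queries `f⁺` and then `f⁻` are issued to `ThresholdMonitor`, and
the key is reported if at least one of the answers is `⊤`. -/
def robustKey {n ℓ b : ℕ} (p : RobustParams) (μ : Measurements n ℓ b) (c : Bucket ℓ b → ℝ)
    (ξ : Fin n → Bool → ℝ × ℝ) (st : (Bucket ℓ b → ℕ) × Finset (Fin n)) (i : Fin n) :
    (Bucket ℓ b → ℕ) × Finset (Fin n) :=
  let cnt₁ := tmCharge p (ξ i true) (aligned μ c i true) st.1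
  let cnt₂ := tmCharge p (ξ i false) (aligned μ c i false) cnt₁
  (cnt₂,
    if tmTop p (ξ i true) (aligned μ c i true) st.1 ∨
        tmTop p (ξ i false) (aligned μ c i false) cnt₁
    then insert i st.2 else st.2)

/-- Processing of one query vector with sketch `c`: start with the empty output and loop over all
keys. -/
def robustRound {n ℓ b : ℕ} (p : RobustParams) (μ : Measurements n ℓ b) (c : Bucket ℓ b → ℝ)
    (ξ : Fin n → Bool → ℝ × ℝ) (cnt : Bucket ℓ b → ℕ) : (Bucket ℓ b → ℕ) × Finset (Fin n) :=
  (List.finRange n).foldl (robustKey p μ c ξ) (cnt, ∅)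

/-- The noise variables: round, key, sign. -/
abbrev NoiseIndex (n : ℕ) : Type := ℕ × Fin n × Bool

/-- The answer of the robust estimator to the last of a sequence of queries, the access counts being
carried over from one query to the next. -/
def robustRespond {n ℓ b : ℕ} (p : RobustParams) (ω : Measurements n ℓ b × (NoiseIndex n → ℝ × ℝ))
    (cs : List (Bucket ℓ b → ℝ)) : Finset (Fin n) :=
  (cs.zipIdx.foldl
    (fun st cq => robustRound p ω.1 cq.1 (fun i σ => ω.2 (cq.2, i, σ)) st.1)
    ((fun _ => 0), (∅ : Finset (Fin n)))).2

/-- Joint law of the measurement vectors and of the (independent) noise. -/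
def robustLaw (kind : SketchKind) (n ℓ b : ℕ) :
    Measure (Measurements n ℓ b × (NoiseIndex n → ℝ × ℝ)) :=
  (measurementLaw kind n ℓ b).prod
    (Measure.infinitePi fun _ : NoiseIndex n => laplace.prod laplace)

/-- The parameters of the robust threshold estimator: `ε = C₁ / √L`, `δ = C₂ / (n m b L)`, access
limit `L`, threshold `(d / b) τ = ℓ τ`. -/
def robustParams (C₁ C₂ τ : ℝ) (n ℓ b L m : ℕ) : RobustParams where
  ε := C₁ / √(L : ℝ)
  δ := C₂ / ((n : ℝ) * m * b * L)
  L := L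
  threshold := ℓ * τ

end SketchAttack

end

/-!
Each attack watches one key `h` and uses the answers only through the bit "is `h` reported?". In its
last phase `h` is a heavy hitter of every query, and the analyst stops at the first answer without
`h` (`watchAnalyst`, `admitsAttack_of_cols`). So it suffices that some answer of the last phase misses
`h` with the required probability. The columns of the measurement matrix are independent, and for
both sketches the entries of fresh columns in the buckets of `h` are independent lazy signs
(`mp_restrict_cols`): fresh keys are a source of independent noise in the buckets of `h`.

*Robust threshold estimator* (`robust_attack`). The query is always the basis vector of `h`. With
constant probability the noise of both tests of `h` is low, and then `h` is reported only at the cost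
of one access to each of its active buckets. If `L ≤ ℓ²`, more than `L` such rounds exhaust the
buckets; if `L > ℓ²`, low noise outweighs all buckets of `h`, and one such round suffices.

*Basic threshold estimator* (`basic_attack`). Weight `1` on a block of `b * ℓ` fresh keys produces
noise of order `√ℓ` in each bucket of `h`. The weight of `h` is first calibrated: it is the least
weight for which `h` is reported for at least half of a family of blocks, and this forces the
expected number of aligned buckets to be within `O(√ℓ)` of the threshold (`threshold_calibration`).
At such a weight the sign of the noise in a given bucket is pivotal with probability of order
`1 / √ℓ`, because the number of aligned buckets is a binomial variable given the absolute values of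
the noise. Hence the noise of a bucket, restricted to the event that `h` is reported, has a mean of
order `1` (`thrRep_drift`). The sum of the blocks that were reported in `Q` rounds, `Q` being of order
`ℓ`, is thus of exact order `Q` in all but a quarter of the buckets (`collected_tail`,
`exists_threshold_collection`). In the last phase this sum is subtracted and the weight of `h` sweeps
an interval of integers of order `ℓ`. At the median of the collected noise neither sign prevails in
more than half of the buckets, up to a small error, so `h` is not reported; it is heavy, since the
collected noise has squared norm `Q * b * ℓ` while the weight of `h` is of order `Q`.

*Median estimator* (`median_attack`). A report is a comparison with other keys. In a collection
round, `k' - 1` huge keys occupy all places but one, and the last place goes to `h`, of weight `a`, or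
to a competitor of weight `a + 1`; all of them but `h` are fresh (`mem_collection_iff`). On a
suitable event the estimate of the competitor is exact and the signs of the errors in the buckets of
`h` nearly cancel, so that the sign of the noise in a given bucket is again pivotal with probability
of order `1 / √ℓ` (`medianZone`, `medianRep_drift_of_zone`, `exists_medianRep_drift`), and the
collected noise is again of order `Q` (`exists_median_collection`).
In the last phase the weight of `h` sweeps half-integers: when it equals the median of the noise, the
estimate of `h` is exactly zero. Among `b * ℓ ^ 2` further keys of weight zero, each has a nonzero
estimate with probability of order at least `1 / √ℓ` (`exists_medianOn_ne_zero`), so `k'` of them are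
ranked before `h` (`median_reported_le`).
-/


noncomputable section

namespace SketchAttack

open Real

variable (kind : SketchKind) {n ℓ b : ℕ}

/-- The law of independent entries with law `μ`, indexed by `I`. -/
notation:70 μ:70 "^⊗" I:71 => Measure.pi fun _ : I => μ

/-- The number of elements of a finite type. -/
notation:max "♯" I:max => Fintype.card I

lemma _root_.MeasureTheory.MeasurePreserving.real_preimage {X Y : Type*} [MeasurableSpace X]
    [MeasurableSpace Y] [DiscreteMeasurableSpace Y] {μ : Measure X} {ν : Measure Y} {f : X → Y}
    (h : MeasurePreserving f μ ν) {s : Set Y} : μ.real (f ⁻¹' s) = ν.real s :=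
  h.measureReal_preimage MeasurableSet.of_discrete.nullMeasurableSet

/-! ### Heavy hitters and top sets -/

lemma exists_isTopSet_mem {f : Fin n → ℝ} {h : Fin n} (hf : ∀ j, |f j| ≤ |f h|)
    {k : ℕ} (hk : 1 ≤ k) : ∃ S, IsTopSet f k S ∧ h ∈ S := by
  induction k, hk using Nat.le_induction with
  | base =>
    refine ⟨{h}, ⟨?_, ?_⟩, mem_singleton_self h⟩
    · have : 1 ≤ n := Nat.one_le_iff_ne_zero.2 (by rintro rfl; exact h.elim0)
      simp [this]
    · intro i hi j _
      rw [mem_singleton.1 hi]; exact hf j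
  | succ k hk ih =>
    obtain ⟨S, ⟨hc, hS⟩, hh⟩ := ih
    by_cases hkn : n ≤ k
    · exact ⟨S, ⟨by rw [hc]; omega, hS⟩, hh⟩
    · have hne : (Sᶜ).Nonempty := by rw [← card_pos, card_compl, Fintype.card_fin, hc]; omega
      obtain ⟨j, hj, hmax⟩ := exists_max_image Sᶜ (fun i => |f i|) hne
      have hj' : j ∉ S := by simpa using hj
      refine ⟨insert j S, ⟨?_, ?_⟩, mem_insert_of_mem hh⟩
      · rw [card_insert_of_notMem hj', hc]; omega
      · intro i hi j' hj'2
        have h2 : j' ∉ S := fun h => hj'2 (mem_insert_of_mem h)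
        rcases mem_insert.1 hi with rfl | hi
        · exact hmax j' (by simpa using h2)
        · exact hS i hi j' h2

lemma isHeavyHitter_of_sum_lt {f : Fin n → ℝ} {h : Fin n} (hf : ∀ j, |f j| ≤ |f h|)
    {k : ℕ} (hk : 1 ≤ k) (hlt : ∑ j ∈ univ.erase h, f j ^ 2 < k * f h ^ 2) :
    IsHeavyHitter k f h := by
  obtain ⟨S, hS, hh⟩ := exists_isTopSet_mem hf hk
  refine ⟨S, hS, ?_⟩
  have hk0 : (0 : ℝ) < k := mod_cast hk
  rw [one_div, inv_mul_lt_iff₀ hk0]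
  refine lt_of_le_of_lt (sum_le_sum_of_subset_of_nonneg ?_ fun _ _ _ => sq_nonneg _) hlt
  intro j hj
  refine mem_erase.2 ⟨?_, mem_univ _⟩
  rintro rfl
  exact (mem_compl.1 hj) hh

lemma IsTopSet.notMem {f : Fin n → ℝ} {k : ℕ} {S : Finset (Fin n)} (hS : IsTopSet f k S)
    {i : Fin n} (G : Finset (Fin n)) (hG : k ≤ #G) (hlt : ∀ j ∈ G, |f i| < |f j|) : i ∉ S := by
  intro hi
  have hsub : G ⊆ S := fun j hj => by
    by_contra hjS
    exact absurd (hS.2 i hi j hjS) (not_le.2 (hlt j hj))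
  have hiG : i ∉ G := fun h => lt_irrefl _ (hlt i h)
  have h1 : #(insert i G) ≤ #S := card_le_card (insert_subset hi hsub)
  rw [card_insert_of_notMem hiG, hS.1] at h1
  have := min_le_left k n
  omega

lemma IsTopSet.mem {f : Fin n → ℝ} {k : ℕ} {S : Finset (Fin n)} (hS : IsTopSet f k S)
    {i : Fin n} (hkn : k ≤ n) (G : Finset (Fin n)) (hG : #G < k)
    (hlt : ∀ j, j ≠ i → j ∉ G → |f j| < |f i|) : i ∈ S := by
  by_contra hi
  have hsub : S ⊆ G := fun j hj => by
    by_contra hjG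
    have hne : j ≠ i := by rintro rfl; exact hi hj
    exact absurd (hS.2 j hj i hi) (not_le.2 (hlt j hne hjG))
  have h1 := card_le_card hsub
  rw [hS.1, min_eq_left hkn] at h1
  omega

/-! ### Attacks that watch a single key -/

/-- The bits "is `h` reported?" of a list of answers. -/
def reportBits (h : Fin n) (ans : List (Finset (Fin n))) : List Bool :=
  ans.map fun K => decide (h ∈ K)

/-- The analyst who poses the query `v bits`, where `bits` records in which of the previous rounds
`h` was reported, and who stops as soon as `h` is not reported in one of the rounds from round `Q₀`
on. -/
def watchAnalyst (h : Fin n) (v : List Bool → Fin n → ℝ) (Q₀ : ℕ) : Analyst n :=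
  fun ans => if false ∈ (reportBits h ans).drop Q₀ then none else some (v (reportBits h ans))

/-- The game with the queries of `watchAnalyst`, without stopping. -/
def fullRun (μ : Measurements n ℓ b) (respond : List (Bucket ℓ b → ℝ) → Finset (Fin n))
    (h : Fin n) (v : List Bool → Fin n → ℝ) : ℕ → List ((Fin n → ℝ) × Finset (Fin n)) :=
  transcript μ respond fun ans => some (v (reportBits h ans))

section
variable (μ : Measurements n ℓ b) (respond : List (Bucket ℓ b → ℝ) → Finset (Fin n))
  (h : Fin n) (v : List Bool → Fin n → ℝ)

lemma fullRun_succ (Q : ℕ) : fullRun μ respond h v (Q + 1) = fullRun μ respond h v Q ++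
      [(v (reportBits h ((fullRun μ respond h v Q).map Prod.snd)),
        respond ((fullRun μ respond h v Q).map (fun x => sketch μ x.1) ++
          [sketch μ (v (reportBits h ((fullRun μ respond h v Q).map Prod.snd)))]))] := rfl

lemma length_fullRun (Q : ℕ) : (fullRun μ respond h v Q).length = Q := by
  induction Q with
  | zero => rfl
  | succ Q ih => rw [fullRun_succ, List.length_append, ih]; rfl

/-- The report bits of the uninterrupted game. -/
def fullBits (Q : ℕ) : List Bool := reportBits h ((fullRun μ respond h v Q).map Prod.snd)

lemma length_fullBits (Q : ℕ) : (fullBits μ respond h v Q).length = Q := by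
  simp [fullBits, reportBits, length_fullRun]

lemma fullBits_succ (Q : ℕ) : fullBits μ respond h v (Q + 1) = fullBits μ respond h v Q ++
    [decide (h ∈ respond ((fullRun μ respond h v Q).map (fun x => sketch μ x.1) ++
          [sketch μ (v (fullBits μ respond h v Q))]))] := by
  rw [fullBits, fullRun_succ]
  simp [reportBits, fullBits]

/-- Unless the attack succeeds, it runs to the end and `h` is reported in all rounds from `Q₀` on. -/
lemma watchAnalyst_spec {k Q₀ : ℕ}
    (hv : ∀ bits : List Bool, Q₀ ≤ bits.length → IsHeavyHitter k (v bits) h) (Q : ℕ) :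
    LastAnswerWrong k (transcript μ respond (watchAnalyst h v Q₀) Q) ∨
      false ∉ (fullBits μ respond h v Q).drop Q₀ := by
  suffices H : (LastAnswerWrong k (transcript μ respond (watchAnalyst h v Q₀) Q) ∧
        false ∈ (reportBits h ((transcript μ respond (watchAnalyst h v Q₀) Q).map Prod.snd)).drop Q₀) ∨
      (transcript μ respond (watchAnalyst h v Q₀) Q = fullRun μ respond h v Q ∧
        false ∉ (fullBits μ respond h v Q).drop Q₀) from H.imp And.left And.right
  induction Q with
  | zero => right; exact ⟨rfl, by simp [fullBits, fullRun, transcript, reportBits]⟩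
  | succ Q ih =>
    rcases ih with ⟨h1, h2⟩ | ⟨h1, h2⟩
    · left
      have : transcript μ respond (watchAnalyst h v Q₀) (Q + 1) =
          transcript μ respond (watchAnalyst h v Q₀) Q := by
        simp only [transcript]
        rw [watchAnalyst, if_pos h2]
      rw [this]; exact ⟨h1, h2⟩
    · have key : transcript μ respond (watchAnalyst h v Q₀) (Q + 1) =
          fullRun μ respond h v (Q + 1) := by
        simp only [transcript]
        have h2' := h2
        rw [fullBits] at h2'
        rw [h1, watchAnalyst, if_neg h2']
        rfl
      rw [key]
      by_cases h3 : false ∈ (fullBits μ respond h v (Q + 1)).drop Q₀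
      · left
        refine ⟨?_, h3⟩
        have hlen : Q₀ ≤ Q := by
          by_contra hlt
          rw [List.drop_eq_nil_of_le (by rw [length_fullBits]; omega)] at h3
          simp at h3
        rw [fullBits_succ, List.drop_append_of_le_length (by rw [length_fullBits]; exact hlen),
          List.mem_append] at h3
        have h4 := h3.resolve_left h2
        rw [List.mem_singleton] at h4
        have h5 := of_decide_eq_false h4.symm
        rw [fullRun_succ, LastAnswerWrong]
        refine ⟨_, List.getLast?_concat, h, hv _ ?_, h5⟩
        have := length_fullBits μ respond h v Q
        rw [fullBits] at this
        omega
      · exact Or.inr ⟨rfl, h3⟩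

lemma fullBits_memoryless (M : Estimator n ℓ b) (Q : ℕ) :
    fullBits μ (M.respond μ) h v (Q + 1) = fullBits μ (M.respond μ) h v Q ++
      [decide (h ∈ M μ (sketch μ (v (fullBits μ (M.respond μ) h v Q))))] := by
  rw [fullBits_succ]
  simp [Estimator.respond]

end

lemma one_sub_le_of_compl_le {Ω : Type*} [MeasurableSpace Ω] {P : Measure Ω} [IsProbabilityMeasure P]
    {A : Set Ω} {δ : ℝ} (hδ : 0 ≤ δ) (h : P Aᶜ ≤ ENNReal.ofReal δ) :
    ENNReal.ofReal (1 - δ) ≤ P A := by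
  rw [ENNReal.ofReal_sub _ hδ, ENNReal.ofReal_one, tsub_le_iff_right]
  calc (1 : ENNReal) = P Set.univ := measure_univ.symm
    _ ≤ P (A ∪ Aᶜ) := by rw [Set.union_compl_self]
    _ ≤ P A + P Aᶜ := measure_union_le _ _
    _ ≤ _ := by gcongr

/-- An attack succeeds with probability at least `1 - δ` if outside of an event of probability at
most `δ` the watched key fails to be reported in some round from `Q₀` on. -/
lemma admitsAttack_of_watch {Ω : Type} [MeasurableSpace Ω] (P : Measure Ω) [IsProbabilityMeasure P]
    (μ : Ω → Measurements n ℓ b) (respond : Ω → List (Bucket ℓ b → ℝ) → Finset (Fin n))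
    (h : Fin n) (v : List Bool → Fin n → ℝ) {k Q₀ Q : ℕ} {δ : ℝ} (hδ : 0 ≤ δ)
    (hv : ∀ bits : List Bool, Q₀ ≤ bits.length → IsHeavyHitter k (v bits) h)
    (hP : P {ω | false ∉ (fullBits (μ ω) (respond ω) h v Q).drop Q₀} ≤ ENNReal.ofReal δ) :
    AdmitsAttack P μ respond k Q (1 - δ) := by
  refine ⟨watchAnalyst h v Q₀, one_sub_le_of_compl_le hδ (le_trans (measure_mono ?_) hP)⟩
  intro ω hω
  exact (watchAnalyst_spec (μ ω) (respond ω) h v hv Q).resolve_left hω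

/-! ### Product measures -/

/-- The laws of finitely many distinct coordinates of a product measure, each transported by a
measure preserving map. -/
lemma mp_pi_precomp {I J : Type*} [Fintype I] [Fintype J] {X Y : Type*}
    [MeasurableSpace X] [MeasurableSpace Y] {μ : J → Measure X} {ν : I → Measure Y}
    [∀ j, IsProbabilityMeasure (μ j)] [∀ i, IsProbabilityMeasure (ν i)]
    (e : I → J) (he : e.Injective) (g : I → X → Y)
    (hg : ∀ i, MeasurePreserving (g i) (μ (e i)) (ν i)) :
    MeasurePreserving (fun (ω : J → X) i => g i (ω (e i))) (Measure.pi μ) (Measure.pi ν) := by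
  refine (measurePreserving_pi _ _ hg).comp (f := fun (ω : J → X) (i : I) => ω (e i)) ?_
  have hm : Measurable (fun (ω : J → X) (i : I) => ω (e i)) := by fun_prop
  refine ⟨hm, ?_⟩
  have h1 : iIndepFun (fun j (ω : J → X) => ω j) (Measure.pi μ) :=
    iIndepFun_pi (X := fun _ x => x) fun _ => aemeasurable_id
  have h2 := (h1.precomp he).map_fun_eq_pi_map fun i => (measurable_pi_apply _).aemeasurable
  rw [h2]
  congr 1
  ext1 i
  exact (measurePreserving_eval μ (e i)).map_eq

lemma mp_of_singleton {X Y : Type*} [MeasurableSpace X] [MeasurableSpace Y]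
    [DiscreteMeasurableSpace X] [Countable Y] [MeasurableSingletonClass Y]
    {μ : Measure X} {ν : Measure Y} (f : X → Y) (h : ∀ y, μ (f ⁻¹' {y}) = ν {y}) :
    MeasurePreserving f μ ν := by
  refine ⟨.of_discrete, Measure.ext_of_singleton fun y => ?_⟩
  rw [Measure.map_apply .of_discrete (measurableSet_singleton y), h]

lemma mp_swap_pi {I J X : Type*} [Fintype I] [Fintype J] [Finite X]
    [MeasurableSpace X] [MeasurableSingletonClass X] (ν : Measure X) [IsProbabilityMeasure ν] :
    MeasurePreserving (fun (ω : I → J → X) j i => ω i j)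
      (Measure.pi fun _ => Measure.pi fun _ => ν) (Measure.pi fun _ => Measure.pi fun _ => ν) := by
  refine mp_of_singleton _ fun y => ?_
  have : (fun (ω : I → J → X) j i => ω i j) ⁻¹' {y} = {fun i j => y j i} := by grind
  rw [this, Measure.pi_singleton, Measure.pi_singleton]
  simp_rw [Measure.pi_singleton]
  exact Finset.prod_comm

lemma mp_curry_pi {I J X : Type*} [Fintype I] [Fintype J] [Finite X]
    [MeasurableSpace X] [MeasurableSingletonClass X] (ν : Measure X) [IsProbabilityMeasure ν] :
    MeasurePreserving (fun (ω : I × J → X) i j => ω (i, j))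
      (Measure.pi fun _ => ν) (Measure.pi fun _ => Measure.pi fun _ => ν) := by
  refine mp_of_singleton _ fun y => ?_
  have : (fun (ω : I × J → X) i j => ω (i, j)) ⁻¹' {y} = {fun p => y p.1 p.2} := by grind
  rw [this, Measure.pi_singleton, Measure.pi_singleton]
  simp_rw [Measure.pi_singleton]
  exact Fintype.prod_prod_type _

/-! ### The law of a single key -/

instance : MeasurableSpace SignType := ⊤

instance : DiscreteMeasurableSpace SignType := ⟨fun _ => trivial⟩

/-- The law of a single entry of a measurement vector: `±1` with probability `1 / (2 b)` each, and
`0` otherwise. -/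
def lazyLaw (b : ℕ) : Measure SignType :=
  ENNReal.ofReal (1 / (2 * b)) • Measure.dirac 1 + ENNReal.ofReal (1 / (2 * b)) • Measure.dirac (-1)
    + ENNReal.ofReal (1 - 1 / b) • Measure.dirac 0

lemma lazyLaw_one (b : ℕ) : lazyLaw b {1} = ENNReal.ofReal (1 / (2 * b)) := by
  simp [lazyLaw, show ((-1 : SignType) ≠ 1) by decide, show ((0 : SignType) ≠ 1) by decide]

lemma lazyLaw_neg_one (b : ℕ) : lazyLaw b {-1} = ENNReal.ofReal (1 / (2 * b)) := by
  simp [lazyLaw, show ((1 : SignType) ≠ -1) by decide, show ((0 : SignType) ≠ -1) by decide]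

lemma lazyLaw_zero (b : ℕ) : lazyLaw b {0} = ENNReal.ofReal (1 - 1 / b) := by
  simp [lazyLaw, show ((1 : SignType) ≠ 0) by decide, show ((-1 : SignType) ≠ 0) by decide]

lemma one_div_nat_le_one (b : ℕ) : (1 : ℝ) / b ≤ 1 := by
  rcases Nat.eq_zero_or_pos b with rfl | h
  · simp
  · rw [div_le_one (mod_cast h)]; exact_mod_cast h

instance (b : ℕ) : IsProbabilityMeasure (lazyLaw b) := by
  refine ⟨?_⟩
  have h1 := one_div_nat_le_one b
  simp only [lazyLaw, Measure.add_apply, Measure.smul_apply, measure_univ, smul_eq_mul, mul_one]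
  rw [← ENNReal.ofReal_add (by positivity) (by positivity), ← ENNReal.ofReal_add (by positivity)
    (by linarith), ← ENNReal.ofReal_one]
  congr 1
  field_simp
  ring

lemma integral_lazyLaw (b : ℕ) (f : SignType → ℝ) :
    ∫ x, f x ∂(lazyLaw b) = (f 1 + f (-1)) / (2 * b) + (1 - 1 / b) * f 0 := by
  have h1 := one_div_nat_le_one b
  have hi : ∀ (c : ℝ) (x : SignType), Integrable f (ENNReal.ofReal c • Measure.dirac x) :=
    fun c x => Integrable.smul_measure .of_finite ENNReal.ofReal_ne_top
  rw [lazyLaw, integral_add_measure ((hi _ _).add_measure (hi _ _)) (hi _ _),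
    integral_add_measure (hi _ _) (hi _ _)]
  simp only [integral_smul_measure, integral_dirac, smul_eq_mul]
  rw [ENNReal.toReal_ofReal (by positivity), ENNReal.toReal_ofReal (by linarith)]
  ring

/-- Negation of a sign, controlled by a Boolean. -/
def flipSign (s : Bool) (x : SignType) : SignType := if s then -x else x

@[simp] lemma flipSign_flipSign (s : Bool) (x : SignType) : flipSign s (flipSign s x) = x := by
  cases s <;> simp [flipSign]

lemma flipSign_eq_iff (s : Bool) (x y : SignType) : flipSign s x = y ↔ x = flipSign s y :=
  ⟨fun h => by rw [← h, flipSign_flipSign], fun h => by rw [h, flipSign_flipSign]⟩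

lemma mp_flipSign (b : ℕ) (s : Bool) : MeasurePreserving (flipSign s) (lazyLaw b) (lazyLaw b) := by
  refine mp_of_singleton _ fun y => ?_
  have : flipSign s ⁻¹' {y} = {flipSign s y} := by ext x; simp [flipSign_eq_iff]
  rw [this]
  cases s
  · rfl
  · have h0 : (-0 : SignType) = 0 := rfl
    cases y
    · simp only [flipSign, if_true]; exact congrArg _ rfl
    · simp only [flipSign, if_true]
      change lazyLaw b {1} = lazyLaw b {-1}
      rw [lazyLaw_one, lazyLaw_neg_one]
    · simp only [flipSign, if_true]
      change lazyLaw b {-1} = lazyLaw b {1}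
      rw [lazyLaw_one, lazyLaw_neg_one]

/-- A random sign as an element of `SignType`. -/
def boolSign (s : Bool) : SignType := if s then 1 else -1

lemma coe_boolSign (s : Bool) : ((boolSign s : SignType) : ℤ) = sgn s := by
  cases s <;> rfl

lemma mp_hash (hb : 1 ≤ b) (j : Fin b) :
    MeasurePreserving (fun p : Fin b × Bool => if p.1 = j then boolSign p.2 else 0)
      (uniformOn (Set.univ : Set (Fin b × Bool))) (lazyLaw b) := by
  have : Nonempty (Fin b) := ⟨j⟩
  have : IsProbabilityMeasure (uniformOn (Set.univ : Set (Fin b × Bool))) :=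
    isProbabilityMeasure_uniformOn Set.finite_univ Set.univ_nonempty
  set f : Fin b × Bool → SignType := fun p => if p.1 = j then boolSign p.2 else 0 with hf
  have hsing : ∀ p : Fin b × Bool, uniformOn (Set.univ : Set (Fin b × Bool)) {p} =
      ENNReal.ofReal (1 / (2 * b)) := fun p => by
    rw [uniformOn_univ, Measure.count_singleton, Fintype.card_prod, Fintype.card_fin,
      Fintype.card_bool, ENNReal.ofReal_div_of_pos (by positivity), ENNReal.ofReal_one]
    congr 1
    rw [mul_comm, ENNReal.ofReal_mul (by norm_num)]
    push_cast
    simp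
  have hone : ∀ s, f ⁻¹' {boolSign s} = {(j, s)} := fun s => by
    ext ⟨i, s'⟩
    by_cases hij : i = j
    · subst hij; cases s <;> cases s' <;> simp [hf, boolSign]
    · cases s <;> simp [hf, hij, boolSign]
  have h1 : uniformOn (Set.univ : Set (Fin b × Bool)) (f ⁻¹' {1}) = lazyLaw b {1} := by
    have := hone true
    rw [show boolSign true = 1 from rfl] at this
    rw [this, hsing, lazyLaw_one]
  have h2 : uniformOn (Set.univ : Set (Fin b × Bool)) (f ⁻¹' {-1}) = lazyLaw b {-1} := by
    have := hone false
    rw [show boolSign false = -1 from rfl] at this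
    rw [this, hsing, lazyLaw_neg_one]
  have h0 : uniformOn (Set.univ : Set (Fin b × Bool)) (f ⁻¹' {0}) = lazyLaw b {0} := by
    have hu : ∀ (ν : Measure SignType) [IsProbabilityMeasure ν], ν {0} = 1 - (ν {1} + ν {-1}) := by
      intro ν _
      have hd : Disjoint ({1} : Set SignType) {-1} := by simp
      rw [← measure_union hd .of_discrete, ← prob_compl_eq_one_sub .of_discrete]
      congr 1
      ext x; cases x <;> simp
    have hm : Measurable f := .of_discrete
    have := Measure.isProbabilityMeasure_map (μ := uniformOn (Set.univ : Set (Fin b × Bool)))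
      hm.aemeasurable
    have h3 := hu ((uniformOn (Set.univ : Set (Fin b × Bool))).map f)
    rw [Measure.map_apply hm .of_discrete, Measure.map_apply hm .of_discrete,
      Measure.map_apply hm .of_discrete, h1, h2, ← hu] at h3
    exact h3
  refine mp_of_singleton _ fun y => ?_
  cases y
  · exact h0
  · exact h2
  · exact h1

lemma mp_select (hb : 1 ≤ b) :
    MeasurePreserving (fun p : Bool × Bool => if p.1 then boolSign p.2 else 0)
      ((selectLaw b).prod (uniformOn (Set.univ : Set Bool))) (lazyLaw b) := by
  have : IsProbabilityMeasure (uniformOn (Set.univ : Set Bool)) :=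
    isProbabilityMeasure_uniformOn Set.finite_univ Set.univ_nonempty
  have hu : ∀ s, uniformOn (Set.univ : Set Bool) {s} = ENNReal.ofReal (1 / 2) := fun s => by
    rw [uniformOn_univ, Measure.count_singleton, Fintype.card_bool,
      ENNReal.ofReal_div_of_pos (by positivity), ENNReal.ofReal_one]
    simp
  have ht : selectLaw b {true} = ENNReal.ofReal (1 / b) := by simp [selectLaw]
  have hf : selectLaw b {false} = ENNReal.ofReal (1 - 1 / b) := by simp [selectLaw]
  have key : ∀ s, ((selectLaw b).prod (uniformOn (Set.univ : Set Bool))) ({true} ×ˢ {s}) =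
      ENNReal.ofReal (1 / (2 * b)) := fun s => by
    rw [Measure.prod_prod, hu, ht, ← ENNReal.ofReal_mul (by positivity)]
    congr 1; field_simp
  refine mp_of_singleton _ fun y => ?_
  cases y
  · have : (fun p : Bool × Bool => if p.1 then boolSign p.2 else 0) ⁻¹' {SignType.zero} =
        {false} ×ˢ Set.univ := by
      ext ⟨i, s⟩; cases i <;> cases s <;> simp [boolSign]
    rw [this, Measure.prod_prod, measure_univ, hf, mul_one]
    exact (lazyLaw_zero b).symm
  · have : (fun p : Bool × Bool => if p.1 then boolSign p.2 else 0) ⁻¹' {SignType.neg} =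
        {true} ×ˢ {false} := by
      ext ⟨i, s⟩; cases i <;> cases s <;> simp [boolSign]
    rw [this, key]
    exact (lazyLaw_neg_one b).symm
  · have : (fun p : Bool × Bool => if p.1 then boolSign p.2 else 0) ⁻¹' {SignType.pos} =
        {true} ×ˢ {true} := by
      ext ⟨i, s⟩; cases i <;> cases s <;> simp [boolSign]
    rw [this, key]
    exact (lazyLaw_one b).symm

/-- A column of the measurement matrix: the entries of a single key in all buckets. -/
abbrev Col (ℓ b : ℕ) : Type := Bucket ℓ b → SignType

/-- The column of a key that is hashed, in each row, to a bucket with a sign. -/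
def hashCol (hs : Fin ℓ → Fin b × Bool) : Col ℓ b :=
  fun t => if (hs t.1).1 = t.2 then boolSign (hs t.1).2 else 0

/-- The law of the column of a key. The columns of different keys are independent. -/
def colLaw (ℓ b : ℕ) : Measure (Col ℓ b) := match kind with
  | .countSketch => (Measure.pi fun _ : Fin ℓ => uniformOn (Set.univ : Set (Fin b × Bool))).map hashCol
  | .bCountSketch => Measure.pi fun _ => lazyLaw b

lemma prob_hash (hb : 1 ≤ b) : IsProbabilityMeasure (uniformOn (Set.univ : Set (Fin b × Bool))) :=
  have : Nonempty (Fin b) := ⟨⟨0, hb⟩⟩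
  isProbabilityMeasure_uniformOn Set.finite_univ Set.univ_nonempty

lemma prob_colLaw (ℓ : ℕ) (hb : 1 ≤ b) : IsProbabilityMeasure (colLaw kind ℓ b) := by
  cases kind with
  | countSketch =>
    have := prob_hash hb
    exact Measure.isProbabilityMeasure_map Measurable.of_discrete.aemeasurable
  | bCountSketch => exact inferInstanceAs (IsProbabilityMeasure (Measure.pi _))

/-- The measurement vectors with given columns. -/
def ofCols (ω : Fin n → Col ℓ b) : Measurements n ℓ b := fun t i => (ω i t : ℤ)

lemma measurementLaw_eq (n ℓ : ℕ) (hb : 1 ≤ b) :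
    MeasurePreserving ofCols (colLaw kind ℓ b ^⊗ (Fin n)) (measurementLaw kind n ℓ b) := by
  refine ⟨.of_discrete, ?_⟩
  cases kind with
  | countSketch =>
    have := prob_hash hb
    have := prob_colLaw .countSketch ℓ hb
    have h1 : MeasurePreserving (hashCol (ℓ := ℓ) (b := b)) _ (colLaw .countSketch ℓ b) :=
      ⟨.of_discrete, rfl⟩
    have h2 := measurePreserving_pi (ι := Fin n) _ _ fun _ => h1
    have h3 := h2.comp (mp_swap_pi (I := Fin ℓ) (J := Fin n)
      (uniformOn (Set.univ : Set (Fin b × Bool))))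
    rw [← h3.map_eq, Measure.map_map .of_discrete .of_discrete]
    change _ = Measure.map countMeasurements _
    congr 1
    ext hs t i
    simp only [ofCols, Function.comp, hashCol, countMeasurements]
    split_ifs
    · rw [coe_boolSign]
    · rfl
  | bCountSketch =>
    have : IsProbabilityMeasure (uniformOn (Set.univ : Set Bool)) :=
      isProbabilityMeasure_uniformOn Set.finite_univ Set.univ_nonempty
    have : IsProbabilityMeasure (selectLaw b) := by
      refine ⟨?_⟩
      have := one_div_nat_le_one b
      simp only [selectLaw, Measure.add_apply, Measure.smul_apply, measure_univ, smul_eq_mul,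
        mul_one]
      rw [← ENNReal.ofReal_add (by positivity) (by linarith), ← ENNReal.ofReal_one]
      congr 1; ring
    have h2 := measurePreserving_pi (ι := Bucket ℓ b) _ _ fun _ => mp_select hb
    have h2' := measurePreserving_pi (ι := Fin n) _ _ fun _ => h2
    have h3 := h2'.comp (mp_swap_pi (I := Bucket ℓ b) (J := Fin n)
      ((selectLaw b).prod (uniformOn (Set.univ : Set Bool))))
    change Measure.map _ (Measure.pi fun _ : Fin n => Measure.pi fun _ => lazyLaw b) = _
    rw [← h3.map_eq, Measure.map_map .of_discrete .of_discrete]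
    change _ = Measure.map bCountMeasurements _
    congr 1
    ext hs t i
    simp only [ofCols, Function.comp, bCountMeasurements]
    split_ifs
    · rw [coe_boolSign]
    · rfl

lemma prob_measurementLaw (n ℓ : ℕ) (hb : 1 ≤ b) :
    IsProbabilityMeasure (measurementLaw kind n ℓ b) := by
  have := prob_colLaw kind ℓ hb
  rw [← (measurementLaw_eq kind n ℓ hb).map_eq]
  exact Measure.isProbabilityMeasure_map Measurable.of_discrete.aemeasurable

/-- The sets of buckets in which the entries of a column are independent: in `CountSketch` those with
at most one bucket per row, in `BCountSketch` all sets. -/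
def Admissible (A : Finset (Bucket ℓ b)) : Prop := match kind with
  | .countSketch => Set.InjOn Prod.fst (A : Set (Bucket ℓ b))
  | .bCountSketch => True

lemma Admissible.mono {kind : SketchKind} {A A' : Finset (Bucket ℓ b)}
    (h : Admissible kind A) (hA : A' ⊆ A) : Admissible kind A' := by
  cases kind with
  | countSketch => exact Set.InjOn.mono (mod_cast hA) h
  | bCountSketch => trivial

lemma mp_restrict_col {kind : SketchKind} (hb : 1 ≤ b)
    {A : Finset (Bucket ℓ b)} (hA : Admissible kind A) :
    MeasurePreserving (fun (κ : Col ℓ b) (t : A) => κ t) (colLaw kind ℓ b) (lazyLaw b ^⊗ A) := by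
  cases kind with
  | countSketch =>
    have := prob_hash hb
    refine ⟨.of_discrete, ?_⟩
    have h1 := mp_pi_precomp (I := A)
      (μ := fun _ : Fin ℓ => uniformOn (Set.univ : Set (Fin b × Bool)))
      (ν := fun _ => lazyLaw b) (fun t : A => t.1.1)
      (fun s t h => Subtype.ext (hA s.2 t.2 h)) _ fun t => mp_hash hb t.1.2
    rw [← h1.map_eq]
    change Measure.map _ (Measure.map hashCol _) = _
    rw [Measure.map_map .of_discrete .of_discrete]
    rfl
  | bCountSketch =>
    exact mp_pi_precomp (I := A) (J := Bucket ℓ b) (μ := fun _ => lazyLaw b)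
      (ν := fun _ => lazyLaw b) (fun t : A => t.1) Subtype.val_injective (fun _ x => x)
      fun _ => .id _

/-- On an admissible set of buckets the entries of finitely many columns, with arbitrary fixed sign
changes of the buckets, are independent; they are listed here bucket by bucket. -/
lemma mp_restrict_cols {kind : SketchKind} (hb : 1 ≤ b)
    {A : Finset (Bucket ℓ b)} (hA : Admissible kind A) (I : Type*) [Fintype I]
    (σ : Bucket ℓ b → Bool) :
    MeasurePreserving (fun (ω : I → Col ℓ b) (t : A) i => flipSign (σ t) (ω i t))
      (Measure.pi fun _ => colLaw kind ℓ b) (Measure.pi fun _ : A => Measure.pi fun _ => lazyLaw b) := by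
  have h1 := measurePreserving_pi (ι := I) _ _ fun _ => mp_restrict_col hb hA
  have h2 := (mp_swap_pi (I := I) (J := A) (lazyLaw b)).comp h1
  have h3 := (measurePreserving_pi (ι := A) _ _ fun t => measurePreserving_pi (ι := I) _ _
    fun _ => mp_flipSign b (σ t)).comp h2
  exact h3

/-- Sign changes of buckets preserve the law of a column. -/
lemma mp_flip_col (hb : 1 ≤ b) (σ : Bucket ℓ b → Bool) :
    MeasurePreserving (fun (κ : Col ℓ b) t => flipSign (σ t) (κ t)) (colLaw kind ℓ b)
      (colLaw kind ℓ b) := by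
  cases kind with
  | countSketch =>
    refine ⟨.of_discrete, ?_⟩
    let g : Fin ℓ → Fin b × Bool → Fin b × Bool := fun r p => (p.1, xor p.2 (σ (r, p.1)))
    have hg : ∀ r, MeasurePreserving (g r) (uniformOn Set.univ) (uniformOn Set.univ) := by
      intro r
      have hinv : ∀ p, g r (g r p) = p := fun p => by simp [g]
      refine mp_of_singleton _ fun y => ?_
      have : g r ⁻¹' {y} = {g r y} := by
        ext x
        simp only [Set.mem_preimage, Set.mem_singleton_iff]
        exact ⟨fun h => by rw [← h, hinv], fun h => by rw [h, hinv]⟩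
      rw [this, uniformOn_univ, uniformOn_univ, Measure.count_singleton, Measure.count_singleton]
    have h1 := measurePreserving_pi (ι := Fin ℓ) _ _ hg
    change Measure.map _ (Measure.map hashCol _) = Measure.map hashCol _
    rw [Measure.map_map .of_discrete .of_discrete]
    conv_rhs => rw [← h1.map_eq, Measure.map_map .of_discrete .of_discrete]
    congr 1
    ext hs t
    simp only [Function.comp, hashCol, g]
    by_cases h : (hs t.1).1 = t.2
    · rw [if_pos h, if_pos h, h]
      cases (hs t.1).2 <;> cases (σ (t.1, t.2)) <;> rfl
    · rw [if_neg h, if_neg h]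
      cases (σ t) <;> rfl
  | bCountSketch =>
    exact measurePreserving_pi _ _ fun t => mp_flipSign b (σ t)

/-- The buckets in which a key participates. -/
def supp (κ : Col ℓ b) : Finset (Bucket ℓ b) := univ.filter fun t => κ t ≠ 0

@[simp] lemma mem_supp {κ : Col ℓ b} {t : Bucket ℓ b} : t ∈ supp κ ↔ κ t ≠ 0 := by simp [supp]

lemma boolSign_ne_zero (s : Bool) : boolSign s ≠ 0 := by cases s <;> decide

lemma supp_hashCol (hs : Fin ℓ → Fin b × Bool) :
    supp (hashCol hs) = univ.image fun r => (r, (hs r).1) := by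
  ext ⟨r, j⟩
  simp only [mem_supp, hashCol, mem_image, mem_univ, true_and, Prod.mk.injEq]
  constructor
  · grind
  · rintro ⟨r', rfl, rfl⟩
    rw [if_pos rfl]; exact boolSign_ne_zero _

lemma card_supp_hashCol (hs : Fin ℓ → Fin b × Bool) : #(supp (hashCol hs)) = ℓ := by
  rw [supp_hashCol, card_image_of_injective _ fun r s h => congrArg Prod.fst h,
    card_univ, Fintype.card_fin]

lemma ae_admissible : ∀ᵐ κ ∂(colLaw kind ℓ b), Admissible kind (supp κ) := by
  cases kind with
  | countSketch =>
    refine (ae_map_iff Measurable.of_discrete.aemeasurable .of_discrete).2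
      (Filter.Eventually.of_forall fun hs => ?_)
    rw [supp_hashCol]
    intro x hx y hy hxy
    simp only [coe_image, coe_univ, Set.image_univ, Set.mem_range] at hx hy
    obtain ⟨r, rfl⟩ := hx
    obtain ⟨s, rfl⟩ := hy
    have : r = s := hxy
    rw [this]
  | bCountSketch => exact Filter.Eventually.of_forall fun _ => trivial

/-- The moment generating function of the number of buckets of a key. -/
lemma integral_exp_card_supp_le (hb : 1 ≤ b) (s : ℝ) :
    ∫ κ, exp (s * #(supp κ)) ∂(colLaw kind ℓ b) ≤ exp (ℓ * (exp s - 1)) := by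
  have hs := add_one_le_exp s
  cases kind with
  | countSketch =>
    have := prob_hash hb
    change ∫ κ, _ ∂(Measure.map hashCol _) ≤ _
    rw [integral_map Measurable.of_discrete.aemeasurable (.of_discrete)]
    simp only [card_supp_hashCol, integral_const, probReal_univ, smul_eq_mul, one_mul]
    rw [mul_comm]
    gcongr
    linarith
  | bCountSketch =>
    change ∫ κ, _ ∂(Measure.pi _) ≤ _
    have h1 : ∀ κ : Col ℓ b, exp (s * #(supp κ)) =
        ∏ t, (if κ t ≠ 0 then exp s else 1) := fun κ => by
      rw [Finset.prod_ite, prod_const, prod_const_one, mul_one, ← exp_nat_mul, mul_comm]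
      rfl
    simp_rw [h1]
    rw [integral_fintype_prod_eq_prod (fun _ (x : SignType) => if x ≠ 0 then exp s else 1)]
    rw [prod_const, card_univ, integral_lazyLaw]
    have h2 : ((if (1 : SignType) ≠ 0 then exp s else 1) +
        (if (-1 : SignType) ≠ 0 then exp s else 1)) / (2 * (b : ℝ)) +
        (1 - 1 / (b : ℝ)) * (if (0 : SignType) ≠ 0 then exp s else 1) = 1 + (exp s - 1) / b := by
      rw [if_pos (by decide), if_pos (by decide), if_neg (by decide)]
      field_simp; ring
    rw [h2, Fintype.card_prod, Fintype.card_fin, Fintype.card_fin]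
    have h3 : 0 ≤ 1 + (exp s - 1) / b := by
      have : (exp s - 1) / b ≥ -(1 / b) := by
        rw [ge_iff_le, neg_eq_neg_one_mul, mul_one_div]
        gcongr
        have := exp_pos s
        linarith
      have := one_div_nat_le_one b
      linarith
    calc (1 + (exp s - 1) / b) ^ (ℓ * b) ≤ exp ((exp s - 1) / b) ^ (ℓ * b) := by
          gcongr
          linarith [add_one_le_exp ((exp s - 1) / b)]
      _ = _ := by
          rw [← exp_nat_mul]
          congr 1
          push_cast
          field_simp

/-! ### Tail bounds -/

lemma measureReal_le_integral {Ω : Type*} [Finite Ω] [MeasurableSpace Ω] [DiscreteMeasurableSpace Ω]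
    (P : Measure Ω) [IsFiniteMeasure P] {S : Set Ω} {f : Ω → ℝ} (h0 : ∀ ω, 0 ≤ f ω)
    (h1 : ∀ ω ∈ S, 1 ≤ f ω) : P.real S ≤ ∫ ω, f ω ∂P := by
  rw [← integral_indicator_one (μ := P) (s := S) .of_discrete]
  refine integral_mono .of_finite .of_finite fun ω => ?_
  by_cases h : ω ∈ S
  · simpa [h] using h1 ω h
  · simpa [h] using h0 ω

/-- The union bound. -/
lemma union_bound {X ι : Type*} [MeasurableSpace X] (μ : Measure X) [IsFiniteMeasure μ]
    (S : Finset ι) {A : Set X} (B : ι → Set X) {δ : ℝ} (hA : ∀ x ∈ A, ∃ i ∈ S, x ∈ B i)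
    (hB : ∀ i ∈ S, μ.real (B i) ≤ δ) : μ.real A ≤ #S * δ := by
  refine (measureReal_mono (s₂ := ⋃ i ∈ S, B i) (fun x hx => ?_) (measure_ne_top _ _)).trans
    ((measureReal_biUnion_finset_le _ _).trans ?_)
  · simpa using hA x hx
  · rw [← nsmul_eq_mul]
    exact sum_le_card_nsmul _ _ _ hB

/-- Exponentially small probabilities are eventually smaller than any power of `ℓ`. -/
lemma eventually_mul_exp_le (K a c : ℝ) (d : ℕ) (ha : 0 < a) :
    ∀ᶠ ℓ : ℕ in Filter.atTop, K * (ℓ : ℝ) ^ d * exp (-a * √ℓ) ≤ (ℓ : ℝ) ^ (-c) := by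
  have h1 := (tendsto_rpow_mul_exp_neg_mul_atTop_nhds_zero (2 * (d + c)) a ha).comp
    (tendsto_sqrt_atTop.comp tendsto_natCast_atTop_atTop)
  have h2 := h1.const_mul K
  rw [mul_zero] at h2
  filter_upwards [h2.eventually (gt_mem_nhds one_pos), Filter.eventually_ge_atTop 1] with ℓ h3 hℓ
  have hpos : (0 : ℝ) < ℓ := mod_cast hℓ
  simp only [Function.comp] at h3
  rw [rpow_mul (sqrt_nonneg _)] at h3
  rw [show (√ℓ) ^ (2 : ℝ) = ℓ by rw [rpow_two, sq_sqrt hpos.le], rpow_add hpos, rpow_natCast] at h3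
  rw [rpow_neg hpos.le, ← one_div, le_div_iff₀ (rpow_pos_of_pos hpos c)]
  calc _ = K * ((ℓ : ℝ) ^ d * (ℓ : ℝ) ^ c * exp (-a * √ℓ)) := by ring
    _ ≤ 1 := h3.le

lemma card_supp_tail (hb : 1 ≤ b) {η : ℝ} (h0 : 0 ≤ η) (h1 : η ≤ 1) :
    (colLaw kind ℓ b).real {κ | η * ℓ ≤ |(#(supp κ) : ℝ) - ℓ|} ≤ 2 * exp (-(η ^ 2 / 4 * ℓ)) := by
  have := prob_colLaw kind ℓ hb
  have key : ∀ s : ℝ, |s| = η / 2 → exp (-(s * ((1 + 2 * s) * ℓ))) *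
        ∫ κ, exp (s * #(supp κ)) ∂(colLaw kind ℓ b) ≤ exp (-(η ^ 2 / 4 * ℓ)) := by
    intro s hs
    have hs2 : s ^ 2 = η ^ 2 / 4 := by rw [← sq_abs, hs]; ring
    have h2 : exp s ≤ 1 + s + s ^ 2 := by
      have := abs_exp_sub_one_sub_id_le (x := s) (by rw [hs]; linarith)
      linarith [le_abs_self (exp s - 1 - s)]
    refine (mul_le_mul_of_nonneg_left (integral_exp_card_supp_le kind hb s) (exp_pos _).le).trans ?_
    rw [← exp_add]
    refine exp_le_exp.2 ?_
    rw [← hs2]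
    have : (ℓ : ℝ) * (exp s - 1) ≤ ℓ * (s + s ^ 2) := by gcongr; linarith
    nlinarith
  have hsub : (colLaw kind ℓ b).real {κ | η * ℓ ≤ |(#(supp κ) : ℝ) - ℓ|} ≤
      ∫ κ, (exp (-(η / 2 * ((1 + 2 * (η / 2)) * ℓ))) * exp (η / 2 * #(supp κ)) +
        exp (-(-(η / 2) * ((1 + 2 * (-(η / 2))) * ℓ))) *
          exp (-(η / 2) * #(supp κ))) ∂(colLaw kind ℓ b) := by
    refine measureReal_le_integral _ (fun κ => by positivity) fun κ hκ => ?_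
    have hκ' : η * ℓ ≤ |(#(supp κ) : ℝ) - ℓ| := hκ
    rcases le_abs.1 hκ' with h | h
    · have : 1 ≤ exp (-(η / 2 * ((1 + 2 * (η / 2)) * ℓ))) * exp (η / 2 * #(supp κ)) := by
        rw [← exp_add]
        refine one_le_exp ?_
        nlinarith
      linarith [exp_pos (-(-(η / 2) * ((1 + 2 * (-(η / 2))) * ℓ))),
        mul_pos (exp_pos (-(-(η / 2) * ((1 + 2 * (-(η / 2))) * ℓ))))
          (exp_pos (-(η / 2) * #(supp κ)))]
    · have : 1 ≤ exp (-(-(η / 2) * ((1 + 2 * (-(η / 2))) * ℓ))) * exp (-(η / 2) * #(supp κ)) := by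
        rw [← exp_add]
        refine one_le_exp ?_
        nlinarith
      linarith [mul_pos (exp_pos (-(η / 2 * ((1 + 2 * (η / 2)) * ℓ))))
          (exp_pos (η / 2 * #(supp κ)))]
  refine hsub.trans ?_
  rw [integral_add .of_finite .of_finite, integral_const_mul, integral_const_mul]
  have e1 := key (η / 2) (abs_of_nonneg (by linarith))
  have e2 := key (-(η / 2)) (by rw [abs_neg, abs_of_nonneg (by linarith)])
  linarith

/-! ### The robust estimator -/

section
variable (p : RobustParams) (μ : Measurements n ℓ b) (c : Bucket ℓ b → ℝ)
  (ξ : Fin n → Bool → ℝ × ℝ)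

lemma le_tmCharge (x : ℝ × ℝ) (f : Finset (Bucket ℓ b)) (cnt : Bucket ℓ b → ℕ) (t : Bucket ℓ b) :
    cnt t ≤ tmCharge p x f cnt t := by
  unfold tmCharge; split_ifs <;> omega

lemma le_robustKey (st : (Bucket ℓ b → ℕ) × Finset (Fin n)) (i : Fin n) (t : Bucket ℓ b) :
    st.1 t ≤ (robustKey p μ c ξ st i).1 t :=
  (le_tmCharge p _ _ _ t).trans (le_tmCharge p _ _ _ t)

lemma le_foldl_robustKey (l : List (Fin n)) (st : (Bucket ℓ b → ℕ) × Finset (Fin n))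
    (t : Bucket ℓ b) : st.1 t ≤ (l.foldl (robustKey p μ c ξ) st).1 t := by
  induction l generalizing st with
  | nil => exact le_rfl
  | cons i l ih => exact (le_robustKey p μ c ξ st i t).trans (ih _)

lemma mem_foldl_robustKey {h : Fin n} (l : List (Fin n)) (hl : h ∉ l)
    (st : (Bucket ℓ b → ℕ) × Finset (Fin n)) :
    h ∈ (l.foldl (robustKey p μ c ξ) st).2 ↔ h ∈ st.2 := by
  induction l generalizing st with
  | nil => exact Iff.rfl
  | cons i l ih =>
    rw [List.mem_cons, not_or] at hl
    rw [List.foldl_cons, ih hl.2]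
    unfold robustKey
    simp only
    split_ifs
    · rw [mem_insert]; exact or_iff_right hl.1
    · exact Iff.rfl

/-- In a round in which the noise of the test `f⁻` of `h` is below the threshold and no bucket is
aligned with `f⁻`, the key `h` is reported only if the test of `f⁺` is positive; then its active
buckets are charged. -/
lemma robustRound_spec {h : Fin n} (cnt : Bucket ℓ b → ℕ)
    (hneg : aligned μ c h false = ∅) (hξ : p.noise (ξ h false) < p.threshold)
    (hmem : h ∈ (robustRound p μ c ξ cnt).2) :
    ∃ cnt' : Bucket ℓ b → ℕ, (∀ t, cnt t ≤ cnt' t) ∧ tmTop p (ξ h true) (aligned μ c h true) cnt' ∧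
      (∀ t ∈ aligned μ c h true, min p.L (cnt t + 1) ≤ (robustRound p μ c ξ cnt).1 t) ∧
      ∀ t, cnt t ≤ (robustRound p μ c ξ cnt).1 t := by
  obtain ⟨l₁, l₂, hl⟩ := List.append_of_mem (List.mem_finRange h)
  have hnd := List.nodup_finRange n
  rw [hl] at hnd
  have h1 : h ∉ l₁ := fun hh => (List.disjoint_of_nodup_append hnd) hh (by simp)
  have h2 : h ∉ l₂ := (List.nodup_cons.1 (List.nodup_append.1 hnd).2.1).1
  have hmono : ∀ t, cnt t ≤ (robustRound p μ c ξ cnt).1 t := fun t =>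
    le_foldl_robustKey p μ c ξ _ (cnt, ∅) t
  unfold robustRound at hmem hmono ⊢
  rw [hl, List.foldl_append, List.foldl_cons] at hmem hmono ⊢
  set st₁ := l₁.foldl (robustKey p μ c ξ) (cnt, ∅) with hst₁
  rw [mem_foldl_robustKey p μ c ξ l₂ h2] at hmem
  have h3 : h ∉ st₁.2 := by rw [hst₁, mem_foldl_robustKey p μ c ξ l₁ h1]; exact notMem_empty h
  have hle : ∀ t, cnt t ≤ st₁.1 t := fun t => le_foldl_robustKey p μ c ξ l₁ (cnt, ∅) t
  have htop : tmTop p (ξ h true) (aligned μ c h true) st₁.1 := by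
    by_contra hno
    have hno2 : ¬ tmTop p (ξ h false) (aligned μ c h false)
        (tmCharge p (ξ h true) (aligned μ c h true) st₁.1) := by
      rw [tmTop, hneg, inter_empty, card_empty, Nat.cast_zero, zero_add, not_le]
      exact hξ
    unfold robustKey at hmem
    simp only at hmem
    rw [if_neg (by tauto)] at hmem
    exact h3 hmem
  refine ⟨st₁.1, hle, htop, fun t ht => ?_, hmono⟩
  refine le_trans ?_ (le_foldl_robustKey p μ c ξ l₂ _ t)
  have h4 : min p.L (cnt t + 1) ≤ tmCharge p (ξ h true) (aligned μ c h true) st₁.1 t := by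
    have := hle t
    unfold tmCharge
    split_ifs with h5
    · omega
    · have : ¬ st₁.1 t < p.L := fun hlt => h5 ⟨htop, mem_inter.2 ⟨by simp [active, hlt], ht⟩⟩
      omega
  exact h4.trans (le_tmCharge p _ _ _ t)

/-- The access counts after `r` rounds with the same query. -/
def countsAfter (ξ : NoiseIndex n → ℝ × ℝ) : ℕ → Bucket ℓ b → ℕ
  | 0 => fun _ => 0
  | r + 1 => (robustRound p μ c (fun i σ => ξ (r, i, σ)) (countsAfter ξ r)).1

lemma robustRespond_replicate (ξ : NoiseIndex n → ℝ × ℝ) (r : ℕ) :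
    robustRespond p (μ, ξ) (List.replicate (r + 1) c) =
      (robustRound p μ c (fun i σ => ξ (r, i, σ)) (countsAfter p μ c ξ r)).2 := by
  have key : ∀ r, ((List.replicate r c).zipIdx.foldl
      (fun (st : (Bucket ℓ b → ℕ) × Finset (Fin n)) cq =>
        robustRound p μ cq.1 (fun i σ => ξ (cq.2, i, σ)) st.1) ((fun _ => 0), ∅)).1 =
      countsAfter p μ c ξ r := by
    intro r
    induction r with
    | zero => rfl
    | succ r ih =>
      rw [List.replicate_succ', List.zipIdx_append, List.foldl_append]
      simp only [List.zipIdx_singleton, List.foldl_cons, List.foldl_nil, List.length_replicate,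
        zero_add]
      rw [ih]
      rfl
  unfold robustRespond
  rw [List.replicate_succ', List.zipIdx_append, List.foldl_append]
  simp only [List.zipIdx_singleton, List.foldl_cons, List.foldl_nil, List.length_replicate, zero_add]
  rw [key]

end

/-- The noise variables by which the robust estimator is certain to underestimate. -/
def lowNoise : Set (ℝ × ℝ) := Set.Iic (-1) ×ˢ Set.Iic 0

lemma noise_le_of_lowNoise {p : RobustParams} (hΔ : 0 ≤ p.Δ) (hB : 0 ≤ p.B) {x : ℝ × ℝ}
    (hx : x ∈ lowNoise) : p.noise x ≤ -(10 * p.Δ) := by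
  obtain ⟨h1, h2⟩ := hx
  simp only [Set.mem_Iic] at h1 h2
  have h3 : min p.Δ (p.B * x.2) ≤ 0 := (min_le_right _ _).trans (mul_nonpos_of_nonneg_of_nonpos hB h2)
  unfold RobustParams.noise
  nlinarith

lemma laplace_pos {s : Set ℝ} (hs : MeasurableSet s) (hv : 0 < volume s) : 0 < laplace s := by
  rw [laplace, withDensity_apply _ hs, setLIntegral_pos_iff (by fun_prop)]
  have : (Function.support fun x : ℝ => ENNReal.ofReal (exp (-|x|) / 2)) = Set.univ := by
    ext x
    simp only [Function.mem_support, ne_eq, ENNReal.ofReal_eq_zero, not_le, Set.mem_univ, iff_true]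
    positivity
  rwa [this, Set.univ_inter]

lemma measurableSet_lowNoise : MeasurableSet lowNoise := measurableSet_Iic.prod measurableSet_Iic

open Classical in
/-- The event that all noise variables of a round are low, as a Boolean. -/
def isLow (x : ℝ × ℝ) : Bool := decide (x ∈ lowNoise)

lemma measurable_isLow : Measurable isLow := by
  refine measurable_to_bool ?_
  have : isLow ⁻¹' {true} = lowNoise := by ext x; simp [isLow]
  rw [this]; exact measurableSet_lowNoise

/-- The law of `isLow`. -/
def lowLaw : Measure Bool := (laplace.prod laplace).map isLow

instance : IsProbabilityMeasure lowLaw := Measure.isProbabilityMeasure_map measurable_isLow.aemeasurable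

lemma lowLaw_true_pos : 0 < lowLaw {true} := by
  rw [lowLaw, Measure.map_apply measurable_isLow .of_discrete]
  have : isLow ⁻¹' {true} = lowNoise := by ext x; simp [isLow]
  rw [this, lowNoise, Measure.prod_prod]
  exact ENNReal.mul_pos (laplace_pos measurableSet_Iic (by simp)).ne'
    (laplace_pos measurableSet_Iic (by simp)).ne'

/-- The rounds `q < Q` in which both noise variables of `h` are low. -/
def lowRounds (h : Fin n) (Q : ℕ) (ξ : NoiseIndex n → ℝ × ℝ) : Finset (Fin Q) :=
  univ.filter fun q => ∀ σ, isLow (ξ (q, h, σ)) = true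

lemma mp_low (h : Fin n) (Q : ℕ) :
    MeasurePreserving (fun (ξ : NoiseIndex n → ℝ × ℝ) (q : Fin Q) (σ : Bool) => isLow (ξ (q, h, σ)))
      (Measure.infinitePi fun _ => laplace.prod laplace)
      (Measure.pi fun _ => Measure.pi fun _ => lowLaw) := by
  have h1 : MeasurePreserving (fun (ξ : NoiseIndex n → ℝ × ℝ) (x : Fin Q × Bool) => ξ (x.1, h, x.2))
      (Measure.infinitePi fun _ => laplace.prod laplace) (Measure.pi fun _ => laplace.prod laplace) := by
    refine ⟨by fun_prop, ?_⟩
    rw [← Measure.infinitePi_eq_pi]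
    refine Measure.map_infinitePi_infinitePi_of_inj
      (f := fun x : Fin Q × Bool => ((x.1 : ℕ), h, x.2)) ?_
    rintro ⟨q, σ⟩ ⟨q', σ'⟩ hq
    simp only [Prod.mk.injEq, true_and] at hq
    rw [Prod.mk.injEq]
    exact ⟨Fin.ext hq.1, hq.2⟩
  have h2 : MeasurePreserving isLow (laplace.prod laplace) lowLaw := ⟨measurable_isLow, rfl⟩
  exact (mp_curry_pi lowLaw).comp ((measurePreserving_pi _ _ fun _ => h2).comp h1)

lemma prob_few_lowRounds : ∃ g : ℝ, 0 < g ∧ ∀ {n : ℕ} (h : Fin n) (Q m : ℕ),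
    (Measure.infinitePi fun _ : NoiseIndex n => laplace.prod laplace).real
      {ξ | #(lowRounds h Q ξ) ≤ m} ≤ exp (m - g * Q) := by
  set ν : Measure (Bool → Bool) := Measure.pi fun _ => lowLaw with hν
  have hpos : 0 < ν.real {fun _ => true} := by
    rw [measureReal_def, hν, Measure.pi_singleton]
    refine ENNReal.toReal_pos (Finset.prod_ne_zero_iff.2 fun _ _ => lowLaw_true_pos.ne') ?_
    exact ENNReal.prod_ne_top fun _ _ => measure_ne_top _ _
  have he : exp (-1) < 1 := by rw [exp_lt_one_iff]; norm_num
  refine ⟨(1 - exp (-1)) * ν.real {fun _ => true}, mul_pos (by linarith) hpos, ?_⟩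
  intro n h Q m
  set g := (1 - exp (-1)) * ν.real {fun _ => true}
  classical
  set φ : (Bool → Bool) → ℝ := fun y => if y = (fun _ => true) then exp (-1) else 1 with hφ
  have hint : ∫ y, φ y ∂ν = 1 - g := by
    have : φ = fun y => 1 - (1 - exp (-1)) * ({fun _ => true} : Set (Bool → Bool)).indicator 1 y := by
      ext y
      by_cases hy : y = fun _ => true
      · simp [hφ, hy]
      · simp [hφ, hy]
    rw [this, integral_sub .of_finite .of_finite, integral_const_mul,
      integral_indicator_one .of_discrete]
    simp [g]
  set S : Set (Fin Q → Bool → Bool) := {y | #{q | y q = fun _ => true} ≤ m}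
  have hS : (fun (ξ : NoiseIndex n → ℝ × ℝ) (q : Fin Q) (σ : Bool) => isLow (ξ (q, h, σ))) ⁻¹' S =
      {ξ | #(lowRounds h Q ξ) ≤ m} := by
    ext ξ
    simp only [S, Set.mem_preimage, Set.mem_ofPred_eq, lowRounds, funext_iff]
  rw [← hS, (mp_low h Q).measureReal_preimage
    (DiscreteMeasurableSpace.forall_measurableSet S).nullMeasurableSet]
  have h1 : (ν ^⊗ (Fin Q)).real S ≤ ∫ y, exp m * ∏ q, φ (y q) ∂(ν ^⊗ (Fin Q)) := by
    have hφ0 : ∀ y, 0 < φ y := fun y => by simp only [hφ]; split_ifs <;> positivity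
    refine measureReal_le_integral _
      (fun y => mul_nonneg (exp_pos _).le (prod_nonneg fun q _ => (hφ0 _).le)) fun y hy => ?_
    have : ∏ q, φ (y q) = exp (-(#{q | y q = fun _ => true} : ℝ)) := by
      simp only [hφ]
      rw [Finset.prod_ite, prod_const, prod_const_one, mul_one, ← exp_nat_mul]
      congr 1; ring
    rw [this, ← exp_add]
    refine one_le_exp ?_
    have : (#{q | y q = fun _ => true} : ℝ) ≤ m := mod_cast hy
    linarith
  refine h1.trans ?_
  rw [integral_const_mul, integral_fintype_prod_eq_prod (fun _ y => φ y), prod_const, hint, card_univ,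
    Fintype.card_fin, show (m : ℝ) - g * Q = m + -(g * Q) by ring, exp_add]
  refine mul_le_mul_of_nonneg_left ?_ (exp_pos _).le
  have hg1 : g ≤ 1 := by
    have : ν.real {fun _ => true} ≤ 1 := measureReal_le_one
    have := exp_pos (-1)
    nlinarith
  clear_value g
  calc (1 - g) ^ Q ≤ exp (-g) ^ Q := by
        gcongr
        linarith [add_one_le_exp (-g)]
    _ = exp (-(g * Q)) := by rw [← exp_nat_mul]; congr 1; ring

section


/-- The query consisting of a single key. -/
def basisVec (h : Fin n) : Fin n → ℝ := fun i => if i = h then 1 else 0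

lemma isHeavyHitter_basisVec (h : Fin n) {k : ℕ} (hk : 1 ≤ k) : IsHeavyHitter k (basisVec h) h := by
  refine isHeavyHitter_of_sum_lt (fun j => ?_) hk ?_
  · unfold basisVec; rw [if_pos rfl]; split_ifs <;> simp
  · rw [sum_eq_zero fun j hj => by simp [basisVec, ne_of_mem_erase hj]]
    simp only [basisVec, if_true]
    have : (1 : ℝ) ≤ k := mod_cast hk
    linarith

lemma sketch_basisVec (μ : Measurements n ℓ b) (h : Fin n) : sketch μ (basisVec h) = fun t => (μ t h : ℝ) := by
  ext t
  simp [sketch, basisVec]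

lemma filter_ofCols_ne_zero (ω : Fin n → Col ℓ b) (h : Fin n) :
    (univ.filter fun t => ofCols ω t h ≠ 0) = supp (ω h) := by
  ext t
  rw [mem_filter, mem_supp]
  simp only [ofCols, mem_univ, true_and]
  generalize ω h t = y
  revert y
  decide

lemma aligned_true_basisVec (ω : Fin n → Col ℓ b) (h : Fin n) :
    aligned (ofCols ω) (sketch (ofCols ω) (basisVec h)) h true = supp (ω h) := by
  ext t
  rw [sketch_basisVec]
  simp only [aligned, mem_filter, mem_univ, true_and, ofCols, sgn, mem_supp]
  generalize ω h t = x
  cases x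
  · norm_num
  · norm_num
  · norm_num

lemma aligned_false_basisVec (μ : Measurements n ℓ b) (h : Fin n) :
    aligned μ (sketch μ (basisVec h)) h false = ∅ := by
  rw [sketch_basisVec, aligned, filter_eq_empty_iff]
  intro t _
  simp only [sgn, not_lt]
  push_cast
  nlinarith [sq_nonneg (μ t h : ℝ)]

/-- While `h` keeps being reported, the access counts of its buckets are at least the number of
rounds with low noise, until these buckets are inactive. -/
lemma min_lowRounds_le_counts (p : RobustParams) (ω : Fin n → Col ℓ b) (h : Fin n)
    (ξ : NoiseIndex n → ℝ × ℝ) (hlow : ∀ x ∈ lowNoise, p.noise x < p.threshold) (Q : ℕ)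
    (hrep : ∀ r < Q, h ∈ robustRespond p (ofCols ω, ξ)
      (List.replicate (r + 1) (sketch (ofCols ω) (basisVec h)))) (t : Bucket ℓ b)
    (ht : t ∈ supp (ω h)) : min p.L #((range Q).filter fun q => ∀ σ, isLow (ξ (q, h, σ)) = true) ≤
      countsAfter p (ofCols ω) (sketch (ofCols ω) (basisVec h)) ξ Q t := by
  induction Q with
  | zero => simp
  | succ Q ih =>
    have ih := ih fun r hr => hrep r (by omega)
    have hQ := hrep Q (by omega)
    rw [robustRespond_replicate] at hQ
    rw [range_add_one, filter_insert]
    simp only [countsAfter]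
    split_ifs with hg
    · obtain ⟨cnt', _, _, h3, _⟩ := robustRound_spec p (ofCols ω) _ (fun i σ => ξ (Q, i, σ)) _
        (aligned_false_basisVec _ h) (hlow _ (by simpa [isLow] using hg false)) hQ
      have := h3 t (by rwa [aligned_true_basisVec])
      rw [card_insert_of_notMem (by simp)]
      omega
    · exact ih.trans (le_foldl_robustKey p _ _ _ _ (_, ∅) t)

/-- If `h` is reported in all rounds, then either few rounds have low noise, or there is no round of
low noise at all, unless the noise is small compared to the number of buckets of `h`. -/
lemma few_lowRounds_of_reported (p : RobustParams) (ω : Fin n → Col ℓ b) (h : Fin n)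
    (ξ : NoiseIndex n → ℝ × ℝ) (hlow : ∀ x ∈ lowNoise, p.noise x < p.threshold) (Q : ℕ)
    (hrep : ∀ r < Q, h ∈ robustRespond p (ofCols ω, ξ)
      (List.replicate (r + 1) (sketch (ofCols ω) (basisVec h)))) : #(lowRounds h Q ξ) ≤ p.L ∧
      ((∀ x ∈ lowNoise, (#(supp (ω h)) : ℝ) + p.noise x < p.threshold) →
        #(lowRounds h Q ξ) = 0) := by
  have hcard : #(lowRounds h Q ξ) =
      #((range Q).filter fun q => ∀ σ, isLow (ξ (q, h, σ)) = true) := by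
    rw [lowRounds, card_filter, card_filter,
      Fin.sum_univ_eq_sum_range (fun q : ℕ => if ∀ σ, isLow (ξ (q, h, σ)) = true then 1 else 0)]
  have hround : ∀ r < Q, (∀ σ, isLow (ξ (r, h, σ)) = true) → (∃ t ∈ supp (ω h),
        countsAfter p (ofCols ω) (sketch (ofCols ω) (basisVec h)) ξ r t < p.L) ∧
      ¬ (∀ x ∈ lowNoise, (#(supp (ω h)) : ℝ) + p.noise x < p.threshold) := by
    intro r hr hg
    have hQ := hrep r hr
    rw [robustRespond_replicate] at hQ
    have hx : ∀ σ, ξ (r, h, σ) ∈ lowNoise := fun σ => by simpa [isLow] using hg σ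
    obtain ⟨cnt', h1, h2, _, _⟩ := robustRound_spec p (ofCols ω) _ (fun i σ => ξ (r, i, σ)) _
      (aligned_false_basisVec _ h) (hlow _ (hx false)) hQ
    rw [aligned_true_basisVec, tmTop] at h2
    constructor
    · by_contra hno
      push Not at hno
      have : active p.L cnt' ∩ supp (ω h) = ∅ := by
        rw [eq_empty_iff_forall_notMem]
        intro t ht
        rw [mem_inter, active, mem_filter] at ht
        have := hno t ht.2
        have := h1 t
        omega
      rw [this, card_empty, Nat.cast_zero, zero_add] at h2
      exact absurd h2 (not_le.2 (hlow _ (hx true)))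
    · intro hall
      have h3 : (#(active p.L cnt' ∩ supp (ω h)) : ℝ) ≤ #(supp (ω h)) := by
        exact_mod_cast card_le_card inter_subset_right
      linarith [hall _ (hx true)]
  constructor
  · rw [hcard]
    by_contra hlt
    push Not at hlt
    obtain ⟨r, hr, hr2⟩ : ∃ r < Q, (∀ σ, isLow (ξ (r, h, σ)) = true) ∧
        p.L ≤ #((range r).filter fun q => ∀ σ, isLow (ξ (q, h, σ)) = true) := by
      clear hrep hcard hround
      induction Q with
      | zero => simp at hlt
      | succ Q ih =>
        rw [range_add_one, filter_insert] at hlt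
        split_ifs at hlt with hg
        · rw [card_insert_of_notMem (by simp)] at hlt
          exact ⟨Q, by omega, hg, by omega⟩
        · obtain ⟨r, hr, h2⟩ := ih hlt
          exact ⟨r, by omega, h2⟩
    obtain ⟨⟨t, ht, ht2⟩, _⟩ := hround r hr hr2.1
    have := min_lowRounds_le_counts p ω h ξ hlow r (fun r' hr' => hrep r' (by omega)) t ht
    rw [min_eq_left hr2.2] at this
    omega
  · intro hall
    rw [hcard, card_eq_zero, filter_eq_empty_iff]
    intro r hr hg
    exact (hround r (mem_range.1 hr) hg).2 hall

lemma map_sketch_fullRun (μ : Measurements n ℓ b) (respond : List (Bucket ℓ b → ℝ) → Finset (Fin n))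
    (h : Fin n) (v : Fin n → ℝ) (Q : ℕ) :
    (fullRun μ respond h (fun _ => v) Q).map (fun x => sketch μ x.1) =
      List.replicate Q (sketch μ v) := by
  induction Q with
  | zero => rfl
  | succ Q ih => rw [fullRun_succ, List.map_append, ih, List.replicate_succ']; rfl

lemma reported_of_fullBits (μ : Measurements n ℓ b)
    (respond : List (Bucket ℓ b → ℝ) → Finset (Fin n)) (h : Fin n) (v : Fin n → ℝ) (Q : ℕ)
    (hbits : false ∉ fullBits μ respond h (fun _ => v) Q) :
    ∀ r < Q, h ∈ respond (List.replicate (r + 1) (sketch μ v)) := by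
  induction Q with
  | zero => intro r hr; omega
  | succ Q ih =>
    rw [fullBits_succ, List.mem_append, not_or, map_sketch_fullRun, ← List.replicate_succ'] at hbits
    intro r hr
    rcases Nat.lt_succ_iff_lt_or_eq.1 hr with hr | rfl
    · exact ih hbits.1 r hr
    · grind

end

theorem robust_attack (C₁ C₂ τ c : ℝ) (hC₁ : 0 < C₁) (hC₂ : 0 < C₂) (hτ : 0 < τ) :
    ∃ (C : ℝ) (ℓ₀ : ℕ), 0 < C ∧ ∀ (kind : SketchKind) (n ℓ b k L m : ℕ),
        ℓ₀ ≤ ℓ → 1 ≤ b → 1 ≤ k → ℓ ≤ n → 1 ≤ L → L ≤ m → ∃ Q : ℕ, (Q : ℝ) ≤ C * (ℓ : ℝ) ^ 2 ∧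
          AdmitsAttack (robustLaw kind n ℓ b) Prod.fst
            (robustRespond (robustParams C₁ C₂ τ n ℓ b L m)) k Q (1 - (ℓ : ℝ) ^ (-c)) := by
  obtain ⟨g, hg, hlowprob⟩ := prob_few_lowRounds
  have hev : ∀ᶠ ℓ : ℕ in Filter.atTop, 1 ≤ ℓ ∧ exp (3 * C₁) * C₂ ≤ ℓ ∧
      3 * (ℓ : ℝ) ^ 0 * exp (-(1 / 4) * √ℓ) ≤ (ℓ : ℝ) ^ (-c) := (Filter.eventually_ge_atTop 1).and
      ((tendsto_natCast_atTop_atTop.eventually_ge_atTop _).and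
        (eventually_mul_exp_le 3 (1 / 4) c 0 (by norm_num)))
  obtain ⟨ℓ₀, hℓ₀⟩ := Filter.eventually_atTop.1 hev
  refine ⟨2 / g + 1, ℓ₀, by positivity, ?_⟩
  intro kind n ℓ b k L m hℓ hb hk hℓn hL hLm
  obtain ⟨hℓ1, hℓ2, hℓ3⟩ := hℓ₀ ℓ hℓ
  have hℓpos : (1 : ℝ) ≤ ℓ := mod_cast hℓ1
  set Q := ⌈2 / g * (ℓ : ℝ) ^ 2⌉₊ with hQ
  have hQ1 : 2 * (ℓ : ℝ) ^ 2 ≤ g * Q := by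
    have : 2 / g * (ℓ : ℝ) ^ 2 ≤ Q := Nat.le_ceil _
    calc 2 * (ℓ : ℝ) ^ 2 = g * (2 / g * (ℓ : ℝ) ^ 2) := by field_simp
      _ ≤ _ := by gcongr
  refine ⟨Q, ?_, ?_⟩
  · have := Nat.ceil_lt_add_one (a := 2 / g * (ℓ : ℝ) ^ 2) (by positivity)
    rw [add_mul]
    have : 1 ≤ (ℓ : ℝ) ^ 2 := by nlinarith
    linarith
  have h : Fin n := ⟨0, by omega⟩
  set p := robustParams C₁ C₂ τ n ℓ b L m with hp
  -- the noise scale is at least `3 √L`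
  have hn1 : (ℓ : ℝ) ≤ n := mod_cast hℓn
  have hb1 : (1 : ℝ) ≤ b := mod_cast hb
  have hL1 : (1 : ℝ) ≤ L := mod_cast hL
  have hm1 : (1 : ℝ) ≤ m := mod_cast hL.trans hLm
  have hsL : 1 ≤ √L := by rw [← sqrt_one]; exact sqrt_le_sqrt hL1
  have hBL : 3 * √L ≤ p.B := by
    have hlog : 3 * C₁ ≤ log (1 / p.δ) := by
      rw [le_log_iff_exp_le]
      · simp only [hp, robustParams, one_div_div]
        rw [le_div_iff₀ hC₂]
        have h1 : (n : ℝ) ≤ n * m := le_mul_of_one_le_right (by positivity) hm1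
        have h2 : (n : ℝ) * m ≤ n * m * b := le_mul_of_one_le_right (by positivity) hb1
        have h3 : (n : ℝ) * m * b ≤ n * m * b * L := le_mul_of_one_le_right (by positivity) hL1
        linarith
      · simp only [hp, robustParams, one_div_div]
        have : (0 : ℝ) < n := by linarith
        positivity
    have : p.B = √L / C₁ * log (1 / p.δ) := by
      simp only [RobustParams.B]
      congr 1
      simp [hp, robustParams]
    rw [this]
    calc 3 * √L = √L / C₁ * (3 * C₁) := by field_simp
      _ ≤ _ := by gcongr
  have hlogB : 1 ≤ log p.B := by
    rw [le_log_iff_exp_le (by linarith)]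
    linarith [exp_one_lt_d9]
  have hΔB : p.B ≤ p.Δ := by
    unfold RobustParams.Δ
    exact le_mul_of_one_le_right (by linarith) hlogB
  have hthr : p.threshold = ℓ * τ := rfl
  have hthr0 : 0 < p.threshold := by rw [hthr]; positivity
  have hlow : ∀ x ∈ lowNoise, p.noise x < p.threshold := fun x hx => by
    have := noise_le_of_lowNoise (p := p) (by linarith) (by linarith) hx
    linarith
  have hpL : p.L = L := rfl
  have := prob_measurementLaw kind n ℓ hb
  have := prob_colLaw kind ℓ hb
  have : IsProbabilityMeasure (robustLaw kind n ℓ b) := by unfold robustLaw; infer_instance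
  refine admitsAttack_of_watch _ _ _ h (fun _ => basisVec h) (Q₀ := 0) (by positivity)
    (fun _ _ => isHeavyHitter_basisVec h hk) ?_
  -- failure requires few rounds of low noise or an exceptional number of buckets of `h`
  have hmp : MeasurePreserving (Prod.map (ofCols (n := n)) id) ((colLaw kind ℓ b ^⊗ (Fin n)).prod
        (Measure.infinitePi fun _ : NoiseIndex n => laplace.prod laplace)) (robustLaw kind n ℓ b) :=
    (measurementLaw_eq kind n ℓ hb).prod (MeasurePreserving.id _)
  have hmeas1 : Measurable (fun ξ : NoiseIndex n → ℝ × ℝ => #(lowRounds h Q ξ)) := by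
    have : (fun ξ : NoiseIndex n → ℝ × ℝ => #(lowRounds h Q ξ)) =
        (fun y : Fin Q → Bool → Bool => #{q | ∀ σ, y q σ = true}) ∘
          (fun ξ q σ => isLow (ξ (q, h, σ))) := rfl
    rw [this]
    exact Measurable.of_discrete.comp (mp_low h Q).measurable
  set E : Set (Measurements n ℓ b × (NoiseIndex n → ℝ × ℝ)) :=
    {x | #(lowRounds h Q x.2) ≤ ℓ ^ 2} ∪ {x | 1 * (ℓ : ℝ) ≤ |(#{t | x.1 t h ≠ 0} : ℝ) - ℓ|}
  have hE1 : MeasurableSet {x : Measurements n ℓ b × (NoiseIndex n → ℝ × ℝ) |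
      #(lowRounds h Q x.2) ≤ ℓ ^ 2} :=
    (hmeas1.comp measurable_snd) (DiscreteMeasurableSpace.forall_measurableSet {a | a ≤ ℓ ^ 2})
  have hE2 : MeasurableSet {x : Measurements n ℓ b × (NoiseIndex n → ℝ × ℝ) |
      1 * (ℓ : ℝ) ≤ |(#{t | x.1 t h ≠ 0} : ℝ) - ℓ|} := by
    exact measurable_fst (DiscreteMeasurableSpace.forall_measurableSet
      {y : Measurements n ℓ b | 1 * (ℓ : ℝ) ≤ |(#{t | y t h ≠ 0} : ℝ) - ℓ|})
  have hprob : (robustLaw kind n ℓ b) E ≤ ENNReal.ofReal ((ℓ : ℝ) ^ (-c)) := by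
    have h1 : (robustLaw kind n ℓ b).real {x | #(lowRounds h Q x.2) ≤ ℓ ^ 2} ≤
        exp (-(ℓ : ℝ) ^ 2) := by
      have hsnd : MeasurePreserving Prod.snd (robustLaw kind n ℓ b)
        (Measure.infinitePi fun _ : NoiseIndex n => laplace.prod laplace) := measurePreserving_snd
      have := hsnd.measureReal_preimage
        (hmeas1 (DiscreteMeasurableSpace.forall_measurableSet {a | a ≤ ℓ ^ 2})).nullMeasurableSet
      refine (le_of_eq this).trans ((hlowprob h Q (ℓ ^ 2)).trans (exp_le_exp.2 ?_))
      push_cast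
      linarith
    have h2 : (robustLaw kind n ℓ b).real {x | 1 * (ℓ : ℝ) ≤ |(#{t | x.1 t h ≠ 0} : ℝ) - ℓ|} ≤
        2 * exp (-(1 ^ 2 / 4 * ℓ)) := by
      have hh : MeasurePreserving (fun x : (Fin n → Col ℓ b) × (NoiseIndex n → ℝ × ℝ) => x.1 h)
          ((colLaw kind ℓ b ^⊗ (Fin n)).prod
            (Measure.infinitePi fun _ : NoiseIndex n => laplace.prod laplace)) (colLaw kind ℓ b) :=
        (measurePreserving_eval (fun _ : Fin n => colLaw kind ℓ b) h).comp measurePreserving_fst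
      rw [← hmp.measureReal_preimage hE2.nullMeasurableSet]
      refine le_trans (le_of_eq ?_) (card_supp_tail kind hb zero_le_one le_rfl)
      rw [← hh.real_preimage]
      congr 1
      ext x
      simp only [Set.mem_preimage, Set.mem_ofPred_eq, Prod.map_fst, filter_ofCols_ne_zero]
    rw [← ofReal_measureReal]
    refine ENNReal.ofReal_le_ofReal ((measureReal_union_le _ _).trans ((add_le_add h1 h2).trans
      (le_trans ?_ hℓ3)))
    have hs : √ℓ ≤ ℓ := by
      rw [sqrt_le_left (by linarith)]
      nlinarith
    have e1 : exp (-(ℓ : ℝ) ^ 2) ≤ exp (-(1 / 4) * √ℓ) := by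
      refine exp_le_exp.2 ?_
      nlinarith
    have e2 : exp (-(1 ^ 2 / 4 * (ℓ : ℝ))) ≤ exp (-(1 / 4) * √ℓ) := by
      refine exp_le_exp.2 ?_
      linarith
    rw [pow_zero]
    linarith
  refine le_trans ?_ hprob
  refine le_trans ?_ (le_of_eq (hmp.measure_preimage (hE1.union hE2).nullMeasurableSet))
  have hfail : ∀ x : (Fin n → Col ℓ b) × (NoiseIndex n → ℝ × ℝ),
      false ∉ (fullBits (ofCols x.1) (robustRespond p (ofCols x.1, x.2)) h
        (fun _ => basisVec h) Q).drop 0 →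
      (Prod.map ofCols id x : Measurements n ℓ b × (NoiseIndex n → ℝ × ℝ)) ∈ E := by
    rintro ⟨ω, ξ⟩ hx
    rw [List.drop_zero] at hx
    obtain ⟨h1, h2⟩ := few_lowRounds_of_reported p ω h ξ hlow Q
      (reported_of_fullBits (ofCols ω) _ h (basisVec h) Q hx)
    rw [hpL] at h1
    by_cases hLℓ : L ≤ ℓ ^ 2
    · exact Or.inl (h1.trans hLℓ)
    · by_contra hno
      simp only [E, Set.mem_union, not_or, Set.mem_ofPred_eq, not_le, Prod.map_fst, Prod.map_snd,
        id] at hno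
      have hT : (#(supp (ω h)) : ℝ) < 2 * ℓ := by
        have h3 := (abs_lt.1 hno.2).2
        rw [filter_ofCols_ne_zero] at h3
        linarith
      have hℓL : (ℓ : ℝ) ≤ √L := by
        refine le_sqrt_of_sq_le ?_
        have : ℓ ^ 2 ≤ L := by omega
        exact_mod_cast this
      have := h2 fun x hx => by
        have := noise_le_of_lowNoise (p := p) (by linarith) (by linarith) hx
        linarith
      have := hno.1
      rw [‹#(lowRounds h Q ξ) = 0›] at this
      omega
  -- the failure event need not be measurable: compare with the law of the columns
  have hset : {x : Measurements n ℓ b × (NoiseIndex n → ℝ × ℝ) |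
      false ∉ (fullBits x.1 (robustRespond p x) h (fun _ => basisVec h) Q).drop 0} ⊆
      E ∪ {x | x.1 ∉ Set.range (ofCols (n := n) (ℓ := ℓ) (b := b))} := by
    rintro ⟨y, ξ⟩ hx
    by_cases hy : y ∈ Set.range (ofCols (n := n) (ℓ := ℓ) (b := b))
    · obtain ⟨ω, rfl⟩ := hy
      exact Or.inl (hfail (ω, ξ) hx)
    · exact Or.inr hy
  have hnull : robustLaw kind n ℓ b {x | x.1 ∉ Set.range (ofCols (n := n) (ℓ := ℓ) (b := b))} = 0 := by
    have hms : MeasurableSet {x : Measurements n ℓ b × (NoiseIndex n → ℝ × ℝ) |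
        x.1 ∉ Set.range (ofCols (n := n) (ℓ := ℓ) (b := b))} :=
      measurable_fst (DiscreteMeasurableSpace.forall_measurableSet
        (Set.range (ofCols (n := n) (ℓ := ℓ) (b := b)))ᶜ)
    rw [← hmp.measure_preimage hms.nullMeasurableSet]
    have : Prod.map (ofCols (n := n)) id ⁻¹' {x : Measurements n ℓ b × (NoiseIndex n → ℝ × ℝ) |
        x.1 ∉ Set.range (ofCols (n := n) (ℓ := ℓ) (b := b))} = ∅ := by
      ext x
      simp
    rw [this, measure_empty]
  calc robustLaw kind n ℓ b _ ≤ robustLaw kind n ℓ b E + _ :=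
        (measure_mono hset).trans (measure_union_le _ _)
    _ = _ := by rw [hnull, add_zero, hmp.measure_preimage (hE1.union hE2).nullMeasurableSet]

/-! ### Sums of lazy signs -/

lemma integral_comp_mp {X Y : Type*} [MeasurableSpace X] [MeasurableSpace Y]
    [Countable Y] [DiscreteMeasurableSpace Y] {μ : Measure X} {ν : Measure Y} {f : X → Y}
    (hf : MeasurePreserving f μ ν) (g : Y → ℝ) : ∫ x, g (f x) ∂μ = ∫ y, g y ∂ν := by
  rw [← hf.map_eq, integral_map hf.measurable.aemeasurable .of_discrete]

/-- The law of the entries, in a single bucket, of the keys of an index set `I`. -/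
abbrev signLaw (b : ℕ) (I : Type*) [Fintype I] : Measure (I → SignType) := lazyLaw b ^⊗ I

/-- The sum of a family of signs. -/
def signSum {I : Type*} [Fintype I] (x : I → SignType) : ℤ := ∑ i, (x i : ℤ)

section
variable {I : Type*} [Fintype I]

@[simp] lemma signSum_neg (x : I → SignType) : signSum (fun i => -x i) = -signSum x := by
  simp [signSum]

lemma signSum_flip (s : Bool) (x : I → SignType) :
    signSum (fun i => flipSign s (x i)) = (if s then -1 else 1) * signSum x := by
  cases s <;> simp [flipSign]

lemma abs_signSum_le (x : I → SignType) : |signSum x| ≤ ♯I := by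
  refine (abs_sum_le_sum_abs _ _).trans ?_
  have : ∀ i ∈ (univ : Finset I), |((x i : SignType) : ℤ)| ≤ 1 := fun i _ => by
    generalize x i = y
    revert y; decide
  refine (sum_le_sum this).trans ?_
  simp

lemma mp_flip_signs (b : ℕ) (s : Bool) :
    MeasurePreserving (fun (x : I → SignType) i => flipSign s (x i)) (signLaw b I) (signLaw b I) :=
  measurePreserving_pi _ _ fun _ => mp_flipSign b s

lemma integral_exp_signSum_le {s : ℕ} (hb : 1 ≤ b) (hI : ♯I = b * s) {r : ℝ}
    (hr : |r| ≤ 1) : ∫ x, exp (r * signSum x) ∂(signLaw b I) ≤ exp (s * r ^ 2) := by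
  have hb' : (0 : ℝ) < b := mod_cast hb
  have h1 : ∀ x : I → SignType, exp (r * signSum x) =
      ∏ i, exp (r * ((x i : SignType) : ℤ)) := fun x => by
    rw [← exp_sum, signSum, Int.cast_sum, mul_sum]
  simp_rw [h1]
  rw [integral_fintype_prod_eq_prod (fun _ (x : SignType) => exp (r * ((x : SignType) : ℤ)))]
  rw [prod_const, card_univ, integral_lazyLaw, hI]
  simp only [SignType.coe_one, SignType.coe_neg_one, SignType.coe_zero, Int.cast_one, Int.cast_neg,
    Int.cast_zero, mul_one, mul_neg, mul_zero, exp_zero]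
  have e1 : exp r ≤ 1 + r + r ^ 2 := by
    have := abs_exp_sub_one_sub_id_le hr
    linarith [le_abs_self (exp r - 1 - r)]
  have e2 : exp (-r) ≤ 1 - r + r ^ 2 := by
    have := abs_exp_sub_one_sub_id_le (x := -r) (by rwa [abs_neg])
    nlinarith [le_abs_self (exp (-r) - 1 - -r)]
  have e3 : (exp r + exp (-r)) / (2 * b) ≤ (1 + r ^ 2) / b := by
    rw [div_le_div_iff₀ (by positivity) hb']
    nlinarith
  have e4 := one_div_nat_le_one b
  calc _ ≤ exp (r ^ 2 / b) ^ (b * s) := by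
        gcongr
        have := add_one_le_exp (r ^ 2 / (b : ℝ))
        rw [add_div 1] at e3
        linarith
    _ = _ := by
        rw [← exp_nat_mul]
        congr 1
        push_cast
        field_simp

lemma integral_signSum (b : ℕ) : ∫ x, (signSum x : ℝ) ∂(signLaw b I) = 0 := by
  have h := integral_comp_mp (mp_flip_signs (I := I) b true) (fun x => (signSum x : ℝ))
  simp only [signSum_flip, if_true, neg_mul, one_mul, Int.cast_neg, integral_neg] at h
  linarith

lemma integral_signSum_sq {s : ℕ} (hb : 1 ≤ b) (hI : ♯I = b * s) :
    ∫ x, (signSum x : ℝ) ^ 2 ∂(signLaw b I) = s := by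
  have h0 := integral_signSum (I := I) b
  have h1 := variance_eq_integral (μ := signLaw b I) (X := fun x => (signSum x : ℝ))
    (Measurable.of_discrete.aemeasurable)
  rw [h0] at h1
  simp only [sub_zero] at h1
  have h2 := variance_sum_pi (μ := fun _ : I => lazyLaw b)
    (X := fun (_ : I) (x : SignType) => (((x : SignType) : ℤ) : ℝ)) (fun _ => MemLp.of_discrete)
  have h3 : (∑ i, fun x : I → SignType => (((x i : SignType) : ℤ) : ℝ)) =
      fun x => (signSum x : ℝ) := by
    ext x; simp [signSum]
  rw [h3, h1] at h2
  rw [h2]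
  have h4 : Var[fun x : SignType => (((x : SignType) : ℤ) : ℝ); lazyLaw b] = 1 / b := by
    rw [variance_eq_integral Measurable.of_discrete.aemeasurable, integral_lazyLaw]
    simp only [integral_lazyLaw]
    simp
    field_simp
    norm_num
  rw [sum_const, h4, card_univ, hI]
  simp
  field_simp

/-- Chebyshev's inequality for a sum of lazy signs. -/
lemma signSum_chebyshev {s : ℕ} (hb : 1 ≤ b) (hI : ♯I = b * s) {r : ℝ} (hr : 0 < r) :
    (signLaw b I).real {x | r ≤ |(signSum x : ℝ)|} ≤ s / r ^ 2 := by
  rw [← integral_signSum_sq hb hI, ← integral_div]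
  refine measureReal_le_integral _ (fun x => by positivity) fun x hx => ?_
  have hx' : r ≤ |(signSum x : ℝ)| := hx
  rw [one_le_div (by positivity), ← sq_abs (signSum x : ℝ)]
  gcongr

lemma integral_cexp_signSum (b : ℕ) (hb : 1 ≤ b) (θ : ℝ) :
    ∫ x, Complex.exp (θ * Complex.I * (signSum x : ℤ)) ∂(signLaw b I) =
      (((1 - (1 - cos θ) / b) ^ ♯I : ℝ) : ℂ) := by
  have hb' : (b : ℂ) ≠ 0 := mod_cast (by omega : b ≠ 0)
  have h1 : ∀ x : I → SignType, Complex.exp (θ * Complex.I * (signSum x : ℤ)) =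
      ∏ i, Complex.exp (θ * Complex.I * ((x i : SignType) : ℤ)) := fun x => by
    rw [← Complex.exp_sum, signSum, Int.cast_sum, mul_sum]
  simp_rw [h1]
  rw [integral_fintype_prod_eq_prod
    (fun _ (x : SignType) => Complex.exp (θ * Complex.I * ((x : SignType) : ℤ)))]
  rw [prod_const, card_univ]
  have hl := one_div_nat_le_one b
  have hi : ∀ (c : ℝ) (x : SignType), Integrable
      (fun x : SignType => Complex.exp (θ * Complex.I * ((x : SignType) : ℤ)))
      (ENNReal.ofReal c • Measure.dirac x) :=
    fun c x => Integrable.smul_measure .of_finite ENNReal.ofReal_ne_top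
  rw [lazyLaw, integral_add_measure ((hi _ _).add_measure (hi _ _)) (hi _ _),
    integral_add_measure (hi _ _) (hi _ _)]
  simp only [integral_smul_measure, integral_dirac]
  rw [ENNReal.toReal_ofReal (by positivity), ENNReal.toReal_ofReal (by linarith)]
  simp only [SignType.coe_one, SignType.coe_neg_one, SignType.coe_zero, Int.cast_one, Int.cast_neg,
    Int.cast_zero, mul_one, mul_neg, mul_zero, Complex.exp_zero, Complex.real_smul]
  push_cast
  congr 1
  rw [Complex.cos, ← neg_mul]
  field_simp
  ring

lemma abs_charFun_le {s : ℕ} (hb : 1 ≤ b) (θ : ℝ) :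
    |(1 - (1 - cos θ) / b) ^ (b * s)| ≤ exp (-(s * sin θ ^ 2 / 2)) := by
  have hb' : (1 : ℝ) ≤ b := mod_cast hb
  have hc1 := abs_cos_le_one θ
  have hs : sin θ ^ 2 ≤ 2 * (1 - |cos θ|) := by
    have := sin_sq_add_cos_sq θ
    rw [← sq_abs (cos θ)] at this
    nlinarith [abs_nonneg (cos θ)]
  have h1 : |1 - (1 - cos θ) / b| ≤ 1 - (1 - |cos θ|) / b := by
    rw [abs_le]
    constructor
    · have : (1 - |cos θ|) / b + (1 - cos θ) / b ≤ 2 := by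
        rw [← add_div, div_le_iff₀ (by linarith)]
        have := neg_abs_le (cos θ)
        linarith
      linarith
    · gcongr
      exact le_abs_self _
  have h2 : 1 - (1 - |cos θ|) / b ≤ exp (-(sin θ ^ 2 / (2 * b))) := by
    have := add_one_le_exp (-(sin θ ^ 2 / (2 * (b : ℝ))))
    have h3 : sin θ ^ 2 / (2 * b) ≤ (1 - |cos θ|) / b := by
      rw [div_le_div_iff₀ (by positivity) (by linarith)]
      nlinarith
    linarith
  rw [abs_pow]
  calc _ ≤ exp (-(sin θ ^ 2 / (2 * b))) ^ (b * s) := by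
        gcongr
        exact h1.trans h2
    _ = _ := by
        rw [← exp_nat_mul]
        congr 1
        push_cast
        field_simp

lemma integral_exp_neg_sin_sq_le {s : ℕ} (hs : 1 ≤ s) : ∫ θ in (-π)..π, exp (-(s * sin θ ^ 2 / 2)) ≤
      3 * √(π / (2 * s / π ^ 2)) := by
  have hs' : (0 : ℝ) < s := mod_cast hs
  have hpi := pi_pos
  set a : ℝ := 2 * s / π ^ 2 with ha
  have ha0 : 0 < a := by positivity
  have hg : Integrable fun θ : ℝ => exp (-a * θ ^ 2) := integrable_exp_neg_mul_sq ha0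
  have key : ∀ φ : ℝ, |φ| ≤ π / 2 → exp (-(s * sin φ ^ 2 / 2)) ≤ exp (-a * φ ^ 2) := by
    intro φ hφ
    refine exp_le_exp.2 ?_
    have h1 := mul_abs_le_abs_sin hφ
    have h2 : (2 / π * |φ|) ^ 2 ≤ sin φ ^ 2 := by rw [← sq_abs (sin φ)]; gcongr
    rw [mul_pow, sq_abs] at h2
    have : a * φ ^ 2 = s * ((2 / π) ^ 2 * φ ^ 2) / 2 := by rw [ha]; field_simp
    rw [neg_mul, this]
    have := mul_le_mul_of_nonneg_left h2 hs'.le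
    linarith
  have h1 : ∫ θ in (-π)..π, exp (-(s * sin θ ^ 2 / 2)) ≤
      ∫ θ in (-π)..π, (exp (-a * θ ^ 2) + exp (-a * (θ - π) ^ 2) + exp (-a * (θ + π) ^ 2)) := by
    refine intervalIntegral.integral_mono_on (by linarith)
      (Continuous.intervalIntegrable (by fun_prop) _ _)
      (Continuous.intervalIntegrable (by fun_prop) _ _) fun θ hθ => ?_
    have p1 := exp_pos (-a * θ ^ 2)
    have p2 := exp_pos (-a * (θ - π) ^ 2)
    have p3 := exp_pos (-a * (θ + π) ^ 2)
    rcases le_or_gt |θ| (π / 2) with h | h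
    · linarith [key θ h]
    · rcases lt_abs.1 h with h | h
      · have := key (θ - π) (abs_le.2 ⟨by linarith, by linarith [hθ.2]⟩)
        rw [sin_sub_pi, neg_sq] at this
        linarith
      · have := key (θ + π) (abs_le.2 ⟨by linarith [hθ.1], by linarith⟩)
        rw [sin_add_pi, neg_sq] at this
        linarith
  refine h1.trans ?_
  have hg2 := hg.comp_sub_right π
  have hg3 := hg.comp_add_right π
  rw [intervalIntegral.integral_of_le (by linarith)]
  refine (setIntegral_le_integral ((hg.add hg2).add hg3)
    (Filter.Eventually.of_forall fun θ => ?_)).trans ?_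
  · simp only [Pi.zero_apply, Pi.add_apply]
    positivity
  · simp only [Pi.add_apply]
    rw [integral_add (f := fun θ => exp (-a * θ ^ 2) + exp (-a * (θ - π) ^ 2))
      (hg.add hg2) hg3, integral_add hg hg2, integral_sub_right_eq_self (fun θ => exp (-a * θ ^ 2)),
      integral_add_right_eq_self (fun θ => exp (-a * θ ^ 2)), integral_gaussian]
    linarith

lemma integral_cos_int_mul (m : ℤ) : ∫ θ in (-π)..π, cos (θ * m) = if m = 0 then 2 * π else 0 := by
  split_ifs with h
  · simp [h]; ring
  · have hm : (m : ℝ) ≠ 0 := mod_cast h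
    rw [intervalIntegral.integral_comp_mul_right _ hm, integral_cos]
    have : sin (π * m) = 0 := by rw [mul_comm]; exact sin_int_mul_pi m
    simp [neg_mul, sin_neg, this]

/-- A sum of lazy signs of variance `s` takes each value with probability `O(1 / √s)`. -/
lemma signSum_atom_le {s : ℕ} (hb : 1 ≤ b) (hs : 1 ≤ s) (hI : ♯I = b * s) (j : ℤ) :
    (signLaw b I).real {x | signSum x = j} ≤ 2 / √s := by
  classical
  have hs' : (0 : ℝ) < s := mod_cast hs
  have hpi := pi_pos
  have h1 : 2 * π * (signLaw b I).real {x | signSum x = j} =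
      ∫ θ in (-π)..π, ∫ x, cos (θ * ((signSum x - j : ℤ) : ℝ)) ∂(signLaw b I) := by
    simp_rw [integral_fintype (μ := signLaw b I) .of_finite]
    rw [intervalIntegral.integral_finsetSum fun x _ =>
      Continuous.intervalIntegrable (by fun_prop) _ _]
    simp_rw [smul_eq_mul, intervalIntegral.integral_const_mul, integral_cos_int_mul]
    rw [← integral_indicator_one .of_discrete, integral_fintype .of_finite, mul_sum]
    refine sum_congr rfl fun x _ => ?_
    by_cases hx : signSum x = j
    · simp [hx]; ring
    · have : signSum x - j ≠ 0 := sub_ne_zero.2 hx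
      simp [hx, this]
  have h2 : ∀ θ : ℝ, ∫ x, cos (θ * ((signSum x - j : ℤ) : ℝ)) ∂(signLaw b I) ≤
      exp (-(s * sin θ ^ 2 / 2)) := by
    intro θ
    have e1 : ∀ x : I → SignType, cos (θ * ((signSum x - j : ℤ) : ℝ)) =
        (Complex.exp (θ * Complex.I * (signSum x : ℤ)) * Complex.exp (-(θ * j) * Complex.I)).re := by
      intro x
      rw [← Complex.exp_add]
      have : (θ * Complex.I * (signSum x : ℤ) + -(θ * j) * Complex.I : ℂ) =
          ((θ * ((signSum x - j : ℤ) : ℝ) : ℝ) : ℂ) * Complex.I := by push_cast; ring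
      rw [this, Complex.exp_ofReal_mul_I_re]
    simp_rw [e1]
    have e2 := integral_re (μ := signLaw b I) (𝕜 := ℂ) (f := fun x : I → SignType =>
      Complex.exp (θ * Complex.I * (signSum x : ℤ)) * Complex.exp (-(θ * j) * Complex.I)) .of_finite
    refine (le_of_eq e2).trans ((Complex.re_le_norm _).trans ?_)
    rw [integral_mul_const, integral_cexp_signSum b hb, norm_mul, hI]
    have e3 : ‖Complex.exp (-(θ * j) * Complex.I)‖ = 1 := by
      have : (-(θ * j) * Complex.I : ℂ) = ((-(θ * j) : ℝ) : ℂ) * Complex.I := by push_cast; ring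
      rw [this, Complex.norm_exp_ofReal_mul_I]
    rw [e3, mul_one, Complex.norm_real, norm_eq_abs]
    exact abs_charFun_le hb θ
  have h3 : 2 * π * (signLaw b I).real {x | signSum x = j} ≤ 3 * √(π / (2 * s / π ^ 2)) := by
    rw [h1]
    refine le_trans (intervalIntegral.integral_mono_on (by linarith) ?_
      (Continuous.intervalIntegrable (by fun_prop) _ _) fun θ _ => h2 θ)
      (integral_exp_neg_sin_sq_le hs)
    simp_rw [integral_fintype (μ := signLaw b I) .of_finite]
    exact Continuous.intervalIntegrable (by fun_prop) _ _
  have h4 : √(π / (2 * s / π ^ 2)) ≤ 4 / 3 * π / √s := by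
    rw [sqrt_le_left (by positivity), div_pow, sq_sqrt hs'.le, div_div_eq_mul_div,
      div_le_div_iff₀ (by positivity) hs']
    have h5 := pi_lt_d2
    have : π * π ^ 2 ≤ 3.15 * π ^ 2 := by gcongr
    nlinarith [mul_pos (pow_pos hpi 2) hs']
  have h5 : 2 * π * (signLaw b I).real {x | signSum x = j} ≤ 2 * π * (2 / √s) := by grind
  exact le_of_mul_le_mul_left h5 (by positivity)

end

/-- A sum of lazy signs of variance `2 s` vanishes with probability of order at least `1 / √s`: it is
a sum of two independent symmetric variables with the same law, so the claim follows from the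
Cauchy-Schwarz inequality. -/
lemma signSum_zero_ge {I : Type*} [Fintype I] {s : ℕ} (hb : 1 ≤ b) (hs : 1 ≤ s) (hI : ♯I = b * s) :
    1 / (28 * √s) ≤ (signLaw b (Bool × I)).real {x | signSum x = 0} := by
  have hs' : (1 : ℝ) ≤ s := mod_cast hs
  set m : ℕ := ⌈2 * √s⌉₊ with hm
  set p : ℤ → ℝ := fun j => (signLaw b I).real {x | signSum x = j} with hp
  have hsq : 1 ≤ √s := by rw [← sqrt_one]; exact sqrt_le_sqrt hs'
  have hm1 : 2 * √s ≤ m := Nat.le_ceil _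
  have hm2 : (m : ℝ) ≤ 3 * √s := by
    have := Nat.ceil_lt_add_one (a := 2 * √s) (by positivity)
    linarith
  have hsymm : ∀ j, p (-j) = p j := fun j => by
    have := (mp_flip_signs (I := I) b true).real_preimage (s := {x | signSum x = j})
    rw [hp]
    simp only
    rw [← this]
    congr 1
    ext x
    simp only [Set.mem_preimage, Set.mem_ofPred_eq, signSum_flip, if_true]
    omega
  -- the mass of the interval `[-m, m]`
  have hmass : 3 / 4 ≤ ∑ j ∈ Icc (-(m : ℤ)) m, p j := by
    have h1 : ∑ j ∈ Icc (-(m : ℤ)) m, p j =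
        (signLaw b I).real {x | signSum x ∈ Icc (-(m : ℤ)) m} := by
      have : {x : I → SignType | signSum x ∈ Icc (-(m : ℤ)) m} =
          ⋃ j ∈ Icc (-(m : ℤ)) m, {x | signSum x = j} := by
        ext x; simp
      rw [this, measureReal_biUnion_finset _ fun _ _ => .of_discrete]
      intro i _ j _ hij
      exact Set.disjoint_left.2 fun x hx hy => hij ((Eq.symm hx).trans hy)
    have h2 := signSum_chebyshev (I := I) hb hI (r := 2 * √s) (by positivity)
    rw [mul_pow, sq_sqrt (by linarith)] at h2
    have h3 : (s : ℝ) / (2 ^ 2 * s) = 1 / 4 := by field_simp; norm_num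
    have h4 := probReal_compl_eq_one_sub (μ := signLaw b I)
      (s := {x | signSum x ∈ Icc (-(m : ℤ)) m}) .of_discrete
    have h5 : (signLaw b I).real {x | signSum x ∈ Icc (-(m : ℤ)) m}ᶜ ≤
        (signLaw b I).real {x | 2 * √s ≤ |(signSum x : ℝ)|} := by
      refine measureReal_mono ?_
      intro x hx
      simp only [Set.mem_compl_iff, Set.mem_ofPred_eq, mem_Icc, ← abs_le, not_le] at hx ⊢
      have : (m : ℝ) < |(signSum x : ℝ)| := mod_cast hx
      linarith
    rw [h1]
    linarith
  -- the Cauchy-Schwarz inequality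
  have hCS : (3 / 4) ^ 2 ≤ (2 * m + 1) * ∑ j ∈ Icc (-(m : ℤ)) m, p j ^ 2 := by
    have h1 := sq_sum_le_card_mul_sum_sq (s := Icc (-(m : ℤ)) m) (f := p)
    rw [Int.card_Icc, show ((m : ℤ) + 1 - -(m : ℤ)).toNat = 2 * m + 1 by omega] at h1
    push_cast at h1
    refine le_trans ?_ h1
    gcongr
  have hconv : ∑ j ∈ Icc (-(m : ℤ)) m, p j ^ 2 ≤
      (signLaw b (Bool × I)).real {x | signSum x = 0} := by
    have hc := mp_curry_pi (I := Bool) (J := I) (lazyLaw b)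
    have h1 : ∀ j : ℤ, (signLaw b (Bool × I)).real
        {x | signSum (fun i => x (true, i)) = j ∧ signSum (fun i => x (false, i)) = -j} =
          p j ^ 2 := by
      intro j
      have h2 := hc.real_preimage (s := Set.univ.pi fun c : Bool =>
        {y : I → SignType | signSum y = if c then j else -j})
      rw [measureReal_def (μ := Measure.pi _) (s := Set.univ.pi _), Measure.pi_pi,
        Fintype.prod_bool, ENNReal.toReal_mul] at h2
      simp only [if_true, Bool.false_eq_true, if_false] at h2
      have h3 : p j ^ 2 = p j * p (-j) := by rw [hsymm, sq]
      rw [h3]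
      refine Eq.trans ?_ h2
      rw [measureReal_def]
      congr 2
      ext x
      simp [and_comm]
    rw [← sum_congr rfl fun j _ => h1 j, ← measureReal_biUnion_finset]
    · refine measureReal_mono ?_
      intro x hx
      simp only [Set.mem_iUnion, Set.mem_ofPred_eq] at hx ⊢
      obtain ⟨j, _, h2, h3⟩ := hx
      have : signSum x = signSum (fun i => x (true, i)) + signSum (fun i => x (false, i)) := by
        simp only [signSum, Fintype.sum_prod_type, Fintype.sum_bool]
      omega
    · intro i _ j _ hij
      exact Set.disjoint_left.2 fun x hx hy => hij (hx.1.symm.trans hy.1)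
    · exact fun _ _ => .of_discrete
  have h6 : (3 / 4 : ℝ) ^ 2 ≤ (7 * √s) * (signLaw b (Bool × I)).real {x | signSum x = 0} :=
    hCS.trans (mul_le_mul (by linarith) hconv (sum_nonneg fun _ _ => sq_nonneg _) (by positivity))
  rw [div_le_iff₀ (by positivity)]
  linarith

/-! ### Accumulation of biased noise -/

lemma exp_neg_le_add_sq (u : ℝ) : exp (-u) ≤ 1 - u + u ^ 2 * exp |u| := by
  have h1 : 1 ≤ exp |u| := one_le_exp (abs_nonneg u)
  rcases le_or_gt |u| 1 with h | h
  · have := abs_exp_sub_one_sub_id_le (x := -u) (by rwa [abs_neg])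
    have h2 := le_abs_self (exp (-u) - 1 - -u)
    nlinarith [sq_nonneg u]
  · have h2 : exp (-u) ≤ exp |u| := exp_le_exp.2 (neg_le_abs u)
    have h3 := le_abs_self u
    have h4 : u ^ 2 = |u| ^ 2 := (sq_abs u).symm
    rw [h4]
    nlinarith [mul_nonneg (by nlinarith : 0 ≤ |u| ^ 2 - 1) (by linarith : 0 ≤ exp |u| - 1)]

lemma exp_abs_le (u : ℝ) : exp |u| ≤ exp u + exp (-u) := by
  rcases abs_cases u with ⟨h, _⟩ | ⟨h, _⟩ <;> rw [h]
  · linarith [exp_pos (-u)]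
  · linarith [exp_pos u]

section
variable {X : Type*} [Finite X] [MeasurableSpace X] [DiscreteMeasurableSpace X] (ν : Measure X)
  [IsProbabilityMeasure ν]

/-- If `|Y| ≤ |V|` and `V` is subgaussian, then the moment generating function of `Y` near the
origin is controlled by the mean of `Y`. -/
lemma integral_exp_neg_le_of_abs_le {Y V : X → ℝ} (hYV : ∀ x, |Y x| ≤ |V x|) {v : ℝ} (hv : 1 ≤ v)
    (hmgf : ∀ r : ℝ, |r| ≤ 1 → ∫ x, exp (r * V x) ∂ν ≤ exp (v * r ^ 2)) {a : ℝ}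
    (ha : 0 ≤ a) (hav : 16 * a ^ 2 * v ≤ 1) :
    ∫ x, exp (-(a * Y x)) ∂ν ≤ 1 - a * ∫ x, Y x ∂ν + 100 * a ^ 2 * v := by
  have hv0 : 0 < √v := sqrt_pos.2 (by linarith)
  have hsq : √v ^ 2 = v := sq_sqrt (by linarith)
  have hv1 : 1 ≤ √v := by rw [← sqrt_one]; exact sqrt_le_sqrt hv
  set b : ℝ := 1 / (2 * √v) with hb
  have hb0 : 0 < b := by positivity
  have hb1 : |b| ≤ 1 := by rw [abs_of_pos hb0, hb, div_le_one (by positivity)]; linarith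
  have hbv : v * b ^ 2 = 1 / 4 := by rw [hb, div_pow, mul_pow, hsq]; field_simp; norm_num
  have hab : a ≤ b / 2 := by
    rw [hb, div_div, le_div_iff₀ (by positivity)]
    refine le_of_sq_le_sq ?_ (by norm_num)
    rw [mul_pow, mul_pow, mul_pow, hsq]
    linarith
  have hpt : ∀ x, exp (-(a * Y x)) ≤ 1 - a * Y x +
      32 * (a ^ 2 * v) * (exp (b * V x) + exp (-b * V x)) := by
    intro x
    have h1 := exp_neg_le_add_sq (a * Y x)
    set w := b * |V x| with hw
    have hw0 : 0 ≤ w := by positivity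
    have h2 : |a * Y x| ≤ w / 2 := by
      rw [abs_mul, abs_of_nonneg ha]
      calc a * |Y x| ≤ b / 2 * |V x| := mul_le_mul hab (hYV x) (abs_nonneg _) (by linarith)
        _ = w / 2 := by rw [hw]; ring
    have h3 : (a * Y x) ^ 2 ≤ 4 * (a ^ 2 * v) * w ^ 2 := by
      have : 4 * (a ^ 2 * v) * w ^ 2 = (a * |V x|) ^ 2 := by
        rw [hw, mul_pow, mul_pow]
        linear_combination (4 * a ^ 2 * |V x| ^ 2) * hbv
      rw [this, mul_pow, mul_pow, ← sq_abs (Y x)]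
      exact mul_le_mul_of_nonneg_left (pow_le_pow_left₀ (abs_nonneg _) (hYV x) 2) (sq_nonneg a)
    have h4 : w ^ 2 ≤ 8 * exp (w / 2) := by
      have := quadratic_le_exp_of_nonneg (x := w / 2) (by linarith)
      nlinarith
    have h5 : exp w ≤ exp (b * V x) + exp (-b * V x) := by
      have := exp_abs_le (b * V x)
      rwa [abs_mul, abs_of_pos hb0, ← neg_mul] at this
    have h6 : (a * Y x) ^ 2 * exp |a * Y x| ≤ 32 * (a ^ 2 * v) * exp w := by
      calc (a * Y x) ^ 2 * exp |a * Y x| ≤ (4 * (a ^ 2 * v) * (8 * exp (w / 2))) * exp (w / 2) := by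
            gcongr
            refine h3.trans ?_
            gcongr
        _ = 32 * (a ^ 2 * v) * (exp (w / 2) * exp (w / 2)) := by ring
        _ = _ := by rw [← exp_add]; congr 2; ring
    have h7 : 32 * (a ^ 2 * v) * exp w ≤
        32 * (a ^ 2 * v) * (exp (b * V x) + exp (-b * V x)) := by gcongr
    linarith
  have hexp : exp (1 / 4) ≤ 3 / 2 := by
    have := abs_exp_sub_one_sub_id_le (x := 1 / 4) (by norm_num [abs_of_pos])
    have := le_abs_self (exp (1 / 4) - 1 - 1 / 4)
    linarith
  refine (integral_mono .of_finite .of_finite hpt).trans ?_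
  rw [integral_add .of_finite .of_finite, integral_sub .of_finite .of_finite, integral_const_mul,
    integral_const_mul, integral_add .of_finite .of_finite]
  have h8 := hmgf b hb1
  have h9 := hmgf (-b) (by rwa [abs_neg])
  rw [neg_sq] at h9
  rw [hbv] at h8 h9
  simp only [integral_const, probReal_univ, smul_eq_mul, mul_one]
  have h10 : 0 ≤ a ^ 2 * v := by positivity
  nlinarith

lemma integral_exp_le_of_abs_le {Y V : X → ℝ} (hYV : ∀ x, |Y x| ≤ |V x|) {v a : ℝ}
    (hmgf : ∀ r : ℝ, |r| ≤ 1 → ∫ x, exp (r * V x) ∂ν ≤ exp (v * r ^ 2))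
    (ha : |a| ≤ 1) : ∫ x, exp (a * Y x) ∂ν ≤ 2 * exp (v * a ^ 2) := by
  have hpt : ∀ x, exp (a * Y x) ≤ exp (a * V x) + exp (-a * V x) := by
    intro x
    rw [neg_mul]
    refine le_trans (exp_le_exp.2 ((le_abs_self _).trans ?_)) (exp_abs_le (a * V x))
    rw [abs_mul, abs_mul]
    exact mul_le_mul_of_nonneg_left (hYV x) (abs_nonneg a)
  refine (integral_mono .of_finite .of_finite hpt).trans ?_
  rw [integral_add .of_finite .of_finite]
  have h8 := hmgf a ha
  have h9 := hmgf (-a) (by rwa [abs_neg])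
  rw [neg_sq] at h9
  linarith

/-- Chernoff's bound for a sum of independent variables. -/
lemma chernoff_pi_prod {T : Type*} [Fintype T] (Y : T → X → ℝ) {a : ℝ} :
    (ν ^⊗ T).real {x | a ≤ ∑ t, Y t (x t)} ≤ exp (-a) * ∏ t, ∫ x, exp (Y t x) ∂ν := by
  have : ∀ _ : T, Countable X := fun _ => inferInstance
  refine (measureReal_le_integral _ (f := fun x => exp (-a) * ∏ t, exp (Y t (x t)))
    (fun x => by positivity) fun x hx => ?_).trans ?_
  · rw [← exp_sum, ← exp_add]
    refine one_le_exp ?_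
    have hx' : a ≤ ∑ t, Y t (x t) := hx
    linarith
  · rw [integral_const_mul, integral_fintype_prod_eq_prod (fun t x => exp (Y t x))]

/-- Chernoff's bound for independent copies of `Y`. -/
lemma chernoff_pi (Y : X → ℝ) {Q : ℕ} {a : ℝ} : (ν ^⊗ (Fin Q)).real {x | a ≤ ∑ q, Y (x q)} ≤
      exp (-a) * (∫ x, exp (Y x) ∂ν) ^ Q := by
  refine (chernoff_pi_prod ν fun _ => Y).trans_eq ?_
  rw [prod_const, card_univ, Fintype.card_fin]

/-- The noise collected, in each bucket, in the rounds in which the watched key is reported. -/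
def collected {T : Type*} (rep : X → Bool) (Z : X → T → ℤ) {Q : ℕ} (x : Fin Q → X) (t : T) : ℤ :=
  ∑ q, if rep (x q) then Z (x q) t else 0

/-- The collected noise `W` is not of the order `Q` in a quarter of the buckets. -/
def NoiseFails {T : Type*} [Fintype T] (β : ℝ) (ℓ Q : ℕ) (W : T → ℤ) : Prop :=
  1 / 4 * (ℓ : ℝ) ≤ #{t | (W t : ℝ) ≤ β * Q / 4} ∨
    1 / 4 * (ℓ : ℝ) ≤ #{t | (12 * Q + 16 * ℓ : ℝ) ≤ W t}

/-- If the noise of the rounds in which the watched key is reported has a bias of order `1` in each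
bucket, then, after sufficiently many rounds, the collected noise is of order `Q` in all but a few
buckets. -/
lemma collected_tail {T : Type*} [Fintype T] {s Q : ℕ} {β : ℝ} (hℓ : 1 ≤ ℓ) (hs : 1 ≤ s)
    (hsℓ : s ≤ ℓ) (hT : ♯T ≤ 2 * ℓ) (hβ : 0 < β) (hβ1 : β ≤ 1)
    (hQ : 12800 * ℓ ≤ Q * β ^ 2) (rep : X → Bool) (Z : X → T → ℤ)
    (hdrift : ∀ t, β ≤ ∫ x, (if rep x then (Z x t : ℝ) else 0) ∂ν)
    (hmgf : ∀ (S : Finset T) (r : ℝ), |r| ≤ 1 →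
      ∫ x, exp (r * ∑ t ∈ S, (Z x t : ℝ)) ∂ν ≤ exp ((#S * s : ℕ) * r ^ 2)) :
    (ν ^⊗ (Fin Q)).real {x | NoiseFails β ℓ Q (collected rep Z x)} ≤ 2 * exp (-ℓ) := by
  classical
  have hℓ' : (1 : ℝ) ≤ ℓ := mod_cast hℓ
  have hs' : (1 : ℝ) ≤ s := mod_cast hs
  have hsℓ' : (s : ℝ) ≤ ℓ := mod_cast hsℓ
  have hT' : (♯T : ℝ) ≤ 2 * ℓ := mod_cast hT
  obtain ⟨η, hη'⟩ : ∃ η : ℝ, η = 1 / 4 := ⟨_, rfl⟩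
  have hη : 0 < η := by rw [hη']; norm_num
  have hQ' : 3200 * ℓ ≤ Q * η * β ^ 2 := by rw [hη']; linarith
  set U : ℝ := 12 * Q + 16 * ℓ with hU
  set Y : Finset T → X → ℝ := fun S x => if rep x then ∑ t ∈ S, (Z x t : ℝ) else 0 with hY
  have hsum : ∀ (S : Finset T) (x : Fin Q → X),
      ∑ t ∈ S, (collected rep Z x t : ℝ) = ∑ q, Y S (x q) := by
    intro S x
    simp only [collected, Int.cast_sum]
    rw [sum_comm]
    refine sum_congr rfl fun q _ => ?_
    simp only [hY]
    split_ifs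
    · rfl
    · simp
  have hYV : ∀ S x, |Y S x| ≤ |∑ t ∈ S, (Z x t : ℝ)| := fun S x => by
    simp only [hY]; split_ifs
    · exact le_rfl
    · simp
  have hmean : ∀ S : Finset T, #S * β ≤ ∫ x, Y S x ∂ν := by
    intro S
    have : ∀ x, Y S x = ∑ t ∈ S, (if rep x then (Z x t : ℝ) else 0) := fun x => by
      simp only [hY]; split_ifs <;> simp
    simp_rw [this]
    rw [integral_finsetSum _ fun _ _ => .of_finite]
    calc #S * β = ∑ t ∈ S, β := by simp
      _ ≤ _ := sum_le_sum fun t _ => hdrift t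
  have hcardS : ∀ S : Finset T, (#S : ℝ) ≤ 2 * ℓ := fun S => le_trans (mod_cast card_le_univ S) hT'
  -- the bounds for a single set of buckets
  have hlow : ∀ S : Finset T, η * ℓ ≤ #S → (ν ^⊗ (Fin Q)).real
      {x | ∑ t ∈ S, (collected rep Z x t : ℝ) ≤ #S * (β * Q / 4)} ≤ exp (-(4 * ℓ)) := by
    intro S hS
    have hS0 : (0 : ℝ) < #S := by nlinarith
    have hS1 : (1 : ℝ) ≤ #S := by
      have : 0 < #S := mod_cast hS0
      exact_mod_cast this
    set a := β / (200 * ℓ) with ha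
    have ha0 : 0 ≤ a := by positivity
    have haℓ : a * ℓ = β / 200 := by rw [ha]; field_simp
    have hv : (1 : ℝ) ≤ (#S * s : ℕ) := by push_cast; nlinarith
    have h1 := integral_exp_neg_le_of_abs_le ν (hYV S) hv (hmgf S) ha0 (by
      push_cast
      have : (#S : ℝ) * s ≤ 2 * ℓ * ℓ := mul_le_mul (hcardS S) hsℓ' (by linarith) (by linarith)
      calc 16 * a ^ 2 * (#S * s) ≤ 16 * a ^ 2 * (2 * ℓ * ℓ) := by gcongr
        _ = 32 * (a * ℓ) ^ 2 := by ring
        _ ≤ 1 := by rw [haℓ]; nlinarith)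
    have h2 : ∫ x, exp (-(a * Y S x)) ∂ν ≤ exp (-(a * #S * β / 2)) := by
      refine h1.trans (le_trans ?_ (add_one_le_exp _))
      have h3 : a * (#S * β) ≤ a * ∫ x, Y S x ∂ν := by gcongr; exact hmean S
      have h4 : 100 * a ^ 2 * ((#S * s : ℕ) : ℝ) ≤ a * #S * β / 2 := by
        push_cast
        calc 100 * a ^ 2 * (#S * s) ≤ 100 * a ^ 2 * (#S * ℓ) := by gcongr
          _ = 100 * a * #S * (a * ℓ) := by ring
          _ = _ := by rw [haℓ]; ring
      linarith
    have h5 := chernoff_pi ν (fun x => -(a * Y S x)) (Q := Q) (a := -(a * (#S * (β * Q / 4))))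
    refine (measureReal_mono ?_).trans (h5.trans ?_)
    · intro x hx
      have hx' : ∑ t ∈ S, (collected rep Z x t : ℝ) ≤ #S * (β * Q / 4) := hx
      rw [hsum] at hx'
      simp only [Set.mem_ofPred_eq]
      rw [sum_neg_distrib, ← mul_sum]
      have := mul_le_mul_of_nonneg_left hx' ha0
      linarith
    · calc _ ≤ exp (- -(a * (#S * (β * Q / 4)))) * exp (-(a * #S * β / 2)) ^ Q := by
            gcongr
        _ = exp (-(a * #S * β * Q / 4)) := by rw [← exp_nat_mul, ← exp_add]; congr 1; ring
        _ ≤ _ := by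
            refine exp_le_exp.2 (neg_le_neg ?_)
            have h6 : a * (η * ℓ) * β * Q / 4 ≤ a * #S * β * Q / 4 := by gcongr
            have h7 : a * (η * ℓ) * β * Q / 4 = Q * η * β ^ 2 / 800 := by
              calc _ = (a * ℓ) * η * β * Q / 4 := by ring
                _ = _ := by rw [haℓ]; ring
            linarith
  have hupp : ∀ S : Finset T, η * ℓ ≤ #S → (ν ^⊗ (Fin Q)).real
      {x | #S * U ≤ ∑ t ∈ S, (collected rep Z x t : ℝ)} ≤ exp (-(4 * ℓ)) := by
    intro S hS
    have hinv : |1 / (ℓ : ℝ)| ≤ 1 := by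
      rw [abs_of_pos (by positivity), div_le_one (by linarith)]; exact hℓ'
    have h1 := integral_exp_le_of_abs_le ν (hYV S) (hmgf S) hinv
    have h2 : ∫ x, exp (1 / (ℓ : ℝ) * Y S x) ∂ν ≤ exp 3 := by
      refine h1.trans ?_
      have h3 : ((#S * s : ℕ) : ℝ) * (1 / (ℓ : ℝ)) ^ 2 ≤ 2 := by
        push_cast
        have : (#S : ℝ) * s ≤ 2 * ℓ * ℓ := mul_le_mul (hcardS S) hsℓ' (by linarith) (by linarith)
        rw [one_div, inv_pow, ← div_eq_mul_inv, div_le_iff₀ (by positivity)]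
        linarith
      have h4 : (2 : ℝ) ≤ exp 1 := by have := add_one_le_exp (1 : ℝ); linarith
      calc _ ≤ exp 1 * exp 2 := by gcongr
        _ = _ := by rw [← exp_add]; norm_num
    have h5 := chernoff_pi ν (fun x => 1 / (ℓ : ℝ) * Y S x) (Q := Q) (a := 1 / (ℓ : ℝ) * (#S * U))
    refine (measureReal_mono ?_).trans (h5.trans ?_)
    · intro x hx
      have hx' : #S * U ≤ ∑ t ∈ S, (collected rep Z x t : ℝ) := hx
      rw [hsum] at hx'
      simp only [Set.mem_ofPred_eq]
      rw [← mul_sum]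
      gcongr
    · calc _ ≤ exp (-(1 / (ℓ : ℝ) * (#S * U))) * exp 3 ^ Q := by gcongr
        _ = exp (3 * Q - 1 / (ℓ : ℝ) * (#S * U)) := by rw [← exp_nat_mul, ← exp_add]; congr 1; ring
        _ ≤ _ := by
            refine exp_le_exp.2 ?_
            have h6 : 1 / (ℓ : ℝ) * (η * ℓ * U) ≤ 1 / (ℓ : ℝ) * (#S * U) := by gcongr
            have h7 : 1 / (ℓ : ℝ) * (η * ℓ * U) = 3 * Q + 4 * ℓ := by
              rw [hU, hη']; field_simp; ring
            linarith
  -- the union bound over all sets of buckets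
  refine (union_bound _ ((univ : Finset (Finset T)).filter fun S => η * ℓ ≤ #S)
    (fun S => {x | ∑ t ∈ S, (collected rep Z x t : ℝ) ≤ #S * (β * Q / 4)} ∪
      {x | #S * U ≤ ∑ t ∈ S, (collected rep Z x t : ℝ)}) (fun x hx => ?_)
    (δ := 2 * exp (-(4 * ℓ))) fun S hS => ?_).trans ?_
  · simp only [Set.mem_union, Set.mem_ofPred_eq, mem_filter, mem_univ, true_and]
    rcases hx with hx | hx <;> rw [← hη'] at hx
    · refine ⟨_, hx, Or.inl ?_⟩
      rw [← nsmul_eq_mul]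
      exact sum_le_card_nsmul _ _ _ fun t ht => (mem_filter.1 ht).2
    · refine ⟨_, hx, Or.inr ?_⟩
      rw [← nsmul_eq_mul]
      exact card_nsmul_le_sum _ _ _ fun t ht => (mem_filter.1 ht).2
  · have hS' := (mem_filter.1 hS).2
    refine (measureReal_union_le _ _).trans ?_
    linarith [hlow S hS', hupp S hS']
  have hcard : (#((univ : Finset (Finset T)).filter fun S => η * ℓ ≤ #S) : ℝ) ≤ exp (2 * ℓ) := by
    have h1 : (#((univ : Finset (Finset T)).filter fun S => η * ℓ ≤ #S) : ℝ) ≤ 2 ^ ♯T := by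
      have := card_filter_le (univ : Finset (Finset T)) fun S => η * ℓ ≤ #S
      rw [card_univ, Fintype.card_finset] at this
      exact_mod_cast this
    have h2 : (2 : ℝ) ≤ exp 1 := by have := add_one_le_exp (1 : ℝ); linarith
    calc _ ≤ (2 : ℝ) ^ ♯T := h1
      _ ≤ exp 1 ^ ♯T := by gcongr
      _ = exp (♯T) := by rw [← exp_nat_mul, mul_one]
      _ ≤ _ := exp_le_exp.2 hT'
  calc _ ≤ exp (2 * ℓ) * (2 * exp (-(4 * ℓ))) := by gcongr
    _ = 2 * exp (-(2 * ℓ)) := by rw [mul_left_comm, ← exp_add]; congr 2; ring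
    _ ≤ _ := by gcongr; linarith

end

/-! ### Binomial coefficients and random signs -/

lemma centralBinom_sq_ge (n : ℕ) (hn : 1 ≤ n) : 16 ^ n ≤ 4 * n * n.centralBinom ^ 2 := by
  induction n, hn using Nat.le_induction with
  | base => simp [Nat.centralBinom]
  | succ n hn ih =>
    have h := Nat.succ_mul_centralBinom_succ n
    have h2 : (n + 1) * (16 ^ (n + 1)) ≤ (n + 1) * (4 * (n + 1) * (n + 1).centralBinom ^ 2) := by
      calc (n + 1) * 16 ^ (n + 1) = 16 * (n + 1) * 16 ^ n := by ring
        _ ≤ 16 * (n + 1) * (4 * n * n.centralBinom ^ 2) := by gcongr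
        _ = 4 * ((4 * n * (n + 1)) * (2 * n.centralBinom) ^ 2) := by ring
        _ ≤ 4 * ((2 * n + 1) ^ 2 * (2 * n.centralBinom) ^ 2) := by gcongr; nlinarith
        _ = 4 * (2 * (2 * n + 1) * n.centralBinom) ^ 2 := by ring
        _ = 4 * ((n + 1) * (n + 1).centralBinom) ^ 2 := by rw [h]
        _ = _ := by ring
    exact Nat.le_of_mul_le_mul_left h2 (by omega)

lemma centralBinom_ge (n : ℕ) (hn : 1 ≤ n) : (4 : ℝ) ^ n / (2 * √n) ≤ n.centralBinom := by
  have hn' : (0 : ℝ) < n := mod_cast hn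
  have h : ((16 : ℝ) ^ n) ≤ 4 * n * (n.centralBinom : ℝ) ^ 2 := by
    exact_mod_cast centralBinom_sq_ge n hn
  rw [div_le_iff₀ (by positivity)]
  refine le_of_sq_le_sq ?_ (by positivity)
  rw [mul_pow, mul_pow, sq_sqrt hn'.le, ← pow_mul, mul_comm n 2, pow_mul]
  norm_num
  linarith

/-- The middle binomial coefficient. -/
lemma choose_half_ge (n : ℕ) (hn : 1 ≤ n) : 1 / (2 * √n) ≤ n.choose (n / 2) / 2 ^ n := by
  have hn' : (0 : ℝ) < n := mod_cast hn
  rw [div_le_div_iff₀ (by positivity) (by positivity), one_mul]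
  rcases Nat.even_or_odd' n with ⟨m, rfl | rfl⟩
  · have h := centralBinom_ge m (by omega)
    rw [div_le_iff₀ (by have : 1 ≤ m := by omega
                        positivity)] at h
    rw [Nat.mul_div_cancel_left m (by norm_num), pow_mul]
    norm_num
    refine h.trans ?_
    rw [Nat.centralBinom]
    gcongr
    exact le_mul_of_one_le_left (by positivity) (by norm_num)
  · have h := centralBinom_ge (m + 1) (by omega)
    rw [div_le_iff₀ (by positivity)] at h
    have h1 : (m + 1).centralBinom = 2 * (2 * m + 1).choose m := by
      rw [Nat.centralBinom, show 2 * (m + 1) = 2 * m + 1 + 1 by ring, Nat.choose_succ_succ,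
        show (2 * m + 1).choose m.succ = (2 * m + 1).choose m from
          Nat.choose_symm_of_eq_add (by omega)]
      ring
    rw [show (2 * m + 1) / 2 = m by omega]
    rw [h1] at h
    have h2 : √((m + 1 : ℕ) : ℝ) ≤ √((2 * m + 1 : ℕ) : ℝ) := by
      refine sqrt_le_sqrt ?_
      push_cast
      linarith
    have h3 : (4 : ℝ) ^ (m + 1) = 2 * 2 ^ (2 * m + 1) := by
      rw [pow_succ, pow_succ, pow_mul]; norm_num; ring
    rw [h3] at h
    push_cast at h h2 ⊢
    have h4 : (2 : ℝ) * ((2 * m + 1).choose m : ℝ) * (2 * √((m : ℝ) + 1)) ≤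
        2 * ((2 * m + 1).choose m : ℝ) * (2 * √(2 * (m : ℝ) + 1)) := by gcongr
    linarith

lemma choose_add_ge {t : ℕ} {ρ : ℝ} (hρ : 0 ≤ ρ)
    (hratio : ∀ u < t, ρ * (n / 2 + u + 1 : ℕ) ≤ (n : ℝ) - (n / 2 + u : ℕ)) :
    (n.choose (n / 2) : ℝ) * ρ ^ t ≤ n.choose (n / 2 + t) := by
  induction t with
  | zero => simp
  | succ t ih =>
    have ih := ih fun u hu => hratio u (by omega)
    have h1 := Nat.choose_succ_right_eq n (n / 2 + t)
    have h2 := hratio t (by omega)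
    have h3 : (n / 2 + t : ℕ) ≤ n ∨ n.choose (n / 2 + t) = 0 := by grind
    have h4 : (n.choose (n / 2 + t + 1) : ℝ) * (n / 2 + t + 1 : ℕ) =
        n.choose (n / 2 + t) * ((n : ℝ) - (n / 2 + t : ℕ)) := by
      rcases h3 with h | h
      · rw [← Nat.cast_sub h]; exact_mod_cast h1
      · rw [h] at h1 ⊢
        rw [Nat.zero_mul] at h1
        rw [Nat.cast_zero, zero_mul]
        exact_mod_cast h1
    have h5 : (0 : ℝ) < (n / 2 + t + 1 : ℕ) := by positivity
    refine le_of_mul_le_mul_right ?_ h5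
    rw [← add_assoc, h4]
    calc (n.choose (n / 2) : ℝ) * ρ ^ (t + 1) * (n / 2 + t + 1 : ℕ) =
          (n.choose (n / 2) * ρ ^ t) * (ρ * (n / 2 + t + 1 : ℕ)) := by ring
      _ ≤ n.choose (n / 2 + t) * (ρ * (n / 2 + t + 1 : ℕ)) := by gcongr
      _ ≤ _ := by gcongr

/-- Within `O(√n)` of the mean, a fair binomial distribution has point probabilities of order
`1 / √n`. -/
lemma exists_choose_ge (K : ℝ) (hK : 0 ≤ K) : ∃ (c : ℝ) (n₀ : ℕ), 0 < c ∧ 1 ≤ n₀ ∧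
    ∀ n m : ℕ, n₀ ≤ n → |(m : ℝ) - n / 2| ≤ K * √n → c / √n ≤ n.choose m / 2 ^ n := by
  set A : ℝ := 4 * K + 8 with hA
  refine ⟨exp (-(2 * A * (K + 1))) / 2, max 1 ⌈(2 * (A + K + 1)) ^ 2⌉₊, by positivity,
    le_max_left _ _, ?_⟩
  intro n m hn hm
  have hn1 : 1 ≤ n := le_trans (le_max_left _ _) hn
  have hn' : (1 : ℝ) ≤ n := mod_cast hn1
  have hn2 : (2 * (A + K + 1)) ^ 2 ≤ n :=
    (Nat.le_ceil _).trans (mod_cast le_trans (le_max_right _ _) hn)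
  have hsq : √n ^ 2 = n := sq_sqrt (by linarith)
  have hs2 : 2 * (A + K + 1) ≤ √n := le_sqrt_of_sq_le hn2
  have main : ∀ t : ℕ, (t : ℝ) ≤ (K + 1) * √n →
      exp (-(2 * A * (K + 1))) / 2 / √n ≤ n.choose (n / 2 + t) / 2 ^ n := by
    intro t ht
    set x : ℝ := A / √n with hx
    have hx0 : 0 ≤ x := by positivity
    have hxs : x * √n = A := by rw [hx]; field_simp
    have hx1 : x ≤ 1 / 2 := by rw [hx, div_le_iff₀ (by linarith)]; linarith
    have h1 := choose_add_ge (n := n) (t := t) (ρ := 1 - x) (by linarith) fun u hu => by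
      have hu' : (u : ℝ) + 1 ≤ t := mod_cast hu
      have hfloor : ((n / 2 : ℕ) : ℝ) ≤ n / 2 := Nat.cast_div_le
      have hfloor2 : (n : ℝ) / 2 ≤ (n / 2 : ℕ) + 1 := by
        have : n ≤ 2 * (n / 2) + 2 := by omega
        have : (n : ℝ) ≤ 2 * (n / 2 : ℕ) + 2 := mod_cast this
        linarith
      push_cast
      have h3 : x * n = A * √n := by rw [← hxs, mul_assoc, ← sq, hsq]
      have h4 : x * ((n : ℝ) / 2 - 1) ≤ x * ((n / 2 : ℕ) + u + 1 : ℝ) := by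
        gcongr
        linarith
      nlinarith
    have h2 : exp (-(2 * A * (K + 1))) ≤ (1 - x) ^ t := by
      have h3 : exp (-(2 * x)) ≤ 1 - x := by
        have h6 := add_one_le_exp (2 * x)
        have h7 : exp (-(2 * x)) * exp (2 * x) = 1 := by rw [← exp_add]; simp
        have h8 : 0 < exp (-(2 * x)) := exp_pos _
        nlinarith
      calc exp (-(2 * A * (K + 1))) ≤ exp (-(2 * x)) ^ t := by
            rw [← exp_nat_mul]
            refine exp_le_exp.2 ?_
            nlinarith
        _ ≤ _ := by gcongr
    have h3 := choose_half_ge n hn1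
    rw [le_div_iff₀ (by positivity)] at h3 ⊢
    calc exp (-(2 * A * (K + 1))) / 2 / √n * 2 ^ n =
          (1 / (2 * √n) * 2 ^ n) * exp (-(2 * A * (K + 1))) := by field_simp
      _ ≤ n.choose (n / 2) * (1 - x) ^ t := by gcongr
      _ ≤ _ := h1
  have hm' := abs_le.1 hm
  rcases le_or_gt (n / 2) m with h | h
  · obtain ⟨t, rfl⟩ := Nat.exists_eq_add_of_le h
    refine main t ?_
    have : (n : ℝ) / 2 ≤ (n / 2 : ℕ) + 1 := by
      have : n ≤ 2 * (n / 2) + 2 := by omega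
      have : (n : ℝ) ≤ 2 * (n / 2 : ℕ) + 2 := mod_cast this
      linarith
    push_cast at hm'
    nlinarith
  · have hmn : m ≤ n := by omega
    obtain ⟨t, ht⟩ := Nat.exists_eq_add_of_le (show n / 2 ≤ n - m by omega)
    rw [← Nat.choose_symm hmn, ht]
    refine main t ?_
    have h1 : (n : ℝ) / 2 ≤ (n / 2 : ℕ) + 1 := by
      have : n ≤ 2 * (n / 2) + 2 := by omega
      have : (n : ℝ) ≤ 2 * (n / 2 : ℕ) + 2 := mod_cast this
      linarith
    have h2 : (n : ℝ) = m + ((n / 2 : ℕ) + t) := by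
      have : n = m + (n / 2 + t) := by omega
      exact_mod_cast this
    nlinarith

lemma card_signs_agree {T : Type*} [Fintype T] [DecidableEq T] (U : Finset T) (ε : T → Bool)
    (m : ℕ) : #{σ : T → Bool | #{u ∈ U | σ u = ε u} = m} = U.card.choose m * 2 ^ (♯T - #U) := by
  rw [← card_powersetCard, ← card_compl, ← card_powerset, ← card_product]
  refine card_nbij' (fun σ => (U.filter fun u => σ u = ε u, Uᶜ.filter fun u => σ u = ε u))
    (fun p u => if u ∈ p.1 ∪ p.2 then ε u else !ε u) ?_ ?_ ?_ ?_
  · intro σ hσ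
    have hσ' : #{u ∈ U | σ u = ε u} = m := by simpa using hσ
    simp only [coe_product, Set.mem_prod, mem_coe, mem_powersetCard, mem_powerset]
    exact ⟨⟨filter_subset _ _, hσ'⟩, filter_subset _ _⟩
  · rintro ⟨A, B⟩ hAB
    simp only [coe_product, Set.mem_prod, mem_coe, mem_powersetCard, mem_powerset] at hAB
    obtain ⟨⟨hA, hAm⟩, hB⟩ := hAB
    simp only [coe_filter, mem_univ, true_and, Set.mem_ofPred_eq]
    convert hAm using 2
    ext u
    simp only [mem_filter, mem_union]
    constructor
    · rintro ⟨hu, h⟩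
      by_contra hno
      have : u ∉ B := fun hB' => (mem_compl.1 (hB hB')) hu
      simp [hno, this] at h
    · intro hu
      exact ⟨hA hu, by simp [hu]⟩
  · intro σ _
    ext u
    by_cases hu : u ∈ U <;> by_cases h : σ u = ε u <;>
      simp [hu, h] <;> (cases h1 : σ u <;> cases h2 : ε u <;> simp_all)
  · rintro ⟨A, B⟩ hAB
    simp only [coe_product, Set.mem_prod, mem_coe, mem_powersetCard, mem_powerset] at hAB
    obtain ⟨⟨hA, hAm⟩, hB⟩ := hAB
    refine Prod.ext ?_ ?_
    · ext u
      simp only [mem_filter, mem_union]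
      constructor
      · rintro ⟨hu, h⟩
        by_contra hno
        have : u ∉ B := fun hB' => (mem_compl.1 (hB hB')) hu
        simp [hno, this] at h
      · intro hu
        exact ⟨hA hu, by simp [hu]⟩
    · ext u
      simp only [mem_filter, mem_union, mem_compl]
      constructor
      · rintro ⟨hu, h⟩
        by_contra hno
        have : u ∉ A := fun hA' => hu (hA hA')
        simp [hno, this] at h
      · intro hu
        exact ⟨mem_compl.1 (hB hu), by simp [hu]⟩

section
variable {X : Type*} [Finite X] [MeasurableSpace X] [DiscreteMeasurableSpace X] {ν : Measure X}
  [IsProbabilityMeasure ν] {T : Type*} [Fintype T] [DecidableEq T]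

/-- If a law is invariant under sign changes of the noise `Z`, then the number of positive entries
among a set `U` of nonzero entries is binomial, conditionally on the magnitudes. -/
lemma measureReal_pos_count_ge {Z : X → T → ℤ} {Φ : (T → Bool) → X → X}
    (hΦ : ∀ σ, MeasurePreserving (Φ σ) ν ν)
    (hZ : ∀ σ x t, Z (Φ σ x) t = (if σ t then -1 else 1) * Z x t)
    {G : Set X} (hG : ∀ σ, ∀ x ∈ G, Φ σ x ∈ G) {U : X → Finset T} {m : X → ℕ}
    (hU : ∀ σ x, U (Φ σ x) = U x) (hm : ∀ σ x, m (Φ σ x) = m x)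
    (hU0 : ∀ x ∈ G, ∀ u ∈ U x, Z x u ≠ 0) {p : ℝ}
    (hp : ∀ x ∈ G, p ≤ (U x).card.choose (m x) / 2 ^ #(U x)) :
    p * ν.real G ≤ ν.real {x | x ∈ G ∧ #((U x).filter fun u => 0 < Z x u) = m x} := by
  classical
  set N := ♯T
  set f : X → ℝ := Set.indicator {x | x ∈ G ∧ #((U x).filter fun u => 0 < Z x u) = m x} 1 with hf
  have h1 : ∀ σ, ∫ x, f (Φ σ x) ∂ν = ∫ x, f x ∂ν := fun σ => integral_comp_mp (hΦ σ) f
  have h2 : ∫ x, ∑ σ : T → Bool, f (Φ σ x) ∂ν = 2 ^ N * ∫ x, f x ∂ν := by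
    rw [integral_finsetSum _ fun _ _ => .of_finite, sum_congr rfl fun σ _ => h1 σ, sum_const,
      card_univ, Fintype.card_fun, Fintype.card_bool, nsmul_eq_mul]
    push_cast
    rfl
  have h3 : ∀ x, 2 ^ N * (p * G.indicator 1 x) ≤ ∑ σ : T → Bool, f (Φ σ x) := by
    intro x
    by_cases hx : x ∈ G
    · rw [Set.indicator_of_mem hx, Pi.one_apply, mul_one]
      have h4 : ∀ σ : T → Bool, f (Φ σ x) =
          if #((U x).filter fun u => σ u = decide (Z x u < 0)) = m x then 1 else 0 := by
        intro σ
        simp only [hf, Set.indicator_apply, Set.mem_ofPred_eq, hG σ x hx, true_and, hU, hm,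
          Pi.one_apply]
        have : ((U x).filter fun u => 0 < Z (Φ σ x) u) =
            (U x).filter fun u => σ u = decide (Z x u < 0) := by
          refine filter_congr fun u hu => ?_
          have h0 := hU0 x hx u hu
          rw [hZ]
          cases hσ : σ u
          · simp only [Bool.false_eq_true, if_false, one_mul]
            rw [eq_comm, decide_eq_false_iff_not]
            omega
          · simp only [if_true]
            rw [eq_comm, decide_eq_true_iff]
            omega
        rw [this]
      simp_rw [h4]
      rw [← sum_filter, sum_const, card_signs_agree (U x) (fun u => decide (Z x u < 0)) (m x),
        nsmul_eq_mul, mul_one]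
      have h5 := hp x hx
      rw [le_div_iff₀ (by positivity)] at h5
      have h6 : #(U x) + (N - #(U x)) = N := by have := card_le_univ (U x); omega
      calc (2 : ℝ) ^ N * p = (p * 2 ^ #(U x)) * 2 ^ (N - #(U x)) := by
            rw [mul_assoc, ← pow_add, h6]; ring
        _ ≤ _ := by push_cast; gcongr
    · rw [Set.indicator_of_notMem hx, mul_zero, mul_zero]
      refine sum_nonneg fun σ _ => ?_
      simp only [hf, Set.indicator_apply]
      split_ifs <;> simp
  have h4 := integral_mono (μ := ν) .of_finite .of_finite h3
  rw [h2, integral_const_mul, integral_const_mul, integral_indicator_one .of_discrete] at h4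
  rw [hf, integral_indicator_one .of_discrete] at h4
  exact le_of_mul_le_mul_left h4 (by positivity)

/-- The change of a single sign. -/
def flipAt (t : T) : T → Bool := fun u => decide (u = t)

/-- The bias of the noise of a bucket `t`, given the event `F`, when `F` is monotone in this noise:
it is bounded from below by the probability that the sign of the noise is decisive for `F`, which is
a point probability of a binomial distribution. -/
lemma drift_of_pivot {Z : X → T → ℤ} {Φ : (T → Bool) → X → X}
    (hΦ : ∀ σ, MeasurePreserving (Φ σ) ν ν)
    (hZ : ∀ σ x t, Z (Φ σ x) t = (if σ t then -1 else 1) * Z x t) {t : T} {F : X → Bool}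
    (hinv : ∀ x, F (Φ (flipAt t) (Φ (flipAt t) x)) = F x)
    (hmono : ∀ x, 0 < Z x t → F (Φ (flipAt t) x) = true → F x = true)
    {G : Set X} (hG : ∀ σ, ∀ x ∈ G, Φ σ x ∈ G) {U : X → Finset T} {m : X → ℕ}
    (hU : ∀ σ x, U (Φ σ x) = U x) (hm : ∀ σ x, m (Φ σ x) = m x) (ht : ∀ x ∈ G, t ∉ U x)
    (hU0 : ∀ x ∈ G, ∀ u ∈ U x, Z x u ≠ 0) {p a : ℝ} (ha : 0 ≤ a)
    (hp : ∀ x ∈ G, p ≤ (U x).card.choose (m x) / 2 ^ #(U x)) (haZ : ∀ x ∈ G, a ≤ |(Z x t : ℝ)|)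
    (hpiv : ∀ x ∈ G, 0 < Z x t → #((U x).filter fun u => 0 < Z x u) = m x →
      F x = true ∧ F (Φ (flipAt t) x) = false) :
    a * p / 2 * ν.real G ≤ ∫ x, (if F x then (Z x t : ℝ) else 0) ∂ν := by
  have hZt : ∀ x, Z (Φ (flipAt t) x) t = -Z x t := fun x => by rw [hZ]; simp [flipAt]
  have hZu : ∀ x, ∀ u ≠ t, Z (Φ (flipAt t) x) u = Z x u := fun x u hu => by
    rw [hZ]; simp [flipAt, hu]
  set E : Set X := {x | x ∈ G ∧ #((U x).filter fun u => 0 < Z x u) = m x} with hE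
  have h1 := integral_comp_mp (hΦ (flipAt t)) fun x => (if F x then (Z x t : ℝ) else 0)
  have h2 : ∀ x, a * E.indicator 1 x ≤ (if F x then (Z x t : ℝ) else 0) +
      (if F (Φ (flipAt t) x) then (Z (Φ (flipAt t) x) t : ℝ) else 0) := by
    intro x
    rw [hZt]
    have key : ∀ y, 0 < Z y t → a * E.indicator 1 y ≤ (if F y then (Z y t : ℝ) else 0) +
        (if F (Φ (flipAt t) y) then ((-Z y t : ℤ) : ℝ) else 0) := by
      intro y hy
      have hy' : (0 : ℝ) < Z y t := mod_cast hy
      by_cases hyE : y ∈ E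
      · obtain ⟨h3, h4⟩ := hpiv y hyE.1 hy hyE.2
        rw [Set.indicator_of_mem hyE, h3, h4]
        have := haZ y hyE.1
        rw [abs_of_pos hy'] at this
        simpa using this
      · rw [Set.indicator_of_notMem hyE, mul_zero]
        cases h3 : F (Φ (flipAt t) y)
        · simp only [Bool.false_eq_true, if_false, add_zero]
          split_ifs <;> linarith
        · rw [hmono y hy h3]
          simp
    rcases lt_trichotomy (Z x t) 0 with hx | hx | hx
    · have h3 := key (Φ (flipAt t) x) (by rw [hZt]; omega)
      rw [hinv, hZt, neg_neg] at h3
      have h4 : x ∈ E → Φ (flipAt t) x ∈ E := by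
        rintro ⟨hxG, hxc⟩
        refine ⟨hG _ x hxG, ?_⟩
        rw [hU, hm, ← hxc]
        congr 1
        refine filter_congr fun u hu => ?_
        rw [hZu]
        rintro rfl
        exact ht x hxG hu
      have h5 : a * E.indicator 1 x ≤ a * E.indicator (1 : X → ℝ) (Φ (flipAt t) x) := by
        refine mul_le_mul_of_nonneg_left ?_ ha
        by_cases hxE : x ∈ E
        · rw [Set.indicator_of_mem hxE, Set.indicator_of_mem (h4 hxE)]; simp
        · rw [Set.indicator_of_notMem hxE]
          exact Set.indicator_nonneg (fun _ _ => zero_le_one) _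
      linarith
    · rw [hx]
      have : a * E.indicator 1 x ≤ 0 := by
        by_cases hxE : x ∈ E
        · rw [Set.indicator_of_mem hxE]
          have := haZ x hxE.1
          rw [hx] at this
          simpa using this
        · rw [Set.indicator_of_notMem hxE, mul_zero]
      simpa using this
    · exact key x hx
  have h3 := integral_mono (μ := ν) .of_finite .of_finite h2
  rw [integral_const_mul, integral_indicator_one .of_discrete, integral_add .of_finite .of_finite,
    h1] at h3
  have h4 := measureReal_pos_count_ge hΦ hZ hG hU hm hU0 hp
  have h5 := mul_le_mul_of_nonneg_left h4 ha
  rw [← hE] at h5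
  linarith

end

/-- Chebyshev's inequality for a sum of independent variables with values in `[0, 1]`. -/
lemma chebyshev_pi {Y T : Type*} [Finite Y] [MeasurableSpace Y] [DiscreteMeasurableSpace Y]
    [Fintype T] (ν : Measure Y) [IsProbabilityMeasure ν] {g : Y → ℝ} (hg0 : ∀ y, 0 ≤ g y)
    (hg1 : ∀ y, g y ≤ 1) (S : Finset T) {r : ℝ} (hr : 0 < r) : (ν ^⊗ T).real
      {x | r ≤ |∑ t ∈ S, g (x t) - #S * ∫ y, g y ∂ν|} ≤ #S / (4 * r ^ 2) := by
  classical
  set p := ∫ y, g y ∂ν with hp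
  have hvar : Var[g; ν] ≤ 1 / 4 := by
    have h := variance_le_sq_of_bounded (μ := ν) (X := g) (a := 0) (b := 1)
      (Filter.Eventually.of_forall fun y => ⟨hg0 y, hg1 y⟩) Measurable.of_discrete.aemeasurable
    norm_num at h ⊢
    linarith
  have hsum := variance_sum_pi (μ := fun _ : T => ν)
    (X := fun t y => if t ∈ S then g y else 0) (fun _ => MemLp.of_discrete)
  have hvs : ∑ t, Var[fun y => if t ∈ S then g y else 0; ν] ≤ #S * (1 / 4) := by
    have : ∀ t, Var[fun y => if t ∈ S then g y else 0; ν] = if t ∈ S then Var[g; ν] else 0 := by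
      intro t
      split_ifs with h
      · rfl
      · exact variance_zero ν
    rw [sum_congr rfl fun t _ => this t, ← sum_filter, sum_const, filter_mem_eq_inter, univ_inter,
      nsmul_eq_mul]
    gcongr
  have hmean : ∫ x, (∑ t, fun x : T → Y => if t ∈ S then g (x t) else 0) x ∂(ν ^⊗ T) = #S * p := by
    simp only [Finset.sum_apply]
    rw [integral_finsetSum _ fun _ _ => .of_finite]
    have : ∀ t, ∫ x, (if t ∈ S then g (x t) else 0) ∂(ν ^⊗ T) = if t ∈ S then p else 0 := by
      intro t
      split_ifs with h
      · exact integral_comp_mp (measurePreserving_eval (fun _ : T => ν) t) g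
      · simp
    rw [sum_congr rfl fun t _ => this t, ← sum_filter, sum_const, filter_mem_eq_inter, univ_inter,
      nsmul_eq_mul]
  rw [variance_eq_integral Measurable.of_discrete.aemeasurable, hmean] at hsum
  calc _ ≤ ∫ x, (∑ t ∈ S, g (x t) - #S * p) ^ 2 / r ^ 2 ∂(ν ^⊗ T) := by
        refine measureReal_le_integral _ (fun x => by positivity) fun x hx => ?_
        have hx' : r ≤ |∑ t ∈ S, g (x t) - #S * p| := hx
        rw [one_le_div (by positivity), ← sq_abs (_ - _)]
        gcongr
    _ = (∑ t, Var[fun y => if t ∈ S then g y else 0; ν]) / r ^ 2 := by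
        rw [integral_div, ← hsum]
        congr 2
        ext x
        simp only [Finset.sum_apply]
        rw [← sum_filter, filter_mem_eq_inter, univ_inter]
    _ ≤ #S * (1 / 4) / r ^ 2 := by gcongr
    _ = _ := by field_simp

/-! ### Queries supported on selected keys -/

/-- The vector with the entries `c j` at the keys `e j`, and `0` elsewhere. -/
def embedVec {J : Type*} [Fintype J] (e : J → Fin n) (c : J → ℝ) :
    Fin n → ℝ := fun i => ∑ j, if e j = i then c j else 0

section
variable {J : Type*} [Fintype J] {e : J → Fin n}

lemma embedVec_apply (he : e.Injective) (c : J → ℝ) (j : J) : embedVec e c (e j) = c j := by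
  classical
  unfold embedVec
  rw [sum_eq_single j (fun j' _ hj' => if_neg fun h => hj' (he h)) (by simp), if_pos rfl]

lemma embedVec_of_notMem (c : J → ℝ) {i : Fin n} (hi : i ∉ Set.range e) : embedVec e c i = 0 :=
  sum_eq_zero fun j _ => if_neg fun h => hi ⟨j, h⟩

lemma sum_mul_embedVec (f : Fin n → ℝ) (c : J → ℝ) :
    ∑ i, f i * embedVec e c i = ∑ j, f (e j) * c j := by
  simp only [embedVec, mul_sum]
  rw [sum_comm]
  refine sum_congr rfl fun j _ => ?_
  simp

lemma sketch_embedVec (μ : Measurements n ℓ b) (c : J → ℝ) (t : Bucket ℓ b) :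
    sketch μ (embedVec e c) t = ∑ j, (μ t (e j) : ℝ) * c j :=
  sum_mul_embedVec (fun i => (μ t i : ℝ)) c

lemma isHeavyHitter_embedVec [DecidableEq J] (he : e.Injective) (c : J → ℝ) (j₀ : J)
    (hc : ∀ j, |c j| ≤ |c j₀|) {k : ℕ} (hk : 1 ≤ k)
    (hlt : ∑ j ∈ univ.erase j₀, c j ^ 2 < k * c j₀ ^ 2) :
    IsHeavyHitter k (embedVec e c) (e j₀) := by
  refine isHeavyHitter_of_sum_lt (fun i => ?_) hk ?_
  · rw [embedVec_apply he]
    by_cases hi : i ∈ Set.range e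
    · obtain ⟨j, rfl⟩ := hi
      rw [embedVec_apply he]; exact hc j
    · rw [embedVec_of_notMem c hi, abs_zero]; exact abs_nonneg _
  · rw [embedVec_apply he]
    refine lt_of_le_of_lt (le_of_eq ?_) hlt
    have h1 : ∑ i, embedVec e c i ^ 2 = ∑ j, c j ^ 2 := by
      simp_rw [sq]
      rw [sum_mul_embedVec]
      refine sum_congr rfl fun j _ => ?_
      rw [embedVec_apply he]
    have h2 := add_sum_erase univ (fun i => embedVec e c i ^ 2) (mem_univ (e j₀))
    have h3 := add_sum_erase univ (fun j => c j ^ 2) (mem_univ j₀)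
    simp only [embedVec_apply he] at h2
    linarith

end

/-! ### Conditioning on parts of the randomness -/

lemma mp_option_pi {J X : Type*} [Fintype J] [Finite X] [MeasurableSpace X]
    [MeasurableSingletonClass X] (ν : Measure X) [IsProbabilityMeasure ν] :
    MeasurePreserving (fun (ω : Option J → X) => (ω none, fun j => ω (some j)))
      (Measure.pi fun _ => ν) (ν.prod (Measure.pi fun _ => ν)) := by
  refine mp_of_singleton _ fun y => ?_
  have : (fun (ω : Option J → X) => (ω none, fun j => ω (some j))) ⁻¹' {y} =
      {fun o => o.elim y.1 y.2} := by
    ext ω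
    simp only [Set.mem_preimage, Set.mem_singleton_iff, Prod.ext_iff, funext_iff, Option.forall,
      Option.elim]
  rw [this, Measure.pi_singleton, ← Set.singleton_prod_singleton (a := y.1) (b := y.2),
    Measure.prod_prod, Measure.pi_singleton, Fintype.prod_option]
  rfl

lemma prod_real_le {X Y : Type*} [Finite X] [MeasurableSpace X] [DiscreteMeasurableSpace X]
    [Finite Y] [MeasurableSpace Y] [DiscreteMeasurableSpace Y] {μ : Measure X} {ν : Measure Y}
    [IsProbabilityMeasure μ] [IsProbabilityMeasure ν] {E : Set (X × Y)} (B : Set X) {δ : ℝ}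
    (hδ : 0 ≤ δ) (h : ∀ x ∉ B, ν.real {y | (x, y) ∈ E} ≤ δ) : (μ.prod ν).real E ≤ μ.real B + δ := by
  have h1 : (μ.prod ν).real E = ∫ x, ν.real {y | (x, y) ∈ E} ∂μ := by
    rw [measureReal_def, Measure.prod_apply .of_discrete, ← integral_toReal
      Measurable.of_discrete.aemeasurable (Filter.Eventually.of_forall fun _ => measure_lt_top _ _)]
    rfl
  rw [h1]
  have h2 : ∀ x, ν.real {y | (x, y) ∈ E} ≤ B.indicator 1 x + δ := by
    intro x
    by_cases hx : x ∈ B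
    · rw [Set.indicator_of_mem hx]
      have := measureReal_le_one (μ := ν) (s := {y | (x, y) ∈ E})
      simp only [Pi.one_apply]
      linarith
    · rw [Set.indicator_of_notMem hx, zero_add]; exact h x hx
  refine (integral_mono .of_finite .of_finite h2).trans ?_
  rw [integral_add .of_finite .of_finite, integral_indicator_one .of_discrete]
  simp

/-- If an event has probability at most `1 / 16`, it rarely occurs in half of a number of
independent trials. -/
lemma majority_le {X : Type*} [Finite X] [MeasurableSpace X] [DiscreteMeasurableSpace X]
    (ν : Measure X) [IsProbabilityMeasure ν] (B : X → Bool) (hB : ν.real {x | B x = true} ≤ 1 / 16)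
    (R : ℕ) : (ν ^⊗ (Fin R)).real {x | R ≤ 2 * #{r | B (x r) = true}} ≤ (1 / 2) ^ R := by
  have h := chernoff_pi ν (fun x => if B x = true then log 16 else 0) (Q := R) (a := R / 2 * log 16)
  have h1 : ∫ x, exp (if B x = true then log 16 else 0) ∂ν ≤ 2 := by
    have : ∀ x, exp (if B x = true then log 16 else 0) =
        1 + 15 * {x | B x = true}.indicator 1 x := fun x => by
      by_cases hx : B x = true
      · simp [hx, exp_log]; norm_num
      · simp [hx]
    simp_rw [this]
    rw [integral_add .of_finite .of_finite, integral_const_mul, integral_indicator_one .of_discrete]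
    simp only [integral_const, probReal_univ, smul_eq_mul, mul_one]
    linarith
  refine (measureReal_mono ?_).trans (h.trans ?_)
  · intro x hx
    have hx' : R ≤ 2 * #{r | B (x r) = true} := hx
    have hx2 : (R : ℝ) ≤ 2 * #{r | B (x r) = true} := mod_cast hx'
    simp only [Set.mem_ofPred_eq]
    rw [← sum_filter, sum_const, nsmul_eq_mul]
    gcongr
    linarith
  · have h2 : exp (-(R / 2 * log 16)) = (1 / 4) ^ R := by
      have h16 : log 16 = 2 * log 4 := by rw [show (16 : ℝ) = 4 ^ 2 by norm_num, log_pow]; norm_num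
      rw [h16, show -((R : ℝ) / 2 * (2 * log 4)) = R * (-log 4) by ring,
        exp_nat_mul, exp_neg, exp_log (by norm_num)]
      norm_num
    rw [h2]
    calc _ ≤ (1 / 4 : ℝ) ^ R * 2 ^ R := by gcongr
      _ = _ := by rw [← mul_pow]; norm_num

/-! ### Counts of aligned buckets -/

section
variable {I T : Type*} [Fintype I] [Fintype T]

/-- The number of buckets in which a key of weight `a` appears with the correct sign. -/
def upCount (a : ℤ) (x : T → I → SignType) : ℕ := #{t | 0 < a + signSum (x t)}

/-- The number of buckets in which a key of weight `a` appears with the wrong sign. -/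
def downCount (a : ℤ) (x : T → I → SignType) : ℕ := #{t | a + signSum (x t) < 0}

/-- Does the basic threshold estimator report a key of weight `a`? -/
def thrRep (τ : ℝ) (ℓ : ℕ) (a : ℤ) (x : T → I → SignType) : Bool :=
  decide (τ * ℓ ≤ upCount a x ∨ τ * ℓ ≤ downCount a x)

/-- The probability that a key of weight `a` appears with the correct sign in a given bucket. -/
def levelProb (b : ℕ) (I : Type*) [Fintype I] (a : ℤ) : ℝ :=
  (signLaw b I).real {y | 0 < a + signSum y}

lemma signLaw_real_neg (b : ℕ) (p : ℤ → Prop) :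
    (signLaw b I).real {y | p (-signSum y)} = (signLaw b I).real {y | p (signSum y)} := by
  have h := (mp_flip_signs (I := I) b true).real_preimage (s := {y | p (signSum y)})
  rw [← h]
  congr 1
  ext y
  simp [signSum_flip]

lemma levelProb_eq_integral (b : ℕ) {a : ℤ} (ha : 1 ≤ a) :
    levelProb b I a = ∫ y, (if |signSum y| < a then (1 : ℝ) else 1 / 2) ∂(signLaw b I) := by
  have h1 : levelProb b I a = (signLaw b I).real {y | 0 < a + -signSum y} :=
    (signLaw_real_neg b fun z => 0 < a + z).symm
  have h2 : levelProb b I a = ∫ y, (1 / 2 : ℝ) * ({y | 0 < a + signSum y}.indicator 1 y +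
      {y | 0 < a + -signSum y}.indicator 1 y) ∂(signLaw b I) := by
    rw [integral_const_mul, integral_add .of_finite .of_finite, integral_indicator_one .of_discrete,
      integral_indicator_one .of_discrete, ← h1]
    rw [levelProb]; ring
  rw [h2]
  congr 1
  ext y
  simp only [Set.indicator_apply, Set.mem_ofPred_eq, Pi.one_apply, abs_lt]
  split_ifs <;> first | omega | norm_num

lemma real_le_abs_signSum (b : ℕ) {a : ℤ} (ha : 1 ≤ a) :
    (signLaw b I).real {y | a ≤ |signSum y|} = 2 * (1 - levelProb b I a) := by
  rw [levelProb_eq_integral b ha, ← integral_indicator_one .of_discrete]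
  have h1 : (1 : ℝ) = ∫ y : I → SignType, (1 : ℝ) ∂(signLaw b I) := by simp
  rw [h1, ← integral_sub .of_finite .of_finite, ← integral_const_mul]
  congr 1
  ext y
  simp only [Set.indicator_apply, Set.mem_ofPred_eq, Pi.one_apply]
  split_ifs <;> first | omega | norm_num

lemma levelProb_zero_le (b : ℕ) : levelProb b I 0 ≤ 1 / 2 := by
  have h1 : levelProb b I 0 = (signLaw b I).real {y | 0 < 0 + -signSum y} :=
    (signLaw_real_neg b fun z => 0 < 0 + z).symm
  have h2 : (signLaw b I).real ({y | 0 < 0 + signSum y} ∪ {y | 0 < 0 + -signSum y}) =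
      levelProb b I 0 + levelProb b I 0 := by
    rw [measureReal_union _ .of_discrete]
    · rw [← h1]; rfl
    · refine Set.disjoint_left.2 fun y h h' => ?_
      simp only [Set.mem_ofPred_eq] at h h'
      omega
  have := measureReal_le_one (μ := signLaw b I)
    (s := {y | 0 < 0 + signSum y} ∪ {y | 0 < 0 + -signSum y})
  linarith

lemma levelProb_succ_le {s : ℕ} (hb : 1 ≤ b) (hs : 1 ≤ s) (hI : ♯I = b * s) (a : ℤ) :
    levelProb b I (a + 1) ≤ levelProb b I a + 2 / √s := by
  refine le_trans ?_ (add_le_add le_rfl (signSum_atom_le hb hs hI (-a)))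
  refine le_trans (measureReal_mono ?_) (measureReal_union_le _ _)
  intro y hy
  simp only [Set.mem_ofPred_eq, Set.mem_union] at hy ⊢
  omega

lemma levelProb_le {s : ℕ} (hb : 1 ≤ b) (hs : 1 ≤ s) (hI : ♯I = b * s) (a : ℕ) :
    levelProb b I a ≤ 1 / 2 + a * (2 / √s) := by
  induction a with
  | zero => simpa using levelProb_zero_le (I := I) b
  | succ a ih =>
    have := levelProb_succ_le hb hs hI (a : ℤ)
    push_cast
    linarith

lemma le_levelProb {s : ℕ} (hb : 1 ≤ b) (hI : ♯I = b * s) {a : ℕ} (ha : 1 ≤ a) :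
    1 - s / (a : ℝ) ^ 2 ≤ levelProb b I a := by
  have h1 := signSum_chebyshev (I := I) hb hI (r := a) (mod_cast ha)
  have h2 := probReal_compl_eq_one_sub (μ := signLaw b I) (s := {y | 0 < (a : ℤ) + signSum y})
    .of_discrete
  have h3 : (signLaw b I).real {y | 0 < (a : ℤ) + signSum y}ᶜ ≤
      (signLaw b I).real {y | (a : ℝ) ≤ |(signSum y : ℝ)|} := by
    refine measureReal_mono fun y hy => ?_
    simp only [Set.mem_compl_iff, Set.mem_ofPred_eq] at hy ⊢
    have : (a : ℤ) ≤ |signSum y| := le_trans (by omega) (neg_le_abs _)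
    exact_mod_cast this
  unfold levelProb
  linarith

lemma upCount_tail (hℓ : 1 ≤ ℓ) (hT : ♯T ≤ 2 * ℓ) (a : ℤ) : (signLaw b I ^⊗ T).real
      {x | 4 * √ℓ ≤ |(upCount a x : ℝ) - ♯T * levelProb b I a|} ≤ 1 / 32 := by
  have hℓ' : (0 : ℝ) < ℓ := mod_cast hℓ
  have hT' : (♯T : ℝ) ≤ 2 * ℓ := mod_cast hT
  have h := chebyshev_pi (T := T) (signLaw b I) (g := {y | 0 < a + signSum y}.indicator 1)
    (fun y => Set.indicator_nonneg (fun _ _ => zero_le_one) _)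
    (fun y => Set.indicator_le_self' (fun _ _ => zero_le_one) _) univ (r := 4 * √ℓ) (by positivity)
  rw [integral_indicator_one .of_discrete, mul_pow, sq_sqrt hℓ'.le, card_univ] at h
  refine le_trans (le_of_eq ?_) (h.trans ?_)
  · congr 1
    ext x
    simp only [Set.mem_ofPred_eq, Set.indicator_apply, Pi.one_apply]
    rw [← sum_filter, sum_const, nsmul_eq_mul, mul_one]
    rfl
  · rw [div_le_iff₀ (by positivity)]
    linarith

lemma downCount_tail {τ δ : ℝ} (hδ : 0 < δ) (hδ1 : δ ≤ 1 / 4) (hδτ : δ ≤ τ - 1 / 2)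
    (hT : (♯T : ℝ) ≤ (1 + δ / 4) * ℓ) {a : ℤ} (ha : 0 ≤ a) :
    (signLaw b I ^⊗ T).real {x | τ * ℓ ≤ (downCount a x : ℝ)} ≤ exp (-(δ ^ 2 / 4 * ℓ)) := by
  have hq : (signLaw b I).real {y | a + signSum y < 0} ≤ 1 / 2 := by
    have h1 : (signLaw b I).real {y | a + signSum y < 0} =
      (signLaw b I).real {y | a + -signSum y < 0} := (signLaw_real_neg b fun z => a + z < 0).symm
    have h2 : (signLaw b I).real ({y | a + signSum y < 0} ∪ {y | a + -signSum y < 0}) =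
        (signLaw b I).real {y | a + signSum y < 0} + (signLaw b I).real {y | a + signSum y < 0} := by
      rw [measureReal_union _ .of_discrete]
      · rw [← h1]
      · refine Set.disjoint_left.2 fun y h h' => ?_
        simp only [Set.mem_ofPred_eq] at h h'
        omega
    have := measureReal_le_one (μ := signLaw b I)
      (s := {y | a + signSum y < 0} ∪ {y | a + -signSum y < 0})
    linarith
  set r : ℝ := δ / 2 with hr
  have hexp : exp r ≤ 1 + r + r ^ 2 := by
    have := abs_exp_sub_one_sub_id_le (x := r) (by rw [abs_of_pos (by positivity)]; linarith)
    linarith [le_abs_self (exp r - 1 - r)]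
  have hone : 1 ≤ exp r := one_le_exp (by positivity)
  have hmgf : ∫ y, (if a + signSum y < 0 then exp r else 1) ∂(signLaw b I) ≤
      exp ((r + r ^ 2) / 2) := by
    have : ∀ y : I → SignType, (if a + signSum y < 0 then exp r else 1) =
        1 + (exp r - 1) * {y | a + signSum y < 0}.indicator 1 y := fun y => by
      by_cases hy : a + signSum y < 0 <;> simp [hy]
    simp_rw [this]
    rw [integral_add .of_finite .of_finite, integral_const_mul, integral_indicator_one .of_discrete]
    simp only [integral_const, probReal_univ, smul_eq_mul, mul_one]
    refine le_trans ?_ (add_one_le_exp _)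
    nlinarith
  refine (measureReal_le_integral _ (f := fun x => exp (-(r * (τ * ℓ))) *
    ∏ t, (if a + signSum (x t) < 0 then exp r else 1)) (fun x => ?_) fun x hx => ?_).trans ?_
  · positivity
  · have hx' : τ * ℓ ≤ (downCount a x : ℝ) := hx
    rw [prod_ite, prod_const, prod_const_one, mul_one, ← exp_nat_mul, ← exp_add]
    refine one_le_exp ?_
    have : r * (τ * ℓ) ≤ r * (downCount a x : ℝ) := by gcongr
    rw [downCount] at this
    linarith
  · rw [integral_const_mul, integral_fintype_prod_eq_prod
      (fun (_ : T) (y : I → SignType) => if a + signSum y < 0 then exp r else 1), prod_const,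
      card_univ]
    calc _ ≤ exp (-(r * (τ * ℓ))) * exp ((r + r ^ 2) / 2) ^ ♯T := by gcongr
      _ = exp (-(r * (τ * ℓ)) + ♯T * ((r + r ^ 2) / 2)) := by
          rw [← exp_nat_mul, ← exp_add]
      _ ≤ _ := by
          refine exp_le_exp.2 ?_
          have h1 : (♯T : ℝ) * ((r + r ^ 2) / 2) ≤ (1 + δ / 4) * ℓ * ((r + r ^ 2) / 2) := by gcongr
          have h2 : r * ((1 / 2 + δ) * ℓ) ≤ r * (τ * ℓ) := by gcongr; linarith
          have h3 : (1 + δ / 4) * ((r + r ^ 2) / 2) + δ ^ 2 / 4 ≤ r * (1 / 2 + δ) := by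
            rw [hr]; nlinarith [mul_pos hδ hδ, mul_pos hδ (mul_pos hδ hδ)]
          nlinarith

end

/-! ### The bias of the noise of a reported key -/

section
variable {I T : Type*} [Fintype I] [Fintype T]

lemma le_upCount_iff [DecidableEq T] {a : ℤ} (ha : 1 ≤ a) (t : T) (x : T → I → SignType)
    (ht : a ≤ |signSum (x t)|) : upCount a x = (#(univ.erase t) -
        #((univ.erase t).filter fun u => a ≤ |signSum (x u)|)) +
      #(((univ.erase t).filter fun u => a ≤ |signSum (x u)|).filter fun u => 0 < signSum (x u)) +
      if 0 < signSum (x t) then 1 else 0 := by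
  have h1 : upCount a x = #((univ.erase t).filter fun u => 0 < a + signSum (x u)) +
      if 0 < signSum (x t) then 1 else 0 := by
    rw [upCount, ← insert_erase (mem_univ t), filter_insert, erase_insert (notMem_erase t _)]
    have : 0 < a + signSum (x t) ↔ 0 < signSum (x t) := by grind
    simp only [this]
    split_ifs
    · rw [card_insert_of_notMem (by simp)]
    · rfl
  have h2 : ((univ.erase t).filter fun u => 0 < a + signSum (x u)) =
      ((univ.erase t).filter fun u => ¬ a ≤ |signSum (x u)|) ∪
      (((univ.erase t).filter fun u => a ≤ |signSum (x u)|).filter fun u => 0 < signSum (x u)) := by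
    ext u
    simp only [mem_filter, mem_union, mem_erase]
    rcases abs_cases (signSum (x u)) with ⟨h, _⟩ | ⟨h, _⟩ <;> rw [h]
    · by_cases hu : u = t <;> simp [hu]; omega
    · by_cases hu : u = t <;> simp [hu]; omega
  have h3 := card_filter_add_card_filter_not (s := univ.erase t) fun u => a ≤ |signSum (x u)|
  rw [h1, h2, card_union_of_disjoint]
  · omega
  · refine disjoint_left.2 fun u hu hu' => ?_
    exact (mem_filter.1 hu).2 (mem_filter.1 (mem_filter.1 hu').1).2

end

section

/-- For large `ℓ`, the square root of `ℓ` exceeds a given bound. -/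
lemma exists_le_sqrt (B : ℝ) : ∃ ℓ₀ : ℕ, 1 ≤ ℓ₀ ∧ ∀ ℓ : ℕ, ℓ₀ ≤ ℓ → B ≤ √ℓ := by
  refine ⟨max 1 ⌈B ^ 2⌉₊, le_max_left _ _, fun ℓ hℓ => ?_⟩
  refine le_sqrt_of_sq_le ?_
  exact (Nat.le_ceil _).trans (mod_cast le_trans (le_max_right _ _) hℓ)

/-- The critical weight of a key is of order `√ℓ`. -/
lemma critical_weight {I : Type*} [Fintype I] {τ δ N : ℝ} (hδ : 0 < δ) (hδ1 : δ ≤ 1 - τ)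
    (hδ2 : δ ≤ τ - 1 / 2) (hℓ : 1 ≤ ℓ) (hb : 1 ≤ b) (hI : ♯I = b * ℓ)
    (hN : |N - ℓ| ≤ δ / 4 * ℓ) {a : ℕ} (ha : |N * levelProb b I a - τ * ℓ| ≤ 8 * √ℓ)
    (hsq : 8 * √ℓ ≤ δ / 4 * ℓ) :
    1 / 2 + δ / 2 ≤ levelProb b I a ∧ levelProb b I a ≤ 1 - δ / 2 ∧ δ / 4 * √ℓ ≤ a := by
  have hℓ' : (1 : ℝ) ≤ ℓ := mod_cast hℓ
  have hN' := abs_le.1 hN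
  have ha' := abs_le.1 ha
  set p := levelProb b I a with hp
  have hp0 : 0 ≤ p := measureReal_nonneg
  have hpl : 1 / 2 + δ / 2 ≤ p := by nlinarith
  refine ⟨hpl, ?_, ?_⟩
  · have h1 : (1 - δ / 4) * ℓ * p ≤ N * p := by gcongr; linarith
    have h2 : (1 - δ + δ / 4) * ℓ ≤ (1 - δ / 4) * (1 - δ / 2) * ℓ := by
      gcongr
      nlinarith
    have h3 : τ * ℓ ≤ (1 - δ) * ℓ := by gcongr; linarith
    have h4 : 0 < (1 - δ / 4) * ℓ := mul_pos (by linarith) (by linarith)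
    refine le_of_mul_le_mul_left (a := (1 - δ / 4) * ℓ) ?_ h4
    linarith
  · have h1 := levelProb_le hb hℓ hI a
    rw [← hp] at h1
    have h2 : δ / 2 ≤ a * (2 / √ℓ) := by linarith
    rw [mul_div_assoc', le_div_iff₀ (sqrt_pos.2 (by linarith))] at h2
    linarith

lemma critical_arith {δ N p q l u τ k : ℝ} (hδ : 0 < δ) (hδ4 : δ ≤ 1 / 4) (hq2 : q ^ 2 = l)
    (hq6 : 6 ≤ q) (e1 : 32 ≤ δ ^ 2 * q) (hN : |N - l| ≤ δ / 4 * l) (ha : |N * p - τ * l| ≤ 8 * q)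
    (hpu : p ≤ 1 - δ / 2) (hk1 : τ * l ≤ k) (hk2 : k < τ * l + 1) (hp0 : 0 ≤ p)
    (hu : |u / 2 - (N - 1) * (1 - p)| < q / δ) (huN : u ≤ N - 1) :
    δ / 2 * l ≤ u ∧ |k - 1 - (N - 1 - u) - u / 2| ≤ (11 + 1 / δ) * q ∧
      0 ≤ k - 1 - (N - 1 - u) ∧ δ / 2 * q ≤ √u ∧ √u ≤ 2 * q := by
  have hN' := abs_le.1 hN
  have ha' := abs_le.1 ha
  have hu' := abs_lt.1 hu
  have hl : 36 ≤ l := by rw [← hq2]; nlinarith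
  have hr : q / δ ≤ δ * l / 32 := by
    rw [div_le_iff₀ hδ, ← hq2]
    have := mul_le_mul_of_nonneg_right e1 (by linarith : 0 ≤ q)
    linarith
  have hql : q ≤ δ * l / 32 := by nlinarith
  have hδl : δ * l ≤ 1 / 4 * l := by gcongr
  have h3 : 3 / 4 * l * (δ / 2) ≤ (N - 1) * (1 - p) :=
    mul_le_mul (by linarith) (by linarith) (by positivity) (by linarith)
  have hlow : δ / 2 * l ≤ u := by linarith
  have hmid : |k - 1 - (N - 1 - u) - u / 2| ≤ (11 + 1 / δ) * q := by grind
  refine ⟨hlow, hmid, ?_, ?_, ?_⟩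
  · linarith
  · refine le_sqrt_of_sq_le (le_trans ?_ hlow)
    rw [mul_pow, hq2]
    gcongr
    rw [sq]
    exact mul_le_of_le_one_right (by positivity) (by linarith)
  · rw [sqrt_le_left (by linarith), mul_pow, hq2]
    linarith

section
variable {I T : Type*} [Fintype I] [Fintype T] [DecidableEq T]

/-- The buckets other than `t` in which the noise is at least the weight `a` of the key. -/
def noisy (a : ℤ) (t : T) (x : T → I → SignType) : Finset T :=
  (univ.erase t).filter fun u => a ≤ |signSum (x u)|

/-- The noise of the bucket `t` may be decisive, and the number of noisy buckets is close to its
mean. -/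
def typicalNoise (b : ℕ) (a : ℤ) (t : T) (r : ℝ) : Set (T → I → SignType) :=
  {x | |(#(noisy a t x) : ℝ) / 2 - (♯T - 1) * (1 - levelProb b I a)| < r ∧
    a ≤ |signSum (x t)|}

lemma typicalNoise_ge {a : ℤ} (ha : 1 ≤ a) (t : T) {r δ : ℝ} (hr : 0 < r)
    (hp : levelProb b I a ≤ 1 - δ / 2) (hr2 : (♯T : ℝ) / (4 * r ^ 2) ≤ δ / 2) :
    δ / 2 ≤ (signLaw b I ^⊗ T).real (typicalNoise b a t r) := by
  set ν := signLaw b I ^⊗ T with hν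
  set g : (I → SignType) → ℝ := fun y => if |signSum y| < a then (1 : ℝ) else 1 / 2 with hg
  have h1 := chebyshev_pi (T := T) (signLaw b I) (g := g)
    (fun y => by simp only [hg]; split_ifs <;> norm_num)
    (fun y => by simp only [hg]; split_ifs <;> norm_num) (univ.erase t) hr
  rw [← levelProb_eq_integral b ha, ← hν] at h1
  have hcard : (#(univ.erase t) : ℝ) = ♯T - 1 := by
    rw [card_erase_of_mem (mem_univ t), card_univ, Nat.cast_sub (Fintype.card_pos_iff.2 ⟨t⟩)]
    simp
  have h2 : (#(univ.erase t) : ℝ) / (4 * r ^ 2) ≤ δ / 2 := by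
    refine le_trans ?_ hr2
    rw [hcard]
    gcongr
    linarith
  have h3 : δ ≤ ν.real {x | a ≤ |signSum (x t)|} := by
    have h4 := real_le_abs_signSum (I := I) b ha
    have h5 := (measurePreserving_eval (fun _ : T => signLaw b I) t).real_preimage
      (s := {y | a ≤ |signSum y|})
    have h6 : ν.real {x | a ≤ |signSum (x t)|} = 2 * (1 - levelProb b I a) := h5.trans h4
    rw [h6]; linarith
  have hsum : ∀ x : T → I → SignType, ∑ u ∈ univ.erase t, g (x u) =
      ♯T - 1 - (#(noisy a t x) : ℝ) / 2 := by
    intro x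
    have h2 : ∀ u ∈ univ.erase t, g (x u) = 1 - if a ≤ |signSum (x u)| then (1 / 2 : ℝ) else 0 := by grind
    rw [sum_congr rfl h2, sum_sub_distrib, ← sum_filter, sum_const, sum_const]
    simp only [nsmul_eq_mul, mul_one, hcard]
    rw [noisy]
    ring
  have h4 : {x | a ≤ |signSum (x t)|} ⊆ typicalNoise b a t r ∪
      {x | r ≤ |∑ u ∈ univ.erase t, g (x u) - #(univ.erase t) * levelProb b I a|} := by
    intro x hx
    rcases lt_or_ge |∑ u ∈ univ.erase t, g (x u) - #(univ.erase t) * levelProb b I a| r with h | h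
    · refine Or.inl ⟨?_, hx⟩
      rw [hsum, hcard, abs_lt] at h
      rw [abs_lt]
      constructor <;> linarith
    · exact Or.inr h
  have h5 := (measureReal_mono (μ := ν) h4).trans (measureReal_union_le _ _)
  linarith

/-- The sign changes of the noise. -/
def flipNoise (σ : T → Bool) (x : T → I → SignType) : T → I → SignType :=
  fun u i => flipSign (σ u) (x u i)

lemma signSum_flipNoise (σ : T → Bool) (x : T → I → SignType) (u : T) :
    signSum (flipNoise σ x u) = (if σ u then -1 else 1) * signSum (x u) := signSum_flip (σ u) (x u)

lemma abs_signSum_flipNoise (σ : T → Bool) (x : T → I → SignType) (u : T) :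
    |signSum (flipNoise σ x u)| = |signSum (x u)| := by
  rw [signSum_flipNoise]; split_ifs <;> simp

lemma noisy_flipNoise (a : ℤ) (t : T) (σ : T → Bool) (x : T → I → SignType) :
    noisy a t (flipNoise σ x) = noisy a t x := by
  simp only [noisy, abs_signSum_flipNoise]

/-- The bias of the noise of a bucket, given that a key of weight `a` has the correct sign in at
least `k` buckets. -/
lemma upCount_drift {a : ℤ} (ha : 1 ≤ a) (t : T) {r p : ℝ} {k : ℕ}
    (hk : ∀ x ∈ typicalNoise (I := I) b a t r, 1 + (#(univ.erase t) - #(noisy a t x)) ≤ k)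
    (hp : ∀ x ∈ typicalNoise (I := I) b a t r, p ≤ (noisy a t x).card.choose
      (k - 1 - (#(univ.erase t) - #(noisy a t x))) / 2 ^ #(noisy a t x)) :
    a * p / 2 * (signLaw b I ^⊗ T).real (typicalNoise b a t r) ≤
      ∫ x, (if decide (k ≤ upCount a x) then (signSum (x t) : ℝ) else 0) ∂(signLaw b I ^⊗ T) := by
  refine drift_of_pivot (Z := fun x u => signSum (x u)) (Φ := flipNoise)
    (fun σ => measurePreserving_pi _ _ fun u => mp_flip_signs b (σ u))
    signSum_flipNoise (t := t) (F := fun x => decide (k ≤ upCount a x)) ?_ ?_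
    (U := noisy a t) (m := fun x => k - 1 - (#(univ.erase t) - #(noisy a t x)))
    ?_ (fun σ x => noisy_flipNoise a t σ x) ?_ ?_ ?_ (by positivity) hp ?_ ?_
  · intro x
    congr 2
    unfold flipNoise
    simp
  · intro x hx hfl
    rw [decide_eq_true_iff] at hfl ⊢
    refine hfl.trans (card_le_card ?_)
    intro u hu
    rw [mem_filter] at hu ⊢
    refine ⟨mem_univ u, ?_⟩
    have h1 := hu.2
    rw [signSum_flipNoise] at h1
    by_cases hut : u = t
    · subst hut
      omega
    · simpa [flipAt, hut] using h1
  · rintro σ x ⟨h1, h2⟩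
    refine ⟨?_, by rw [abs_signSum_flipNoise]; exact h2⟩
    rw [noisy_flipNoise]
    exact h1
  · intro σ x
    simp only [noisy_flipNoise]
  · intro x _ h
    simp [noisy] at h
  · intro x _ u hu h0
    have h1 := (mem_filter.1 hu).2
    have h2 : signSum (x u) = 0 := h0
    rw [h2] at h1
    simp at h1
    omega
  · intro x hx
    have := hx.2
    exact_mod_cast this
  · intro x hx hpos hcount
    have h1 := le_upCount_iff ha t x hx.2
    have h2 := le_upCount_iff ha t (flipNoise (flipAt t) x)
      (by rw [abs_signSum_flipNoise]; exact hx.2)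
    have h3 := hk x hx
    have h4 : ((noisy a t x).filter fun u => 0 < signSum (flipNoise (flipAt t) x u)) =
        (noisy a t x).filter fun u => 0 < signSum (x u) := by
      refine filter_congr fun u hu => ?_
      have : u ≠ t := ne_of_mem_erase (mem_filter.1 hu).1
      rw [signSum_flipNoise]; simp [flipAt, this]
    have h5 : ¬ 0 < signSum (flipNoise (flipAt t) x t) := by
      rw [signSum_flipNoise]; simp only [flipAt, decide_true, if_true]
      omega
    have hpos' : 0 < signSum (x t) := hpos
    have e1 : ((univ.erase t).filter fun u => a ≤ |signSum (x u)|) = noisy a t x := rfl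
    have e2 : ((univ.erase t).filter fun u => a ≤ |signSum (flipNoise (flipAt t) x u)|) =
      noisy a t x := noisy_flipNoise a t _ x
    rw [e1, if_pos hpos'] at h1
    rw [e2, if_neg h5, h4] at h2
    rw [decide_eq_true_iff, decide_eq_false_iff_not]
    omega

/-- Reports which are due to buckets with the wrong sign hardly affect the bias. -/
lemma drift_of_upCount_drift (hb : 1 ≤ b) (hℓ : 1 ≤ ℓ) (hI : ♯I = b * ℓ)
    {τ β : ℝ} {a : ℤ} (t : T) (hβ : 0 < β)
    (hup : β ≤ ∫ x, (if decide (τ * ℓ ≤ upCount a x) then (signSum (x t) : ℝ) else 0)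
        ∂(signLaw b I ^⊗ T)) (hdown : (signLaw b I ^⊗ T).real {x | τ * ℓ ≤ (downCount a x : ℝ)} ≤
      β ^ 2 / (4 * ℓ)) : β / 2 ≤ ∫ x, (if thrRep τ ℓ a x then (signSum (x t) : ℝ) else 0)
        ∂(signLaw b I ^⊗ T) := by
  set ν := signLaw b I ^⊗ T with hν
  set D : Set (T → I → SignType) := {x | τ * ℓ ≤ (downCount a x : ℝ)} with hD
  have hsq : ∫ x, (signSum (x t) : ℝ) ^ 2 ∂ν = ℓ :=
    (integral_comp_mp (measurePreserving_eval (fun _ : T => signLaw b I) t)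
      fun y => (signSum y : ℝ) ^ 2).trans (integral_signSum_sq hb hI)
  have hcomp : ∀ x, (if decide (τ * ℓ ≤ upCount a x) then (signSum (x t) : ℝ) else 0) ≤
      (if thrRep τ ℓ a x then (signSum (x t) : ℝ) else 0) +
      (β / (4 * ℓ) * (signSum (x t) : ℝ) ^ 2 + ℓ / β * D.indicator 1 x) := by
    intro x
    have hpos : 0 ≤ β / (4 * ℓ) * (signSum (x t) : ℝ) ^ 2 := by positivity
    by_cases hx : x ∈ D
    · rw [Set.indicator_of_mem hx, Pi.one_apply, mul_one]
      have h1 : |(signSum (x t) : ℝ)| ≤ β / (4 * ℓ) * (signSum (x t) : ℝ) ^ 2 + ℓ / β := by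
        rw [← sq_abs (signSum (x t) : ℝ)]
        generalize |(signSum (x t) : ℝ)| = w
        have h2 : β / (4 * ℓ) * w ^ 2 + ℓ / β - w = (β / (2 * ℓ) * w - 1) ^ 2 * (ℓ / β) := by
          field_simp
          ring
        have h3 : 0 ≤ (β / (2 * ℓ) * w - 1) ^ 2 * (ℓ / β) := by positivity
        linarith
      have h2 := abs_le.1 (le_refl |(signSum (x t) : ℝ)|)
      have h3 : thrRep τ ℓ a x = true := by
        simp only [thrRep, decide_eq_true_iff]; exact Or.inr hx
      rw [h3]
      simp only [if_true]
      split_ifs <;> linarith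
    · rw [Set.indicator_of_notMem hx, mul_zero, add_zero]
      have h3 : thrRep τ ℓ a x = decide (τ * ℓ ≤ upCount a x) := by
        simp only [thrRep]
        have hx' : ¬ τ * ℓ ≤ (downCount a x : ℝ) := hx
        simp only [hx', or_false]
      rw [h3]
      linarith
  have hint := integral_mono (μ := ν) .of_finite .of_finite hcomp
  rw [integral_add .of_finite .of_finite, integral_add .of_finite .of_finite, integral_const_mul,
    integral_const_mul, integral_indicator_one .of_discrete, hsq] at hint
  have h1 : β / (4 * ℓ) * ℓ = β / 4 := by field_simp
  have h2 : ℓ / β * ν.real D ≤ β / 4 := by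
    calc ℓ / β * ν.real D ≤ ℓ / β * (β ^ 2 / (4 * ℓ)) := by gcongr
      _ = _ := by field_simp
  linarith

end

/-- If the weight `a` of the key is close to the critical one, then the noise of a bucket, restricted
to the event that the key is reported, has a mean bounded from below. -/
lemma thrRep_drift (τ δ : ℝ) (hδ : 0 < δ) (hδ1 : δ ≤ 1 - τ) (hδ2 : δ ≤ τ - 1 / 2) :
    ∃ (β : ℝ) (ℓ₀ : ℕ), 0 < β ∧ β ≤ 1 ∧ ∀ (I T : Type) [Fintype I] [Fintype T] (b ℓ : ℕ),
      ℓ₀ ≤ ℓ → 1 ≤ b → ♯I = b * ℓ → |(♯T : ℝ) - ℓ| ≤ δ / 4 * ℓ →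
      ∀ a : ℕ, |♯T * levelProb b I a - τ * ℓ| ≤ 8 * √ℓ → ∀ t : T,
        β ≤ ∫ x, (if thrRep τ ℓ a x then (signSum (x t) : ℝ) else 0) ∂(signLaw b I ^⊗ T) := by
  have hδ4 : δ ≤ 1 / 4 := by linarith
  obtain ⟨c, n₀, hc, hn₀, hbin⟩ := exists_choose_ge ((11 + 1 / δ) * (2 / δ)) (by positivity)
  obtain ⟨β₀, hβ₀⟩ : ∃ β₀, β₀ = δ ^ 2 * c / 32 := ⟨_, rfl⟩
  have hβ₀pos : 0 < β₀ := by rw [hβ₀]; positivity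
  obtain ⟨ℓ₀, hℓ₀1, hℓ₀⟩ := exists_le_sqrt (32 / δ ^ 2 + 2 * n₀ / δ + 128 / (δ ^ 4 * β₀ ^ 2) + 6)
  refine ⟨min (β₀ / 2) 1, ℓ₀, by positivity, min_le_right _ _, ?_⟩
  intro I T _ _ b ℓ hℓ hb hI hT a ha t
  classical
  have hB := hℓ₀ ℓ hℓ
  have hℓ1 : 1 ≤ ℓ := hℓ₀1.trans hℓ
  have hℓ' : (1 : ℝ) ≤ ℓ := mod_cast hℓ1
  obtain ⟨q, hq⟩ : ∃ q, q = √ℓ := ⟨_, rfl⟩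
  have hq2 : q ^ 2 = ℓ := by rw [hq]; exact sq_sqrt (by linarith)
  rw [← hq] at hB ha
  have p1 : 0 < 32 / δ ^ 2 := by positivity
  have p2 : 0 ≤ 2 * n₀ / δ := by positivity
  have p3 : 0 < 128 / (δ ^ 4 * β₀ ^ 2) := by positivity
  have hq6 : 6 ≤ q := by linarith
  have hqℓ : q ≤ ℓ := by nlinarith
  have e1 : 32 ≤ δ ^ 2 * q := by
    have : 32 / δ ^ 2 ≤ q := by linarith
    rwa [div_le_iff₀ (by positivity), mul_comm] at this
  have e2 : 2 * n₀ ≤ δ * ℓ := by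
    have : 2 * n₀ / δ ≤ ℓ := by linarith
    rw [div_le_iff₀ (by positivity)] at this
    linarith
  have e3 : 128 ≤ δ ^ 4 * β₀ ^ 2 * ℓ := by
    have : 128 / (δ ^ 4 * β₀ ^ 2) ≤ ℓ := by linarith
    rw [div_le_iff₀ (by positivity)] at this
    linarith
  have e4 : 8 * q ≤ δ / 4 * ℓ := by nlinarith
  obtain ⟨hpl, hpu, haq⟩ := critical_weight hδ hδ1 hδ2 hℓ1 hb hI hT (by rwa [hq] at ha)
    (by rwa [hq] at e4)
  rw [← hq] at haq
  have ha1 : 1 ≤ (a : ℤ) := by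
    have : (0 : ℝ) < a := lt_of_lt_of_le (by positivity) haq
    have : 0 < a := mod_cast this
    omega
  have hTle : (♯T : ℝ) ≤ (1 + δ / 4) * ℓ := by linarith [(abs_le.1 hT).2]
  have hScard : (#(univ.erase t) : ℝ) = ♯T - 1 := by
    rw [card_erase_of_mem (mem_univ t), card_univ, Nat.cast_sub (Fintype.card_pos_iff.2 ⟨t⟩)]
    simp
  have hk1 : τ * ℓ ≤ ⌈τ * ℓ⌉₊ := Nat.le_ceil _
  have hτ : 0 ≤ τ := by linarith
  have hk2 : (⌈τ * ℓ⌉₊ : ℝ) < τ * ℓ + 1 := Nat.ceil_lt_add_one (by positivity)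
  have hUle : ∀ x : T → I → SignType, #(noisy (a : ℤ) t x) ≤ #(univ.erase t) :=
    fun x => card_filter_le _ _
  have key : ∀ x ∈ typicalNoise (I := I) b (a : ℤ) t (q / δ), _ := fun x hx =>
    critical_arith hδ hδ4 hq2 hq6 e1 hT ha hpu hk1 hk2 measureReal_nonneg hx.1 (by
      rw [← hScard]; exact_mod_cast hUle x)
  have hkU : ∀ x ∈ typicalNoise (I := I) b (a : ℤ) t (q / δ),
      1 + (#(univ.erase t) - #(noisy (a : ℤ) t x)) ≤ ⌈τ * ℓ⌉₊ := by
    intro x hx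
    obtain ⟨_, _, h3, _, _⟩ := key x hx
    have h6 : (1 : ℝ) + ((#(univ.erase t) - #(noisy (a : ℤ) t x) : ℕ) : ℝ) ≤ ⌈τ * ℓ⌉₊ := by
      rw [Nat.cast_sub (hUle x), hScard]; linarith
    exact_mod_cast h6
  have hdrift := upCount_drift (I := I) (b := b) ha1 t (p := c / (2 * q)) hkU (by
    intro x hx
    obtain ⟨h1, h2, h3, h4, h5⟩ := key x hx
    have h6 := hkU x hx
    refine le_trans ?_ (hbin _ _ ?_ ?_)
    · have : 0 < √(#(noisy (a : ℤ) t x) : ℝ) := lt_of_lt_of_le (by positivity) h4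
      gcongr
    · have : (n₀ : ℝ) ≤ #(noisy (a : ℤ) t x) := by linarith
      exact_mod_cast this
    · have h7 : ((⌈τ * ℓ⌉₊ - 1 - (#(univ.erase t) - #(noisy (a : ℤ) t x)) : ℕ) : ℝ) =
          ⌈τ * ℓ⌉₊ - 1 - ((♯T : ℝ) - 1 - #(noisy (a : ℤ) t x)) := by
        rw [Nat.cast_sub (by omega), Nat.cast_sub (by omega), Nat.cast_sub (hUle x), hScard]
        simp
      rw [h7]
      refine h2.trans ?_
      calc (11 + 1 / δ) * q = (11 + 1 / δ) * (2 / δ) * (δ / 2 * q) := by field_simp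
        _ ≤ _ := mul_le_mul_of_nonneg_left h4 (by positivity))
  have hG := typicalNoise_ge (I := I) (b := b) ha1 t (r := q / δ) (by positivity) hpu (by
    rw [div_pow, hq2, div_le_iff₀ (by positivity)]
    have h8 : δ / 2 * (4 * (ℓ / δ ^ 2)) = 2 * ℓ / δ := by field_simp; norm_num
    rw [h8, le_div_iff₀ hδ]
    calc (♯T : ℝ) * δ ≤ (1 + δ / 4) * ℓ * 1 := by gcongr; linarith
      _ ≤ 2 * ℓ := by rw [mul_one]; gcongr; linarith)
  refine le_trans (min_le_left _ _) (drift_of_upCount_drift hb hℓ1 hI t hβ₀pos ?_ ?_)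
  · have h1 : ∀ x : T → I → SignType, decide (⌈τ * ℓ⌉₊ ≤ upCount (a : ℤ) x) =
        decide (τ * ℓ ≤ upCount (a : ℤ) x) := fun x => by simp only [Nat.ceil_le]
    simp only [h1] at hdrift
    refine le_trans ?_ hdrift
    have h2 : δ / 4 * q * (c / (2 * q)) / 2 * (δ / 2) = β₀ := by rw [hβ₀]; field_simp; norm_num
    rw [← h2, Int.cast_natCast]
    gcongr
  · refine (downCount_tail (I := I) (T := T) (b := b) hδ hδ4 hδ2 hTle
      (Int.natCast_nonneg a)).trans ?_
    have h1 := quadratic_le_exp_of_nonneg (x := δ ^ 2 / 4 * ℓ) (by positivity)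
    have h2 : (δ ^ 2 / 4 * ℓ) ^ 2 / 2 ≤ exp (δ ^ 2 / 4 * ℓ) := by
      have : 0 ≤ δ ^ 2 / 4 * ℓ := by positivity
      linarith
    rw [exp_neg, inv_le_comm₀ (exp_pos _) (by positivity)]
    refine le_trans ?_ h2
    rw [inv_div, div_le_iff₀ (by positivity)]
    have : (δ ^ 2 / 4 * ℓ) ^ 2 / 2 * β₀ ^ 2 = δ ^ 4 * β₀ ^ 2 * ℓ * (ℓ / 32) := by ring
    rw [this]
    have := mul_le_mul_of_nonneg_right e3 (by positivity : (0 : ℝ) ≤ ℓ / 32)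
    linarith

end

/-! ### Calibration of the weight against the threshold estimator -/

/-- The least weight `a < nA` for which at least half of the bits `g (a * R), …, g (a * R + R - 1)`
are set (and `0` if there is none). -/
def calibrated (nA R : ℕ) (g : ℕ → Bool) : ℕ :=
  sInf {a | a < nA ∧ R ≤ 2 * #((range R).filter fun r => g (a * R + r) = true)}

lemma calibrated_congr {nA R : ℕ} {g g' : ℕ → Bool} (h : ∀ i < nA * R, g i = g' i) :
    calibrated nA R g = calibrated nA R g' := by
  unfold calibrated
  congr 1
  ext a
  refine and_congr_right fun ha => ?_
  suffices h : ∀ r ∈ range R, (g (a * R + r) = true ↔ g' (a * R + r) = true) by rw [filter_congr h]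
  intro r hr
  have hr' := mem_range.1 hr
  have : a * R + r < nA * R := by nlinarith
  rw [h _ this]

lemma card_filter_range {R : ℕ} (p : ℕ → Prop) [DecidablePred p] (q : Fin R → Prop)
    [DecidablePred q] (h : ∀ r : Fin R, p r ↔ q r) : #((range R).filter p) = #(univ.filter q) := by
  rw [card_filter, card_filter, ← Fin.sum_univ_eq_sum_range (fun r => if p r then 1 else 0)]
  exact sum_congr rfl fun r _ => by simp only [h r]

/-- The calibration weight determined by the noise of the calibration rounds. -/
def calWeight {X : Type*} (nA R : ℕ) (rep : ℤ → X → Bool) (x : Fin R → X) : ℕ :=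
  sInf {a | a < nA ∧ R ≤ 2 * #{r | rep (a : ℕ) (x r) = true}}

lemma calibrated_eq {X : Type*} {nA R : ℕ} {rep : ℤ → X → Bool} {x : Fin R → X} {g : ℕ → Bool}
    (h : ∀ a < nA, ∀ r : Fin R, g (a * R + r) = rep (a : ℕ) (x r)) :
    calibrated nA R g = calWeight nA R rep x := by
  unfold calibrated calWeight
  congr 1
  ext a
  refine and_congr_right fun ha => ?_
  rw [card_filter_range _ (fun r => rep (a : ℕ) (x r) = true) fun r => by rw [h a ha r]]

/-- The calibration ends, up to a small probability, at a weight for which the expected number of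
aligned buckets is within `O(√ℓ)` of the threshold: far below or above it, the key is reported for
hardly any, or nearly all, of the `R` blocks. -/
lemma threshold_calibration {τ δ : ℝ} (hδ : 0 < δ) (hδ4 : δ ≤ 1 / 4) (hδ1 : δ ≤ 1 - τ)
    (hδ2 : δ ≤ τ - 1 / 2) : ∃ ℓ₀ : ℕ, ∀ (I T : Type) [Fintype I] [Fintype T] (b ℓ nA R : ℕ),
      ℓ₀ ≤ ℓ → 1 ≤ b → ♯I = b * ℓ → |(♯T : ℝ) - ℓ| ≤ δ / 4 * ℓ →
      4 / δ * √ℓ ≤ nA → 1 ≤ R → ((signLaw b I ^⊗ T) ^⊗ (Fin R)).real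
        {x | ¬ (calWeight nA R (thrRep τ ℓ) x < nA ∧
          |♯T * levelProb b I (calWeight nA R (thrRep τ ℓ) x : ℕ) - τ * ℓ|
            ≤ 8 * √ℓ)} ≤ nA * (1 / 2) ^ R := by
  obtain ⟨ℓ₀, hℓ₀1, hℓ₀⟩ := exists_le_sqrt (32 / δ + 20 / δ ^ 2)
  refine ⟨ℓ₀, fun I T _ _ b ℓ nA R hℓ hb hI hT hnA hR => ?_⟩
  classical
  have hB := hℓ₀ ℓ hℓ
  have hℓ1 : 1 ≤ ℓ := hℓ₀1.trans hℓ
  have hℓ' : (1 : ℝ) ≤ ℓ := mod_cast hℓ1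
  have hsq : √ℓ * √ℓ = ℓ := mul_self_sqrt (by linarith)
  have hs1 : 1 ≤ √ℓ := by rw [← sqrt_one]; exact sqrt_le_sqrt hℓ'
  obtain ⟨hT1, hT2⟩ := abs_le.1 hT
  have hT2' : ♯T ≤ 2 * ℓ := by
    have : (♯T : ℝ) ≤ 2 * ℓ := by nlinarith
    exact_mod_cast this
  have h32 : 32 ≤ √ℓ * δ := by
    have h1 : 32 / δ ≤ √ℓ := le_trans (le_add_of_nonneg_right (by positivity)) hB
    rwa [div_le_iff₀ hδ] at h1
  have h20 : 20 ≤ ℓ * δ ^ 2 := by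
    have h1 : 20 / δ ^ 2 ≤ √ℓ := le_trans (le_add_of_nonneg_left (by positivity)) hB
    rw [div_le_iff₀ (by positivity)] at h1
    refine h1.trans ?_
    gcongr
    nlinarith
  -- `4 √ℓ ≤ δ ℓ / 8`
  have h4 : 4 * √ℓ ≤ δ / 8 * ℓ := by
    have := mul_le_mul_of_nonneg_right h32 (zero_le_one.trans hs1)
    nlinarith
  obtain ⟨p, hp⟩ : ∃ p : ℕ → ℝ, ∀ a, p a = levelProb b I (a : ℕ) := ⟨_, fun _ => rfl⟩
  have hdown : ∀ a : ℕ, (signLaw b I ^⊗ T).real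
      {x | τ * ℓ ≤ (downCount (a : ℤ) x : ℝ)} ≤ 1 / 32 := fun a => by
    refine (downCount_tail hδ hδ4 hδ2 (by linarith) (Int.natCast_nonneg a)).trans ?_
    calc exp (-(δ ^ 2 / 4 * ℓ)) ≤ exp (-5) := exp_le_exp.2 (by linarith)
      _ ≤ 1 / 32 := by
        rw [exp_neg, ← one_div]
        refine one_div_le_one_div_of_le (by norm_num) ?_
        have h2 : (2 : ℝ) ≤ exp 1 := by have := add_one_le_exp 1; linarith
        calc (32 : ℝ) = 2 ^ 5 := by norm_num
          _ ≤ exp 1 ^ 5 := by gcongr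
          _ = exp 5 := by rw [← exp_nat_mul]; norm_num
  have hup := fun a : ℕ => upCount_tail (I := I) (T := T) (b := b) hℓ1 hT2' (a : ℤ)
  have hlow : ∀ a : ℕ, ♯T * p a ≤ τ * ℓ - 4 * √ℓ →
      (signLaw b I ^⊗ T).real {x | thrRep τ ℓ (a : ℤ) x = true} ≤ 1 / 16 := by
    intro a ha
    rw [hp] at ha
    refine (measureReal_mono (s₂ := {x | 4 * √ℓ ≤
      |(upCount (a : ℤ) x : ℝ) - ♯T * levelProb b I a|} ∪
        {x | τ * ℓ ≤ (downCount (a : ℤ) x : ℝ)}) ?_).trans ?_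
    · intro x hx
      rcases (of_decide_eq_true hx : _ ∨ _) with h | h
      · left
        have h' := le_abs_self ((upCount (a : ℤ) x : ℝ) - ♯T * levelProb b I a)
        simp only [Set.mem_ofPred_eq]
        linarith
      · right; exact h
    · refine (measureReal_union_le _ _).trans ?_
      have := hup a
      have := hdown a
      linarith
  have hhigh : ∀ a : ℕ, τ * ℓ + 4 * √ℓ ≤ ♯T * p a →
      (signLaw b I ^⊗ T).real {x | (!thrRep τ ℓ (a : ℤ) x) = true} ≤ 1 / 16 := by
    intro a ha
    rw [hp] at ha
    refine (measureReal_mono (s₂ := {x | 4 * √ℓ ≤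
      |(upCount (a : ℤ) x : ℝ) - ♯T * levelProb b I a|}) ?_).trans
        ((hup a).trans (by norm_num))
    intro x hx
    have hx' : thrRep τ ℓ (a : ℤ) x = false := by simpa using hx
    have h := of_decide_eq_false hx'
    push Not at h
    simp only [Set.mem_ofPred_eq]
    refine le_trans ?_ (neg_le_abs _)
    linarith [h.1]
  -- the event that in some of the calibrations the majority is misleading
  obtain ⟨bad, hbad⟩ : ∃ bad : ℕ → Set (Fin R → T → I → SignType), ∀ a, bad a =
      {x | (♯T * p a ≤ τ * ℓ - 4 * √ℓ ∧
          R ≤ 2 * #{r | thrRep τ ℓ (a : ℤ) (x r) = true}) ∨ (τ * ℓ + 4 * √ℓ ≤ ♯T * p a ∧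
          R ≤ 2 * #{r | (!thrRep τ ℓ (a : ℤ) (x r)) = true})} := ⟨_, fun _ => rfl⟩
  have hbadP : ∀ a, ((signLaw b I ^⊗ T) ^⊗ (Fin R)).real (bad a) ≤ (1 / 2) ^ R := by
    intro a
    rw [hbad]
    by_cases h1 : ♯T * p a ≤ τ * ℓ - 4 * √ℓ
    · refine (measureReal_mono ?_).trans (majority_le _ _ (hlow a h1) R)
      rintro x (hx | hx)
      · exact hx.2
      · linarith [hx.1]
    · by_cases h2 : τ * ℓ + 4 * √ℓ ≤ ♯T * p a
      · refine (measureReal_mono ?_).trans (majority_le _ _ (hhigh a h2) R)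
        rintro x (hx | hx)
        · exact absurd hx.1 h1
        · exact hx.2
      · refine le_of_eq_of_le ?_ (show (0 : ℝ) ≤ _ by positivity)
        simp [h1, h2]
  refine (union_bound _ (range nA) bad ?_ fun a _ => hbadP a).trans (by simp)
  · intro x hx
    by_contra hno
    apply hx
    have hno' : ∀ a < nA, x ∉ bad a := fun a ha h => hno ⟨a, mem_range.2 ha, h⟩
    have hno1 : ∀ a < nA, ♯T * p a ≤ τ * ℓ - 4 * √ℓ →
        ¬ R ≤ 2 * #{r | thrRep τ ℓ (a : ℤ) (x r) = true} :=
      fun a ha h1 h2 => hno' a ha (by rw [hbad]; exact Or.inl ⟨h1, h2⟩)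
    have hno2 : ∀ a < nA, τ * ℓ + 4 * √ℓ ≤ ♯T * p a →
        R ≤ 2 * #{r | thrRep τ ℓ (a : ℤ) (x r) = true} := by
      intro a ha h1
      have h2 : ¬ R ≤ 2 * #{r | (!thrRep τ ℓ (a : ℤ) (x r)) = true} :=
        fun h2 => hno' a ha (by rw [hbad]; exact Or.inr ⟨h1, h2⟩)
      have h3 := card_filter_add_card_filter_not (s := (univ : Finset (Fin R)))
        (fun r => thrRep τ ℓ (a : ℤ) (x r) = true)
      simp only [Bool.not_eq_true', card_univ, Fintype.card_fin, Bool.not_eq_true] at h2 h3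
      omega
    have hnA1 : 1 ≤ nA := by
      have : (0 : ℝ) < nA := lt_of_lt_of_le (by positivity) hnA
      exact_mod_cast this
    -- the largest weight is reported
    have hlast : τ * ℓ + 4 * √ℓ ≤ ♯T * p (nA - 1) := by
      rw [hp]
      have h1 : 3 / δ * √ℓ ≤ ((nA - 1 : ℕ) : ℝ) := by
        rw [Nat.cast_sub hnA1]
        have : (1 : ℝ) ≤ 1 / δ * √ℓ := by rw [one_div, ← div_eq_inv_mul, le_div_iff₀ hδ]; linarith
        have h4 : 4 / δ * √ℓ = 3 / δ * √ℓ + 1 / δ * √ℓ := by ring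
        push_cast
        linarith
      have h2 : (1 : ℝ) ≤ ((nA - 1 : ℕ) : ℝ) := by
        refine le_trans ?_ h1
        rw [div_mul_eq_mul_div, le_div_iff₀ hδ]; nlinarith
      have h3 := le_levelProb (I := I) hb hI (a := nA - 1) (mod_cast h2)
      have h5 : (ℓ : ℝ) / ((nA - 1 : ℕ) : ℝ) ^ 2 ≤ δ / 4 := by
        rw [div_le_iff₀ (by positivity)]
        have h6 : (3 / δ * √ℓ) ^ 2 ≤ ((nA - 1 : ℕ) : ℝ) ^ 2 := by gcongr
        have h7 : (3 / δ * √ℓ) ^ 2 = 9 * ℓ / δ ^ 2 := by rw [mul_pow, sq_sqrt (by linarith)]; ring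
        rw [h7] at h6
        refine le_trans ?_ (mul_le_mul_of_nonneg_left h6 (by positivity))
        have : δ / 4 * (9 * ℓ / δ ^ 2) = 9 / 4 * ℓ / δ := by field_simp
        rw [this, le_div_iff₀ hδ]
        nlinarith
      have h8 : (1 - δ / 4) * ℓ * (1 - δ / 4) ≤ ♯T * levelProb b I (nA - 1 : ℕ) := by
        have : (1 - δ / 4) ≤ levelProb b I (nA - 1 : ℕ) := by linarith
        refine mul_le_mul (by linarith) this (by linarith) (by positivity)
      refine le_trans ?_ h8
      nlinarith
    have hset : ∃ a, a < nA ∧ R ≤ 2 * #{r | thrRep τ ℓ (a : ℤ) (x r) = true} :=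
      ⟨nA - 1, by omega, hno2 _ (by omega) hlast⟩
    have hmem : calWeight nA R (thrRep τ ℓ) x ∈ {a : ℕ | a < nA ∧
      R ≤ 2 * #{r | thrRep τ ℓ (a : ℕ) (x r) = true}} := Nat.sInf_mem hset
    have hmin : ∀ a < calWeight nA R (thrRep τ ℓ) x, ¬ (a < nA ∧
      R ≤ 2 * #{r | thrRep τ ℓ (a : ℕ) (x r) = true}) := fun a ha => Nat.notMem_of_lt_sInf ha
    obtain ⟨A, hA⟩ : ∃ A, A = calWeight nA R (thrRep τ ℓ) x := ⟨_, rfl⟩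
    rw [← hA] at hmem hmin ⊢
    refine ⟨hmem.1, ?_⟩
    have hA1 : τ * ℓ - 4 * √ℓ < ♯T * p A := by
      by_contra h
      exact hno1 A hmem.1 (not_lt.1 h) hmem.2
    have hA0 : A ≠ 0 := by
      rintro rfl
      have h1 : p 0 ≤ 1 / 2 := by rw [hp]; exact levelProb_zero_le b
      have h2 : ♯T * p 0 ≤ (1 + δ / 4) * ℓ * (1 / 2) := by
        refine (mul_le_mul_of_nonneg_left h1 (by positivity)).trans ?_
        nlinarith
      nlinarith
    obtain ⟨A', rfl⟩ := Nat.exists_eq_succ_of_ne_zero hA0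
    have hA2 : ♯T * p A' < τ * ℓ + 4 * √ℓ := by
      by_contra h
      have hlt : A' < nA := by have := hmem.1; omega
      exact hmin A' (by omega) ⟨hlt, hno2 A' hlt (not_lt.1 h)⟩
    have hstep : p (A' + 1) ≤ p A' + 2 / √ℓ := by
      rw [hp, hp]
      have := levelProb_succ_le (I := I) hb hℓ1 hI (A' : ℤ)
      exact_mod_cast this
    have hstep2 : ♯T * p (A' + 1) ≤ ♯T * p A' + 4 * √ℓ := by
      have h1 := mul_le_mul_of_nonneg_left hstep (Nat.cast_nonneg (α := ℝ) (♯T))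
      have h2 : (♯T : ℝ) * (2 / √ℓ) ≤ 4 * √ℓ := by
        rw [mul_div_assoc', div_le_iff₀ (by linarith)]
        nlinarith
      linarith
    rw [← hp, abs_le]
    constructor <;> linarith

/-! ### The report bits of the game -/

/-- The answer bit of round `m` of the uninterrupted game against an estimator without memory. -/
def runBit (μ : Measurements n ℓ b) (M : Estimator n ℓ b) (h : Fin n)
    (v : List Bool → Fin n → ℝ) (m : ℕ) : Bool :=
  decide (h ∈ M μ (sketch μ (v (fullBits μ (M.respond μ) h v m))))

lemma fullBits_eq_map_runBit (μ : Measurements n ℓ b) (M : Estimator n ℓ b) (h : Fin n)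
    (v : List Bool → Fin n → ℝ) (Q : ℕ) :
    fullBits μ (M.respond μ) h v Q = (List.range Q).map (runBit μ M h v) := by
  induction Q with
  | zero => rfl
  | succ Q ih =>
    rw [fullBits_memoryless, List.range_succ, List.map_append, ← ih]
    rfl

lemma runBit_eq (μ : Measurements n ℓ b) (M : Estimator n ℓ b) (h : Fin n)
    (v : List Bool → Fin n → ℝ) (m : ℕ) :
    runBit μ M h v m = decide (h ∈ M μ (sketch μ (v ((List.range m).map (runBit μ M h v))))) := by
  rw [← fullBits_eq_map_runBit]; rfl

lemma getD_map_range {f : ℕ → Bool} {i m : ℕ} (h : i < m) :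
    ((List.range m).map f).getD i false = f i := by
  simp [List.getD, h]

/-- If the watched key is reported in all rounds from `Q₀` on, the corresponding bits are set. -/
lemma runBit_of_false_notMem {μ : Measurements n ℓ b} {M : Estimator n ℓ b} {h : Fin n}
    {v : List Bool → Fin n → ℝ} {Q₀ Q : ℕ}
    (hno : false ∉ (fullBits μ (M.respond μ) h v Q).drop Q₀) {m : ℕ} (h0 : Q₀ ≤ m) (h1 : m < Q) :
    runBit μ M h v m = true := by
  by_contra hf
  apply hno
  rw [fullBits_eq_map_runBit, List.mem_iff_getElem]
  refine ⟨m - Q₀, by simp; omega, ?_⟩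
  simp only [List.getElem_drop, List.getElem_map, List.getElem_range]
  rw [show Q₀ + (m - Q₀) = m by omega]
  simpa using hf

/-! ### Alignment counts of a selected key -/

/-- The flips that turn the signs of a column positive. -/
def orient (κ : Col ℓ b) (t : Bucket ℓ b) : Bool := decide (κ t = -1)

lemma mul_eq_flipSign {κ y : SignType} (hκ : κ ≠ 0) :
    (κ : ℤ) * y = (flipSign (decide (κ = -1)) y : SignType) := by
  revert hκ; cases κ <;> cases y <;> decide

lemma coe_mul_self {κ : SignType} (hκ : κ ≠ 0) : (κ : ℤ) * κ = 1 := by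
  revert hκ; cases κ <;> decide

lemma card_aligned_eq (ω : Fin n → Col ℓ b) (c : Bucket ℓ b → ℝ) (h : Fin n)
    (S : Bucket ℓ b → ℤ) (hS : ∀ t, ω h t ≠ 0 → (ω h t : ℝ) * c t = S t) :
    #(aligned (ofCols ω) c h true) = #{t : supp (ω h) | 0 < S t} ∧
      #(aligned (ofCols ω) c h false) = #{t : supp (ω h) | S t < 0} := by
  have key : ∀ (σ : Bool) (p : Bucket ℓ b → Prop) [DecidablePred p],
      (∀ t, 0 < ((ω h t : ℤ) : ℝ) * c t * (sgn σ : ℝ) ↔ ω h t ≠ 0 ∧ p t) →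
      #(aligned (ofCols ω) c h σ) = #{t : supp (ω h) | p t} := by
    intro σ p _ hp
    symm
    refine card_bij (fun t _ => (t : Bucket ℓ b)) ?_ ?_ ?_
    · intro t ht
      exact mem_filter.2 ⟨mem_univ _, (hp t).2 ⟨mem_supp.1 t.2, (mem_filter.1 ht).2⟩⟩
    · intro t _ t' _ htt
      exact Subtype.ext htt
    · intro t ht
      have := (hp t).1 (mem_filter.1 ht).2
      exact ⟨⟨t, mem_supp.2 this.1⟩, mem_filter.2 ⟨mem_univ _, this.2⟩, rfl⟩
  constructor
  · refine key true (fun t => 0 < S t) fun t => ?_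
    by_cases h0 : ω h t = 0
    · simp [h0]
    · have := hS t h0
      rw [show (((ω h t : SignType) : ℤ) : ℝ) = ((ω h t : SignType) : ℝ) by
        cases ω h t <;> simp, this]
      simp [h0, sgn]
  · refine key false (fun t => S t < 0) fun t => ?_
    by_cases h0 : ω h t = 0
    · simp [h0]
    · have := hS t h0
      rw [show (((ω h t : SignType) : ℤ) : ℝ) = ((ω h t : SignType) : ℝ) by
        cases ω h t <;> simp, this]
      simp [h0, sgn]

lemma mem_basicThresholdEstimator_iff (hℓ : 1 ≤ ℓ) {τ : ℝ} (ω : Fin n → Col ℓ b)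
    (c : Bucket ℓ b → ℝ) (h : Fin n) (S : Bucket ℓ b → ℤ)
    (hS : ∀ t, ω h t ≠ 0 → (ω h t : ℝ) * c t = S t) :
    h ∈ basicThresholdEstimator n ℓ b τ (ofCols ω) c ↔ τ * ℓ ≤ (#{t : supp (ω h) | 0 < S t} : ℝ) ∨
        τ * ℓ ≤ (#{t : supp (ω h) | S t < 0} : ℝ) := by
  obtain ⟨h1, h2⟩ := card_aligned_eq ω c h S hS
  have hℓ' : (0 : ℝ) < ℓ := mod_cast hℓ
  simp only [basicThresholdEstimator, basicEstimate, mem_filter, mem_univ, true_and, le_max_iff,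
    h1, h2, one_div, ← div_eq_inv_mul, le_div_iff₀ hℓ']

/-- The sum of a block of keys, oriented along the column `κ`. -/
def blockSum {I : Type*} [Fintype I] (κ : Col ℓ b) (x : I → Col ℓ b) (t : Bucket ℓ b) : ℤ :=
  signSum fun i => flipSign (orient κ t) (x i t)

lemma mul_sketch_blocks {D I : Type*} [Fintype D] [Fintype I]
    (ω : Fin n → Col ℓ b) (e : Option (D × I) → Fin n) (A : ℤ) (w : D → ℤ) (t : Bucket ℓ b)
    (ht : ω (e none) t ≠ 0) : ((ω (e none) t : SignType) : ℝ) * sketch (ofCols ω)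
        (embedVec e fun o => ((o.elim A fun p => w p.1 : ℤ) : ℝ)) t =
      (A + ∑ q, w q * blockSum (ω (e none)) (fun i => ω (e (some (q, i)))) t : ℤ) := by
  have hcast : ((ω (e none) t : SignType) : ℝ) = (((ω (e none) t : SignType) : ℤ) : ℝ) := by
    cases ω (e none) t <;> simp
  rw [sketch_embedVec, hcast]
  simp only [ofCols]
  norm_cast
  rw [Fintype.sum_option]
  simp only [Option.elim]
  rw [mul_add, ← mul_assoc, coe_mul_self ht, one_mul, Fintype.sum_prod_type, mul_sum]
  congr 1
  refine sum_congr rfl fun q _ => ?_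
  rw [blockSum, signSum, mul_sum, mul_sum]
  refine sum_congr rfl fun i _ => ?_
  rw [orient, ← mul_eq_flipSign ht]
  ring

/-! ### The attack on the threshold estimator -/

section
variable (nA R Q A₀ : ℕ) (bits : List Bool)

/-- The weight of the watched key: in the calibration rounds every weight below `nA` is used `R`
times, in the collection rounds the calibrated weight is used, and in the last phase all weights from
`A₀` on are tried. -/
def phaseWeight : ℤ := if bits.length < nA * R then (bits.length / R : ℕ)
  else if bits.length < nA * R + Q then (calibrated nA R fun i => bits.getD i false : ℕ)
  else (A₀ + (bits.length - (nA * R + Q)) : ℕ)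

/-- The coefficients of the blocks of noise keys: one block per round in the first two phases (the
blocks of the calibration rounds being shared by all weights), and minus the sum of the blocks of the
positively answered collection rounds in the last phase. -/
def phaseCoef : Fin R ⊕ Fin Q → ℤ
  | .inl r => if bits.length < nA * R ∧ bits.length % R = r then 1 else 0
  | .inr q =>
    if bits.length < nA * R + Q then if bits.length = nA * R + q then 1 else 0
    else if bits.getD (nA * R + q) false = true then -1 else 0

/-- The queries of the attack on the threshold estimator. -/
def thresholdQuery {I : Type*} [Fintype I] (e : Option ((Fin R ⊕ Fin Q) × I) → Fin n) : Fin n → ℝ :=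
  embedVec e fun o => ((o.elim (phaseWeight nA R Q A₀ bits)
    fun p => phaseCoef nA R Q bits p.1 : ℤ) : ℝ)

end

section
variable {nA R Q A₀ : ℕ} {I : Type*} [Fintype I] (τ : ℝ) (ω : Fin n → Col ℓ b)
  (e : Option ((Fin R ⊕ Fin Q) × I) → Fin n)

/-- The entries of the block `q` of noise keys in the buckets of the watched key, oriented. -/
def noiseBlock (q : Fin R ⊕ Fin Q) (t : supp (ω (e none))) (i : I) : SignType :=
  flipSign (orient (ω (e none)) t) (ω (e (some (q, i))) t)

lemma runBit_threshold (hℓ : 1 ≤ ℓ) (A₀ nA m : ℕ) (g : ℕ → Bool)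
    (hg : g = runBit (ofCols ω) (basicThresholdEstimator n ℓ b τ) (e none)
      fun bits => thresholdQuery nA R Q A₀ bits e) : g m = decide (
      τ * ℓ ≤ (#{t | 0 < phaseWeight nA R Q A₀ ((List.range m).map g) +
        ∑ q, phaseCoef nA R Q ((List.range m).map g) q * signSum (noiseBlock ω e q t)} : ℝ) ∨
      τ * ℓ ≤ (#{t | phaseWeight nA R Q A₀ ((List.range m).map g) +
        ∑ q, phaseCoef nA R Q ((List.range m).map g) q * signSum (noiseBlock ω e q t) < 0} : ℝ)) := by
  conv_lhs => rw [hg, runBit_eq, ← hg]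
  rw [decide_eq_decide]
  exact mem_basicThresholdEstimator_iff hℓ ω _ (e none)
    (fun t => phaseWeight nA R Q A₀ ((List.range m).map g) +
      ∑ q, phaseCoef nA R Q ((List.range m).map g) q *
        blockSum (ω (e none)) (fun i => ω (e (some (q, i)))) t)
    (fun t ht => mul_sketch_blocks ω e _ _ t ht)

lemma runBit_calibration (hℓ : 1 ≤ ℓ) (A₀ : ℕ) (g : ℕ → Bool)
    (hg : g = runBit (ofCols ω) (basicThresholdEstimator n ℓ b τ) (e none)
      fun bits => thresholdQuery nA R Q A₀ bits e) {a : ℕ} (ha : a < nA) (r : Fin R) :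
    g (a * R + r) = thrRep τ ℓ (a : ℕ) (noiseBlock ω e (.inl r)) := by
  have hR : 0 < R := r.pos
  have hlt : a * R + r < nA * R := by
    calc a * R + r < a * R + R := by have := r.2; omega
      _ = (a + 1) * R := by ring
      _ ≤ nA * R := Nat.mul_le_mul_right _ ha
  have hdiv : (a * R + r) / R = a := by
    rw [mul_comm, Nat.mul_add_div hR, Nat.div_eq_of_lt r.2, add_zero]
  have hmod : (a * R + r) % R = r := by rw [mul_comm, Nat.mul_add_mod, Nat.mod_eq_of_lt r.2]
  have hS : ∀ t, phaseWeight nA R Q A₀ ((List.range (a * R + r)).map g) +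
      ∑ q, phaseCoef nA R Q ((List.range (a * R + r)).map g) q * signSum (noiseBlock ω e q t) =
      (a : ℕ) + signSum (noiseBlock ω e (.inl r) t) := by
    intro t
    simp only [phaseWeight, phaseCoef, Fintype.sum_sum_type, List.length_map, List.length_range,
      hlt, hdiv, hmod, if_true, true_and]
    congr 1
    rw [sum_eq_single r (fun r' _ hr' => by rw [if_neg fun h => hr' (Fin.ext h.symm), zero_mul])
      (by simp), if_pos rfl, one_mul, sum_eq_zero fun q _ => ?_, add_zero]
    rw [if_pos (by omega), if_neg (by omega), zero_mul]
  rw [runBit_threshold τ ω e hℓ A₀ nA _ g hg]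
  simp only [hS]
  rfl

lemma runBit_collection (hℓ : 1 ≤ ℓ) (A₀ : ℕ) (g : ℕ → Bool)
    (hg : g = runBit (ofCols ω) (basicThresholdEstimator n ℓ b τ) (e none)
      fun bits => thresholdQuery nA R Q A₀ bits e) (q : Fin Q) : g (nA * R + q) = thrRep τ ℓ
      (calWeight nA R (thrRep τ ℓ) fun r => noiseBlock ω e (.inl r) : ℕ)
      (noiseBlock ω e (.inr q)) := by
  have hcal : calibrated nA R (fun i => ((List.range (nA * R + q)).map g).getD i false) =
      calWeight nA R (thrRep τ ℓ) fun r => noiseBlock ω e (.inl r) := by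
    rw [← calibrated_eq (g := g) fun a ha r => runBit_calibration τ ω e hℓ A₀ g hg ha r]
    exact calibrated_congr fun i hi => getD_map_range (by omega)
  have hS : ∀ t, phaseWeight nA R Q A₀ ((List.range (nA * R + q)).map g) +
      ∑ q', phaseCoef nA R Q ((List.range (nA * R + q)).map g) q' * signSum (noiseBlock ω e q' t) =
      (calWeight nA R (thrRep τ ℓ) fun r => noiseBlock ω e (.inl r) : ℕ) +
        signSum (noiseBlock ω e (.inr q) t) := by
    intro t
    have h1 : ¬ nA * R + (q : ℕ) < nA * R := by omega
    simp only [phaseWeight, phaseCoef, Fintype.sum_sum_type, List.length_map, List.length_range,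
      h1, hcal, if_false, false_and, zero_mul, sum_const_zero, zero_add, add_lt_add_iff_left,
      q.2, if_true, add_right_inj]
    rw [sum_eq_single q (fun r' _ hr' => by rw [if_neg fun h => hr' (Fin.ext h.symm), zero_mul])
      (by simp), if_pos rfl, one_mul]
  rw [runBit_threshold τ ω e hℓ A₀ nA _ g hg]
  simp only [hS]
  rfl

/-- The noise collected in the buckets of the watched key, as a function of the oriented entries of
the blocks of noise keys. -/
def thrCollected {T I : Type*} [Fintype T] [Fintype I] {R Q : ℕ} (τ : ℝ) (ℓ nA : ℕ)
    (x : Fin R ⊕ Fin Q → T → I → SignType) : T → ℤ :=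
  collected (thrRep τ ℓ (calWeight nA R (thrRep τ ℓ) fun r => x (.inl r) : ℕ))
    (fun y t => signSum (y t)) fun q => x (.inr q)

lemma runBit_last (hℓ : 1 ≤ ℓ) (A₀ : ℕ) (g : ℕ → Bool)
    (hg : g = runBit (ofCols ω) (basicThresholdEstimator n ℓ b τ) (e none)
      fun bits => thresholdQuery nA R Q A₀ bits e) (i : ℕ) : g (nA * R + Q + i) = decide (
      τ * ℓ ≤ (#{t | thrCollected τ ℓ nA (noiseBlock ω e) t < (A₀ + i : ℕ)} : ℝ) ∨
      τ * ℓ ≤ (#{t | (A₀ + i : ℕ) < thrCollected τ ℓ nA (noiseBlock ω e) t} : ℝ)) := by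
  have hS : ∀ t, phaseWeight nA R Q A₀ ((List.range (nA * R + Q + i)).map g) +
      ∑ q', phaseCoef nA R Q ((List.range (nA * R + Q + i)).map g) q' * signSum (noiseBlock ω e q' t) =
      (A₀ + i : ℕ) - thrCollected τ ℓ nA (noiseBlock ω e) t := by
    intro t
    have h1 : ¬ nA * R + Q + i < nA * R := by omega
    have h2 : ¬ nA * R + Q + i < nA * R + Q := by omega
    simp only [phaseWeight, phaseCoef, Fintype.sum_sum_type, List.length_map, List.length_range,
      h1, h2, if_false, false_and, zero_mul, sum_const_zero, zero_add, thrCollected, collected]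
    rw [show nA * R + Q + i - (nA * R + Q) = i by omega, sub_eq_add_neg, ← sum_neg_distrib]
    congr 1
    refine sum_congr rfl fun q _ => ?_
    rw [getD_map_range (by have := q.2; omega), runBit_collection τ ω e hℓ A₀ g hg]
    split_ifs <;> simp
  rw [runBit_threshold τ ω e hℓ A₀ nA _ g hg]
  simp only [hS, sub_pos, sub_neg]

end

/-- The integer median of the collected noise is a weight at which neither sign prevails. -/
lemma exists_balanced {T : Type*} [Fintype T] (W : T → ℤ) {lo hi : ℤ}
    (hlo : 2 * #{t | W t ≤ lo} < ♯T) (hhi : ♯T ≤ 2 * #{t | W t ≤ hi}) :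
    ∃ A, lo < A ∧ A ≤ hi ∧ 2 * #{t | W t < A} ≤ ♯T ∧ 2 * #{t | A < W t} ≤ ♯T := by
  have hmono : ∀ A A', A ≤ A' → #{t | W t ≤ A} ≤ #{t | W t ≤ A'} := fun A A' h =>
    card_le_card (monotone_filter_right _ fun t _ ht => le_trans ht h)
  obtain ⟨A, ⟨hA1, hA2⟩, hA3⟩ := Int.exists_least_of_bdd
    (P := fun A => ♯T ≤ 2 * #{t | W t ≤ A} ∧ A ≤ hi) ⟨lo, fun z hz => by
      by_contra h
      have := hmono z lo (not_le.1 h).le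
      omega⟩ ⟨hi, hhi, le_rfl⟩
  refine ⟨A, ?_, hA2, ?_, ?_⟩
  · by_contra h
    have := hmono A lo (not_lt.1 h)
    omega
  · have h1 : ¬ ♯T ≤ 2 * #{t | W t ≤ A - 1} := fun h => by
      have := hA3 (A - 1) ⟨h, by omega⟩
      omega
    have h2 : (univ.filter fun t => W t < A) = univ.filter fun t => W t ≤ A - 1 :=
      filter_congr fun t _ => by omega
    rw [h2]; omega
  · have h1 := card_filter_add_card_filter_not (s := (univ : Finset T)) (fun t => W t ≤ A)
    simp only [not_le, card_univ] at h1
    omega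

lemma admitsAttack_of_cols {kind : SketchKind} (hb : 1 ≤ b) (M : Estimator n ℓ b)
    (h : Fin n) (v : List Bool → Fin n → ℝ) {k Q₀ Q : ℕ} {δ : ℝ} (hδ : 0 ≤ δ)
    (hv : ∀ bits : List Bool, Q₀ ≤ bits.length → IsHeavyHitter k (v bits) h)
    (hP : (colLaw kind ℓ b ^⊗ (Fin n)).real
      {ω | false ∉ (fullBits (ofCols ω) (M.respond (ofCols ω)) h v Q).drop Q₀} ≤ δ) :
    AdmitsAttack (measurementLaw kind n ℓ b) id M.respond k Q (1 - δ) := by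
  have := prob_measurementLaw kind n ℓ hb
  have := prob_colLaw kind ℓ hb
  have hmp := measurementLaw_eq kind n ℓ hb
  refine admitsAttack_of_watch _ _ _ h v (Q₀ := Q₀) hδ hv ?_
  have : DiscreteMeasurableSpace (Measurements n ℓ b) := inferInstance
  rw [← hmp.measure_preimage MeasurableSet.of_discrete.nullMeasurableSet, ← ofReal_measureReal]
  exact ENNReal.ofReal_le_ofReal hP

lemma mp_keys {kind : SketchKind} (hb : 1 ≤ b) {J : Type*} [Fintype J]
    {e : Option J → Fin n} (he : e.Injective) :
    MeasurePreserving (fun (ω : Fin n → Col ℓ b) => (ω (e none), fun j => ω (e (some j))))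
      (Measure.pi fun _ => colLaw kind ℓ b)
      ((colLaw kind ℓ b).prod (Measure.pi fun _ => colLaw kind ℓ b)) := by
  have := prob_colLaw kind ℓ hb
  exact (mp_option_pi (J := J) (colLaw kind ℓ b)).comp
    (mp_pi_precomp e he (fun _ => id) fun _ => MeasurePreserving.id _)

lemma integral_exp_sum_signSum_le {I T : Type*} [Fintype I] [Fintype T] {s : ℕ} (hb : 1 ≤ b)
    (hI : ♯I = b * s) (S : Finset T) {r : ℝ} (hr : |r| ≤ 1) :
    ∫ x, exp (r * ∑ t ∈ S, (signSum (x t) : ℝ)) ∂(signLaw b I ^⊗ T) ≤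
      exp ((#S * s : ℕ) * r ^ 2) := by
  classical
  obtain ⟨f, hf⟩ : ∃ f : T → (I → SignType) → ℝ, ∀ t y, f t y =
    if t ∈ S then exp (r * signSum y) else 1 := ⟨_, fun _ _ => rfl⟩
  have h1 : ∀ x : T → I → SignType, exp (r * ∑ t ∈ S, (signSum (x t) : ℝ)) = ∏ t, f t (x t) := by
    intro x
    simp only [hf]
    rw [mul_sum, exp_sum, ← prod_filter, filter_mem_eq_inter, univ_inter]
  simp_rw [h1]
  rw [integral_fintype_prod_eq_prod (𝕜 := ℝ)]
  simp only [hf]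
  have h2 : ∀ t : T, ∫ y : I → SignType, (if t ∈ S then exp (r * signSum y) else 1)
      ∂(signLaw b I) ≤ if t ∈ S then exp (s * r ^ 2) else 1 := by
    intro t
    split_ifs
    · exact integral_exp_signSum_le hb hI hr
    · simp
  refine (prod_le_prod (fun t _ => integral_nonneg fun y => ?_) fun t _ => h2 t).trans ?_
  · split_ifs <;> positivity
  · rw [← prod_filter, filter_mem_eq_inter, univ_inter, prod_const, ← exp_nat_mul]
    push_cast
    exact le_of_eq (by ring_nf)

/-- Given the column `κ` of the watched key, the oriented entries of disjoint blocks of other keys in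
its buckets are independent lazy signs. -/
lemma mp_blocks {kind : SketchKind} (hb : 1 ≤ b) {κ : Col ℓ b}
    (hκ : Admissible kind (supp κ)) (D I : Type*) [Fintype D] [Fintype I] :
    MeasurePreserving (fun (ω : D × I → Col ℓ b) q (t : supp κ) i =>
        flipSign (orient κ t) (ω (q, i) t)) (Measure.pi fun _ => colLaw kind ℓ b)
      (Measure.pi fun _ : D => signLaw b I ^⊗ (supp κ)) := by
  have := prob_colLaw kind ℓ hb
  exact (measurePreserving_pi (ι := D) _ _ fun _ =>
    mp_restrict_cols hb hκ I (orient κ)).comp (mp_curry_pi _)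

/-- After calibration, the noise collected against the threshold estimator is of the expected order,
by a union bound over the weights at which the calibration may end. -/
lemma exists_threshold_collection {τ : ℝ} (hτ : 1 / 2 < τ) (hτ1 : τ < 1) :
    ∃ (δ β : ℝ) (ℓ₀ : ℕ), 0 < δ ∧ δ ≤ 1 / 4 ∧ δ ≤ τ - 1 / 2 ∧ 0 < β ∧ β ≤ 1 ∧
      ∀ (T I : Type) [Fintype T] [Fintype I] (ℓ b nA R Q : ℕ),
        ℓ₀ ≤ ℓ → 1 ≤ b → ♯I = b * ℓ → |(♯T : ℝ) - ℓ| ≤ δ / 4 * ℓ →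
        4 / δ * √ℓ ≤ nA → 1 ≤ R → 12800 * ℓ ≤ Q * β ^ 2 →
        ((signLaw b I ^⊗ T) ^⊗ (Fin R ⊕ Fin Q)).real {x | NoiseFails β ℓ Q (thrCollected τ ℓ nA x)} ≤
          nA * (1 / 2) ^ R + nA * (2 * exp (-ℓ)) := by
  obtain ⟨δ, hδeq⟩ : ∃ δ, δ = min (1 - τ) (τ - 1 / 2) := ⟨_, rfl⟩
  have hδ : 0 < δ := by rw [hδeq]; exact lt_min (by linarith) (by linarith)
  have hδ1 : δ ≤ 1 - τ := hδeq ▸ min_le_left _ _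
  have hδ2 : δ ≤ τ - 1 / 2 := hδeq ▸ min_le_right _ _
  have hδ4 : δ ≤ 1 / 4 := by linarith
  obtain ⟨β, ℓ₁, hβ, hβ1, hdrift⟩ := thrRep_drift τ δ hδ hδ1 hδ2
  obtain ⟨ℓ₂, hcal⟩ := threshold_calibration hδ hδ4 hδ1 hδ2
  refine ⟨δ, β, max (max ℓ₁ ℓ₂) 1, hδ, hδ4, hδ2, hβ, hβ1, ?_⟩
  intro T I _ _ ℓ b nA R Q hℓ hb hI hN hnA hR hQ
  have hℓ1 : 1 ≤ ℓ := (le_max_right _ _).trans hℓ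
  have hℓ2 := (le_max_left _ _).trans hℓ
  have hℓ' : (1 : ℝ) ≤ ℓ := mod_cast hℓ1
  have hT : ♯T ≤ 2 * ℓ := by
    have h1 := (abs_le.1 hN).2
    have : (♯T : ℝ) ≤ 2 * ℓ := by nlinarith
    exact_mod_cast this
  obtain ⟨ν, hν⟩ : ∃ ν, ν = signLaw b I ^⊗ T := ⟨_, rfl⟩
  have hνp : IsProbabilityMeasure ν := by rw [hν]; infer_instance
  rw [← hν]
  have hl : MeasurePreserving (fun (x : Fin R ⊕ Fin Q → T → I → SignType) r => x (.inl r))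
      (Measure.pi fun _ => ν) (Measure.pi fun _ => ν) :=
    mp_pi_precomp (Sum.inl : Fin R → Fin R ⊕ Fin Q) Sum.inl_injective (fun _ => id)
      fun _ => MeasurePreserving.id _
  have hr : MeasurePreserving (fun (x : Fin R ⊕ Fin Q → T → I → SignType) q => x (.inr q))
      (Measure.pi fun _ => ν) (Measure.pi fun _ => ν) :=
    mp_pi_precomp (Sum.inr : Fin Q → Fin R ⊕ Fin Q) Sum.inr_injective (fun _ => id)
      fun _ => MeasurePreserving.id _
  have hdis : ∀ (D : Type) [Finite D], DiscreteMeasurableSpace (D → T → I → SignType) := by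
    intro D _
    have h1 : ∀ _ : D, Countable (T → I → SignType) := fun _ => inferInstance
    infer_instance
  obtain ⟨good, hgood⟩ : ∃ good : ℕ → Prop, ∀ a, good a ↔
    |♯T * levelProb b I (a : ℕ) - τ * ℓ| ≤ 8 * √ℓ := ⟨_, fun _ => Iff.rfl⟩
  obtain ⟨E₁, hE₁⟩ : ∃ E₁, E₁ = {x : Fin R → T → I → SignType |
      ¬ (calWeight nA R (thrRep τ ℓ) x < nA ∧ good (calWeight nA R (thrRep τ ℓ) x))} := ⟨_, rfl⟩
  have hE₁P : (ν ^⊗ (Fin R)).real E₁ ≤ nA * (1 / 2) ^ R := by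
    simp only [hE₁, hν, hgood]
    exact hcal I T b ℓ nA R ((le_max_right _ _).trans hℓ2) hb hI hN hnA hR
  obtain ⟨E₂, hE₂⟩ : ∃ E₂ : ℕ → Set (Fin Q → T → I → SignType), ∀ a, E₂ a = {y | good a ∧
      NoiseFails β ℓ Q (collected (thrRep τ ℓ (a : ℕ)) (fun x t => signSum (x t)) y)} :=
    ⟨_, fun _ => rfl⟩
  have hE₂P : ∀ a, (ν ^⊗ (Fin Q)).real (E₂ a) ≤ 2 * exp (-ℓ) := by
    intro a
    rw [hE₂]
    by_cases ha : good a
    · refine (measureReal_mono fun y hy => hy.2).trans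
        (collected_tail ν hℓ1 hℓ1 le_rfl hT hβ hβ1 hQ (thrRep τ ℓ (a : ℕ)) (fun x t => signSum (x t))
          (fun t => ?_) fun S r hr => ?_) <;> rw [hν]
      · exact hdrift I T b ℓ ((le_max_left _ _).trans hℓ2) hb hI hN a ((hgood a).1 ha) t
      · exact integral_exp_sum_signSum_le hb hI S hr
    · simp only [ha, false_and, Set.ofPred_false, measureReal_empty]
      positivity
  refine (measureReal_mono (s₂ := (fun x r => x (.inl r)) ⁻¹' E₁ ∪
    {x | ∃ a ∈ range nA, (fun q => x (.inr q)) ∈ E₂ a}) fun x hx => ?_).trans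
      ((measureReal_union_le _ _).trans (add_le_add ?_ ?_))
  · rw [Set.mem_union, or_iff_not_imp_left]
    intro h1
    rw [hE₁, Set.mem_preimage, Set.mem_ofPred_eq, not_not] at h1
    exact ⟨_, mem_range.2 h1.1, by rw [hE₂]; exact ⟨h1.2, hx⟩⟩
  · rw [hl.real_preimage]
    exact hE₁P
  · refine (union_bound _ (range nA)
      (fun a => (fun (x : Fin R ⊕ Fin Q → T → I → SignType) q => x (.inr q)) ⁻¹' E₂ a) (fun _ h => h)
      fun a _ => ?_).trans_eq (by rw [card_range])
    rw [hr.real_preimage]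
    exact hE₂P a

lemma isHeavyHitter_thresholdQuery {nA R Q A₀ s k : ℕ} {I : Type*} [Fintype I]
    {e : Option ((Fin R ⊕ Fin Q) × I) → Fin n} (he : e.Injective) (hI : ♯I = s)
    (hk : 1 ≤ k) (hA : 1 ≤ A₀) (hlt : Q * s < k * A₀ ^ 2) (bits : List Bool)
    (hbits : nA * R + Q ≤ bits.length) :
    IsHeavyHitter k (thresholdQuery nA R Q A₀ bits e) (e none) := by
  classical
  have h1 : ¬ bits.length < nA * R := by omega
  have h2 : ¬ bits.length < nA * R + Q := by omega
  have hw : (A₀ : ℝ) ≤ (phaseWeight nA R Q A₀ bits : ℝ) := by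
    rw [phaseWeight, if_neg h1, if_neg h2]
    push_cast
    exact le_add_of_nonneg_right (by positivity)
  have hA' : (1 : ℝ) ≤ A₀ := mod_cast hA
  have hc : ∀ q, |(phaseCoef nA R Q bits q : ℝ)| ≤ 1 := by
    rintro (q | q)
    · simp only [phaseCoef, h1, false_and, if_false]; simp
    · simp only [phaseCoef, h2, if_false]
      split_ifs <;> simp
  refine isHeavyHitter_embedVec he _ none ?_ hk ?_
  · rintro (_ | ⟨q, i⟩)
    · exact le_rfl
    · simp only [Option.elim]
      exact (hc q).trans ((hA'.trans hw).trans (le_abs_self _))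
  · have hsum : ∑ j ∈ univ.erase (none : Option ((Fin R ⊕ Fin Q) × I)),
        (((j.elim (phaseWeight nA R Q A₀ bits) fun p => phaseCoef nA R Q bits p.1 : ℤ) : ℝ)) ^ 2 ≤
        Q * s := by
      have h3 : (univ.erase (none : Option ((Fin R ⊕ Fin Q) × I))) =
          univ.map Function.Embedding.some := by
        ext o; cases o <;> simp
      rw [h3, sum_map]
      simp only [Function.Embedding.some_apply, Option.elim, Fintype.sum_prod_type, sum_const,
        card_univ, hI, nsmul_eq_mul, Fintype.sum_sum_type]
      have h4 : ∀ r : Fin R, phaseCoef nA R Q bits (.inl r) = 0 := fun r => by simp [phaseCoef, h1]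
      simp only [h4, Int.cast_zero, ne_eq, OfNat.ofNat_ne_zero, not_false_eq_true, zero_pow,
        mul_zero, sum_const_zero, zero_add]
      refine (sum_le_sum (g := fun _ => (s : ℝ)) fun q _ => ?_).trans (by simp)
      refine mul_le_of_le_one_right (by positivity) ?_
      rw [← sq_abs]
      exact pow_le_one₀ (abs_nonneg _) (hc _)
    refine lt_of_le_of_lt hsum ?_
    simp only [Option.elim]
    calc ((Q : ℝ) * s) < k * (A₀ : ℝ) ^ 2 := mod_cast hlt
      _ ≤ _ := by gcongr

/-- The attack on the threshold estimator fails only if the calibration fails, or the collected noise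
is not of the expected order in a quarter of the buckets. -/
lemma exists_failure_of_reported {nA R Q A₀ : ℕ} {I : Type*} [Fintype I] {τ δ β : ℝ}
    (hℓ : 1 ≤ ℓ) (hδ4 : δ ≤ 1 / 4) (hδ0 : 0 < δ) (hδ : δ ≤ τ - 1 / 2) (hA₀ : (A₀ : ℝ) ≤ β * Q / 4)
    (ω : Fin n → Col ℓ b) (e : Option ((Fin R ⊕ Fin Q) × I) → Fin n)
    (hN : |(#(supp (ω (e none))) : ℝ) - ℓ| < δ / 4 * ℓ)
    (hfail : false ∉ (fullBits (ofCols ω) ((basicThresholdEstimator n ℓ b τ).respond (ofCols ω))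
      (e none) (fun bits => thresholdQuery nA R Q A₀ bits e)
        (nA * R + Q + (12 * Q + 16 * ℓ + 1))).drop (nA * R + Q)) :
    NoiseFails β ℓ Q (thrCollected τ ℓ nA (noiseBlock ω e)) := by
  by_contra hno
  rw [NoiseFails, not_or, not_le, not_le] at hno
  obtain ⟨hno1, hno2⟩ := hno
  obtain ⟨W, hW⟩ : ∃ W, W = thrCollected τ ℓ nA (noiseBlock ω e) := ⟨_, rfl⟩
  rw [← hW] at hno1 hno2
  have hno1' : 4 * #{t | (W t : ℝ) ≤ β * Q / 4} < ℓ := by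
    have : (4 : ℝ) * #{t | (W t : ℝ) ≤ β * Q / 4} < ℓ := by linarith
    exact_mod_cast this
  have hno2' : 4 * #{t | 12 * Q + 16 * ℓ ≤ W t} < ℓ := by
    have h : ∀ t, (12 * Q + 16 * ℓ : ℝ) ≤ W t ↔ 12 * Q + 16 * ℓ ≤ W t := fun t => by norm_cast
    simp only [h] at hno2
    have : (4 : ℝ) * #{t | 12 * Q + 16 * ℓ ≤ W t} < ℓ := by linarith
    exact_mod_cast this
  have hℓ' : (1 : ℝ) ≤ ℓ := mod_cast hℓ
  obtain ⟨hN1, hN2⟩ := abs_lt.1 hN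
  have hcard : (♯(supp (ω (e none))) : ℝ) = #(supp (ω (e none))) := by
    rw [Fintype.card_coe]
  have hT : ℓ < 2 * ♯(supp (ω (e none))) := by
    have : (ℓ : ℝ) < 2 * ♯(supp (ω (e none))) := by rw [hcard]; nlinarith
    exact_mod_cast this
  obtain ⟨A, hA1, hA2, hA3, hA4⟩ := exists_balanced W (lo := A₀) (hi := 12 * Q + 16 * ℓ) (by
      have : #{t | W t ≤ A₀} ≤ #{t | (W t : ℝ) ≤ β * Q / 4} := by
        refine card_le_card (monotone_filter_right _ fun t _ ht => ?_)
        have : (W t : ℝ) ≤ A₀ := mod_cast ht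
        linarith
      omega)
    (by
      have h1 := card_filter_add_card_filter_not (s := univ) (fun t => W t ≤ 12 * Q + 16 * ℓ)
      have h2 : #{t | ¬ W t ≤ 12 * Q + 16 * ℓ} ≤ #{t | 12 * Q + 16 * ℓ ≤ W t} :=
        card_le_card (monotone_filter_right _ fun t _ ht => (not_le.1 ht).le)
      rw [card_univ] at h1
      omega)
  obtain ⟨i, hi⟩ : ∃ i : ℕ, A = (A₀ + i : ℕ) := ⟨(A - A₀).toNat, by push_cast; omega⟩
  have hbit := runBit_of_false_notMem hfail (m := nA * R + Q + i) (by omega) (by omega)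
  rw [runBit_last τ ω e hℓ A₀ _ rfl i, ← hW, ← hi, decide_eq_true_eq] at hbit
  have hhalf : (♯(supp (ω (e none))) : ℝ) < 2 * (τ * ℓ) := by nlinarith
  have h3 : 2 * (#{t | W t < A} : ℝ) ≤ ♯(supp (ω (e none))) := mod_cast hA3
  have h4 : 2 * (#{t | A < W t} : ℝ) ≤ ♯(supp (ω (e none))) := mod_cast hA4
  rcases hbit with h | h <;> linarith

/-- The constants of the attack on the threshold estimator. -/
lemma threshold_rounds {δ β κ : ℝ} (hδ : 0 < δ) (hβ : 0 < β) (hβ1 : β ≤ 1) :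
    ∃ C : ℝ, 0 < C ∧ ∀ ℓ : ℕ, 1 ≤ ℓ → ∃ nA R Q A₀ : ℕ,
      4 / δ * √ℓ ≤ nA ∧ (nA : ℝ) ≤ C * ℓ ∧ 1 ≤ R ∧ √ℓ ≤ R ∧ 12800 * ℓ ≤ Q * β ^ 2 ∧
      (A₀ : ℝ) ≤ β * Q / 4 ∧ 1 ≤ A₀ ∧ Q * κ * ℓ < (A₀ : ℝ) ^ 2 ∧
      ((nA * R + Q + (12 * Q + 16 * ℓ + 1) : ℕ) : ℝ) ≤ C * ℓ ∧ ((1 + (R + Q) : ℕ) : ℝ) ≤ C * ℓ := by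
  obtain ⟨D, hD⟩ : ∃ D, D = 12800 / β ^ 2 + 64 * |κ| / β ^ 2 + 1 := ⟨_, rfl⟩
  have hD0 : 0 < D := by rw [hD]; positivity
  have hDβ : D * β ^ 2 = 12800 + 64 * |κ| + β ^ 2 := by rw [hD]; field_simp
  refine ⟨2 * (4 / δ + 1) + 13 * (D + 1) + 20, by positivity, fun ℓ hℓ => ?_⟩
  have hℓ' : (1 : ℝ) ≤ ℓ := mod_cast hℓ
  have hsq : √ℓ * √ℓ = ℓ := mul_self_sqrt (by linarith)
  have hs1 : 1 ≤ √ℓ := by rw [← sqrt_one]; exact sqrt_le_sqrt hℓ'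
  have hsℓ : √ℓ ≤ ℓ := by nlinarith
  obtain ⟨nA, hnA1, hnA2⟩ : ∃ nA : ℕ, 4 / δ * √ℓ ≤ nA ∧ (nA : ℝ) < 4 / δ * √ℓ + 1 :=
    ⟨_, Nat.le_ceil _, Nat.ceil_lt_add_one (by positivity)⟩
  obtain ⟨R, hR1, hR2⟩ : ∃ R : ℕ, √ℓ ≤ R ∧ (R : ℝ) < √ℓ + 1 :=
    ⟨_, Nat.le_ceil _, Nat.ceil_lt_add_one (by positivity)⟩
  obtain ⟨Q, hQ1, hQ2⟩ : ∃ Q : ℕ, D * ℓ ≤ Q ∧ (Q : ℝ) < D * ℓ + 1 :=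
    ⟨_, Nat.le_ceil _, Nat.ceil_lt_add_one (by positivity)⟩
  have hQ3 : (12800 + 64 * |κ|) * ℓ ≤ Q * β ^ 2 := by nlinarith
  have hQβ : 12800 ≤ Q * β := by
    have h1 : (Q : ℝ) * β ^ 2 ≤ Q * β := by
      refine mul_le_mul_of_nonneg_left ?_ (by positivity); nlinarith
    nlinarith [abs_nonneg κ, mul_nonneg (abs_nonneg κ) (by linarith : (0 : ℝ) ≤ ℓ)]
  have hκℓ : 0 ≤ |κ| * ℓ := by positivity
  obtain ⟨A₀, hA1, hA2⟩ : ∃ A₀ : ℕ, (A₀ : ℝ) ≤ β * Q / 4 ∧ β * Q / 4 < A₀ + 1 :=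
    ⟨_, Nat.floor_le (by positivity), Nat.lt_floor_add_one _⟩
  have hδs : 0 ≤ 4 / δ * √ℓ := by positivity
  have hδℓ : 4 / δ * √ℓ ≤ 4 / δ * ℓ := by gcongr
  have hDℓ : 0 ≤ D * ℓ := by positivity
  refine ⟨nA, R, Q, A₀, hnA1, ?_, ?_, hR1, by nlinarith, hA1, ?_, ?_, ?_, ?_⟩
  · nlinarith
  · have : (0 : ℝ) < R := by linarith
    exact_mod_cast this
  · have : (0 : ℝ) < A₀ := by linarith
    exact_mod_cast this
  · have h1 : β * Q / 8 ≤ A₀ := by linarith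
    have h2 : (β * Q / 8) ^ 2 ≤ (A₀ : ℝ) ^ 2 := by gcongr
    refine lt_of_lt_of_le ?_ h2
    have hQ0 : (0 : ℝ) < Q := by nlinarith
    have h3 : 64 * (κ * ℓ) < Q * β ^ 2 := by
      have : κ * ℓ ≤ |κ| * ℓ := by gcongr; exact le_abs_self κ
      nlinarith
    have h4 := mul_lt_mul_of_pos_left h3 hQ0
    nlinarith
  · push_cast
    have h1 : (nA : ℝ) * R ≤ (4 / δ * √ℓ + 1) * (√ℓ + 1) := by gcongr
    have h2 : (4 / δ * √ℓ + 1) * (√ℓ + 1) = 4 / δ * ℓ + 4 / δ * √ℓ + √ℓ + 1 := by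
      linear_combination 4 / δ * hsq
    linarith
  · grind

lemma threshold_failure_le {δ C : ℝ} (hδ : 0 < δ) (hδ4 : δ ≤ 1 / 4) {nA R : ℕ} (hℓ : 1 ≤ ℓ)
    (hnA' : (nA : ℝ) ≤ C * ℓ) (hR : √ℓ ≤ R) :
    2 * exp (-((δ / 4) ^ 2 / 4 * ℓ)) + (nA * (1 / 2) ^ R + nA * (2 * exp (-ℓ))) ≤
      (2 + 3 * C) * (ℓ : ℝ) ^ 1 * exp (-(δ ^ 2 / 64) * √ℓ) := by
  have hℓ' : (1 : ℝ) ≤ ℓ := mod_cast hℓ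
  have ha : 0 < δ ^ 2 / 64 := by positivity
  have hC0 : 0 ≤ C * ℓ := (Nat.cast_nonneg _).trans hnA'
  have hsq : √ℓ * √ℓ = ℓ := mul_self_sqrt (by linarith)
  have hs1 : 1 ≤ √ℓ := by rw [← sqrt_one]; exact sqrt_le_sqrt hℓ'
  have hsℓ : √ℓ ≤ ℓ := by nlinarith
  have hδ2 : δ ^ 2 / 64 ≤ 1 / 2 := by nlinarith
  have hx : 0 ≤ exp (-(δ ^ 2 / 64) * √ℓ) := (exp_pos _).le
  have e1 : exp (-((δ / 4) ^ 2 / 4 * ℓ)) ≤ exp (-(δ ^ 2 / 64) * √ℓ) := by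
    refine exp_le_exp.2 ?_
    have := mul_le_mul_of_nonneg_left hsℓ ha.le
    nlinarith
  have e2 : exp (-(ℓ : ℝ)) ≤ exp (-(δ ^ 2 / 64) * √ℓ) := by
    refine exp_le_exp.2 ?_
    nlinarith
  have e3 : (1 / 2 : ℝ) ^ R ≤ exp (-(δ ^ 2 / 64) * √ℓ) := by
    have h1 : (1 / 2 : ℝ) ≤ exp (-(1 / 2)) := by have := add_one_le_exp (-(1 / 2) : ℝ); linarith
    calc (1 / 2 : ℝ) ^ R ≤ exp (-(1 / 2)) ^ R := by gcongr
      _ = exp (-(R / 2)) := by rw [← exp_nat_mul]; ring_nf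
      _ ≤ _ := exp_le_exp.2 (by nlinarith)
  have f1 : (nA : ℝ) * (1 / 2) ^ R ≤ C * ℓ * exp (-(δ ^ 2 / 64) * √ℓ) := by gcongr
  have f2 : (nA : ℝ) * (2 * exp (-ℓ)) ≤ C * ℓ * (2 * exp (-(δ ^ 2 / 64) * √ℓ)) := by gcongr
  have f3 : 2 * exp (-((δ / 4) ^ 2 / 4 * ℓ)) ≤ 2 * ℓ * exp (-(δ ^ 2 / 64) * √ℓ) := by
    have := mul_le_mul_of_nonneg_right hℓ' hx
    linarith
  rw [pow_one]
  linarith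

theorem basic_attack (τ κ c : ℝ) (hτ : 1 / 2 < τ) (hτ1 : τ < 1) : ∃ (C : ℝ) (ℓ₀ : ℕ), 0 < C ∧
      ∀ (kind : SketchKind) (n ℓ b k : ℕ),
        ℓ₀ ≤ ℓ → 1 ≤ b → 1 ≤ k → (b : ℝ) ≤ κ * k → C * b * (ℓ : ℝ) ^ 3 ≤ n →
        ∃ Q : ℕ, (Q : ℝ) ≤ C * ℓ ∧ AdmitsAttack (measurementLaw kind n ℓ b) id
            (basicThresholdEstimator n ℓ b τ).respond k Q (1 - (ℓ : ℝ) ^ (-c)) := by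
  obtain ⟨δ, β, ℓ₁, hδ, hδ4, hδτ, hβ, hβ1, hcoll⟩ := exists_threshold_collection hτ hτ1
  obtain ⟨C, hC, hrounds⟩ := threshold_rounds (κ := κ) hδ hβ hβ1
  have ha : 0 < δ ^ 2 / 64 := by positivity
  have hev : ∀ᶠ ℓ : ℕ in Filter.atTop, 1 ≤ ℓ ∧ ℓ₁ ≤ ℓ ∧
      (2 + 3 * C) * (ℓ : ℝ) ^ 1 * exp (-(δ ^ 2 / 64) * √ℓ) ≤ (ℓ : ℝ) ^ (-c) :=
    (Filter.eventually_ge_atTop 1).and ((Filter.eventually_ge_atTop ℓ₁).and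
      (eventually_mul_exp_le _ _ c 1 ha))
  obtain ⟨ℓ₀, hℓ₀⟩ := Filter.eventually_atTop.1 hev
  refine ⟨C, ℓ₀, hC, ?_⟩
  intro kind n ℓ b k hℓ hb hk hκ hn
  obtain ⟨hℓ1, hℓ2, hℓ3⟩ := hℓ₀ ℓ hℓ
  have hℓ' : (1 : ℝ) ≤ ℓ := mod_cast hℓ1
  have hb' : (1 : ℝ) ≤ b := mod_cast hb
  obtain ⟨nA, R, Q, A₀, hnA, hnA', hR1, hR, hQ, hA1, hA4, hheavy, htot, hkeys⟩ := hrounds ℓ hℓ1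
  refine ⟨nA * R + Q + (12 * Q + 16 * ℓ + 1), htot, ?_⟩
  -- the keys
  obtain ⟨e, he⟩ : ∃ e : Option ((Fin R ⊕ Fin Q) × Fin (b * ℓ)) → Fin n, e.Injective := by
    have hcard : ♯(Option ((Fin R ⊕ Fin Q) × Fin (b * ℓ))) ≤ ♯(Fin n) := by
      rw [Fintype.card_option, Fintype.card_prod, Fintype.card_sum]
      simp only [Fintype.card_fin]
      have h1 : (((R + Q) * (b * ℓ) + 1 : ℕ) : ℝ) ≤ n := by
        refine le_trans ?_ hn
        have h2 : (((R + Q) * (b * ℓ) + 1 : ℕ) : ℝ) ≤ ((1 + (R + Q) : ℕ) : ℝ) * (b * ℓ) := by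
          push_cast
          have : (1 : ℝ) ≤ b * ℓ := one_le_mul_of_one_le_of_one_le hb' hℓ'
          nlinarith
        refine h2.trans ((mul_le_mul_of_nonneg_right hkeys (by positivity)).trans ?_)
        have : (C * ℓ * (b * ℓ) : ℝ) = C * b * (ℓ : ℝ) ^ 2 := by ring
        rw [this]
        have : (ℓ : ℝ) ^ 2 ≤ (ℓ : ℝ) ^ 3 := pow_le_pow_right₀ hℓ' (by norm_num)
        gcongr
      exact_mod_cast h1
    obtain ⟨f⟩ := Function.Embedding.nonempty_of_card_le hcard
    exact ⟨f, f.injective⟩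
  have := prob_colLaw kind ℓ hb
  refine admitsAttack_of_cols hb _ (e none) (fun bits => thresholdQuery nA R Q A₀ bits e)
    (Q₀ := nA * R + Q) (by positivity) (fun bits hbits => ?_) ?_
  · refine isHeavyHitter_thresholdQuery he (Fintype.card_fin _) hk hA4 ?_ bits hbits
    have h1 : ((Q * (b * ℓ) : ℕ) : ℝ) < ((k * A₀ ^ 2 : ℕ) : ℝ) := by
      push_cast
      calc (Q : ℝ) * (b * ℓ) ≤ Q * ((κ * k) * ℓ) := by gcongr
        _ = k * (Q * κ * ℓ) := by ring
        _ < k * (A₀ : ℝ) ^ 2 := by gcongr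
    exact_mod_cast h1
  -- the failure event, given the column of the watched key
  obtain ⟨B, hB⟩ : ∃ B : Set (Col ℓ b), B = {κ | ¬ Admissible kind (supp κ)} ∪
      {κ | δ / 4 * ℓ ≤ |(#(supp κ) : ℝ) - ℓ|} := ⟨_, rfl⟩
  have hBP : (colLaw kind ℓ b).real B ≤ 2 * exp (-((δ / 4) ^ 2 / 4 * ℓ)) := by
    rw [hB]
    refine (measureReal_union_le _ _).trans ?_
    have h0 : (colLaw kind ℓ b).real {κ | ¬ Admissible kind (supp κ)} = 0 := by
      rw [measureReal_def, ae_iff.1 (ae_admissible kind), ENNReal.toReal_zero]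
    rw [h0, zero_add]
    exact card_supp_tail kind hb (by linarith) (by linarith)
  have hB' : ∀ κ ∉ B, Admissible kind (supp κ) ∧ |(#(supp κ) : ℝ) - ℓ| < δ / 4 * ℓ := fun κ hκ => by
    simpa only [hB, Set.mem_union, Set.mem_ofPred_eq, not_or, not_not, not_le] using hκ
  have hE := prod_real_le (μ := colLaw kind ℓ b)
    (ν := colLaw kind ℓ b ^⊗ ((Fin R ⊕ Fin Q) × Fin (b * ℓ)))
    (E := {x | x.1 ∈ B ∨ NoiseFails β ℓ Q (thrCollected τ ℓ nA fun q (t : supp x.1) i =>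
      flipSign (orient x.1 t) (x.2 (q, i) t))}) B
    (δ := nA * (1 / 2) ^ R + nA * (2 * exp (-ℓ))) (by positivity) (fun κ hκ => by
      obtain ⟨h1, h2⟩ := hB' κ hκ
      have hT : DiscreteMeasurableSpace (Fin R ⊕ Fin Q → supp κ → Fin (b * ℓ) → SignType) := by
        have h1 : ∀ _ : Fin R ⊕ Fin Q, Countable (supp κ → Fin (b * ℓ) → SignType) :=
          fun _ => inferInstance
        infer_instance
      refine le_trans (le_of_eq ?_) ((mp_blocks hb h1 (Fin R ⊕ Fin Q)
        (Fin (b * ℓ))).real_preimage.trans_le (hcoll (supp κ) (Fin (b * ℓ)) ℓ b nA R Q hℓ2 hb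
          (Fintype.card_fin _) (by rw [Fintype.card_coe]; exact h2.le) hnA hR1 hQ))
      congr 1
      ext ω
      simp only [Set.mem_ofPred_eq, hκ, false_or, Set.mem_preimage])
  have hmp := mp_keys (kind := kind) (ℓ := ℓ) hb he
  refine (measureReal_mono (s₂ := (fun ω : Fin n → Col ℓ b =>
    (ω (e none), fun j => ω (e (some j)))) ⁻¹' _) ?_ (measure_ne_top _ _)).trans
      (hmp.real_preimage.trans_le (hE.trans ?_))
  · intro ω hω
    rw [Set.mem_preimage, Set.mem_ofPred_eq, or_iff_not_imp_left]
    intro hκ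
    exact exists_failure_of_reported hℓ1 hδ4 hδ hδτ hA1 ω e (hB' _ hκ).2 hω
  · refine le_trans ?_ hℓ3
    exact (add_le_add_left hBP _).trans (threshold_failure_le hδ hδ4 hℓ1 hnA' hR)

/-! ### Medians -/

lemma getD_le_iff_of_pairwise (l : List ℝ) (hl : l.Pairwise (· ≤ ·)) (x : ℝ) (k : ℕ)
    (hk : k < l.length) : l.getD k 0 ≤ x ↔ k < l.countP (· ≤ x) := by
  induction l generalizing k with
  | nil => simp at hk
  | cons a l ih =>
    rw [List.pairwise_cons] at hl
    by_cases hax : a ≤ x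
    · grind
    · have h0 : ∀ y ∈ a :: l, ¬ y ≤ x := by grind
      have h1 : (a :: l).countP (· ≤ x) = 0 :=
        List.countP_eq_zero.2 fun y hy => by simpa using h0 y hy
      rw [h1]
      refine iff_of_false (h0 _ ?_) (by omega)
      rw [List.getD_eq_getElem _ _ hk]
      exact List.getElem_mem hk

section
variable {α : Type*}

/-- The lower one of the two middle elements of the values of `f` on `A`. -/
def lowerMid (A : Finset α) (f : α → ℝ) : ℝ := ((A.val.map f).sort (· ≤ ·)).getD ((#A - 1) / 2) 0

/-- The upper one of the two middle elements of the values of `f` on `A`. -/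
def upperMid (A : Finset α) (f : α → ℝ) : ℝ := ((A.val.map f).sort (· ≤ ·)).getD (#A / 2) 0

/-- The median of the values of `f` on `A`. -/
def medianOn (A : Finset α) (f : α → ℝ) : ℝ := median (A.val.map f)

lemma medianOn_eq (A : Finset α) (f : α → ℝ) :
    medianOn A f = (lowerMid A f + upperMid A f) / 2 := by
  simp [medianOn, median, lowerMid, upperMid]

variable {A : Finset α} {f g : α → ℝ} {x : ℝ}

lemma sort_getD_le_iff {k : ℕ} (hk : k < #A) :
    ((A.val.map f).sort (· ≤ ·)).getD k 0 ≤ x ↔ k < #{t ∈ A | f t ≤ x} := by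
  rw [getD_le_iff_of_pairwise _ (Multiset.pairwise_sort _ _) _ _ (by simpa using hk),
    ← Multiset.coe_countP, Multiset.sort_eq, Multiset.countP_map]
  rfl

lemma sort_getD_mem {k : ℕ} (hk : k < #A) :
    ∃ t ∈ A, ((A.val.map f).sort (· ≤ ·)).getD k 0 = f t := by
  have h1 : k < ((A.val.map f).sort (· ≤ ·)).length := by simpa using hk
  rw [List.getD_eq_getElem _ _ h1]
  have h2 := List.getElem_mem h1
  rw [Multiset.mem_sort, Multiset.mem_map] at h2
  obtain ⟨t, ht, h⟩ := h2
  exact ⟨t, ht, h.symm⟩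

lemma sort_getD_lt_iff {k : ℕ} (hk : k < #A) :
    ((A.val.map f).sort (· ≤ ·)).getD k 0 < x ↔ k < #{t ∈ A | f t < x} := by
  constructor
  · intro h
    have h1 := (sort_getD_le_iff (f := f) hk).1 le_rfl
    refine h1.trans_le (card_le_card ?_)
    exact monotone_filter_right _ fun t _ ht => lt_of_le_of_lt ht h
  · intro h
    have hne : (A.filter fun t => f t < x).Nonempty := card_pos.1 (by omega)
    obtain ⟨t, ht, hmax⟩ := exists_max_image _ f hne
    refine lt_of_le_of_lt ((sort_getD_le_iff hk).2 (h.trans_le (card_le_card ?_)))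
      (mem_filter.1 ht).2
    intro u hu
    exact mem_filter.2 ⟨(mem_filter.1 hu).1, hmax u hu⟩

lemma card_filter_le_add_gt (A : Finset α) (f : α → ℝ) (x : ℝ) :
    #{t ∈ A | f t ≤ x} + #{t ∈ A | x < f t} = #A := by
  rw [← card_filter_add_card_filter_not (s := A) (fun t => f t ≤ x)]
  simp only [not_le]

lemma card_filter_lt_add_ge (A : Finset α) (f : α → ℝ) (x : ℝ) :
    #{t ∈ A | f t < x} + #{t ∈ A | x ≤ f t} = #A := by
  rw [← card_filter_add_card_filter_not (s := A) (fun t => f t < x)]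
  simp only [not_lt]

lemma lt_lowerMid_iff (hA : A.Nonempty) : x < lowerMid A f ↔ 2 * #{t ∈ A | f t ≤ x} < #A := by
  have hc := card_pos.2 hA
  rw [← not_le, lowerMid, sort_getD_le_iff (by omega)]
  omega

lemma lowerMid_lt_iff (hA : A.Nonempty) : lowerMid A f < x ↔ #A ≤ 2 * #{t ∈ A | f t < x} := by
  have hc := card_pos.2 hA
  rw [lowerMid, sort_getD_lt_iff (by omega)]
  omega

lemma lt_upperMid_iff (hA : A.Nonempty) : x < upperMid A f ↔ #A ≤ 2 * #{t ∈ A | x < f t} := by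
  have hc := card_pos.2 hA
  have := card_filter_le_add_gt A f x
  rw [← not_le, upperMid, sort_getD_le_iff (by omega)]
  omega

lemma upperMid_lt_iff (hA : A.Nonempty) : upperMid A f < x ↔ 2 * #{t ∈ A | x ≤ f t} < #A := by
  have hc := card_pos.2 hA
  have := card_filter_lt_add_ge A f x
  rw [upperMid, sort_getD_lt_iff (by omega)]
  omega

lemma lowerMid_mem (hA : A.Nonempty) : ∃ t ∈ A, lowerMid A f = f t :=
  sort_getD_mem (by have := card_pos.2 hA; omega)

lemma upperMid_mem (hA : A.Nonempty) : ∃ t ∈ A, upperMid A f = f t :=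
  sort_getD_mem (by have := card_pos.2 hA; omega)

lemma lowerMid_le_upperMid (hA : A.Nonempty) : lowerMid A f ≤ upperMid A f := by
  by_contra h
  rw [not_le, upperMid_lt_iff hA] at h
  have h1 : ¬ lowerMid A f < lowerMid A f := lt_irrefl _
  rw [lowerMid_lt_iff hA] at h1
  have := card_filter_lt_add_ge A f (lowerMid A f)
  omega

lemma lowerMid_mono (hA : A.Nonempty) (h : ∀ t ∈ A, f t ≤ g t) : lowerMid A f ≤ lowerMid A g := by
  refine le_of_forall_lt fun x hx => ?_
  rw [lt_lowerMid_iff hA] at hx ⊢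
  have : #{t ∈ A | g t ≤ x} ≤ #{t ∈ A | f t ≤ x} :=
    card_le_card (monotone_filter_right _ fun t ht hg => (h t ht).trans hg)
  omega

lemma upperMid_mono (hA : A.Nonempty) (h : ∀ t ∈ A, f t ≤ g t) : upperMid A f ≤ upperMid A g := by
  refine le_of_forall_lt fun x hx => ?_
  rw [lt_upperMid_iff hA] at hx ⊢
  have : #{t ∈ A | x < f t} ≤ #{t ∈ A | x < g t} :=
    card_le_card (monotone_filter_right _ fun t ht hf => hf.trans_le (h t ht))
  omega

lemma medianOn_mono (hA : A.Nonempty) (h : ∀ t ∈ A, f t ≤ g t) : medianOn A f ≤ medianOn A g := by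
  rw [medianOn_eq, medianOn_eq]
  have := lowerMid_mono hA h
  have := upperMid_mono hA h
  linarith

lemma lowerMid_comp (hA : A.Nonempty) {φ : ℝ → ℝ} (hφ : Monotone φ) :
    lowerMid A (fun t => φ (f t)) = φ (lowerMid A f) := by
  apply le_antisymm
  · by_contra h
    rw [not_le, lt_lowerMid_iff hA] at h
    have h1 : ¬ lowerMid A f < lowerMid A f := lt_irrefl _
    rw [lt_lowerMid_iff hA] at h1
    have : #{t ∈ A | f t ≤ lowerMid A f} ≤ #{t ∈ A | φ (f t) ≤ φ (lowerMid A f)} :=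
      card_le_card (monotone_filter_right _ fun t _ ht => hφ ht)
    omega
  · by_contra h
    rw [not_le, lowerMid_lt_iff hA] at h
    have h1 : ¬ lowerMid A f < lowerMid A f := lt_irrefl _
    rw [lowerMid_lt_iff hA] at h1
    have : #{t ∈ A | φ (f t) < φ (lowerMid A f)} ≤ #{t ∈ A | f t < lowerMid A f} :=
      card_le_card (monotone_filter_right _ fun t _ ht => hφ.reflect_lt ht)
    omega

lemma upperMid_comp (hA : A.Nonempty) {φ : ℝ → ℝ} (hφ : Monotone φ) :
    upperMid A (fun t => φ (f t)) = φ (upperMid A f) := by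
  apply le_antisymm
  · by_contra h
    rw [not_le, lt_upperMid_iff hA] at h
    have h1 : ¬ upperMid A f < upperMid A f := lt_irrefl _
    rw [lt_upperMid_iff hA] at h1
    have : #{t ∈ A | φ (upperMid A f) < φ (f t)} ≤ #{t ∈ A | upperMid A f < f t} :=
      card_le_card (monotone_filter_right _ fun t _ ht => hφ.reflect_lt ht)
    omega
  · by_contra h
    rw [not_le, upperMid_lt_iff hA] at h
    have h1 : ¬ upperMid A f < upperMid A f := lt_irrefl _
    rw [upperMid_lt_iff hA] at h1
    have : #{t ∈ A | upperMid A f ≤ f t} ≤ #{t ∈ A | φ (upperMid A f) ≤ φ (f t)} :=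
      card_le_card (monotone_filter_right _ fun t _ ht => hφ ht)
    omega

lemma lowerMid_const_sub (hA : A.Nonempty) (c : ℝ) :
    lowerMid A (fun t => c - f t) = c - upperMid A f := by
  refine eq_of_forall_lt_iff fun x => ?_
  rw [lt_lowerMid_iff hA, lt_sub_comm, upperMid_lt_iff hA]
  simp only [sub_le_comm]

lemma upperMid_const_sub (hA : A.Nonempty) (c : ℝ) :
    upperMid A (fun t => c - f t) = c - lowerMid A f := by
  refine eq_of_forall_lt_iff fun x => ?_
  rw [lt_upperMid_iff hA, lt_sub_comm, lowerMid_lt_iff hA]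
  simp only [lt_sub_comm]

lemma medianOn_const_sub (hA : A.Nonempty) (c : ℝ) :
    medianOn A (fun t => c - f t) = c - medianOn A f := by
  rw [medianOn_eq, medianOn_eq, lowerMid_const_sub hA, upperMid_const_sub hA]
  ring

/-- Truncating values outside of a window which contains both middle elements does not change the
median. -/
lemma medianOn_eq_of_monotone (hA : A.Nonempty) {φ : ℝ → ℝ} (hφ : Monotone φ) {lo hi a r : ℝ}
    (hφ' : ∀ y, lo ≤ y → y ≤ hi → y = a + r * φ y) (hlo : 2 * #{t ∈ A | f t < lo} < #A)
    (hhi : 2 * #{t ∈ A | hi < f t} < #A) :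
    medianOn A f = a + r * medianOn A (fun t => φ (f t)) ∧ lo ≤ medianOn A f ∧
      medianOn A f ≤ hi := by
  have h1 : lo ≤ lowerMid A f := by
    by_contra h
    rw [not_le, lowerMid_lt_iff hA] at h
    omega
  have h2 : upperMid A f ≤ hi := by
    by_contra h
    rw [not_le, lt_upperMid_iff hA] at h
    omega
  have h3 := lowerMid_le_upperMid (f := f) hA
  rw [medianOn_eq, medianOn_eq, lowerMid_comp hA hφ, upperMid_comp hA hφ]
  have h4 := hφ' _ h1 (h3.trans h2)
  have h5 := hφ' _ (h1.trans h3) h2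
  refine ⟨?_, by linarith, by linarith⟩
  linear_combination (h4 + h5) / 2

lemma exists_medianOn_eq (hA : A.Nonempty) (W : α → ℤ) :
    ∃ p : ℤ, 2 * medianOn A (fun t => (W t : ℝ)) = p := by
  obtain ⟨t, _, ht⟩ := lowerMid_mem (f := fun t => (W t : ℝ)) hA
  obtain ⟨u, _, hu⟩ := upperMid_mem (f := fun t => (W t : ℝ)) hA
  refine ⟨W t + W u, ?_⟩
  rw [medianOn_eq, ht, hu]
  push_cast
  ring

lemma medianOn_le (hA : A.Nonempty) (h : 2 * #{t ∈ A | x < f t} < #A) : medianOn A f ≤ x := by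
  have h1 : upperMid A f ≤ x := by
    by_contra h'
    rw [not_le, lt_upperMid_iff hA] at h'
    omega
  have := lowerMid_le_upperMid (f := f) hA
  rw [medianOn_eq]; linarith

lemma le_medianOn (hA : A.Nonempty) (h : 2 * #{t ∈ A | f t < x} < #A) : x ≤ medianOn A f := by
  have h1 : x ≤ lowerMid A f := by
    by_contra h'
    rw [not_le, lowerMid_lt_iff hA] at h'
    omega
  have := lowerMid_le_upperMid (f := f) hA
  rw [medianOn_eq]; linarith

lemma medianOn_pos (h : #A < 2 * #{t ∈ A | 0 < f t}) : 0 < medianOn A f := by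
  have hA : A.Nonempty := card_pos.1 (by
    have := card_filter_le A fun t => 0 < f t
    omega)
  have h1 : 0 < lowerMid A f := by
    rw [lt_lowerMid_iff hA]
    have := card_filter_le_add_gt A f 0
    omega
  have := lowerMid_le_upperMid (f := f) hA
  rw [medianOn_eq]; linarith

lemma medianOn_eq_zero (hA : A.Nonempty) (h1 : 2 * #{t ∈ A | 0 < f t} < #A)
    (h2 : 2 * #{t ∈ A | f t < 0} < #A) : medianOn A f = 0 :=
  le_antisymm (medianOn_le hA h1) (le_medianOn hA h2)

/-- If one of the values vanishes, the sign of the median is decided by the number of positive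
values. -/
lemma medianOn_pos_iff {t : α} (ht : t ∈ A) (h0 : f t = 0) :
    0 < medianOn A f ↔ #A ≤ 2 * #{t ∈ A | 0 < f t} := by
  have hA : A.Nonempty := ⟨t, ht⟩
  constructor
  · intro h
    by_contra h'
    exact absurd (medianOn_le hA (not_le.1 h')) (not_le.2 h)
  · intro h
    have h1 : 0 < upperMid A f := (lt_upperMid_iff hA).2 h
    have h2 : 0 ≤ lowerMid A f := by
      by_contra h'
      rw [not_le, lowerMid_lt_iff hA] at h'
      have h3 : #{t ∈ A | f t < 0} + 1 ≤ #{t ∈ A | f t ≤ 0} := by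
        refine Nat.succ_le_of_lt (card_lt_card (ssubset_iff_of_subset
          (monotone_filter_right _ fun u _ hu => le_of_lt hu) |>.2
            ⟨t, mem_filter.2 ⟨ht, h0.le⟩, fun h => ?_⟩))
        exact absurd (mem_filter.1 h).2 (by rw [h0]; exact lt_irrefl _)
      have := card_filter_le_add_gt A f 0
      omega
    rw [medianOn_eq]; linarith

end

lemma medianEstimate_eq (ω : Fin n → Col ℓ b) (c : Bucket ℓ b → ℝ) (i : Fin n) :
    medianEstimate (ofCols ω) c i =
      medianOn (supp (ω i)) fun t => ((ω i t : SignType) : ℝ) * c t := by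
  have h1 : ∀ y : SignType, ((y : ℤ) : ℝ) = (y : ℝ) := fun y => by cases y <;> simp
  rw [medianEstimate, filter_ofCols_ne_zero, medianOn]
  simp only [ofCols, h1]

/-! ### Reports of the median estimator -/

/-- The columns of a competitor, of huge keys and of noise keys. -/
notation "Round[" ℓ "," b "," G "," I "]" => (Option G → Col ℓ b) × (I → Col ℓ b)

section
variable {G I : Type*} [Fintype G] [Fintype I]

/-- The contribution to a bucket of a competitor of weight `a + 1` (with column `w none`) and of huge
keys of weight `H` (with columns `w (some i)`). -/
def netWatched (a H : ℕ) (w : Option G → Col ℓ b) (u : Bucket ℓ b) : ℤ :=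
  (a + 1) * (w none u : ℤ) + H * ∑ i, (w (some i) u : ℤ)

/-- The contribution to a bucket of the watched key (with column `κ`), of weight `a`, and of huge
keys. -/
def netRival (a H : ℕ) (κ : Col ℓ b) (w : Option G → Col ℓ b) (u : Bucket ℓ b) : ℤ :=
  a * (κ u : ℤ) + H * ∑ i, (w (some i) u : ℤ)

/-- The sum of the noise keys in a bucket. -/
def noiseSum (z : I → Col ℓ b) (u : Bucket ℓ b) : ℤ := signSum fun i => z i u

/-- The truncated deviations of the measurements of a key with column `κ` from its weight: in the
buckets without other heavy keys, this is the oriented noise, and in the remaining ones, `±D`. -/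
def deviation (κ : Col ℓ b) (net Z : Bucket ℓ b → ℤ) (D : ℤ) (u : Bucket ℓ b) : ℤ :=
  (κ u : ℤ) * if net u = 0 then Z u else (SignType.sign (net u) : ℤ) * D

/-- The truncated deviations of the competitor of a watched key with column `κ`. -/
notation "rivalDev[" a "," H "," κ "," D "," x "]" =>
  deviation (Prod.fst x none) (netRival a H κ (Prod.fst x)) (noiseSum (Prod.snd x)) D

/-- Does the median estimator prefer the watched key (with column `κ`) to its competitor? -/
def medianRep (a H : ℕ) (D : ℤ) (κ : Col ℓ b) (x : Round[ℓ, b, G, I]) : Bool :=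
  decide (medianOn (supp (x.1 none)) (fun u => (rivalDev[a, H, κ, D, x] u : ℝ)) <
    medianOn (supp κ) fun u => (deviation κ (netWatched a H x.1) (noiseSum x.2) D u : ℝ))

lemma netWatched_eq_zero_iff {a H : ℕ} (hH : a + 1 < H) (w : Option G → Col ℓ b) (u : Bucket ℓ b) :
    netWatched a H w u = 0 ↔ w none u = 0 ∧ ∑ i, (w (some i) u : ℤ) = 0 := by
  unfold netWatched
  generalize (∑ i, (w (some i) u : ℤ)) = s
  generalize w none u = y
  have hs : s = 0 ∨ (H : ℤ) ≤ |H * s| := by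
    by_cases h : s = 0
    · exact Or.inl h
    · right
      rw [abs_mul, Nat.abs_cast]
      exact le_mul_of_one_le_right (by positivity) (Int.one_le_abs h)
  rcases hs with rfl | hs
  · cases y <;> simp <;> omega
  · have hs0 : s ≠ 0 := by rintro rfl; simp at hs; omega
    refine iff_of_false (fun h => ?_) fun h => hs0 h.2
    have h2 : (H : ℤ) * s = -((a + 1) * (y : ℤ)) := by linarith
    rw [h2, abs_neg, abs_mul] at hs
    have h3 : |((y : SignType) : ℤ)| ≤ 1 := by cases y <;> simp
    have h4 : |(a : ℤ) + 1| = a + 1 := abs_of_pos (by positivity)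
    rw [h4] at hs
    have : ((a : ℤ) + 1) * |((y : SignType) : ℤ)| ≤ (a + 1) * 1 :=
      mul_le_mul_of_nonneg_left h3 (by positivity)
    omega

lemma netRival_eq_zero_iff {a H : ℕ} (ha : 1 ≤ a) (hH : a + 1 < H) (κ : Col ℓ b)
    (w : Option G → Col ℓ b) (u : Bucket ℓ b) :
    netRival a H κ w u = 0 ↔ κ u = 0 ∧ ∑ i, (w (some i) u : ℤ) = 0 := by
  have h := netWatched_eq_zero_iff (G := G) (a := a - 1) (H := H) (by omega)
    (fun o => o.elim κ fun i => w (some i)) u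
  rw [netWatched] at h
  rw [netRival]
  have h1 : ((a - 1 : ℕ) : ℤ) + 1 = a := by omega
  rw [h1] at h
  exact h

lemma abs_noiseSum_le (z : I → Col ℓ b) (u : Bucket ℓ b) : |noiseSum z u| ≤ ♯I := abs_signSum_le _

/-- The changes of the signs of the noise in the buckets of the watched key. -/
def flipWatched (κ : Col ℓ b) (σ : Bucket ℓ b → Bool) (x : Round[ℓ, b, G, I]) : Round[ℓ, b, G, I] :=
  (x.1, fun i u => flipSign (σ u && decide (κ u ≠ 0)) (x.2 i u))

lemma noiseSum_flipWatched (κ : Col ℓ b) (σ : Bucket ℓ b → Bool)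
    (x : Round[ℓ, b, G, I]) (u : Bucket ℓ b) : noiseSum (flipWatched κ σ x).2 u =
      (if σ u && decide (κ u ≠ 0) then -1 else 1) * noiseSum x.2 u := signSum_flip _ _

lemma abs_noiseSum_flipWatched (κ : Col ℓ b) (σ : Bucket ℓ b → Bool)
    (x : Round[ℓ, b, G, I]) (u : Bucket ℓ b) :
    |noiseSum (flipWatched κ σ x).2 u| = |noiseSum x.2 u| := by
  rw [noiseSum_flipWatched]; split_ifs <;> simp

lemma deviation_rival_flipWatched {a H : ℕ} (ha : 1 ≤ a) (hH : a + 1 < H) (D : ℤ) (κ : Col ℓ b)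
    (σ : Bucket ℓ b → Bool) (x : Round[ℓ, b, G, I]) (u : Bucket ℓ b) :
    deviation ((flipWatched κ σ x).1 none) (netRival a H κ (flipWatched κ σ x).1)
        (noiseSum (flipWatched κ σ x).2) D u = rivalDev[a, H, κ, D, x] u := by
  unfold deviation
  change (x.1 none u : ℤ) * (if netRival a H κ x.1 u = 0 then _ else _) = _
  congr 1
  by_cases h : netRival a H κ x.1 u = 0
  · have h0 := ((netRival_eq_zero_iff ha hH κ x.1 u).1 h).1
    rw [if_pos h, if_pos h, noiseSum_flipWatched]
    simp [h0]
  · rw [if_neg h, if_neg h]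
    rfl

/-- The buckets of the watched key, other than `t`, without other heavy keys and with nonzero
noise. -/
def pivots (a H : ℕ) (κ : Col ℓ b) (t : Bucket ℓ b) (x : Round[ℓ, b, G, I]) : Finset (Bucket ℓ b) :=
  (supp κ).filter fun u => u ≠ t ∧ netWatched a H x.1 u = 0 ∧ noiseSum x.2 u ≠ 0

/-- The buckets in which the measurement of the watched key is much too large (`s = 1`) or much too
small (`s = -1`). -/
def outliers (a H : ℕ) (κ : Col ℓ b) (s : SignType) (w : Option G → Col ℓ b) :
    Finset (Bucket ℓ b) :=
  (supp κ).filter fun u => κ u * SignType.sign (netWatched a H w u) = s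

/-- The buckets of the watched key without other keys or noise. -/
def silents (a H : ℕ) (κ : Col ℓ b) (x : Round[ℓ, b, G, I]) : Finset (Bucket ℓ b) :=
  (supp κ).filter fun u => netWatched a H x.1 u = 0 ∧ noiseSum x.2 u = 0

/-- The situation in which the sign of the noise of the bucket `t` is decisive with probability of
order `1 / √ℓ`: the estimate of the competitor is exact, and the outliers nearly cancel. -/
def medianZone (a H : ℕ) (D : ℤ) (κ : Col ℓ b) (t : Bucket ℓ b) (r : ℕ) (K : ℝ) :
    Set (Round[ℓ, b, G, I]) :=
  {x | netWatched a H x.1 t = 0 ∧ (r : ℤ) ≤ |noiseSum x.2 t| ∧ medianOn (supp (x.1 none))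
      (fun u => (rivalDev[a, H, κ, D, x] u : ℝ)) = 0 ∧
    (silents a H κ x).Nonempty ∧ (#(silents a H κ x) : ℝ) ≤ K * √ℓ ∧
    |(#(outliers a H κ 1 x.1) : ℝ) - #(outliers a H κ (-1) x.1)| ≤ 10 * √ℓ ∧
    (#(outliers a H κ 1 x.1) + #(outliers a H κ (-1) x.1) : ℝ) ≤ 9 / 25 * #(supp κ)}

lemma pivots_flipWatched (a H : ℕ) (κ : Col ℓ b) (t : Bucket ℓ b) (σ : Bucket ℓ b → Bool)
    (x : Round[ℓ, b, G, I]) : pivots a H κ t (flipWatched κ σ x) = pivots a H κ t x := by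
  refine filter_congr fun u _ => ?_
  rw [← abs_ne_zero, abs_noiseSum_flipWatched, abs_ne_zero]
  rfl

lemma silents_flipWatched (a H : ℕ) (κ : Col ℓ b) (σ : Bucket ℓ b → Bool) (x : Round[ℓ, b, G, I]) :
    silents a H κ (flipWatched κ σ x) = silents a H κ x := by
  refine filter_congr fun u _ => ?_
  rw [← abs_eq_zero (a := noiseSum _ u), abs_noiseSum_flipWatched, abs_eq_zero]
  rfl

lemma flipWatched_mem_medianZone {a H : ℕ} (ha : 1 ≤ a) (hH : a + 1 < H) {D : ℤ} {κ : Col ℓ b}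
    {t : Bucket ℓ b} {r : ℕ} {K : ℝ} (σ : Bucket ℓ b → Bool)
    {x : Round[ℓ, b, G, I]} (hx : x ∈ medianZone a H D κ t r K) :
    flipWatched κ σ x ∈ medianZone a H D κ t r K := by
  obtain ⟨h1, h2, h3, h4, h5, h6, h7⟩ := hx
  refine ⟨h1, ?_, ?_, ?_, ?_, h6, h7⟩
  · rwa [abs_noiseSum_flipWatched]
  · simp only [deviation_rival_flipWatched ha hH]
    exact h3
  · rwa [silents_flipWatched]
  · rwa [silents_flipWatched]

lemma deviation_pos_iff {κ : Col ℓ b} {net Z : Bucket ℓ b → ℤ} {D : ℤ} (hD : 0 < D)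
    (u : Bucket ℓ b) : 0 < deviation κ net Z D u ↔
      (net u = 0 ∧ 0 < (κ u : ℤ) * Z u) ∨ κ u * SignType.sign (net u) = 1 := by
  unfold deviation
  by_cases h : net u = 0
  · simp [h]
  · rw [if_neg h, ← mul_assoc, mul_pos_iff_of_pos_right hD]
    simp only [h, false_and, false_or]
    generalize SignType.sign (net u) = s
    generalize κ u = y
    revert s y; decide

/-- The buckets of the watched key with a positive deviation, other than `t`. -/
lemma card_deviation_pos {a H : ℕ} {D : ℤ} (hD : 0 < D) {κ : Col ℓ b}
    {t : Bucket ℓ b} (ht : κ t ≠ 0) (x : Round[ℓ, b, G, I]) (hnet : netWatched a H x.1 t = 0) :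
    #{u ∈ supp κ | 0 < (deviation κ (netWatched a H x.1) (noiseSum x.2) D u : ℝ)} =
      #(outliers a H κ 1 x.1) +
        #((pivots a H κ t x).filter fun u => 0 < (κ u : ℤ) * noiseSum x.2 u) +
        if 0 < (κ t : ℤ) * noiseSum x.2 t then 1 else 0 := by
  have h1 : ((supp κ).filter fun u =>
        0 < (deviation κ (netWatched a H x.1) (noiseSum x.2) D u : ℝ)) = outliers a H κ 1 x.1 ∪
        ((pivots a H κ t x).filter (fun u => 0 < (κ u : ℤ) * noiseSum x.2 u) ∪
        if 0 < (κ t : ℤ) * noiseSum x.2 t then {t} else ∅) := by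
    ext u
    rw [mem_filter, Int.cast_pos, deviation_pos_iff hD, mem_union, mem_union, outliers,
      mem_filter, mem_filter, pivots, mem_filter]
    by_cases hut : u = t
    · subst hut
      split_ifs with hp <;> simp [hp, hnet, ht]
    · have : u ∉ (if 0 < (κ t : ℤ) * noiseSum x.2 t then ({t} : Finset (Bucket ℓ b)) else ∅) := by grind
      simp only [this, or_false]
      constructor
      · grind
      · grind
  rw [h1, card_union_of_disjoint, card_union_of_disjoint, add_assoc]
  · grind
  · rw [Finset.disjoint_left]
    intro u hu
    have := (mem_filter.1 (mem_filter.1 hu).1).2.1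
    split_ifs <;> simp [this]
  · rw [Finset.disjoint_left]
    intro u hu
    rw [outliers, mem_filter] at hu
    have hne : netWatched a H x.1 u ≠ 0 := fun h => by rw [h] at hu; simp at hu
    rw [mem_union]
    rintro (h | h)
    · exact hne (mem_filter.1 (mem_filter.1 h).1).2.2.1
    · split_ifs at h
      · rw [mem_singleton] at h; subst h; exact hne hnet
      · simp at h

lemma medianRep_eq_of_zone {a H : ℕ} (hD : 0 < D) {κ : Col ℓ b} {t : Bucket ℓ b}
    (ht : κ t ≠ 0) {r : ℕ} {K : ℝ} {x : Round[ℓ, b, G, I]} (hx : x ∈ medianZone a H D κ t r K) :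
    medianRep a H D κ x = decide (#(supp κ) ≤ 2 * (#(outliers a H κ 1 x.1) +
        #((pivots a H κ t x).filter fun u => 0 < (κ u : ℤ) * noiseSum x.2 u) +
        if 0 < (κ t : ℤ) * noiseSum x.2 t then 1 else 0)) := by
  obtain ⟨h1, _, h3, ⟨v, hv⟩, _⟩ := hx
  rw [medianRep, h3, ← card_deviation_pos hD ht x h1]
  rw [silents, mem_filter] at hv
  exact decide_eq_decide.2 (medianOn_pos_iff hv.1 (by simp [deviation, hv.2.1, hv.2.2]))

/-- The buckets of the watched key, classified. -/
lemma card_supp_eq {a H : ℕ} {κ : Col ℓ b} {t : Bucket ℓ b} (ht : κ t ≠ 0)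
    (x : Round[ℓ, b, G, I]) (hnet : netWatched a H x.1 t = 0) (hZ : noiseSum x.2 t ≠ 0) :
    #(supp κ) = #(outliers a H κ 1 x.1) + #(outliers a H κ (-1) x.1) +
      #(silents a H κ x) + #(pivots a H κ t x) + 1 := by
  have h1 : #(supp κ) = ∑ u ∈ supp κ,
      ((if κ u * SignType.sign (netWatched a H x.1 u) = 1 then 1 else 0) +
        (if κ u * SignType.sign (netWatched a H x.1 u) = -1 then 1 else 0) +
        (if netWatched a H x.1 u = 0 ∧ noiseSum x.2 u = 0 then 1 else 0) +
        (if u ≠ t ∧ netWatched a H x.1 u = 0 ∧ noiseSum x.2 u ≠ 0 then 1 else 0) +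
        if u = t then 1 else 0) := by
    rw [card_eq_sum_ones]
    refine sum_congr rfl fun u hu => ?_
    rw [mem_supp] at hu
    by_cases hn : netWatched a H x.1 u = 0
    · by_cases hz : noiseSum x.2 u = 0
      · have : u ≠ t := by rintro rfl; exact hZ hz
        simp [hn, hz, this]
      · by_cases hut : u = t
        · subst hut; simp [hn, hz]
        · simp [hn, hz, hut]
    · have hut : u ≠ t := by rintro rfl; exact hn hnet
      have hs : SignType.sign (netWatched a H x.1 u) ≠ 0 := sign_ne_zero.2 hn
      simp only [hn, hut, false_and, and_false, if_false, add_zero]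
      generalize SignType.sign (netWatched a H x.1 u) = s at hs
      generalize κ u = y at hu
      revert s y; decide
  rw [h1]
  simp only [sum_add_distrib, ← card_filter, outliers, silents, pivots]
  congr 1
  rw [filter_eq', if_pos (mem_supp.2 ht), card_singleton]

end

section
variable {G I : Type*} [Fintype G] [Fintype I]

instance {J : Type*} [Finite J] : DiscreteMeasurableSpace (J → Col ℓ b) := by
  have : ∀ _ : J, Countable (Col ℓ b) := fun _ => inferInstance
  infer_instance

instance {J J' : Type*} [Finite J] [Finite J'] :
    DiscreteMeasurableSpace ((J → Col ℓ b) × (J' → Col ℓ b)) := by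
  have h1 : Finite (J → Col ℓ b) := inferInstance
  have h2 : Finite (J' → Col ℓ b) := inferInstance
  have h3 : DiscreteMeasurableSpace (J → Col ℓ b) := inferInstance
  have h4 : DiscreteMeasurableSpace (J' → Col ℓ b) := inferInstance
  have h5 : Countable ((J → Col ℓ b) × (J' → Col ℓ b)) := inferInstance
  exact MeasurableSingletonClass.toDiscreteMeasurableSpace

lemma mp_flipWatched (hb : 1 ≤ b) (κ : Col ℓ b)
    (σ : Bucket ℓ b → Bool) : MeasurePreserving (flipWatched (G := G) (I := I) κ σ)
      ((Measure.pi fun _ => colLaw kind ℓ b).prod (Measure.pi fun _ => colLaw kind ℓ b))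
      ((Measure.pi fun _ => colLaw kind ℓ b).prod (Measure.pi fun _ => colLaw kind ℓ b)) := by
  have := prob_colLaw kind ℓ hb
  exact (MeasurePreserving.id _).prod (measurePreserving_pi _ _ fun _ =>
    mp_flip_col kind hb fun u => σ u && decide (κ u ≠ 0))

/-- The bias of the noise of a bucket of the watched key, given that this key is preferred to its
competitor, is at least of the order of the probability of the favourable situations, times the
noise, divided by `√ℓ`. -/
lemma medianRep_drift_of_zone (hb : 1 ≤ b) {a H : ℕ} (ha : 1 ≤ a)
    (hH : a + 1 < H) {D : ℤ} (hD : ♯I < D) {κ : Col ℓ b} {t : Bucket ℓ b} (ht : κ t ≠ 0)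
    {r : ℕ} (hr : 1 ≤ r) {K p : ℝ} (hm : ∀ x ∈ medianZone (G := G) (I := I) a H D κ t r K,
      2 * (#(outliers a H κ 1 x.1) + 1) ≤ #(supp κ))
    (hp : ∀ x ∈ medianZone (G := G) (I := I) a H D κ t r K, p ≤ (pivots a H κ t x).card.choose
        ((#(supp κ) + 1) / 2 - 1 - #(outliers a H κ 1 x.1)) / 2 ^ #(pivots a H κ t x)) :
    r * p / 2 * ((Measure.pi fun _ => colLaw kind ℓ b).prod
        (Measure.pi fun _ => colLaw kind ℓ b)).real (medianZone (G := G) (I := I) a H D κ t r K) ≤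
      ∫ x, (if medianRep (G := G) (I := I) a H D κ x then (((κ t : ℤ) * noiseSum x.2 t : ℤ) : ℝ) else 0)
        ∂((Measure.pi fun _ => colLaw kind ℓ b).prod (Measure.pi fun _ => colLaw kind ℓ b)) := by
  have := prob_colLaw kind ℓ hb
  have hD0 : 0 < D := lt_of_le_of_lt (Int.natCast_nonneg _) hD
  have habs : ∀ x : Round[ℓ, b, G, I], |(κ t : ℤ) * noiseSum x.2 t| =
      |noiseSum x.2 t| := fun x => by
    rw [abs_mul]
    generalize κ t = y at ht
    cases y <;> simp at ht ⊢
  refine drift_of_pivot (Z := fun x u => (κ u : ℤ) * noiseSum x.2 u) (Φ := flipWatched κ)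
    (mp_flipWatched kind hb κ) ?_ (t := t) (F := medianRep a H D κ) ?_ ?_
    (fun σ x hx => flipWatched_mem_medianZone ha hH σ hx) (U := pivots a H κ t)
    (m := fun x => (#(supp κ) + 1) / 2 - 1 - #(outliers a H κ 1 x.1))
    (fun σ x => pivots_flipWatched a H κ t σ x) (fun _ _ => rfl) ?_ ?_ (by positivity) hp ?_ ?_
  · intro σ x u
    rw [noiseSum_flipWatched]
    by_cases h : κ u = 0
    · simp [h]
    · simp only [ne_eq, h, not_false_eq_true, decide_true, Bool.and_true]
      ring
  · intro x
    congr 1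
    unfold flipWatched
    simp
  · intro x hx hfl
    rw [medianRep, decide_eq_true_iff] at hfl ⊢
    simp only [deviation_rival_flipWatched ha hH] at hfl
    refine hfl.trans_le (medianOn_mono ⟨t, mem_supp.2 ht⟩ fun u hu => ?_)
    rw [Int.cast_le]
    unfold deviation
    change (κ u : ℤ) * (if netWatched a H x.1 u = 0 then _ else _) ≤ _
    by_cases hn : netWatched a H x.1 u = 0
    · rw [if_pos hn, if_pos hn, noiseSum_flipWatched]
      by_cases hut : u = t
      · subst hut
        simp only [flipAt, decide_true, ne_eq, ht, not_false_eq_true, Bool.and_self, if_true]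
        linarith
      · simp [flipAt, hut]
    · rw [if_neg hn, if_neg hn]
      rfl
  · intro x _ h
    exact (mem_filter.1 h).2.1 rfl
  · intro x _ u hu
    have h1 := mem_filter.1 hu
    have h2 : ((κ u : SignType) : ℤ) ≠ 0 := by
      have := mem_supp.1 h1.1
      generalize κ u = y at this
      cases y <;> simp at this ⊢
    exact mul_ne_zero h2 h1.2.2.2
  · intro x hx
    have h1 := hx.2.1
    have h2 : ((r : ℤ) : ℝ) ≤ ((|(κ t : ℤ) * noiseSum x.2 t| : ℤ) : ℝ) := by
      rw [habs]; exact_mod_cast h1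
    rw [Int.cast_abs] at h2
    exact_mod_cast h2
  · intro x hx hpos hcount
    have hpos' : 0 < (κ t : ℤ) * noiseSum x.2 t := hpos
    have h1 := hm x hx
    have h2 := medianRep_eq_of_zone hD0 ht hx
    have h3 := medianRep_eq_of_zone hD0 ht (flipWatched_mem_medianZone ha hH (flipAt t) hx)
    have hcount' : #((pivots a H κ t x).filter fun u => 0 < (κ u : ℤ) * noiseSum x.2 u) =
      (#(supp κ) + 1) / 2 - 1 - #(outliers a H κ 1 x.1) := hcount
    rw [if_pos hpos', hcount'] at h2
    have h4 : ((pivots a H κ t (flipWatched κ (flipAt t) x)).filter fun u =>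
        0 < (κ u : ℤ) * noiseSum (flipWatched κ (flipAt t) x).2 u) =
        (pivots a H κ t x).filter fun u => 0 < (κ u : ℤ) * noiseSum x.2 u := by
      rw [pivots_flipWatched]
      refine filter_congr fun u hu => ?_
      rw [noiseSum_flipWatched]
      simp [flipAt, (mem_filter.1 hu).2.1]
    have h5 : ¬ 0 < (κ t : ℤ) * noiseSum (flipWatched κ (flipAt t) x).2 t := by
      rw [noiseSum_flipWatched]
      simp only [flipAt, decide_true, ne_eq, ht, not_false_eq_true, Bool.and_self, if_true]
      linarith
    rw [h4, if_neg h5, hcount'] at h3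
    have h6 : (flipWatched κ (flipAt t) x).1 = x.1 := rfl
    rw [h6] at h3
    rw [h2, h3, decide_eq_true_iff, decide_eq_false_iff_not]
    omega

/-- The variance of a sum of variables whose signs can be flipped one at a time. -/
lemma integral_sum_sq_of_flip {X B : Type*} [Finite X] [MeasurableSpace X]
    [DiscreteMeasurableSpace X] [Fintype B] (ν : Measure X) [IsProbabilityMeasure ν]
    (f : B → X → ℝ) (Φ : B → X → X) (hΦ : ∀ t, MeasurePreserving (Φ t) ν ν)
    (hneg : ∀ t x, f t (Φ t x) = -f t x) (hinv : ∀ t u x, u ≠ t → f u (Φ t x) = f u x) :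
    ∫ x, (∑ t, f t x) ^ 2 ∂ν = ∑ t, ∫ x, f t x ^ 2 ∂ν := by
  have h1 : ∀ x, (∑ t, f t x) ^ 2 = ∑ t, ∑ u, f t x * f u x := fun x => by rw [sq, sum_mul_sum]
  simp_rw [h1]
  rw [integral_finsetSum _ fun _ _ => .of_finite]
  refine sum_congr rfl fun t _ => ?_
  rw [integral_finsetSum _ fun _ _ => .of_finite, sum_eq_single t]
  · simp only [sq]
  · intro u _ hu
    have h2 := integral_comp_mp (hΦ t) fun x => f t x * f u x
    simp only [hneg, hinv t u _ hu, neg_mul, integral_neg] at h2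
    linarith
  · simp

lemma tail_le_of_integral_sq {X : Type*} [Finite X] [MeasurableSpace X]
    [DiscreteMeasurableSpace X] (ν : Measure X) [IsProbabilityMeasure ν] (f : X → ℝ) {r : ℝ}
    (hr : 0 < r) : ν.real {x | r ≤ |f x|} ≤ (∫ x, f x ^ 2 ∂ν) / r ^ 2 := by
  rw [← integral_div]
  refine measureReal_le_integral ν (fun x => by positivity) fun x hx => ?_
  have hx' : r ≤ |f x| := hx
  rw [one_le_div (by positivity), ← sq_abs (f x)]
  gcongr

lemma admissible_singleton (t : Bucket ℓ b) : Admissible kind ({t} : Finset (Bucket ℓ b)) := by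
  cases kind with
  | countSketch => simp [Admissible]
  | bCountSketch => trivial

lemma colLaw_real_ne_zero (hb : 1 ≤ b) (t : Bucket ℓ b) :
    (colLaw kind ℓ b).real {κ | κ t ≠ 0} = 1 / b := by
  have hmp := mp_restrict_col hb (admissible_singleton kind t)
  have h1 := (measurePreserving_eval (fun _ : ({t} : Finset (Bucket ℓ b)) => lazyLaw b)
    ⟨t, mem_singleton_self t⟩).comp hmp
  have h2 := h1.real_preimage (s := {y | y ≠ 0})
  refine Eq.trans ?_ (h2.trans ?_)
  · rfl
  · rw [← integral_indicator_one .of_discrete, integral_lazyLaw]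
    have hb' : (b : ℝ) ≠ 0 := by positivity
    simp only [ne_eq, Set.indicator, Set.mem_ofPred_eq, one_ne_zero, not_false_eq_true, if_true,
      not_true_eq_false, if_false, Pi.one_apply, mul_zero, add_zero, SignType.neg_eq_zero_iff]
    field_simp
    norm_num

end

section
variable {G I F : Type*} [Fintype G] [Fintype I] [Fintype F]

/-- If there are at most `b / 3` columns, then they meet not much more than a third of the buckets
of an admissible set. -/
lemma outlier_tail (hb : 1 ≤ b) {A : Finset (Bucket ℓ b)}
    (hA : Admissible kind A) (hA0 : A.Nonempty) (hF : 3 * ♯F ≤ b) : (colLaw kind ℓ b ^⊗ F).real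
      {w | 9 / 25 * (#A : ℝ) < #{u ∈ A | ∃ o, w o u ≠ 0}} ≤ 352 / #A := by
  classical
  have hb' : (0 : ℝ) < b := mod_cast hb
  have := prob_colLaw kind ℓ hb
  have hA1 : (0 : ℝ) < #A := mod_cast hA0.card_pos
  have hmp := mp_restrict_cols hb hA F fun _ => false
  set g : (F → SignType) → ℝ := fun y => if ∃ o, y o ≠ 0 then 1 else 0 with hg
  have hmean : ∫ y, g y ∂(signLaw b F) ≤ 1 / 3 := by
    calc ∫ y, g y ∂(signLaw b F) ≤ ∫ y, ∑ o, (if y o ≠ 0 then (1 : ℝ) else 0) ∂(signLaw b F) := by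
          refine integral_mono .of_finite .of_finite fun y => ?_
          by_cases h : ∃ o, y o ≠ 0
          · simp only [hg, h, if_true]
            obtain ⟨o, ho⟩ := h
            refine le_trans ?_ (single_le_sum (f := fun o => if y o ≠ 0 then (1 : ℝ) else 0)
              (fun o _ => by positivity) (mem_univ o))
            simp [ho]
          · simp only [hg, h, if_false]
            exact sum_nonneg fun o _ => by positivity
      _ = ∑ o : F, ∫ y, (if y ≠ 0 then (1 : ℝ) else 0) ∂(lazyLaw b) := by
          rw [integral_finsetSum _ fun _ _ => .of_finite]
          refine sum_congr rfl fun o _ => ?_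
          exact integral_comp_mp
            (measurePreserving_eval (fun _ : F => lazyLaw b) o) fun y => if y ≠ 0 then (1 : ℝ) else 0
      _ = ♯F * (1 / b) := by
          rw [sum_const, card_univ, nsmul_eq_mul, integral_lazyLaw]
          have : (-1 : SignType) ≠ 0 := by decide
          simp [this]
          left; field_simp; norm_num
      _ ≤ 1 / 3 := by
          have : (3 : ℝ) * ♯F ≤ b := mod_cast hF
          rw [mul_one_div, div_le_div_iff₀ hb' (by norm_num)]
          linarith
  have h1 := chebyshev_pi (T := A) (signLaw b F) (g := g) (fun y => by positivity)
    (fun y => by simp only [hg]; split_ifs <;> norm_num) univ (r := 2 / 75 * #A) (by positivity)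
  have h2 := hmp.real_preimage (s := {x : A → F → SignType | 2 / 75 * (#A : ℝ) ≤
    |∑ t ∈ univ, g (x t) - #(univ : Finset A) * ∫ y, g y ∂(signLaw b F)|})
  refine (measureReal_mono ?_ (measure_ne_top _ _)).trans ((h2.le.trans h1).trans ?_)
  · intro w hw
    have hw' : 9 / 25 * (#A : ℝ) < #{u ∈ A | ∃ o, w o u ≠ 0} := hw
    change 2 / 75 * (#A : ℝ) ≤ |_|
    refine le_trans ?_ (le_abs_self _)
    have h3 : ∑ t : A, g (fun i => flipSign false (w i t)) = (#{u ∈ A | ∃ o, w o u ≠ 0} : ℝ) := by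
      rw [card_filter, Nat.cast_sum, ← sum_coe_sort A]
      refine sum_congr rfl fun t _ => ?_
      simp only [hg, flipSign]
      push_cast
      rfl
    rw [h3]
    have h4 : (#(univ : Finset A) : ℝ) = #A := by simp
    rw [h4]
    have := mul_le_mul_of_nonneg_left hmean hA1.le
    linarith
  · have h4 : (#(univ : Finset A) : ℝ) = #A := by simp
    rw [h4]
    rw [div_le_div_iff₀ (by positivity) hA1]
    nlinarith

/-- The number of noiseless buckets of an admissible set concentrates. -/
lemma zeros_tail (hb : 1 ≤ b) {A : Finset (Bucket ℓ b)}
    (hA : Admissible kind A) {r : ℝ} (hr : 0 < r) : (colLaw kind ℓ b ^⊗ I).real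
      {z | r ≤ |(#{u ∈ A | noiseSum z u = 0} : ℝ) -
        #A * (signLaw b I).real {x | signSum x = 0}|} ≤ #A / (4 * r ^ 2) := by
  classical
  have := prob_colLaw kind ℓ hb
  have hmp := mp_restrict_cols hb hA I fun _ => false
  set g : (I → SignType) → ℝ := fun y => if signSum y = 0 then 1 else 0 with hg
  have hmean : ∫ y, g y ∂(signLaw b I) = (signLaw b I).real {x | signSum x = 0} := by
    rw [← integral_indicator_one .of_discrete]
    refine integral_congr_ae (.of_forall fun y => ?_)
    simp [hg, Set.indicator]
  have h1 := chebyshev_pi (T := A) (signLaw b I) (g := g) (fun y => by positivity)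
    (fun y => by simp only [hg]; split_ifs <;> norm_num) univ hr
  have h2 := hmp.real_preimage (s := {x : A → I → SignType | r ≤
    |∑ t ∈ univ, g (x t) - #(univ : Finset A) * ∫ y, g y ∂(signLaw b I)|})
  have h4 : #(univ : Finset A) = #A := by simp
  rw [hmean, h4] at h2
  rw [hmean, h4] at h1
  refine (measureReal_mono ?_ (measure_ne_top _ _)).trans (h2.le.trans h1)
  intro z hz
  have h3 : ∑ t : A, g (fun i => flipSign false (z i t)) = (#{u ∈ A | noiseSum z u = 0} : ℝ) := by
    rw [card_filter, Nat.cast_sum, ← sum_coe_sort A]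
    refine sum_congr rfl fun t _ => ?_
    simp only [hg, flipSign]
    push_cast
    rfl
  change r ≤ |_|
  rw [h3]
  exact hz

/-- Small values of the noise of a given bucket. -/
lemma noise_small (hb : 1 ≤ b) {s : ℕ} (hs : 1 ≤ s) (hI : ♯I = b * s) (t : Bucket ℓ b) (r : ℕ) :
    (colLaw kind ℓ b ^⊗ I).real {z | |noiseSum z t| < r} ≤ 4 * r / √s := by
  classical
  have hmp := mp_restrict_cols hb (admissible_singleton kind t) I fun _ => false
  have h0 := (measurePreserving_eval (fun _ : ({t} : Finset (Bucket ℓ b)) => signLaw b I)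
    ⟨t, mem_singleton_self t⟩).comp hmp
  have h2 := h0.real_preimage (s := {x : I → SignType | |signSum x| < r})
  have h3 : (signLaw b I).real {x | |signSum x| < r} ≤ 4 * r / √s := by
    refine (union_bound _ (Ioo (-(r : ℤ)) r) (fun j => {x | signSum x = j})
      (fun x hx => ⟨signSum x, mem_Ioo.2 (abs_lt.1 hx), rfl⟩)
      fun j _ => signSum_atom_le hb hs hI j).trans ?_
    rw [Int.card_Ioo, mul_div_assoc']
    refine div_le_div_of_nonneg_right ?_ (sqrt_nonneg _)
    have : ((((r : ℤ) - -(r : ℤ) - 1).toNat : ℕ) : ℝ) ≤ 2 * r := by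
      have : ((r : ℤ) - -(r : ℤ) - 1).toNat ≤ 2 * r := by omega
      exact_mod_cast this
    linarith
  exact (h2.le.trans h3)

lemma sum_sign_eq {B : Type*} [Fintype B] (σ : B → SignType) : ∑ u, ((σ u : SignType) : ℝ) =
      (#{u | σ u = 1} : ℝ) - #{u | σ u = -1} := by
  rw [card_filter, card_filter, Nat.cast_sum, Nat.cast_sum, ← sum_sub_distrib]
  refine sum_congr rfl fun u _ => ?_
  generalize σ u = y
  cases y <;> simp

/-- The imbalance of the outliers of the watched key. -/
lemma outlier_balance (hb : 1 ≤ b) (a H : ℕ) (κ : Col ℓ b) {r : ℝ}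
    (hr : 0 < r) : (colLaw kind ℓ b ^⊗ (Option G)).real
      {w | r ≤ |(#(outliers a H κ 1 w) : ℝ) - #(outliers a H κ (-1) w)|} ≤ #(supp κ) / r ^ 2 := by
  classical
  have := prob_colLaw kind ℓ hb
  set ν := colLaw kind ℓ b ^⊗ (Option G) with hν
  set f : Bucket ℓ b → (Option G → Col ℓ b) → ℝ := fun u w =>
    ((κ u * SignType.sign (netWatched a H w u) : SignType) : ℝ) with hf
  have hsum : ∀ w : Option G → Col ℓ b, ∑ u, f u w =
      (#(outliers a H κ 1 w) : ℝ) - #(outliers a H κ (-1) w) := fun w => by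
    have h1 : ∀ s : SignType, s ≠ 0 → outliers a H κ s w =
        univ.filter fun u => κ u * SignType.sign (netWatched a H w u) = s := by
      intro s hs
      ext u
      rw [outliers, mem_filter, mem_filter, mem_supp]
      refine and_congr_left fun h => iff_of_true ?_ (mem_univ _)
      rintro h0
      rw [h0, zero_mul] at h
      exact hs h.symm
    rw [h1 1 (by decide), h1 (-1) (by decide), ← sum_sign_eq]
  simp_rw [← hsum]
  refine (tail_le_of_integral_sq ν _ hr).trans ?_
  have h2 := integral_sum_sq_of_flip ν f (fun t w o u => flipSign (decide (u = t)) (w o u))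
    (fun t => measurePreserving_pi _ _ fun _ => mp_flip_col kind hb _) ?_ ?_
  · gcongr
    rw [h2]
    calc ∑ t, ∫ x, f t x ^ 2 ∂ν ≤ ∑ t, (if κ t ≠ 0 then (1 : ℝ) else 0) := by
          refine sum_le_sum fun t _ => ?_
          refine (integral_mono (g := fun _ => if κ t ≠ 0 then (1 : ℝ) else 0) .of_finite
            .of_finite fun w => ?_).trans (by simp)
          simp only [hf]
          generalize SignType.sign (netWatched a H w t) = s
          generalize κ t = y
          cases y <;> cases s <;> simp
      _ = #(supp κ) := by
          rw [supp, card_filter, Nat.cast_sum]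
          exact sum_congr rfl fun t _ => by split_ifs <;> simp
  · intro t w
    have : netWatched a H (fun o u => flipSign (decide (u = t)) (w o u)) t = - netWatched a H w t := by
      simp only [netWatched, flipSign, decide_true, if_true, SignType.coe_neg, sum_neg_distrib]
      ring
    simp only [hf, this, Left.sign_neg, mul_neg, SignType.coe_neg]
  · intro t u w hut
    have : netWatched a H (fun o u => flipSign (decide (u = t)) (w o u)) u = netWatched a H w u := by
      simp [netWatched, flipSign, hut]
    simp only [hf, this]

/-- The imbalance of the signs of the deviations of the competitor. -/
lemma rival_balance (hb : 1 ≤ b) (a H : ℕ) (D : ℤ) (κ : Col ℓ b) {r : ℝ}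
    (hr : 0 < r) : ((colLaw kind ℓ b ^⊗ (Option G)).prod (colLaw kind ℓ b ^⊗ I)).real
      {x | r ≤ |(#{u ∈ supp (x.1 none) | 0 < rivalDev[a, H, κ, D, x] u} : ℝ) -
          #{u ∈ supp (x.1 none) | rivalDev[a, H, κ, D, x] u < 0}|} ≤ ℓ / r ^ 2 := by
  classical
  have := prob_colLaw kind ℓ hb
  have hb' : (b : ℝ) ≠ 0 := by positivity
  set ν := (colLaw kind ℓ b ^⊗ (Option G)).prod (colLaw kind ℓ b ^⊗ I)
  set f : Bucket ℓ b → Round[ℓ, b, G, I] → ℝ := fun u x =>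
    ((SignType.sign (rivalDev[a, H, κ, D, x] u) : SignType) : ℝ)
    with hf
  have hsum : ∀ x : Round[ℓ, b, G, I], ∑ u, f u x =
      (#{u ∈ supp (x.1 none) | 0 < rivalDev[a, H, κ, D, x] u} : ℝ) -
          #{u ∈ supp (x.1 none) | rivalDev[a, H, κ, D, x] u < 0} := fun x => by
    have h0 : ∀ u, rivalDev[a, H, κ, D, x] u ≠ 0 → u ∈ supp (x.1 none) := fun u hu => by
      rw [mem_supp]
      intro h
      exact hu (by simp [deviation, h])
    rw [sum_sign_eq]
    congr 2
    · congr 1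
      ext u
      rw [mem_filter, mem_filter, sign_eq_one_iff]
      exact and_congr_left fun h => iff_of_true (mem_univ _) (h0 u h.ne')
    · congr 1
      ext u
      rw [mem_filter, mem_filter, sign_eq_neg_one_iff]
      exact and_congr_left fun h => iff_of_true (mem_univ _) (h0 u h.ne)
  simp_rw [← hsum]
  have h5 : ∀ (t u : Bucket ℓ b) (x : Round[ℓ, b, G, I]), rivalDev[a, H, κ, D, Prod.map (fun w o u =>
      flipSign (decide (o = none) && decide (u = t)) (w o u)) id x] u =
        if u = t then -rivalDev[a, H, κ, D, x] u else rivalDev[a, H, κ, D, x] u := fun t u x => by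
    by_cases h : u = t <;> simp [deviation, netRival, flipSign, h] <;> grind
  refine (tail_le_of_integral_sq ν _ hr).trans ?_
  have h2 := integral_sum_sq_of_flip ν f
    (Φ := fun t => Prod.map (fun w o u => flipSign (decide (o = none) && decide (u = t)) (w o u)) id)
    (fun t => (measurePreserving_pi _ _ fun o => mp_flip_col kind hb
      fun u => decide (o = none) && decide (u = t)).prod (MeasurePreserving.id _)) ?_ ?_
  · refine div_le_div_of_nonneg_right ?_ (by positivity)
    rw [h2]
    have h3 : ∀ t, ∫ x, f t x ^ 2 ∂ν ≤ 1 / b := fun t => by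
      have hmp := (measurePreserving_eval (fun _ : Option G => colLaw kind ℓ b) none).comp
        (measurePreserving_fst (μ := colLaw kind ℓ b ^⊗ (Option G)) (ν := colLaw kind ℓ b ^⊗ I))
      have h4 := hmp.real_preimage (s := {y | y t ≠ 0})
      rw [colLaw_real_ne_zero kind hb t] at h4
      rw [← h4, ← integral_indicator_one .of_discrete]
      refine integral_mono .of_finite .of_finite fun x => ?_
      by_cases h : x.1 none t = 0
      · have : f t x = 0 := by simp [hf, deviation, h]
        rw [this]
        refine le_trans (by norm_num) (Set.indicator_nonneg (fun _ _ => zero_le_one) _)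
      · rw [Set.indicator_of_mem (by exact h)]
        simp only [hf]
        generalize SignType.sign (deviation _ _ _ _ _) = s
        cases s <;> simp
    refine (sum_le_sum fun t _ => h3 t).trans ?_
    rw [sum_const, card_univ, nsmul_eq_mul, Fintype.card_prod, Fintype.card_fin, Fintype.card_fin]
    push_cast
    field_simp
    rfl
  · intro t x
    simp only [hf, h5, if_true, Left.sign_neg, SignType.coe_neg]
  · intro t u x hut
    simp only [hf, h5, if_neg hut]

lemma mem_medianZone_of {a H : ℕ} (ha : 1 ≤ a) (hH : a + 1 < H) {D : ℤ}
    {κ : Col ℓ b} {t : Bucket ℓ b} {r : ℕ} {K : ℝ} (x : Round[ℓ, b, G, I]) (ht : ∀ o, x.1 o t = 0)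
    (hr : (r : ℤ) ≤ |noiseSum x.2 t|) (hout : #{u ∈ supp κ | ∃ o, x.1 o u ≠ 0} ≤
      9 / 25 * (#(supp κ) : ℝ))
    (hbal : |(#(outliers a H κ 1 x.1) : ℝ) - #(outliers a H κ (-1) x.1)| ≤ 10 * √ℓ)
    (hsil : 0 < #(silents a H κ x)) (hsil' : (#(silents a H κ x) : ℝ) ≤ K * √ℓ)
    (hriv : |(#{u ∈ supp (x.1 none) | 0 < rivalDev[a, H, κ, D, x] u} : ℝ) -
          #{u ∈ supp (x.1 none) | rivalDev[a, H, κ, D, x] u < 0}| <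
      #(((supp (x.1 none)).filter fun u => κ u = 0 ∧ ∀ i, x.1 (some i) u = 0).filter
        fun u => noiseSum x.2 u = 0)) : x ∈ medianZone a H D κ t r K := by
  classical
  have hnet : ∀ u, (∀ o, x.1 o u = 0) → netWatched a H x.1 u = 0 := fun u hu => by
    simp [netWatched, hu]
  refine ⟨hnet t ht, hr, ?_, card_pos.1 hsil, hsil', hbal, ?_⟩
  · set f := rivalDev[a, H, κ, D, x] with hf
    set S := supp (x.1 none) with hS
    have h1 : (#((S.filter fun u => κ u = 0 ∧ ∀ i, x.1 (some i) u = 0).filter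
        fun u => noiseSum x.2 u = 0)) ≤ #{u ∈ S | f u = 0} := by
      refine card_le_card fun u hu => ?_
      rw [filter_filter, mem_filter] at hu
      refine mem_filter.2 ⟨hu.1, ?_⟩
      have : netRival a H κ x.1 u = 0 :=
        (netRival_eq_zero_iff ha hH κ x.1 u).2 ⟨hu.2.1.1, by simp [hu.2.1.2]⟩
      simp [hf, deviation, this, hu.2.2]
    have h2 : #S = #{u ∈ S | 0 < f u} + #{u ∈ S | f u < 0} + #{u ∈ S | f u = 0} := by
      have h3 := card_filter_add_card_filter_not (s := S) (fun u => 0 < f u)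
      have h4 := card_filter_add_card_filter_not (s := S.filter fun u => ¬ 0 < f u) (fun u => f u < 0)
      have h5 : (S.filter fun u => ¬ 0 < f u).filter (fun u => f u < 0) = S.filter fun u => f u < 0 := by
        rw [filter_filter]; exact filter_congr fun u _ => by omega
      have h6 : (S.filter fun u => ¬ 0 < f u).filter (fun u => ¬ f u < 0) = S.filter fun u => f u = 0 := by
        rw [filter_filter]; exact filter_congr fun u _ => by omega
      rw [h5, h6] at h4
      omega
    rw [abs_lt] at hriv
    have h7 : ((#((S.filter fun u => κ u = 0 ∧ ∀ i, x.1 (some i) u = 0).filter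
        fun u => noiseSum x.2 u = 0)) : ℝ) ≤ #{u ∈ S | f u = 0} := by
      exact_mod_cast h1
    have h8 : #{u ∈ S | 0 < f u} < #{u ∈ S | f u < 0} + #{u ∈ S | f u = 0} := by
      have : (#{u ∈ S | 0 < f u} : ℝ) <
        #{u ∈ S | f u < 0} + #{u ∈ S | f u = 0} := by linarith [hriv.2]
      exact_mod_cast this
    have h9 : #{u ∈ S | f u < 0} < #{u ∈ S | 0 < f u} + #{u ∈ S | f u = 0} := by
      have : (#{u ∈ S | f u < 0} : ℝ) <
        #{u ∈ S | 0 < f u} + #{u ∈ S | f u = 0} := by linarith [hriv.1]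
      exact_mod_cast this
    refine medianOn_eq_zero (card_pos.1 (by omega)) ?_ ?_
    · simp only [Int.cast_pos]; omega
    · have : (S.filter fun u => (f u : ℝ) < 0) = S.filter fun u => f u < 0 :=
        filter_congr fun u _ => by rw [Int.cast_lt_zero]
      rw [this]; omega
  · refine le_trans ?_ hout
    rw [← Nat.cast_add, Nat.cast_le, ← card_union_of_disjoint]
    · refine card_le_card fun u hu => ?_
      rw [outliers, outliers, ← filter_or, mem_filter] at hu
      refine mem_filter.2 ⟨hu.1, ?_⟩
      by_contra! h
      rw [hnet u h] at hu
      simp at hu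
    · rw [outliers, outliers, disjoint_filter]
      intro u _ h
      rw [h]; decide

end

section
variable {G I : Type*} [Fintype G] [Fintype I]

lemma columns_tail (hb : 1 ≤ b) (hG : 3 * ♯(Option G) ≤ b)
    (hℓ : (40000 : ℝ) ≤ ℓ) (h1 : 2 * exp (-((1 / 100 : ℝ) ^ 2 / 4 * ℓ)) ≤ 1 / 100) :
    (colLaw kind ℓ b ^⊗ (Option G)).real {w | ¬ (Admissible kind (supp (w none)) ∧
          |(#(supp (w none)) : ℝ) - ℓ| < 1 / 100 * ℓ ∧
          #{u ∈ supp (w none) | ∃ i, w (some i) u ≠ 0} ≤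
            9 / 25 * (#(supp (w none)) : ℝ))} ≤ 1 / 50 := by
  classical
  have := prob_colLaw kind ℓ hb
  have hmp := mp_option_pi (J := G) (colLaw kind ℓ b)
  have h2 := hmp.real_preimage (s := {p : Col ℓ b × (G → Col ℓ b) |
      ¬ (Admissible kind (supp p.1) ∧ |(#(supp p.1) : ℝ) - ℓ| < 1 / 100 * ℓ ∧
          #{u ∈ supp p.1 | ∃ i, p.2 i u ≠ 0} ≤ 9 / 25 * (#(supp p.1) : ℝ))})
  refine h2.le.trans ?_
  have hbad : (colLaw kind ℓ b).real ({y | ¬ Admissible kind (supp y)} ∪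
      {y | 1 / 100 * ℓ ≤ |(#(supp y) : ℝ) - ℓ|}) ≤ 1 / 100 := by
    refine (measureReal_union_le _ _).trans ?_
    have h3 : (colLaw kind ℓ b).real {y | ¬ Admissible kind (supp y)} = 0 := by
      rw [measureReal_def, ae_iff.1 (ae_admissible kind)]; rfl
    have h4 := card_supp_tail kind (ℓ := ℓ) hb (η := 1 / 100) (by norm_num) (by norm_num)
    linarith
  refine (prod_real_le _ (by norm_num : (0 : ℝ) ≤ 1 / 100) fun y hy => ?_).trans
    ((add_le_add_left hbad _).trans (by norm_num))
  simp only [Set.mem_union, Set.mem_ofPred_eq, not_or, not_not, not_le] at hy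
  have hcard : 39600 ≤ (#(supp y) : ℝ) := by grind
  have hpos : 0 < #(supp y) := by
    have : (0 : ℝ) < #(supp y) := by linarith
    exact_mod_cast this
  have h5 := outlier_tail (F := G) kind hb hy.1 (card_pos.1 hpos)
    (le_trans (by rw [Fintype.card_option]; omega) hG)
  refine (measureReal_mono (fun w hw => ?_)).trans (h5.trans ?_)
  · grind
  · rw [div_le_div_iff₀ (by linarith) (by norm_num)]
    linarith

/-- The favourable situations are likely. -/
lemma medianZone_real_ge (hb : 1 ≤ b) {a H : ℕ} (ha : 1 ≤ a) (hH : a + 1 < H)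
    (D : ℤ) {κ : Col ℓ b} {t : Bucket ℓ b} (hκ : Admissible kind (supp κ))
    (hN : |(#(supp κ) : ℝ) - ℓ| ≤ 1 / 100 * ℓ) (hG : 3 * ♯(Option G) ≤ b) (hℓ : (40000 : ℝ) ≤ ℓ)
    (h1 : 2 * exp (-((1 / 100 : ℝ) ^ 2 / 4 * ℓ)) ≤ 1 / 100)
    {s : ℕ} (hs : 1 ≤ s) (hI : ♯I = b * s) {r : ℕ} (hr : 100 * (r : ℝ) ≤ √s)
    {K : ℝ} (hp : 40 / √ℓ ≤ (signLaw b I).real {x | signSum x = 0})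
    (hp' : (signLaw b I).real {x | signSum x = 0} ≤ K / √ℓ) :
    1 / 4 ≤ ((Measure.pi fun _ => colLaw kind ℓ b).prod (Measure.pi fun _ => colLaw kind ℓ b)).real
      (medianZone (G := G) (I := I) a H D κ t r (2 * K + 3)) := by
  classical
  have := prob_colLaw kind ℓ hb
  set μW := colLaw kind ℓ b ^⊗ (Option G) with hμW
  set μZ := colLaw kind ℓ b ^⊗ I with hμZ
  set N : ℝ := (#(supp κ) : ℝ) with hNdef
  set p := (signLaw b I).real {x | signSum x = 0} with hpdef
  have hℓ0 : (0 : ℝ) < ℓ := by linarith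
  set q := √ℓ with hq
  have hq0 : 0 < q := sqrt_pos.2 hℓ0
  have hqq : q * q = ℓ := mul_self_sqrt hℓ0.le
  obtain ⟨hN1, hN2⟩ := abs_le.1 hN
  have hp1 : 40 ≤ p * q := (div_le_iff₀ hq0).1 hp
  have hp2 : p * q ≤ K := (le_div_iff₀ hq0).1 hp'
  have hp0 : 0 ≤ p := measureReal_nonneg
  -- the events that concern the columns of the heavy keys
  have hW1 : μW.real {w | ∃ o, w o t ≠ 0} ≤ 1 / 3 := by
    refine le_trans (union_bound _ univ (fun o : Option G => {w : Option G → Col ℓ b | w o t ≠ 0}) (fun w ⟨o, ho⟩ => ⟨o, mem_univ _, ho⟩)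
      (δ := 1 / b) fun o _ => ?_) ?_
    · rw [← colLaw_real_ne_zero kind hb t]
      exact ((measurePreserving_eval (fun _ : Option G => colLaw kind ℓ b) o).real_preimage
        (s := {y | y t ≠ 0})).le
    rw [card_univ]
    have hb' : (0 : ℝ) < b := mod_cast hb
    have hG' : (3 : ℝ) * ♯(Option G) ≤ b := mod_cast hG
    rw [mul_one_div, div_le_div_iff₀ hb' (by norm_num)]
    linarith
  have hNpos : 0 < #(supp κ) := by
    have : (0 : ℝ) < N := by linarith
    rw [hNdef] at this
    exact_mod_cast this
  have hW2 := outlier_tail (F := Option G) kind hb hκ (card_pos.1 hNpos) hG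
  have hW2' : 352 / N ≤ 1 / 100 := by
    rw [div_le_div_iff₀ (by linarith) (by norm_num)]
    linarith
  have hW3 := outlier_balance (G := G) kind hb a H κ (r := 10 * q) (by positivity)
  have hW3' : N / (10 * q) ^ 2 ≤ 11 / 1000 := by
    have : (10 * q) ^ 2 = 100 * ℓ := by rw [← hqq]; ring
    rw [this, div_le_div_iff₀ (by positivity) (by norm_num)]
    linarith
  have hW4 := columns_tail (G := G) kind hb hG hℓ h1
  have hZ1 := fun {A : Finset (Bucket ℓ b)} (hA : Admissible kind A) (hA1 : (#A : ℝ) ≤ 101 / 100 * ℓ) =>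
    (zeros_tail (I := I) kind hb hA (r := 3 * q) (by positivity)).trans
      (show (#A : ℝ) / (4 * (3 * q) ^ 2) ≤ 3 / 100 by
        have : 4 * (3 * q) ^ 2 = 36 * ℓ := by rw [← hqq]; ring
        rw [this, div_le_div_iff₀ (by positivity) (by norm_num)]
        linarith)
  have hZ2 : μZ.real {z | |noiseSum z t| < r} ≤ 4 / 100 := by
    refine (noise_small kind hb hs hI t r).trans ?_
    have : 0 < √s := sqrt_pos.2 (mod_cast hs)
    rw [div_le_div_iff₀ this (by norm_num)]
    linarith
  have hR := rival_balance (G := G) (I := I) kind hb a H D κ (r := 6 * q) (by positivity)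
  have hR' : (ℓ : ℝ) / (6 * q) ^ 2 ≤ 3 / 100 := by
    have : (6 * q) ^ 2 = 36 * ℓ := by rw [← hqq]; ring
    rw [this, div_le_div_iff₀ (by positivity) (by norm_num)]
    linarith
  set R : Set (Round[ℓ, b, G, I]) := {x | 6 * q ≤
    |(#{u ∈ supp (x.1 none) | 0 < rivalDev[a, H, κ, D, x] u} : ℝ) -
          #{u ∈ supp (x.1 none) | rivalDev[a, H, κ, D, x] u < 0}|} with hRdef
  set BW : Set (Option G → Col ℓ b) := (({w | ∃ o, w o t ≠ 0} ∪
    {w | 9 / 25 * N < #{u ∈ supp κ | ∃ o, w o u ≠ 0}}) ∪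
    {w | 10 * q ≤ |(#(outliers a H κ 1 w) : ℝ) - #(outliers a H κ (-1) w)|}) ∪
    {w | ¬ (Admissible kind (supp (w none)) ∧
          |(#(supp (w none)) : ℝ) - ℓ| < 1 / 100 * ℓ ∧
          #{u ∈ supp (w none) | ∃ i, w (some i) u ≠ 0} ≤ 9 / 25 * (#(supp (w none)) : ℝ))} with hBW
  have hBWle : μW.real BW ≤ 1 / 3 + 1 / 100 + 11 / 1000 + 1 / 50 := by
    refine (measureReal_union_le _ _).trans (add_le_add ((measureReal_union_le _ _).trans
      (add_le_add ((measureReal_union_le _ _).trans (add_le_add hW1 ?_)) ?_)) hW4)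
    · exact hW2.trans hW2'
    · exact hW3.trans hW3'
  set zone := medianZone (G := G) (I := I) a H D κ t r (2 * K + 3) with hzone
  have hmain : (μW.prod μZ).real {x | x ∉ zone ∧ x ∉ R} ≤
      μW.real BW + (3 / 100 + 3 / 100 + 4 / 100) := by
    refine prod_real_le BW (by norm_num) fun w hw => ?_
    simp only [hBW, Set.mem_union, Set.mem_ofPred_eq, not_or, not_not, not_lt, not_le] at hw
    obtain ⟨⟨⟨hw1, hw2⟩, hw3⟩, hw4, hw5, hw6⟩ := hw
    push Not at hw1
    obtain ⟨hy1, hy2⟩ := abs_lt.1 hw5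
    set Sj := (supp (w none)).filter fun u => κ u = 0 ∧ ∀ i, w (some i) u = 0 with hSj
    set Sh := (supp κ).filter fun u => netWatched a H w u = 0 with hSh
    have hSjA : Admissible kind Sj := hw4.mono (filter_subset _ _)
    have hShA : Admissible kind Sh := hκ.mono (filter_subset _ _)
    have hSj1 : (#Sj : ℝ) ≤ 101 / 100 * ℓ := by
      have : (#Sj : ℝ) ≤ #(supp (w none)) := mod_cast card_filter_le _ _
      linarith
    have hSh1 : (#Sh : ℝ) ≤ 101 / 100 * ℓ := by
      have : (#Sh : ℝ) ≤ N := by rw [hNdef]; exact_mod_cast card_filter_le _ _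
      linarith
    have hSj2 : 1 / 4 * (ℓ : ℝ) ≤ #Sj := by
      have h2 : #(supp (w none)) ≤ #Sj + #{u ∈ supp (w none) | ∃ i, w (some i) u ≠ 0} +
          #{u ∈ supp κ | ∃ o, w o u ≠ 0} := by
        refine (card_le_card (t := (Sj ∪ (supp (w none)).filter fun u => ∃ i, w (some i) u ≠ 0) ∪
          (supp κ).filter fun u => ∃ o, w o u ≠ 0) fun u hu => ?_).trans
          ((card_union_le _ _).trans (Nat.add_le_add_right (card_union_le _ _) _))
        simp only [mem_union, hSj, mem_filter, hu, true_and]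
        by_cases h3 : κ u = 0
        · by_cases h4 : ∀ i, w (some i) u = 0
          · exact Or.inl (Or.inl ⟨h3, h4⟩)
          · push Not at h4
            exact Or.inl (Or.inr h4)
        · exact Or.inr ⟨mem_supp.2 h3, none, mem_supp.1 hu⟩
      have h3 : (#(supp (w none)) : ℝ) ≤ #Sj + #{u ∈ supp (w none) | ∃ i, w (some i) u ≠ 0} +
          #{u ∈ supp κ | ∃ o, w o u ≠ 0} := mod_cast h2
      linarith
    have hSh2 : 1 / 4 * (ℓ : ℝ) ≤ #Sh := by
      have h2 : #(supp κ) ≤ #Sh + #{u ∈ supp κ | ∃ o, w o u ≠ 0} := by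
        refine (card_le_card (t := Sh ∪ (supp κ).filter fun u => ∃ o, w o u ≠ 0) fun u hu => ?_).trans
          (card_union_le _ _)
        simp only [mem_union, hSh, mem_filter, hu, true_and]
        by_cases h3 : ∃ o, w o u ≠ 0
        · exact Or.inr h3
        · push Not at h3
          exact Or.inl (by simp [netWatched, h3])
      have h3 : N ≤ #Sh + #{u ∈ supp κ | ∃ o, w o u ≠ 0} := by
        rw [hNdef]; exact_mod_cast h2
      linarith
    have hzero : ∀ {A : Finset (Bucket ℓ b)} {z : I → Col ℓ b}, 1 / 4 * (ℓ : ℝ) ≤ #A →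
        (#A : ℝ) ≤ 101 / 100 * ℓ →
        |(#{u ∈ A | noiseSum z u = 0} : ℝ) - #A * p| < 3 * q →
        6 * q < #{u ∈ A | noiseSum z u = 0} ∧
          (#{u ∈ A | noiseSum z u = 0} : ℝ) ≤ (2 * K + 3) * q := by
      intro A z h2 h3 h4
      obtain ⟨h5, h6⟩ := abs_lt.1 h4
      have h7 : 1 / 4 * ℓ * p ≤ #A * p := mul_le_mul_of_nonneg_right h2 hp0
      have h8 : #A * p ≤ 101 / 100 * ℓ * p := mul_le_mul_of_nonneg_right h3 hp0
      have h9 : (ℓ : ℝ) * p = q * (p * q) := by rw [← hqq]; ring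
      have h10 : q * 40 ≤ q * (p * q) := mul_le_mul_of_nonneg_left hp1 hq0.le
      have h11 : q * (p * q) ≤ q * K := mul_le_mul_of_nonneg_left hp2 hq0.le
      have h12 : 1 / 4 * ℓ * p = 1 / 4 * (ℓ * p) := by ring
      have h13 : 101 / 100 * ℓ * p = 101 / 100 * (ℓ * p) := by ring
      rw [h12, h9] at h7
      rw [h13, h9] at h8
      constructor
      · linarith
      · have h14 : (2 * K + 3) * q = 2 * (q * K) + 3 * q := by ring
        linarith
    refine (measureReal_mono (s₂ := ({z | 3 * q ≤ |(#{u ∈ Sj | noiseSum z u = 0} : ℝ) -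
        #Sj * p|} ∪ {z | 3 * q ≤ |(#{u ∈ Sh | noiseSum z u = 0} : ℝ) -
        #Sh * p|}) ∪ {z | |noiseSum z t| < r}) (fun z hz => ?_) (measure_ne_top _ _)).trans
      ((measureReal_union_le _ _).trans (add_le_add ((measureReal_union_le _ _).trans
        (add_le_add (hZ1 hSjA hSj1) (hZ1 hShA hSh1))) hZ2))
    by_contra hnot
    simp only [Set.mem_union, Set.mem_ofPred_eq, not_or, not_lt, not_le] at hnot
    obtain ⟨⟨hz1, hz2⟩, hz3⟩ := hnot
    obtain ⟨hzz, hzR⟩ : (w, z) ∉ zone ∧ (w, z) ∉ R := hz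
    have hj := hzero hSj2 hSj1 hz1
    have hh := hzero hSh2 hSh1 hz2
    have hsil : silents a H κ (w, z) = Sh.filter fun u => noiseSum z u = 0 := by
      rw [hSh, filter_filter]; rfl
    refine hzz (mem_medianZone_of ha hH (w, z) hw1 hz3 hw2 hw3.le ?_ ?_ ?_)
    · rw [hsil]
      have : (0 : ℝ) < #{u ∈ Sh | noiseSum z u = 0} := by linarith [hh.1]
      exact_mod_cast this
    · rw [hsil]
      exact hh.2
    · exact (not_le.1 hzR).trans hj.1
  have hcompl : (μW.prod μZ).real zoneᶜ = 1 - (μW.prod μZ).real zone :=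
    probReal_compl_eq_one_sub (DiscreteMeasurableSpace.forall_measurableSet _)
  have hle : (μW.prod μZ).real zoneᶜ ≤
      (μW.prod μZ).real {x | x ∉ zone ∧ x ∉ R} + (μW.prod μZ).real R := by
    refine (measureReal_mono (fun x hx => ?_)).trans (measureReal_union_le _ _)
    by_cases h : x ∈ R
    · exact Or.inr h
    · exact Or.inl ⟨hx, h⟩
  linarith [hR.trans hR']

end

section

/-- In the favourable situations, the other buckets are balanced up to `O(√ℓ)`, so that they leave
the decision to a given bucket with probability of order `1 / √ℓ`. -/
lemma exists_choose_of_zone {K : ℝ} (hK : 0 ≤ K) : ∃ (p : ℝ) (ℓ₀ : ℕ), 0 < p ∧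
    ∀ {ℓ b : ℕ} {G I : Type} [Fintype G] [Fintype I] {a H : ℕ} {D : ℤ} {κ : Col ℓ b}
      {t : Bucket ℓ b} {r : ℕ}, ℓ₀ ≤ ℓ → κ t ≠ 0 → 1 ≤ r →
      |(#(supp κ) : ℝ) - ℓ| ≤ 1 / 100 * ℓ →
      ∀ x ∈ medianZone (G := G) (I := I) a H D κ t r K,
        2 * (#(outliers a H κ 1 x.1) + 1) ≤ #(supp κ) ∧ p / √ℓ ≤ (pivots a H κ t x).card.choose
          ((#(supp κ) + 1) / 2 - 1 - #(outliers a H κ 1 x.1)) / 2 ^ #(pivots a H κ t x) := by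
  obtain ⟨c, n₀, hc, hn₀, hch⟩ := exists_choose_ge (K + 16) (by linarith)
  obtain ⟨ℓ₁, hℓ₁, hsq⟩ := exists_le_sqrt (20 * (K + 20) + 2 * n₀)
  refine ⟨c / 2, ℓ₁, by positivity, ?_⟩
  intro ℓ b G I _ _ a H D κ t r hℓ ht hr hN x hx
  have hsq := hsq ℓ hℓ
  set q := √ℓ with hq
  have hn₀' : (1 : ℝ) ≤ n₀ := mod_cast hn₀
  have hq1 : 400 ≤ q := by linarith
  have hqq : q * q = ℓ := mul_self_sqrt (Nat.cast_nonneg _)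
  have hqK : (20 * (K + 20) + 2 * n₀) * q ≤ ℓ := by
    rw [← hqq]; exact mul_le_mul_of_nonneg_right hsq (by linarith)
  obtain ⟨h1, h2, -, -, h5, h6, h7⟩ := hx
  have hZ : noiseSum x.2 t ≠ 0 := by
    intro h
    rw [h, abs_zero] at h2
    omega
  have hcard := card_supp_eq ht x h1 hZ
  set N := #(supp κ)
  set O₁ := #(outliers a H κ 1 x.1)
  set O₂ := #(outliers a H κ (-1) x.1)
  set S := #(silents a H κ x)
  set U := #(pivots a H κ t x)
  obtain ⟨hN1, hN2⟩ := abs_le.1 hN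
  obtain ⟨h61, h62⟩ := abs_le.1 h6
  have hcard' : (N : ℝ) = O₁ + O₂ + S + U + 1 := mod_cast hcard
  have hnq : (1 : ℝ) * q ≤ n₀ * q := mul_le_mul_of_nonneg_right hn₀' (by linarith)
  have hO : 2 * (O₁ + 1) ≤ N := by
    have : 2 * ((O₁ : ℝ) + 1) ≤ N := by linarith
    exact_mod_cast this
  refine ⟨hO, ?_⟩
  have hUn : n₀ ≤ U := by
    have : (n₀ : ℝ) ≤ U := by linarith
    exact_mod_cast this
  have hsU : q ≤ 2 * √U := by
    have : q / 2 ≤ √U := le_sqrt_of_sq_le (by linarith)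
    linarith
  have hsU' : √U ≤ 2 * q := by
    rw [hq]
    refine sqrt_le_iff.2 ⟨by positivity, ?_⟩
    linarith
  have hm : |(((N + 1) / 2 - 1 - O₁ : ℕ) : ℝ) - U / 2| ≤ (K + 16) * √U := by
    have hm1 : 2 * (((N + 1) / 2 - 1 - O₁ : ℕ) : ℝ) + 2 + 2 * O₁ ≤ N + 1 := by
      have : 2 * ((N + 1) / 2 - 1 - O₁) + 2 + 2 * O₁ ≤ N + 1 := by omega
      exact_mod_cast this
    have hm2 : (N : ℝ) ≤ 2 * (((N + 1) / 2 - 1 - O₁ : ℕ) : ℝ) + 2 + 2 * O₁ := by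
      have : N ≤ 2 * ((N + 1) / 2 - 1 - O₁) + 2 + 2 * O₁ := by omega
      exact_mod_cast this
    have h8 : (K / 2 + 8) * q ≤ (K / 2 + 8) * (2 * √U) :=
      mul_le_mul_of_nonneg_left hsU (by linarith)
    rw [abs_le]
    constructor <;> linarith
  refine le_trans ?_ (hch U _ hUn hm)
  have hU0 : 0 < √U := by linarith
  rw [div_div, div_le_div_iff₀ (by linarith) hU0]
  exact mul_le_mul_of_nonneg_left hsU' hc.le

/-- The number of noise keys of a query is `b` times this number. -/
def noiseRate (ℓ : ℕ) : ℕ := 2 * (ℓ / 10 ^ 10)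

/-- The watched key is more likely to be preferred to its competitor if the noise of its buckets is
positive. -/
lemma exists_medianRep_drift : ∃ (β : ℝ) (ℓ₀ : ℕ), 0 < β ∧ ∀ (kind : SketchKind) {ℓ b : ℕ}
    {G J : Type} [Fintype G] [Fintype J] {a H : ℕ} {D : ℤ} {κ : Col ℓ b} {t : Bucket ℓ b},
    ℓ₀ ≤ ℓ → 1 ≤ b → 1 ≤ a → a + 1 < H → (b * noiseRate ℓ : ℤ) < D →
    3 * ♯(Option G) ≤ b → ♯J = b * (ℓ / 10 ^ 10) →
    Admissible kind (supp κ) → |(#(supp κ) : ℝ) - ℓ| ≤ 1 / 100 * ℓ → κ t ≠ 0 →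
    β ≤ ∫ x, (if medianRep (G := G) (I := Bool × J) a H D κ x then
        (((κ t : ℤ) * noiseSum x.2 t : ℤ) : ℝ) else 0)
      ∂((Measure.pi fun _ => colLaw kind ℓ b).prod (Measure.pi fun _ => colLaw kind ℓ b)) := by
  obtain ⟨p, ℓ₁, hp, hzone⟩ := exists_choose_of_zone (K := 2 * (2 * 10 ^ 5) + 3) (by norm_num)
  obtain ⟨ℓ₂, hℓ₂, hsq⟩ := exists_le_sqrt (10 ^ 8)
  refine ⟨p / (10 ^ 5 * 1600), max ℓ₁ ℓ₂, by positivity, ?_⟩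
  intro kind ℓ b G J _ _ a H D κ t hℓ hb ha hH hD hG hJ hκ hN ht
  have hℓ1 : ℓ₁ ≤ ℓ := le_trans (le_max_left _ _) hℓ
  have hℓ2 : ℓ₂ ≤ ℓ := le_trans (le_max_right _ _) hℓ
  have hq8 := hsq ℓ hℓ2
  set q := √ℓ with hq
  have hqq : q * q = ℓ := mul_self_sqrt (Nat.cast_nonneg _)
  have hq0 : 0 < q := by linarith
  have hℓbig : (10 : ℝ) ^ 16 ≤ ℓ := by nlinarith
  set s' := ℓ / 10 ^ 10 with hs'
  have hs1 : (10 : ℝ) ^ 10 * s' ≤ ℓ := by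
    have : 10 ^ 10 * s' ≤ ℓ := Nat.mul_div_le _ _
    exact_mod_cast this
  have hs2 : (ℓ : ℝ) ≤ 10 ^ 10 * (2 * s') := by
    have h1 : ℓ < 10 ^ 10 * (s' + 1) := by
      rw [mul_comm]; exact Nat.lt_mul_of_div_lt (by omega) (by norm_num)
    have h2 : (ℓ : ℝ) < 10 ^ 10 * (s' + 1) := mod_cast h1
    linarith
  have hs'1 : 1 ≤ s' := by
    have : (0 : ℝ) < s' := by linarith
    exact_mod_cast this
  have hs'0 : (0 : ℝ) < s' := mod_cast hs'1
  have hs : noiseRate ℓ = 2 * s' := rfl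
  have hI : ♯(Bool × J) = b * (2 * s') := by
    rw [Fintype.card_prod, Fintype.card_bool, hJ]; ring
  have hsq1 : √(s' : ℝ) ≤ q / 10 ^ 5 := by
    refine sqrt_le_iff.2 ⟨by positivity, ?_⟩
    have : (q / 10 ^ 5) ^ 2 = ℓ / 10 ^ 10 := by rw [← hqq]; ring
    rw [this, le_div_iff₀ (by norm_num)]
    linarith
  have hsq2 : q / 10 ^ 5 ≤ √((2 * s' : ℕ) : ℝ) := by
    refine le_sqrt_of_sq_le ?_
    have : (q / 10 ^ 5) ^ 2 = ℓ / 10 ^ 10 := by rw [← hqq]; ring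
    rw [this, div_le_iff₀ (by norm_num)]
    push_cast
    linarith
  have hsqr0 : 0 < √((2 * s' : ℕ) : ℝ) := by positivity
  have hp1 : 40 / q ≤ (signLaw b (Bool × J)).real {x | signSum x = 0} := by
    refine le_trans ?_ (signSum_zero_ge hb hs'1 hJ)
    rw [div_le_div_iff₀ hq0 (by positivity)]
    linarith
  have hp2 : (signLaw b (Bool × J)).real {x | signSum x = 0} ≤ 2 * 10 ^ 5 / q := by
    refine (signSum_atom_le hb (by omega) hI 0).trans ?_
    rw [div_le_div_iff₀ hsqr0 hq0]
    linarith
  set r := ⌊√((2 * s' : ℕ) : ℝ) / 100⌋₊ with hr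
  have hr1 : 100 * (r : ℝ) ≤ √((2 * s' : ℕ) : ℝ) := by
    have := Nat.floor_le (a := √((2 * s' : ℕ) : ℝ) / 100) (by positivity)
    rw [← hr] at this
    linarith
  have hr2 : q / 10 ^ 5 / 200 ≤ r := by
    have h1 := Nat.lt_floor_add_one (√((2 * s' : ℕ) : ℝ) / 100)
    rw [← hr] at h1
    linarith
  have hr3 : 1 ≤ r := by
    have : (0 : ℝ) < r := by linarith
    exact_mod_cast this
  have hexp : 2 * exp (-((1 / 100 : ℝ) ^ 2 / 4 * ℓ)) ≤ 1 / 100 := by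
    have h1 : 2 * exp (-((1 / 100 : ℝ) ^ 2 / 4 * ℓ)) = 2 * (exp ((1 / 100 : ℝ) ^ 2 / 4 * ℓ))⁻¹ := by
      rw [exp_neg]
    rw [h1]
    have h2 := add_one_le_exp ((1 / 100 : ℝ) ^ 2 / 4 * ℓ)
    rw [← div_eq_mul_inv, div_le_div_iff₀ (by linarith) (by norm_num)]
    linarith
  have hge := medianZone_real_ge (G := G) (I := Bool × J) kind hb ha hH D (t := t) hκ hN hG
    (by linarith) hexp (s := 2 * s') (by omega) hI hr1 hp1 hp2
  have hD' : (♯(Bool × J) : ℤ) < D := by nlinarith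
  have hz := fun x hx => hzone (G := G) (I := Bool × J) (a := a) (H := H) (D := D) (r := r) hℓ1 ht hr3 hN x hx
  refine le_trans ?_ (medianRep_drift_of_zone kind hb ha hH hD' ht hr3 (fun x hx => (hz x hx).1)
    fun x hx => (hz x hx).2)
  calc p / (10 ^ 5 * 1600) = (q / 10 ^ 5 / 200) * (p / q) / 2 * (1 / 4) := by field_simp; norm_num
    _ ≤ r * (p / q) / 2 * _ := by gcongr

end

/-! ### Accuracy of the median estimates -/

section
variable {F : Type*} [Fintype F]

lemma mul_eq_flipSign_real {κ y : SignType} (hκ : κ ≠ 0) :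
    (κ : ℝ) * y = (flipSign (decide (κ = -1)) y : SignType) := by
  cases κ <;> cases y <;> simp [flipSign] at hκ ⊢

/-- A combination of few columns is positive in a given bucket with probability at most `1 / 3`, by
symmetry. -/
lemma signLaw_pos_le (hb : 1 ≤ b) (hF : 3 * ♯F ≤ 2 * b) (L : F → ℝ) :
    (signLaw b F).real {y | 0 < ∑ j, L j * (y j : ℝ)} ≤ 1 / 3 := by
  classical
  have hb' : (0 : ℝ) < b := mod_cast hb
  have hF' : (3 : ℝ) * ♯F ≤ 2 * b := mod_cast hF
  have hmp := measurePreserving_pi (ι := F) _ _ fun _ => mp_flipSign b true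
  have hneg : (signLaw b F).real {y | ∑ j, L j * (y j : ℝ) < 0} =
      (signLaw b F).real {y | 0 < ∑ j, L j * (y j : ℝ)} := by
    rw [← hmp.real_preimage (s := {y | 0 < ∑ j, L j * (y j : ℝ)})]
    congr 1
    ext y
    simp [flipSign]
  have hunion : (signLaw b F).real {y | ∑ j, L j * (y j : ℝ) < 0} +
      (signLaw b F).real {y | 0 < ∑ j, L j * (y j : ℝ)} ≤ 2 / 3 := by
    have hdis : Disjoint {y : F → SignType | ∑ j, L j * (y j : ℝ) < 0}
        {y | 0 < ∑ j, L j * (y j : ℝ)} := by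
      rw [Set.disjoint_left]
      intro y h1 h2
      have h1' : ∑ j, L j * (y j : ℝ) < 0 := h1
      have h2' : 0 < ∑ j, L j * (y j : ℝ) := h2
      linarith
    rw [← measureReal_union hdis MeasurableSet.of_discrete]
    refine (union_bound _ univ (fun j => {y | y j ≠ 0}) (fun y hy => ?_) (δ := 1 / b)
      fun j _ => ?_).trans ?_
    · by_contra hno
      simp only [mem_univ, Set.mem_ofPred_eq, not_exists, ne_eq, not_not, true_and] at hno
      have h0 : ∑ j, L j * (y j : ℝ) = 0 := sum_eq_zero fun j _ => by simp [hno j]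
      exact hy.elim (fun h => absurd h0 (ne_of_lt h)) fun h => absurd h0 (ne_of_gt h)
    · have h4 := (measurePreserving_eval (fun _ : F => lazyLaw b) j).real_preimage
        (s := {y | y ≠ 0})
      refine le_of_eq (h4.trans ?_)
      rw [← integral_indicator_one .of_discrete, integral_lazyLaw]
      have h5 : (-1 : SignType) ≠ 0 := by decide
      simp [Set.indicator, h5]
      field_simp; norm_num
    rw [card_univ]
    rw [mul_one_div, div_le_div_iff₀ hb' (by norm_num)]
    linarith
  linarith

lemma estimate_tail_of_col (hb : 1 ≤ b) (hF : 3 * ♯F ≤ 2 * b)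
    (L : F → ℝ) {κ : Col ℓ b} (hκ : Admissible kind (supp κ))
    (hN : |(#(supp κ) : ℝ) - ℓ| < 1 / 2 * ℓ) : (colLaw kind ℓ b ^⊗ F).real
      {w | #(supp κ) ≤ 2 * #{t ∈ supp κ | 0 < (κ t : ℝ) * ∑ j, L j * (w j t : ℝ)}} ≤ exp (-(ℓ / 44)) := by
  classical
  have := prob_colLaw kind ℓ hb
  have hmp := mp_restrict_cols hb hκ F (orient κ)
  set N := #(supp κ) with hNdef
  set g : (F → SignType) → ℝ := fun y => if 0 < ∑ j, L j * (y j : ℝ) then log (3 / 2) else 0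
    with hg
  have hlog : 0 ≤ log (3 / 2) := log_nonneg (by norm_num)
  have h1 := chernoff_pi_prod (T := supp κ) (signLaw b F) (fun _ => g) (a := N / 2 * log (3 / 2))
  have h2 := hmp.real_preimage (s := {x : supp κ → F → SignType |
    N / 2 * log (3 / 2) ≤ ∑ t, g (x t)})
  refine (measureReal_mono (fun w hw => ?_)).trans ((h2.le.trans h1).trans ?_)
  · have hw' : N ≤ 2 * #{t ∈ supp κ | 0 < (κ t : ℝ) * ∑ j, L j * (w j t : ℝ)} := hw
    change N / 2 * log (3 / 2) ≤ ∑ t : supp κ, g fun i => flipSign (orient κ t) (w i t)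
    have h3 : ∑ t : supp κ, g (fun i => flipSign (orient κ t) (w i t)) =
        #{t ∈ supp κ | 0 < (κ t : ℝ) * ∑ j, L j * (w j t : ℝ)} * log (3 / 2) := by
      rw [card_filter, Nat.cast_sum, sum_mul, ← sum_coe_sort (supp κ)]
      refine sum_congr rfl fun t _ => ?_
      have ht := mem_supp.1 t.2
      have h4 : ∑ j, L j * ((flipSign (orient κ t) (w j t) : SignType) : ℝ) =
          (κ t : ℝ) * ∑ j, L j * (w j t : ℝ) := by
        rw [mul_sum]
        refine sum_congr rfl fun j _ => ?_
        rw [orient, ← mul_eq_flipSign_real ht]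
        ring
      simp only [hg, h4]
      split_ifs <;> simp
    rw [h3]
    refine mul_le_mul_of_nonneg_right ?_ hlog
    have : (N : ℝ) ≤ 2 * #{t ∈ supp κ | 0 < (κ t : ℝ) * ∑ j, L j * (w j t : ℝ)} := mod_cast hw'
    linarith
  · have h5 : ∫ y, exp (g y) ∂(signLaw b F) ≤ 7 / 6 := by
      have h6 : ∀ y, exp (g y) = 1 + 1 / 2 * Set.indicator
          {y : F → SignType | 0 < ∑ j, L j * (y j : ℝ)} 1 y := fun y => by
        simp only [hg, Set.indicator, Set.mem_ofPred_eq]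
        split_ifs
        · rw [exp_log (by norm_num)]; norm_num
        · simp
      simp_rw [h6]
      rw [integral_add .of_finite .of_finite, integral_const_mul,
        integral_indicator_one .of_discrete]
      have := signLaw_pos_le hb hF L
      simp
      linarith
    have hN1 := (abs_lt.1 hN).1
    have h8 : log (54 / 49) = log (3 / 2) - 2 * log (7 / 6) := by
      rw [show (54 / 49 : ℝ) = 3 / 2 / (7 / 6) ^ 2 by norm_num, log_div (by norm_num)
        (by norm_num), log_pow]
      norm_num
    have h9 := one_sub_inv_le_log_of_pos (show (0 : ℝ) < 54 / 49 by norm_num)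
    rw [prod_const, card_univ, Fintype.card_coe, ← hNdef]
    calc _ ≤ exp (-(N / 2 * log (3 / 2))) * (7 / 6) ^ N := by gcongr
      _ = exp (-(N / 2 * log (3 / 2))) * exp (N * log (7 / 6)) := by
          rw [exp_nat_mul, exp_log (by norm_num)]
      _ = exp (-(N / 2 * log (54 / 49))) := by rw [← exp_add, h8]; congr 1; ring
      _ ≤ _ := by
          refine exp_le_exp.2 (neg_le_neg ?_)
          have h10 : (ℓ : ℝ) / 4 ≤ N / 2 := by linarith
          have h11 : (1 : ℝ) / 11 ≤ log (54 / 49) := le_trans (by norm_num) h9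
          calc (ℓ : ℝ) / 44 = ℓ / 4 * (1 / 11) := by ring
            _ ≤ _ := mul_le_mul h10 h11 (by norm_num) (by positivity)

lemma estimate_tail (hb : 1 ≤ b) (hF : 3 * ♯F ≤ 2 * b) (L : F → ℝ) :
    ((colLaw kind ℓ b).prod (colLaw kind ℓ b ^⊗ F)).real
      {x | #(supp x.1) ≤ 2 * #{t ∈ supp x.1 | 0 < (x.1 t : ℝ) * ∑ j, L j * (x.2 j t : ℝ)}} ≤ 3 * exp (-(ℓ / 44)) := by
  have := prob_colLaw kind ℓ hb
  refine (prod_real_le ({κ | ¬ Admissible kind (supp κ)} ∪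
    {κ | 1 / 2 * (ℓ : ℝ) ≤ |(#(supp κ) : ℝ) - ℓ|}) (exp_pos (-(ℓ / 44))).le fun κ hκ => ?_).trans ?_
  · simp only [Set.mem_union, Set.mem_ofPred_eq, not_or, not_not, not_le] at hκ
    exact estimate_tail_of_col kind hb hF L hκ.1 hκ.2
  · have h3 : (colLaw kind ℓ b).real {y | ¬ Admissible kind (supp y)} = 0 := by
      rw [measureReal_def, ae_iff.1 (ae_admissible kind)]; rfl
    have h4 := card_supp_tail kind (ℓ := ℓ) hb (η := 1 / 2) (by norm_num) (by norm_num)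
    have h5 := measureReal_union_le (μ := colLaw kind ℓ b) {κ | ¬ Admissible kind (supp κ)}
      {κ | 1 / 2 * (ℓ : ℝ) ≤ |(#(supp κ) : ℝ) - ℓ|}
    have h6 : exp (-((1 / 2) ^ 2 / 4 * (ℓ : ℝ))) ≤ exp (-(ℓ / 44)) := by bound
    linarith

/-- A sparse vector is estimated without overshoot: fewer than half of the measurements of any key
exceed its weight. -/
lemma estimate_tail_key (hb : 1 ≤ b) (L : Fin n → ℝ)
    {D : Finset (Fin n)} (hD : ∀ j ∉ D, L j = 0) (i : Fin n) (hF : 3 * #(D.erase i) ≤ 2 * b) :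
    (colLaw kind ℓ b ^⊗ (Fin n)).real
      {ω | #(supp (ω i)) ≤ 2 * #{t ∈ supp (ω i) | L i < (ω i t : ℝ) * sketch (ofCols ω) L t}} ≤ 3 * exp (-(ℓ / 44)) := by
  classical
  have he : Function.Injective (fun o : Option (D.erase i) => o.elim i fun j => (j : Fin n)) := by
    rintro (_ | j) (_ | j') h
    · rfl
    · simp only [Option.elim] at h
      exact absurd h.symm (mem_erase.1 j'.2).1
    · simp only [Option.elim] at h
      exact absurd h (mem_erase.1 j.2).1
    · simp only [Option.elim] at h
      rw [Subtype.ext h]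
  have hmp := mp_keys (kind := kind) (ℓ := ℓ) hb he
  have h1 := estimate_tail (ℓ := ℓ) (F := D.erase i) kind hb (by rwa [Fintype.card_coe])
    fun j => L j
  rw [← hmp.real_preimage] at h1
  refine le_trans (le_of_eq ?_) h1
  congr 1
  ext ω
  rw [Set.mem_preimage]
  simp only [Set.mem_ofPred_eq, Option.elim]
  have h2 : ((supp (ω i)).filter fun t => L i < (ω i t : ℝ) * sketch (ofCols ω) L t) =
      (supp (ω i)).filter fun t => 0 < (ω i t : ℝ) * ∑ j : D.erase i, L j * (ω j t : ℝ) := by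
    refine filter_congr fun t ht => ?_
    rw [mem_supp] at ht
    have hcast : ∀ y : SignType, ((y : ℤ) : ℝ) = (y : ℝ) := fun y => by cases y <;> simp
    have h3 : sketch (ofCols ω) L t = (ω i t : ℝ) * L i + ∑ j : D.erase i, L j * (ω j t : ℝ) := by
      rw [sketch, ← add_sum_erase univ _ (mem_univ i)]
      simp only [ofCols, hcast]
      congr 1
      rw [sum_coe_sort (D.erase i) fun j => L j * (ω j t : ℝ)]
      refine (sum_subset (erase_subset_erase _ (subset_univ D)) fun j hj hjD => ?_).symm.trans
        (sum_congr rfl fun j _ => mul_comm _ _)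
      have : j ∉ D := fun h => hjD (mem_erase.2 ⟨(mem_erase.1 hj).1, h⟩)
      rw [hD j this, mul_zero]
    have h4 : (ω i t : ℝ) * (ω i t : ℝ) = 1 := by
      generalize ω i t = y at ht
      cases y <;> simp at ht ⊢
    rw [h3, mul_add, ← mul_assoc, h4, one_mul, lt_add_iff_pos_right]
  rw [h2]

end

section


/-- For every key, fewer than half of the measurements of the vector `L` exceed the entry of `L`, and
fewer than half of them are smaller. -/
def Accurate (ω : Fin n → Col ℓ b) (L : Fin n → ℝ) : Prop :=
  ∀ i, 2 * #{t ∈ supp (ω i) | L i < (ω i t : ℝ) * sketch (ofCols ω) L t} <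
      #(supp (ω i)) ∧
    2 * #{t ∈ supp (ω i) | (ω i t : ℝ) * sketch (ofCols ω) L t < L i} < #(supp (ω i))

lemma not_accurate_le (hb : 1 ≤ b) (L : Fin n → ℝ) {D : Finset (Fin n)}
    (hD : ∀ j ∉ D, L j = 0) (hF : 3 * #D ≤ 2 * b) :
    (colLaw kind ℓ b ^⊗ (Fin n)).real {ω | ¬ Accurate ω L} ≤ n * (6 * exp (-(ℓ / 44))) := by
  have := prob_colLaw kind ℓ hb
  refine (union_bound _ univ (fun i : Fin n =>
      {ω | #(supp (ω i)) ≤ 2 * #{t ∈ supp (ω i) | L i < (ω i t : ℝ) * sketch (ofCols ω) L t}} ∪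
      {ω | #(supp (ω i)) ≤ 2 * #{t ∈ supp (ω i) |
        (fun j => -L j) i < (ω i t : ℝ) * sketch (ofCols ω) (fun j => -L j) t}}) (fun ω hω => ?_)
    (δ := 6 * exp (-(ℓ / 44))) fun i _ => ?_).trans_eq (by simp)
  · simp only [Accurate, Set.mem_ofPred_eq, not_forall] at hω
    obtain ⟨i, hi⟩ := hω
    refine ⟨i, mem_univ _, ?_⟩
    by_contra h
    simp only [Set.mem_union, Set.mem_ofPred_eq, not_or, not_le] at h
    refine hi ⟨h.1, ?_⟩
    have h2 := h.2
    simp only [sketch, mul_neg, sum_neg_distrib, neg_lt_neg_iff] at h2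
    exact h2
  have hF' : 3 * #(D.erase i) ≤ 2 * b :=
    (Nat.mul_le_mul_left 3 (card_le_card (erase_subset i D))).trans hF
  have h1 := estimate_tail_key (ℓ := ℓ) kind hb L hD i hF'
  have h2 := estimate_tail_key (ℓ := ℓ) kind hb (fun j => -L j) (D := D)
    (fun j hj => by simp [hD j hj]) i hF'
  refine (measureReal_union_le _ _).trans ?_
  linarith

lemma Accurate.counts {ω : Fin n → Col ℓ b} {L : Fin n → ℝ} (h : Accurate ω L)
    {c : Bucket ℓ b → ℝ} {B : ℝ} (hc : ∀ t, |c t - sketch (ofCols ω) L t| ≤ B) (i : Fin n) :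
    2 * #{t ∈ supp (ω i) | L i + B < (ω i t : ℝ) * c t} < #(supp (ω i)) ∧
    2 * #{t ∈ supp (ω i) | (ω i t : ℝ) * c t < L i - B} < #(supp (ω i)) := by
  have habs : ∀ t, |(ω i t : ℝ) * c t - (ω i t : ℝ) * sketch (ofCols ω) L t| ≤ B := fun t => by
    rw [← mul_sub, abs_mul]
    refine le_trans (mul_le_of_le_one_left (abs_nonneg _) ?_) (hc t)
    generalize ω i t = y
    cases y <;> simp
  refine ⟨lt_of_le_of_lt (Nat.mul_le_mul_left 2 (card_le_card ?_)) (h i).1,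
    lt_of_le_of_lt (Nat.mul_le_mul_left 2 (card_le_card ?_)) (h i).2⟩
  · grind
  · grind

lemma Accurate.abs_sub_le {ω : Fin n → Col ℓ b} {L : Fin n → ℝ} (h : Accurate ω L)
    {c : Bucket ℓ b → ℝ} {B : ℝ} (hc : ∀ t, |c t - sketch (ofCols ω) L t| ≤ B) (i : Fin n) :
    |medianEstimate (ofCols ω) c i - L i| ≤ B := by
  obtain ⟨h1, h2⟩ := h.counts hc i
  have hA : (supp (ω i)).Nonempty := card_pos.1 (by omega)
  rw [medianEstimate_eq, abs_sub_le_iff]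
  constructor
  · linarith [medianOn_le hA h1]
  · linarith [le_medianOn hA h2]

/-- The median of measurements of a key is determined by the truncated deviations. -/
lemma medianOn_eq_deviation {κ : Col ℓ b} {c : Bucket ℓ b → ℝ} {net Z : Bucket ℓ b → ℤ} {x : ℝ}
    {B : ℕ} (hc : ∀ t, κ t ≠ 0 → (κ t : ℝ) * c t = x + (κ t : ℝ) * (net t + 4 * Z t))
    (hZ : ∀ t, |Z t| ≤ B) (hnet : ∀ t, net t ≠ 0 → 8 * (B : ℤ) + 4 ≤ |net t|)
    (h1 : 2 * #{t ∈ supp κ | x + 4 * B < (κ t : ℝ) * c t} < #(supp κ))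
    (h2 : 2 * #{t ∈ supp κ | (κ t : ℝ) * c t < x - 4 * B} < #(supp κ)) :
    medianOn (supp κ) (fun t => (κ t : ℝ) * c t) =
      x + 4 * medianOn (supp κ) fun t => (deviation κ net Z (B + 1) t : ℝ) := by
  have hA : (supp κ).Nonempty := card_pos.1 (by omega)
  set φ : ℝ → ℝ := fun y => max (-(B + 1 : ℝ)) (min (B + 1 : ℝ) ((y - x) / 4)) with hφ
  have hmono : Monotone φ := fun y y' h => by grind
  have h3 := medianOn_eq_of_monotone hA (f := fun t => (κ t : ℝ) * c t) hmono (lo := x - 4 * B)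
    (hi := x + 4 * B) (a := x) (r := 4) (fun y hy hy' => by
      simp only [hφ]
      rw [min_eq_right (by linarith), max_eq_right (by linarith)]
      ring) h2 h1
  rw [h3.1]
  congr 2
  refine le_antisymm (medianOn_mono hA fun t ht => le_of_eq ?_) (medianOn_mono hA fun t ht => ge_of_eq ?_)
  all_goals
    rw [mem_supp] at ht
    have hZt := hZ t
    have hnt := hnet t
    simp only [hφ, hc t ht, add_sub_cancel_left, deviation]
    have hcast : ((κ t : SignType) : ℝ) = (((κ t : SignType) : ℤ) : ℝ) := by simp
    by_cases h0 : net t = 0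
    · rw [if_pos h0, h0]
      have h4 : |(κ t : ℤ) * Z t| ≤ B := by
        rw [abs_mul]
        refine le_trans (mul_le_of_le_one_left (abs_nonneg _) ?_) hZt
        generalize κ t = y; cases y <;> simp
      obtain ⟨h5, h6⟩ := abs_le.1 h4
      have h5' : (-(B : ℝ)) ≤ (κ t : ℤ) * Z t := mod_cast h5
      have h6' : (((κ t : SignType) : ℤ) : ℝ) * Z t ≤ B := mod_cast h6
      rw [← hcast] at h5' h6'
      rw [Int.cast_zero, min_eq_right (by linarith), max_eq_right (by linarith), Int.cast_mul, ← hcast]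
      ring
    · rw [if_neg h0]
      have h4 := hnt h0
      obtain ⟨h5, h6⟩ := abs_le.1 hZt
      have h5' : (-(B : ℝ)) ≤ Z t := mod_cast h5
      have h6' : (Z t : ℝ) ≤ B := mod_cast h6
      rcases lt_or_gt_of_ne h0 with hn | hn
      · rw [sign_neg hn]
        rw [abs_of_neg hn] at h4
        have h4' : 8 * (B : ℝ) + 4 ≤ -(net t : ℝ) := mod_cast h4
        generalize κ t = y at ht
        cases y
        · simp at ht
        · rw [min_eq_left (by simp; linarith), max_eq_right (by linarith [Nat.cast_nonneg (α := ℝ) B])]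
          simp
        · rw [max_eq_left (le_trans (min_le_right _ _) (by simp; linarith))]
          simp
      · rw [sign_pos hn]
        rw [abs_of_pos hn] at h4
        have h4' : 8 * (B : ℝ) + 4 ≤ (net t : ℝ) := mod_cast h4
        generalize κ t = y at ht
        cases y
        · simp at ht
        · rw [max_eq_left (le_trans (min_le_right _ _) (by simp; linarith))]
          simp
        · rw [min_eq_left (by simp; linarith), max_eq_right (by linarith [Nat.cast_nonneg (α := ℝ) B])]
          simp

/-- Whether a key is reported along with huge keys is decided by the comparison with its
competitor. -/
lemma IsTopSet.mem_iff_lt {G : Type*} [Fintype G] {f : Fin n → ℝ} {S : Finset (Fin n)}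
    (hS : IsTopSet f (♯(Option G)) S) {h j : Fin n} {huge : G → Fin n}
    (hinj : Function.Injective fun o : Option G => o.elim j huge) (hh : f h ≠ f j)
    {x : ℝ} (hx : 0 < x) (hfh : x < f h) (hfj : x < f j) (hhuge : ∀ g, f h < f (huge g))
    (hrest : ∀ i, i ≠ h → i ≠ j → (∀ g, i ≠ huge g) → |f i| ≤ x) : h ∈ S ↔ f j < f h := by
  classical
  have hh0 : |f h| = f h := abs_of_pos (hx.trans hfh)
  have hj0 : |f j| = f j := abs_of_pos (hx.trans hfj)
  constructor
  · intro hmem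
    by_contra hlt
    have hlt' : f h < f j := lt_of_le_of_ne (not_lt.1 hlt) hh
    refine hS.notMem (univ.image fun o : Option G => o.elim j huge) ?_ ?_ hmem
    · rw [card_image_of_injective _ hinj, card_univ]
    · intro i hi
      obtain ⟨o, -, rfl⟩ := mem_image.1 hi
      rcases o with _ | g
      · simp only [Option.elim]; rwa [hh0, hj0]
      · simp only [Option.elim]
        rw [hh0]
        exact (hhuge g).trans_le (le_abs_self _)
  · intro hlt
    refine hS.mem ?_ (univ.image huge) ?_ ?_
    · have := Fintype.card_le_of_injective _ hinj
      rwa [Fintype.card_fin] at this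
    · refine lt_of_le_of_lt card_image_le ?_
      rw [card_univ, Fintype.card_option]
      exact Nat.lt_succ_self _
    · intro i hi hiG
      rw [hh0]
      by_cases hij : i = j
      · rw [hij, hj0]; exact hlt
      · refine (hrest i hi hij fun g hg => hiG ?_).trans_lt hfh
        rw [hg]; exact mem_image_of_mem _ (mem_univ g)

end

/-! ### The queries of the attack on the median estimator -/

section
variable {G N : Type} [Fintype G] [Fintype N] {Q Z : ℕ}

/-- The keys of the attack besides the watched one: for each collection round a competitor, huge keys
and a block of noise keys; moreover a final block of noise keys, and keys of weight zero. -/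
abbrev MedianKey (G N : Type) (Q Z : ℕ) : Type := (Fin Q × (Option G ⊕ N)) ⊕ (N ⊕ Fin Z)

/-- The heavy part of the query of the collection round `m`. -/
def medianHeavy (a H m : ℕ) : Option (MedianKey G N Q Z) → ℝ
  | none => a
  | some (.inl (q, .inl none)) => if (q : ℕ) = m then a + 1 else 0
  | some (.inl (q, .inl (some _))) => if (q : ℕ) = m then H else 0
  | some (.inl (_, .inr _)) => 0
  | some (.inr _) => 0

/-- The noise of the query of the collection round `m`. -/
def medianNoise (m : ℕ) : Option (MedianKey G N Q Z) → ℝ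
  | some (.inl (q, .inr _)) => if (q : ℕ) = m then 4 else 0
  | _ => 0

/-- A query of the last phase: the watched key has weight `x`, and the noise of the rounds selected
by `s` is subtracted, as well as the final block of noise. -/
def medianFinal (x : ℝ) (s : Fin Q → Bool) : Option (MedianKey G N Q Z) → ℝ
  | none => x
  | some (.inl (q, .inr _)) => if s q then -1 else 0
  | some (.inr (.inl _)) => -1
  | _ => 0

/-- The queries of the attack on the median estimator: `Q` collection rounds, after which the weights
of the watched key run through the half-integers from `A₀` on. -/
def medianQuery (a H A₀ : ℕ) (e : Option (MedianKey G N Q Z) → Fin n)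
    (bits : List Bool) : Fin n → ℝ :=
  if bits.length < Q then
    embedVec e fun o => medianHeavy a H bits.length o + medianNoise bits.length o
  else embedVec e (medianFinal (A₀ + (bits.length - Q : ℕ) / 2) fun q => bits.getD q false)

/-- The columns of the keys of a collection round. -/
def roundCols (ω : Fin n → Col ℓ b) (e : Option (MedianKey G N Q Z) → Fin n) (q : Fin Q) :
    Round[ℓ, b, G, N] :=
  (fun o => ω (e (some (.inl (q, .inl o)))), fun i => ω (e (some (.inl (q, .inr i)))))

lemma coe_sign_int_real (y : SignType) : ((y : ℤ) : ℝ) = (y : ℝ) := by cases y <;> simp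

lemma sketch_medianHeavy (ω : Fin n → Col ℓ b) (e : Option (MedianKey G N Q Z) → Fin n) (a H : ℕ)
    (q : Fin Q) (t : Bucket ℓ b) : sketch (ofCols ω) (embedVec e (medianHeavy a H q)) t =
      a * (ω (e none) t : ℝ) + ((a + 1) * ((roundCols ω e q).1 none t : ℝ) +
        H * ∑ g, ((roundCols ω e q).1 (some g) t : ℝ)) := by
  classical
  rw [sketch_embedVec]
  simp only [Fintype.sum_option, Fintype.sum_sum_type, Fintype.sum_prod_type, ofCols, medianHeavy,
    roundCols, coe_sign_int_real, mul_ite, mul_zero, sum_const_zero, add_zero, Fin.val_inj,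
    sum_ite_irrel, sum_add_distrib, sum_ite_eq', mem_univ, if_true, mul_sum]
  congr 1
  · ring
  · grind

lemma sketch_medianNoise (ω : Fin n → Col ℓ b) (e : Option (MedianKey G N Q Z) → Fin n)
    (q : Fin Q) (t : Bucket ℓ b) :
    sketch (ofCols ω) (embedVec e (medianNoise q)) t = 4 * (noiseSum (roundCols ω e q).2 t : ℝ) := by
  classical
  rw [sketch_embedVec]
  simp only [Fintype.sum_option, Fintype.sum_sum_type, Fintype.sum_prod_type, ofCols, medianNoise,
    roundCols, coe_sign_int_real, mul_ite, mul_zero, sum_const_zero, add_zero, Fin.val_inj,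
    sum_ite_irrel, sum_ite_eq', mem_univ, if_true, zero_add]
  rw [noiseSum, signSum, Int.cast_sum, mul_sum]
  refine sum_congr rfl fun i _ => ?_
  rw [coe_sign_int_real, mul_comm]

lemma sketch_add_embedVec (ω : Fin n → Col ℓ b) {J : Type*} [Fintype J] (e : J → Fin n) (c d : J → ℝ)
    (t : Bucket ℓ b) : sketch (ofCols ω) (embedVec e fun o => c o + d o) t =
      sketch (ofCols ω) (embedVec e c) t + sketch (ofCols ω) (embedVec e d) t := by
  rw [sketch_embedVec, sketch_embedVec, sketch_embedVec, ← sum_add_distrib]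
  exact sum_congr rfl fun _ _ => mul_add _ _ _

lemma le_abs_of_net {p H : ℕ} (hH : 2 * p ≤ H) (y : SignType) (s : ℤ)
    (h : (p : ℤ) * y + H * s ≠ 0) : (p : ℤ) ≤ |p * (y : ℤ) + H * s| := by
  by_cases hs : s = 0
  · subst hs
    cases y <;> simp at h ⊢
  · have h1 : (H : ℤ) ≤ |H * s| := by
      rw [abs_mul, Nat.abs_cast]
      exact le_mul_of_one_le_right (by positivity) (Int.one_le_abs hs)
    have h2 : |(p : ℤ) * (y : ℤ)| ≤ p := by
      rw [abs_mul, Nat.abs_cast]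
      exact mul_le_of_le_one_right (by positivity) (by cases y <;> simp)
    have h3 := abs_sub_abs_le_abs_sub ((H : ℤ) * s) (-(p * (y : ℤ)))
    rw [abs_neg, sub_neg_eq_add, add_comm ((H : ℤ) * s)] at h3
    omega

/-- If the heavy parts are estimated accurately, the answer to a query of a collection round is
determined by the comparison of the noise of the watched key and of its competitor. -/
lemma mem_collection_iff {a H : ℕ} {M : Estimator n ℓ b}
    (hM : IsMedianEstimator (♯(Option G)) M) (ω : Fin n → Col ℓ b)
    {e : Option (MedianKey G N Q Z) → Fin n} (he : e.Injective) (q : Fin Q)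
    (ha : 8 * ♯N + 4 ≤ a) (hH : 2 * a + 2 ≤ H)
    (hacc : Accurate ω (embedVec e (medianHeavy a H q))) : e none ∈ M (ofCols ω) (sketch (ofCols ω)
        (embedVec e fun o => medianHeavy a H q o + medianNoise q o)) ↔
      medianRep a H (♯N + 1) (ω (e none)) (roundCols ω e q) = true := by
  classical
  set B := ♯N with hB
  set c := sketch (ofCols ω) (embedVec e fun o => medianHeavy a H q o + medianNoise q o) with hc
  set x := roundCols ω e q with hx
  set L := embedVec e (medianHeavy a H (q : ℕ)) with hL
  have hZ : ∀ t, |noiseSum x.2 t| ≤ B := fun t => abs_noiseSum_le _ t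
  have hcL : ∀ t, c t = sketch (ofCols ω) L t + 4 * (noiseSum x.2 t : ℝ) := fun t => by
    rw [hc, sketch_add_embedVec, sketch_medianNoise]
  have hcL' : ∀ t, |c t - sketch (ofCols ω) L t| ≤ 4 * B := fun t => by
    rw [hcL, add_sub_cancel_left, abs_mul, abs_of_pos (by norm_num : (0 : ℝ) < 4)]
    have : ((|noiseSum x.2 t| : ℤ) : ℝ) ≤ B := mod_cast hZ t
    rw [Int.cast_abs] at this
    linarith
  have hsk : ∀ t, sketch (ofCols ω) L t = a * (ω (e none) t : ℝ) + ((a + 1) * (x.1 none t : ℝ) +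
      H * ∑ g, (x.1 (some g) t : ℝ)) := sketch_medianHeavy ω e a H q
  have hsq : ∀ y : SignType, y ≠ 0 → (y : ℝ) * y = 1 := fun y hy => by cases y <;> simp at hy ⊢
  have hLh : L (e none) = a := embedVec_apply he _ none
  have hLj : L (e (some (.inl (q, .inl none)))) = a + 1 := by
    rw [hL, embedVec_apply he]; simp [medianHeavy]
  have hLg : ∀ g, L (e (some (.inl (q, .inl (some g))))) = H := fun g => by
    rw [hL, embedVec_apply he]; simp [medianHeavy]
  have hest := fun i => abs_le.1 (hacc.abs_sub_le hcL' i)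
  have hA := fun i => card_pos.1 (lt_of_le_of_lt (Nat.zero_le _) (hacc i).1)
  have hh : medianEstimate (ofCols ω) c (e none) = a + 4 * medianOn (supp (ω (e none)))
      (fun t => (deviation (ω (e none)) (netWatched a H x.1) (noiseSum x.2) (B + 1) t : ℝ)) := by
    rw [medianEstimate_eq]
    refine medianOn_eq_deviation (B := B) (fun t ht => ?_) hZ (fun t ht => ?_) ?_ ?_
    · rw [hcL, hsk, mul_add, mul_add, mul_left_comm, hsq _ ht, netWatched]
      push_cast
      ring
    · have := le_abs_of_net (p := a + 1) (H := H) (by omega) (x.1 none t) (∑ i, (x.1 (some i) t : ℤ))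
        (by have h1 := ht; rw [netWatched] at h1; push_cast; exact h1)
      rw [netWatched]
      push_cast at this
      omega
    · have := (hacc.counts hcL' (e none)).1
      rwa [hLh] at this
    · have := (hacc.counts hcL' (e none)).2
      rwa [hLh] at this
  have hj : medianEstimate (ofCols ω) c (e (some (.inl (q, .inl none)))) = (a + 1) +
      4 * medianOn (supp (x.1 none))
      (fun t => (deviation (x.1 none) (netRival a H (ω (e none)) x.1) (noiseSum x.2) (B + 1) t : ℝ)) := by
    rw [medianEstimate_eq]
    have hxj : ω (e (some (.inl (q, .inl none)))) = x.1 none := rfl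
    have hcount := hacc.counts hcL' (e (some (.inl (q, .inl none))))
    rw [hLj] at hcount
    rw [hxj] at hcount ⊢
    refine medianOn_eq_deviation (B := B) (fun t ht => ?_) hZ (fun t ht => ?_) hcount.1 hcount.2
    · rw [hcL, hsk, netRival]
      have := hsq _ ht
      push_cast
      linear_combination (a + 1 : ℝ) * this
    · have := le_abs_of_net (p := a) (H := H) (by omega) (ω (e none) t) (∑ i, (x.1 (some i) t : ℤ)) ht
      rw [netRival]
      omega
  obtain ⟨p, hp⟩ := exists_medianOn_eq (hA (e none))
    fun t => deviation (ω (e none)) (netWatched a H x.1) (noiseSum x.2) (B + 1) t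
  obtain ⟨p', hp'⟩ := exists_medianOn_eq (hA (e (some (.inl (q, .inl none)))))
    fun t => deviation (x.1 none) (netRival a H (ω (e none)) x.1) (noiseSum x.2) (B + 1) t
  have hxj : ω (e (some (.inl (q, .inl none)))) = x.1 none := rfl
  rw [hxj] at hp'
  have ha' : 8 * (B : ℝ) + 4 ≤ a := mod_cast ha
  have hH' : 2 * (a : ℝ) + 2 ≤ H := mod_cast hH
  have hcmp : ∀ i j : ℤ, (a : ℝ) + 1 + 2 * j < a + 2 * i ↔ j < i := fun i j => by
    have h1 : (a : ℝ) + 1 + 2 * j < a + 2 * i ↔ ((1 + 2 * j : ℤ) : ℝ) < ((2 * i : ℤ) : ℝ) := by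
      push_cast; constructor <;> intro h <;> linarith
    rw [h1, Int.cast_lt]; omega
  have hne : medianEstimate (ofCols ω) c (e none) ≠
      medianEstimate (ofCols ω) c (e (some (.inl (q, .inl none)))) := by
    rw [hh, hj]
    intro h
    have h1 : ((2 * p : ℤ) : ℝ) = ((2 * p' + 1 : ℤ) : ℝ) := by push_cast; linarith
    rw [Int.cast_inj] at h1
    omega
  have hinj : Function.Injective fun o : Option G => o.elim (e (some (.inl (q, .inl none))))
      fun g => e (some (.inl (q, .inl (some g)))) := by
    have h1 : (fun o : Option G => o.elim (e (some (.inl (q, .inl none))))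
      fun g => e (some (.inl (q, .inl (some g))))) = fun o => e (some (.inl (q, .inl o))) := by
      funext o; cases o <;> rfl
    rw [h1]
    intro o o' h
    simpa using he h
  have htop := (hM (ofCols ω) c).mem_iff_lt hinj hne (x := 4 * B + 1) (by positivity)
    (by have := (hest (e none)).1; rw [hLh] at this; linarith)
    (by have := (hest (e (some (.inl (q, .inl none))))).1; rw [hLj] at this; linarith)
    (fun g => by
      have h1 := (hest (e none)).2
      have h2 := (hest (e (some (.inl (q, .inl (some g)))))).1
      rw [hLh] at h1
      rw [hLg] at h2
      linarith)
    (fun i h1 h2 h3 => by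
      have h4 : L i = 0 := by
        by_cases hi : i ∈ Set.range e
        · obtain ⟨o, rfl⟩ := hi
          rw [hL, embedVec_apply he]
          rcases o with _ | ⟨q', (_ | g) | i⟩ | _
          · exact absurd rfl h1
          · by_cases hq : q' = q
            · subst hq; exact absurd rfl h2
            · simp [medianHeavy, Fin.val_inj, hq]
          · by_cases hq : q' = q
            · subst hq; exact absurd rfl (h3 g)
            · simp [medianHeavy, Fin.val_inj, hq]
          · rfl
          · rfl
        · exact embedVec_of_notMem _ hi
      have h5 := hest i
      rw [h4, sub_zero] at h5
      exact abs_le.2 ⟨by linarith, by linarith⟩)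
  rw [htop, hh, hj, medianRep, decide_eq_true_iff]
  have h1 : ((a : ℝ) + 1 + 4 * medianOn (supp (x.1 none)) fun t => ((deviation (x.1 none)
      (netRival a H (ω (e none)) x.1) (noiseSum x.2) (B + 1) t : ℤ) : ℝ)) = a + 1 + 2 * p' := by
    linarith
  have h2 : ((a : ℝ) + 4 * medianOn (supp (ω (e none))) fun t => ((deviation (ω (e none))
      (netWatched a H x.1) (noiseSum x.2) (B + 1) t : ℤ) : ℝ)) = a + 2 * p := by
    linarith
  rw [h1, h2, hcmp]
  have h3 : ((p' : ℤ) : ℝ) < p ↔ p' < p := Int.cast_lt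
  rw [← h3, ← hp, ← hp']
  constructor <;> intro h <;> linarith

/-- The measurements of a query of the last phase: `κ` is the column of the watched key, `x` its
weight, `y` are the columns of the collection rounds, and `z` those of the final noise. -/
def finalSketch (κ : Col ℓ b) (x : ℝ) (s : Fin Q → Bool)
    (y : Fin Q → Round[ℓ, b, G, N]) (z : N → Col ℓ b) (t : Bucket ℓ b) : ℝ :=
  x * (κ t : ℝ) - (((noiseSum z t + ∑ q, if s q then noiseSum (y q).2 t else 0 : ℤ)) : ℝ)

lemma sketch_medianFinal (ω : Fin n → Col ℓ b) (e : Option (MedianKey G N Q Z) → Fin n) (x : ℝ)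
    (s : Fin Q → Bool) (t : Bucket ℓ b) : sketch (ofCols ω) (embedVec e (medianFinal x s)) t =
      finalSketch (ω (e none)) x s (roundCols ω e) (fun i => ω (e (some (.inr (.inl i))))) t := by
  classical
  rw [sketch_embedVec]
  simp only [Fintype.sum_option, Fintype.sum_sum_type, Fintype.sum_prod_type, ofCols, medianFinal,
    roundCols, coe_sign_int_real, mul_zero, sum_const_zero, add_zero,
    zero_add, finalSketch, noiseSum, signSum]
  push_cast
  have h1 : ∑ i, (ω (e (some (.inr (.inl i)))) t : ℝ) * -1 =
      -∑ i, (ω (e (some (.inr (.inl i)))) t : ℝ) := by simp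
  have h2 : ∑ q, ∑ i, (ω (e (some (.inl (q, .inr i)))) t : ℝ) * (if s q = true then (-1 : ℝ) else 0) =
      -∑ q, if s q = true then ∑ i, (ω (e (some (.inl (q, .inr i)))) t : ℝ) else 0 := by
    rw [← sum_neg_distrib]
    refine sum_congr rfl fun q _ => ?_
    split_ifs <;> simp
  rw [h1, h2]
  ring

/-- If the weight of the watched key is the median of the oriented noise, its estimate vanishes, so
that it is reported only if almost all keys of weight zero have a vanishing estimate as well. -/
lemma card_lt_of_mem_final {k' : ℕ} {M : Estimator n ℓ b} (hM : IsMedianEstimator k' M)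
    (ω : Fin n → Col ℓ b) {e : Option (MedianKey G N Q Z) → Fin n} (he : e.Injective) {x : ℝ}
    (s : Fin Q → Bool) {c : Bucket ℓ b → ℝ} (hc : c = finalSketch (ω (e none)) x s (roundCols ω e)
      (fun i => ω (e (some (.inr (.inl i)))))) (hA : (supp (ω (e none))).Nonempty)
    (hx : x = medianOn (supp (ω (e none))) fun t => (((ω (e none) t : ℤ) *
      (noiseSum (fun i => ω (e (some (.inr (.inl i))))) t +
        ∑ q, if s q then noiseSum (roundCols ω e q).2 t else 0) : ℤ) : ℝ))
    (hmem : e none ∈ M (ofCols ω) (sketch (ofCols ω) (embedVec e (medianFinal x s)))) :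
    #{ζ : Fin Z | medianOn (supp (ω (e (some (.inr (.inr ζ))))))
      (fun t => (ω (e (some (.inr (.inr ζ)))) t : ℝ) * c t) ≠ 0} < k' := by
  classical
  by_contra hlt
  have hsk : sketch (ofCols ω) (embedVec e (medianFinal x s)) = c := by
    rw [hc]; funext t; exact sketch_medianFinal ω e x s t
  rw [hsk] at hmem
  have h0 : medianEstimate (ofCols ω) c (e none) = 0 := by
    rw [medianEstimate_eq]
    set W : Bucket ℓ b → ℤ := fun t => (ω (e none) t : ℤ) *
      (noiseSum (fun i => ω (e (some (.inr (.inl i))))) t +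
        ∑ q, if s q then noiseSum (roundCols ω e q).2 t else 0) with hW
    have h1 : medianOn (supp (ω (e none))) (fun t => (ω (e none) t : ℝ) * c t) =
        medianOn (supp (ω (e none))) fun t => x - (W t : ℝ) := by
      refine le_antisymm (medianOn_mono hA fun t ht => le_of_eq ?_)
        (medianOn_mono hA fun t ht => ge_of_eq ?_)
      all_goals
        rw [mem_supp] at ht
        have h2 : (ω (e none) t : ℝ) * (ω (e none) t : ℝ) = 1 := by
          generalize ω (e none) t = y at ht
          cases y <;> simp at ht ⊢
        rw [hc, finalSketch, hW]
        push_cast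
        linear_combination x * h2
    rw [h1, medianOn_const_sub hA, ← hx, sub_self]
  refine (hM (ofCols ω) c).notMem ((univ.filter fun ζ : Fin Z =>
    medianOn (supp (ω (e (some (.inr (.inr ζ))))))
      (fun t => (ω (e (some (.inr (.inr ζ)))) t : ℝ) * c t) ≠ 0).image
        fun ζ => e (some (.inr (.inr ζ)))) ?_ ?_ hmem
  · rw [card_image_of_injective _ fun ζ ζ' h => by simpa using he h]
    exact not_lt.1 hlt
  · intro j hj
    obtain ⟨ζ, hζ, rfl⟩ := mem_image.1 hj
    rw [h0, abs_zero, medianEstimate_eq]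
    exact abs_pos.2 (mem_filter.1 hζ).2

end

/-! ### The noise collected by the attack on the median estimator -/

section

/-- The noise collected in the buckets of the watched key, signed by its column. -/
def medianCollected {G N : Type} [Fintype N] {Q : ℕ} (rep : Round[ℓ, b, G, N] → Bool) (κ : Col ℓ b)
    (x : Fin Q → Round[ℓ, b, G, N]) : supp κ → ℤ :=
  collected rep (fun x t => (κ t : ℤ) * noiseSum x.2 t) x

lemma mul_noiseSum_eq {N : Type*} [Fintype N] (κ : Col ℓ b) (z : N → Col ℓ b)
    {t : Bucket ℓ b} (ht : κ t ≠ 0) :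
    (κ t : ℤ) * noiseSum z t = signSum fun i => flipSign (orient κ t) (z i t) := by
  rw [noiseSum, signSum, signSum, mul_sum]
  exact sum_congr rfl fun i _ => mul_eq_flipSign ht

lemma integral_exp_noise_le {s : ℕ} {N : Type*} [Fintype N] (hb : 1 ≤ b)
    (hN : ♯N = b * s) {κ : Col ℓ b} (hκ : Admissible kind (supp κ))
    (S : Finset (supp κ)) {r : ℝ} (hr : |r| ≤ 1) :
    ∫ z, exp (r * ∑ t ∈ S, (((κ t : ℤ) * noiseSum z t : ℤ) : ℝ))
        ∂(colLaw kind ℓ b ^⊗ N) ≤ exp ((#S * s : ℕ) * r ^ 2) := by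
  have hmp := mp_restrict_cols hb hκ N (orient κ)
  have h1 := integral_comp_mp hmp fun x : supp κ → N → SignType =>
    exp (r * ∑ t ∈ S, (signSum (x t) : ℝ))
  have h2 := integral_exp_sum_signSum_le (T := supp κ) hb hN S hr
  refine le_trans (le_of_eq ?_) (h1.le.trans h2)
  refine integral_congr_ae (.of_forall fun z => ?_)
  simp only
  congr 2
  exact sum_congr rfl fun t _ => by rw [mul_noiseSum_eq κ z (mem_supp.1 t.2)]

lemma exists_median_collection : ∃ (β : ℝ) (ℓ₀ : ℕ), 0 < β ∧ β ≤ 1 ∧ ∀ (kind : SketchKind) {ℓ b : ℕ}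
    {G J : Type} [Fintype G] [Fintype J] {a H Q : ℕ} {D : ℤ} {κ : Col ℓ b},
    ℓ₀ ≤ ℓ → 1 ≤ b → 1 ≤ a → a + 1 < H → (b * noiseRate ℓ : ℤ) < D →
    3 * ♯(Option G) ≤ b → ♯J = b * (ℓ / 10 ^ 10) →
    Admissible kind (supp κ) → |(#(supp κ) : ℝ) - ℓ| ≤ 1 / 100 * ℓ → 12800 * ℓ ≤ Q * β ^ 2 →
    (Measure.pi fun _ : Fin Q => (colLaw kind ℓ b ^⊗ (Option G)).prod
        (colLaw kind ℓ b ^⊗ (Bool × J))).real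
      {x | NoiseFails β ℓ Q (medianCollected (medianRep a H D κ) κ x)} ≤ 2 * exp (-ℓ) := by
  obtain ⟨β, ℓ₁, hβ, hdrift⟩ := exists_medianRep_drift
  refine ⟨min β 1, max ℓ₁ (10 ^ 10), lt_min hβ one_pos, min_le_right _ _, ?_⟩
  intro kind ℓ b G J _ _ a H Q D κ hℓ hb ha hH hD hG hJ hκ hN hQ
  have := prob_colLaw kind ℓ hb
  have hℓ1 : ℓ₁ ≤ ℓ := (le_max_left _ _).trans hℓ
  have hℓ2 : 10 ^ 10 ≤ ℓ := (le_max_right _ _).trans hℓ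
  have hs1 : 1 ≤ noiseRate ℓ := by unfold noiseRate; omega
  have hs2 : noiseRate ℓ ≤ ℓ := by unfold noiseRate; omega
  have hT : ♯(supp κ) ≤ 2 * ℓ := by
    rw [Fintype.card_coe]
    have h1 := (abs_le.1 hN).2
    have : (#(supp κ) : ℝ) ≤ 2 * ℓ := by linarith
    exact_mod_cast this
  have hI : ♯(Bool × J) = b * noiseRate ℓ := by
    rw [Fintype.card_prod, Fintype.card_bool, hJ, noiseRate]; ring
  refine collected_tail _ (by omega) hs1 hs2 hT (lt_min hβ one_pos) (min_le_right _ _)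
    hQ (medianRep a H D κ) (fun x t => (κ t : ℤ) * noiseSum x.2 t)
    (fun t => (min_le_left _ _).trans (hdrift kind hℓ1 hb ha hH hD hG hJ hκ hN
      (mem_supp.1 t.2))) fun S r hr => ?_
  refine le_trans (le_of_eq ?_) (integral_exp_noise_le (N := Bool × J) kind hb hI hκ S hr)
  exact integral_comp_mp (measurePreserving_snd (μ := colLaw kind ℓ b ^⊗ (Option G))
      (ν := colLaw kind ℓ b ^⊗ (Bool × J)))
    fun z => exp (r * ∑ t ∈ S, (((κ t : ℤ) * noiseSum z t : ℤ) : ℝ))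

/-- Uniform bound for the noise in the buckets of the watched key. -/
lemma noise_large_le {s : ℕ} {N : Type*} [Fintype N] (hb : 1 ≤ b)
    (hN : ♯N = b * s) (hs : s ≤ ℓ) {κ : Col ℓ b} (hκ : Admissible kind (supp κ)) :
    (colLaw kind ℓ b ^⊗ N).real
      {z | ∃ t ∈ supp κ, (ℓ : ℝ) ≤ |(((κ t : ℤ) * noiseSum z t : ℤ) : ℝ)|} ≤
      #(supp κ) * (2 * exp (-(ℓ / 4))) := by
  classical
  have := prob_colLaw kind ℓ hb
  set μ := colLaw kind ℓ b ^⊗ N with hμ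
  refine union_bound _ (supp κ) (fun t => {z | (ℓ : ℝ) ≤ |(((κ t : ℤ) * noiseSum z t : ℤ) : ℝ)|})
    (fun z hz => hz) fun t ht => ?_
  lift t to supp κ using ht
  have key : ∀ r : ℝ, |r| = 1 / 2 → ∫ z, exp (r * (((κ t : ℤ) * noiseSum z t : ℤ) : ℝ)) ∂μ ≤
      exp (ℓ / 4) := by
    intro r hr
    have h2 := integral_exp_noise_le kind hb hN hκ {t} (r := r) (by rw [hr]; norm_num)
    simp only [sum_singleton, card_singleton, one_mul] at h2
    refine h2.trans (exp_le_exp.2 ?_)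
    rw [← sq_abs, hr]
    have : (s : ℝ) ≤ ℓ := mod_cast hs
    linarith
  refine (measureReal_le_integral μ (f := fun z => exp (-(ℓ / 2 : ℝ)) *
    (exp (1 / 2 * (((κ t : ℤ) * noiseSum z t : ℤ) : ℝ)) +
      exp (-(1 / 2) * (((κ t : ℤ) * noiseSum z t : ℤ) : ℝ)))) (fun z => by positivity)
      fun z hz => ?_).trans ?_
  · have hz' : (ℓ : ℝ) ≤ |(((κ t : ℤ) * noiseSum z t : ℤ) : ℝ)| := hz
    rw [mul_add, ← exp_add, ← exp_add]
    rcases le_abs.1 hz' with h | h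
    · refine le_trans (one_le_exp ?_) (le_add_of_nonneg_right (exp_pos _).le)
      linarith
    · refine le_trans (one_le_exp ?_) (le_add_of_nonneg_left (exp_pos _).le)
      linarith
  · rw [integral_const_mul, integral_add .of_finite .of_finite]
    have h3 := key (1 / 2) (abs_of_pos (by norm_num))
    have h4 := key (-(1 / 2)) (by rw [abs_neg]; exact abs_of_pos (by norm_num))
    calc _ ≤ exp (-(ℓ / 2 : ℝ)) * (exp (ℓ / 4) + exp (ℓ / 4)) := by gcongr
      _ = _ := by
        rw [← two_mul, mul_left_comm, ← exp_add]
        congr 2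
        ring

end

/-! ### Keys of weight zero -/

section

/-- In the buckets of a given column, the noise rarely assumes prescribed values. -/
lemma prescribed_noise_tail {s : ℕ} {N : Type*} [Fintype N] (hb : 1 ≤ b)
    (hs : 1 ≤ s) (hN : ♯N = b * s) (hsℓ : (ℓ : ℝ) ≤ 10 ^ 10 * s) (hℓ : 1 ≤ ℓ)
    {κ : Col ℓ b} (hκ : Admissible kind (supp κ)) (hcard : (#(supp κ) : ℝ) ≤ 2 * ℓ)
    (d : Bucket ℓ b → ℝ) : (colLaw kind ℓ b ^⊗ N).real
      {z | 10 ^ 6 * √ℓ ≤ #{t ∈ supp κ | (noiseSum z t : ℝ) = d t}} ≤ exp (-√ℓ) := by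
  classical
  have := prob_colLaw kind ℓ hb
  have hℓ0 : (0 : ℝ) < ℓ := mod_cast hℓ
  set q := √ℓ with hq
  have hq0 : 0 < q := sqrt_pos.2 hℓ0
  have hqq : q * q = ℓ := mul_self_sqrt hℓ0.le
  have hmp := mp_restrict_cols hb hκ N fun _ => false
  set g : supp κ → (N → SignType) → ℝ := fun t y => if (signSum y : ℝ) = d t then 1 else 0
    with hg
  have h1 := chernoff_pi_prod (T := supp κ) (signLaw b N) g (a := 10 ^ 6 * q)
  have h2 := hmp.real_preimage (s := {x : supp κ → N → SignType | 10 ^ 6 * q ≤ ∑ t, g t (x t)})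
  refine (measureReal_mono (fun z hz => ?_)).trans ((h2.le.trans h1).trans ?_)
  · have hz' : 10 ^ 6 * q ≤ #{t ∈ supp κ | (noiseSum z t : ℝ) = d t} := hz
    refine hz'.trans (le_of_eq ?_)
    rw [card_filter, Nat.cast_sum, ← sum_coe_sort (supp κ)]
    refine sum_congr rfl fun t _ => ?_
    simp only [hg, flipSign]
    push_cast
    rfl
  · have hs' : q / 10 ^ 5 ≤ √s := by
      refine le_sqrt_of_sq_le ?_
      have : (q / 10 ^ 5) ^ 2 = ℓ / 10 ^ 10 := by rw [← hqq]; ring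
      rw [this, div_le_iff₀ (by norm_num)]
      linarith
    have hs0 : 0 < √s := sqrt_pos.2 (mod_cast hs)
    have h5 : ∀ t, ∫ y, exp (g t y) ∂(signLaw b N) ≤ exp (4 * 10 ^ 5 / q) := fun t => by
      have h6 : ∀ y, exp (g t y) = 1 + (exp 1 - 1) * Set.indicator
          {y : N → SignType | (signSum y : ℝ) = d t} 1 y := fun y => by
        simp only [hg, Set.indicator, Set.mem_ofPred_eq]
        split_ifs <;> simp
      simp_rw [h6]
      rw [integral_add .of_finite .of_finite, integral_const_mul,
        integral_indicator_one .of_discrete]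
      have h7 : (signLaw b N).real {y | (signSum y : ℝ) = d t} ≤ 2 / √s := by
        by_cases h : ∃ j : ℤ, (j : ℝ) = d t
        · obtain ⟨j, hj⟩ := h
          rw [← hj]
          simp only [Int.cast_inj]
          exact signSum_atom_le hb hs hN j
        · have : {y : N → SignType | (signSum y : ℝ) = d t} = ∅ :=
            Set.eq_empty_of_forall_notMem fun y hy => h ⟨_, hy⟩
          rw [this, measureReal_empty]
          positivity
      have h8 : 2 / √s ≤ 2 * 10 ^ 5 / q := by
        rw [div_le_div_iff₀ hs0 hq0]
        linarith
      have h9 := add_one_le_exp (4 * 10 ^ 5 / q)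
      have h10 : exp 1 - 1 ≤ 2 := by linarith [exp_one_lt_d9]
      have h12 : (exp 1 - 1) * (signLaw b N).real {y | (signSum y : ℝ) = d t} ≤
          2 * (2 * 10 ^ 5 / q) := mul_le_mul h10 (h7.trans h8) measureReal_nonneg (by norm_num)
      have h13 : 2 * (2 * 10 ^ 5 / q) = 4 * 10 ^ 5 / q := by ring
      simp
      linarith
    calc _ ≤ exp (-(10 ^ 6 * q)) * ∏ _t : supp κ, exp (4 * 10 ^ 5 / q) := by
          refine mul_le_mul_of_nonneg_left (prod_le_prod (fun t _ => integral_nonneg fun y => ?_)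
            fun t _ => h5 t) (exp_pos _).le
          exact (exp_pos _).le
      _ = exp (-(10 ^ 6 * q) + #(supp κ) * (4 * 10 ^ 5 / q)) := by
          rw [prod_const, card_univ, Fintype.card_coe, ← exp_nat_mul, ← exp_add]
      _ ≤ _ := by
          refine exp_le_exp.2 ?_
          have h14 : #(supp κ) * (4 * 10 ^ 5 / q) ≤ 2 * ℓ * (4 * 10 ^ 5 / q) := by gcongr
          have h15 : 2 * ℓ * (4 * 10 ^ 5 / q) = 8 * 10 ^ 5 * q := by
            rw [← hqq]; field_simp; norm_num
          linarith

/-- The columns that are typical, and meet only `O(√ℓ)` zeros of the sketch `c`. -/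
def typicalCols (c : Bucket ℓ b → ℝ) : Set (Col ℓ b) :=
  {κ | Admissible kind (supp κ) ∧ |(#(supp κ) : ℝ) - ℓ| < 1 / 100 * ℓ ∧
    #{t ∈ supp κ | c t = 0} < 10 ^ 6 * √ℓ}

lemma typicalCols_tail {s : ℕ} {N : Type*} [Fintype N] (hb : 1 ≤ b)
    (hs : 1 ≤ s) (hN : ♯N = b * s) (hsℓ : (ℓ : ℝ) ≤ 10 ^ 10 * s) (hℓ : 1 ≤ ℓ)
    (h1 : 2 * exp (-((1 / 100 : ℝ) ^ 2 / 4 * ℓ)) ≤ 1 / 100) (d : Bucket ℓ b → ℝ) :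
    (colLaw kind ℓ b ^⊗ N).real
      {z | (colLaw kind ℓ b).real (typicalCols kind fun t => d t - noiseSum z t) < 1 / 2} ≤
      4 * exp (-√ℓ) := by
  classical
  have := prob_colLaw kind ℓ hb
  set μ := colLaw kind ℓ b ^⊗ N with hμ
  set E : Set (Col ℓ b × (N → Col ℓ b)) := {p | (Admissible kind (supp p.1) ∧
    |(#(supp p.1) : ℝ) - ℓ| < 1 / 100 * ℓ) ∧
    10 ^ 6 * √ℓ ≤ #{t ∈ supp p.1 | (noiseSum p.2 t : ℝ) = d t}} with hE
  have hfin : Finite (N → Col ℓ b) := inferInstance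
  have hdis : DiscreteMeasurableSpace (N → Col ℓ b) := inferInstance
  have hEle : ((colLaw kind ℓ b).prod μ).real E ≤ exp (-√ℓ) := by
    have h2 := prod_real_le (μ := colLaw kind ℓ b) (ν := μ) (E := E) ∅
      (exp_pos (-√ℓ)).le fun κ _ => ?_
    · simpa using h2
    · by_cases hκ : Admissible kind (supp κ) ∧ |(#(supp κ) : ℝ) - ℓ| < 1 / 100 * ℓ
      · refine (measureReal_mono (fun z hz => hz.2)).trans
          (prescribed_noise_tail (N := N) kind hb hs hN hsℓ hℓ hκ.1 ?_ d)
        have := (abs_lt.1 hκ.2).2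
        linarith
      · have : {y | (κ, y) ∈ E} = ∅ := Set.eq_empty_of_forall_notMem fun z hz => hκ hz.1
        rw [this, measureReal_empty]
        positivity
  have hint : ((colLaw kind ℓ b).prod μ).real E = ∫ z, (colLaw kind ℓ b).real {κ | (κ, z) ∈ E} ∂μ := by
    have hdisp : MeasurableSet E := (Set.to_countable E).measurableSet
    rw [measureReal_def, Measure.prod_apply_symm hdisp, ← integral_toReal
      Measurable.of_discrete.aemeasurable (Filter.Eventually.of_forall fun _ => measure_lt_top _ _)]
    rfl
  have hbad : (colLaw kind ℓ b).real ({y | ¬ Admissible kind (supp y)} ∪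
      {y | 1 / 100 * ℓ ≤ |(#(supp y) : ℝ) - ℓ|}) ≤ 1 / 4 := by
    refine (measureReal_union_le _ _).trans ?_
    have h3 : (colLaw kind ℓ b).real {y | ¬ Admissible kind (supp y)} = 0 := by
      rw [measureReal_def, ae_iff.1 (ae_admissible kind)]; rfl
    have h4 := card_supp_tail kind (ℓ := ℓ) hb (η := 1 / 100) (by norm_num) (by norm_num)
    linarith
  refine (measureReal_le_integral μ (f := fun z => 4 * (colLaw kind ℓ b).real {κ | (κ, z) ∈ E})
    (fun z => by positivity) fun z hz => ?_).trans ?_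
  · have hz' : (colLaw kind ℓ b).real (typicalCols kind fun t => d t - noiseSum z t) < 1 / 2 := hz
    have h5 : (Set.univ : Set (Col ℓ b)) ⊆ (typicalCols kind fun t => d t - noiseSum z t) ∪
        (({y | ¬ Admissible kind (supp y)} ∪
          {y | 1 / 100 * ℓ ≤ |(#(supp y) : ℝ) - ℓ|}) ∪ {κ | (κ, z) ∈ E}) := by
      intro κ _
      by_contra hno
      simp only [Set.mem_union, not_or, Set.mem_ofPred_eq, not_not, not_le, typicalCols, not_and,
        not_lt] at hno
      obtain ⟨h6, ⟨h7, h8⟩, h9⟩ := hno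
      refine h9 ⟨⟨h7, h8⟩, ?_⟩
      have h10 := h6 h7 h8
      have h11 : ((supp κ).filter fun t => d t - (noiseSum z t : ℝ) = 0) =
          (supp κ).filter fun t => (noiseSum z t : ℝ) = d t :=
        filter_congr fun t _ => by rw [sub_eq_zero, eq_comm]
      rwa [h11] at h10
    have h12 := measureReal_mono (μ := colLaw kind ℓ b) h5 (measure_ne_top _ _)
    rw [probReal_univ] at h12
    have h13 := h12.trans ((measureReal_union_le _ _).trans
      (add_le_add le_rfl (measureReal_union_le _ _)))
    linarith
  · rw [integral_const_mul, ← hint]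
    linarith

end

section

/-- The median of a key of weight zero does not vanish with probability of order at least
`1 / √ℓ`. -/
lemma exists_medianOn_ne_zero : ∃ (p : ℝ) (ℓ₀ : ℕ), 0 < p ∧ ∀ (kind : SketchKind) {ℓ b : ℕ}
    (c : Bucket ℓ b → ℝ), ℓ₀ ≤ ℓ → 1 ≤ b → 1 / 2 ≤ (colLaw kind ℓ b).real (typicalCols kind c) →
    p / √ℓ ≤ (colLaw kind ℓ b).real {κ | medianOn (supp κ) (fun t => (κ t : ℝ) * c t) ≠ 0} := by
  classical
  obtain ⟨p, n₀, hp, hn₀, hch⟩ := exists_choose_ge (2 * 10 ^ 6) (by norm_num)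
  obtain ⟨ℓ₁, hℓ₁, hsq⟩ := exists_le_sqrt (10 ^ 7 + 4 * n₀)
  refine ⟨p / 4, ℓ₁, by positivity, ?_⟩
  intro kind ℓ b c hℓ hb hgood
  have := prob_colLaw kind ℓ hb
  have hsq := hsq ℓ hℓ
  set q := √ℓ with hq
  have hn₀' : (1 : ℝ) ≤ n₀ := mod_cast hn₀
  have hq1 : 10 ^ 7 ≤ q := by linarith
  have hqq : q * q = ℓ := mul_self_sqrt (Nat.cast_nonneg _)
  have hqℓ : (10 ^ 7 + 4 * n₀) * q ≤ ℓ := by nlinarith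
  have hnq : (n₀ : ℝ) * 1 ≤ n₀ * q := mul_le_mul_of_nonneg_left (by linarith) (by linarith)
  have hsupp : ∀ (σ : Bucket ℓ b → Bool) (κ : Col ℓ b),
      supp (fun t => flipSign (σ t) (κ t)) = supp κ := fun σ κ => by
    ext t
    rw [mem_supp, mem_supp]
    unfold flipSign
    split_ifs <;> simp
  set U : Col ℓ b → Finset (Bucket ℓ b) := fun κ => (supp κ).filter fun t => c t ≠ 0 with hU
  set m : Col ℓ b → ℕ := fun κ => #(supp κ) / 2 + 1 with hm
  have hchoose : ∀ κ ∈ typicalCols kind c, p / (2 * q) ≤ (U κ).card.choose (m κ) / 2 ^ #(U κ) := by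
    rintro κ ⟨-, h2, h3⟩
    obtain ⟨h21, h22⟩ := abs_lt.1 h2
    have h4 := card_filter_add_card_filter_not (s := supp κ) (fun t => c t = 0)
    have h5 : (#{t ∈ supp κ | c t = 0} : ℝ) + #(U κ) = #(supp κ) := mod_cast h4
    have hUn : n₀ ≤ #(U κ) := by
      have : (n₀ : ℝ) ≤ #(U κ) := by linarith
      exact_mod_cast this
    have hsU : q ≤ 2 * √(#(U κ) : ℝ) := by
      have : q / 2 ≤ √(#(U κ) : ℝ) := le_sqrt_of_sq_le (by linarith)
      linarith
    have hsU' : √(#(U κ) : ℝ) ≤ 2 * q := by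
      rw [hq]
      refine sqrt_le_iff.2 ⟨by positivity, ?_⟩
      rw [mul_pow, sq_sqrt (Nat.cast_nonneg _)]
      linarith
    have hmU : |(m κ : ℝ) - #(U κ) / 2| ≤ 2 * 10 ^ 6 * √(#(U κ) : ℝ) := by
      have hm1 : 2 * (m κ : ℝ) ≤ #(supp κ) + 2 := by
        have : 2 * m κ ≤ #(supp κ) + 2 := by simp only [hm]; omega
        exact_mod_cast this
      have hm2 : (#(supp κ) : ℝ) ≤ 2 * (m κ : ℝ) := by
        have : #(supp κ) ≤ 2 * m κ := by simp only [hm]; omega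
        exact_mod_cast this
      rw [abs_le]
      constructor <;> linarith
    refine le_trans ?_ (hch _ _ hUn hmU)
    have hU0 : 0 < √(#(U κ) : ℝ) := by linarith
    rw [div_le_div_iff₀ (by linarith) hU0]
    exact mul_le_mul_of_nonneg_left hsU' hp.le
  have hmain := measureReal_pos_count_ge (ν := colLaw kind ℓ b)
    (Z := fun κ t => (κ t : ℤ) * (SignType.sign (c t) : ℤ))
    (Φ := fun σ (κ : Col ℓ b) t => flipSign (σ t) (κ t)) (fun σ => mp_flip_col kind hb σ)
    (fun σ κ t => by unfold flipSign; split_ifs <;> simp)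
    (G := typicalCols kind c) (fun σ κ hκ => by
      simpa only [typicalCols, Set.mem_ofPred_eq, hsupp] using hκ)
    (U := U) (m := m) (fun σ κ => by simp only [hU, hsupp]) (fun σ κ => by simp only [hm, hsupp])
    (fun κ _ u hu => by
      have h1 := mem_filter.1 hu
      have h2 := mem_supp.1 h1.1
      have h3 : SignType.sign (c u) ≠ 0 := sign_ne_zero.2 h1.2
      refine mul_ne_zero ?_ ?_
      · generalize κ u = y at h2; cases y <;> simp at h2 ⊢
      · generalize SignType.sign (c u) = y at h3; cases y <;> simp at h3 ⊢) hchoose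
  have h0 : 0 ≤ p / (2 * q) := by positivity
  calc p / 4 / q = p / (2 * q) * (1 / 2) := by field_simp; norm_num
    _ ≤ p / (2 * q) * (colLaw kind ℓ b).real (typicalCols kind c) := mul_le_mul_of_nonneg_left hgood h0
    _ ≤ _ := hmain
    _ ≤ _ := measureReal_mono (fun κ hκ => ?_) (measure_ne_top _ _)
  have h1 : #((U κ).filter fun u => 0 < (κ u : ℤ) * (SignType.sign (c u) : ℤ)) = m κ := hκ.2
  refine (medianOn_pos ?_).ne'
  have h2 : m κ ≤ #{t ∈ supp κ | 0 < (κ t : ℝ) * c t} := by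
    rw [← h1]
    refine card_le_card fun u hu => ?_
    obtain ⟨h3, h4⟩ := mem_filter.1 hu
    refine mem_filter.2 ⟨(mem_filter.1 h3).1, ?_⟩
    have hc := (mem_filter.1 h3).2
    generalize κ u = y at h4
    rcases lt_or_gt_of_ne hc with h5 | h5
    · rw [sign_neg h5] at h4
      cases y <;> simp at h4 ⊢
      exact h5
    · rw [sign_pos h5] at h4
      cases y <;> simp at h4 ⊢
      exact h5
  simp only [hm] at h2
  omega

/-- Among many keys of weight zero, at least `k'` have a nonzero estimate. -/
lemma few_nonzero_le (hb : 1 ≤ b) (c : Bucket ℓ b → ℝ) {p : ℝ} (hp : p ≤ (colLaw kind ℓ b).real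
      {κ | medianOn (supp κ) (fun t => (κ t : ℝ) * c t) ≠ 0}) (Z k' : ℕ) :
    (colLaw kind ℓ b ^⊗ (Fin Z)).real
      {ζ | #{i | medianOn (supp (ζ i)) (fun t => (ζ i t : ℝ) * c t) ≠ 0} <
        k'} ≤ exp (k' - Z * p / 2) := by
  classical
  have := prob_colLaw kind ℓ hb
  set S : Set (Col ℓ b) := {κ | medianOn (supp κ) (fun t => (κ t : ℝ) * c t) ≠ 0} with hS
  have h1 := chernoff_pi (colLaw kind ℓ b) (Q := Z) (fun κ => if κ ∈ S then (-1 : ℝ) else 0)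
    (a := -(k' : ℝ))
  have h3 : ∫ κ, exp (if κ ∈ S then (-1 : ℝ) else 0) ∂(colLaw kind ℓ b) ≤ exp (-(p / 2)) := by
    have h4 : ∀ κ, exp (if κ ∈ S then (-1 : ℝ) else 0) =
        1 - (1 - exp (-1)) * S.indicator 1 κ := fun κ => by
      simp only [Set.indicator]
      split_ifs <;> simp
    simp_rw [h4]
    rw [integral_sub .of_finite .of_finite, integral_const_mul, integral_indicator_one .of_discrete]
    have h5 : exp (-1) ≤ 1 / 2 := by
      rw [exp_neg, one_div]
      gcongr
      linarith [exp_one_gt_d9]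
    have h6 := add_one_le_exp (-(p / 2))
    have h7 : 1 / 2 * (colLaw kind ℓ b).real S ≤ (1 - exp (-1)) * (colLaw kind ℓ b).real S :=
      mul_le_mul_of_nonneg_right (by linarith) measureReal_nonneg
    simp
    linarith
  refine (measureReal_mono (fun ζ hζ => ?_)).trans (h1.trans ?_)
  · have hζ' : #{i | ζ i ∈ S} < k' := hζ
    change -(k' : ℝ) ≤ ∑ i, if ζ i ∈ S then (-1 : ℝ) else 0
    have h9 : ∑ i, (if ζ i ∈ S then (-1 : ℝ) else 0) = -(#{i | ζ i ∈ S} : ℝ) := by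
      rw [← sum_filter, sum_const, nsmul_eq_mul, mul_neg_one]
    rw [h9]
    have : (#{i | ζ i ∈ S} : ℝ) ≤ k' := mod_cast hζ'.le
    linarith
  · rw [neg_neg]
    calc _ ≤ exp k' * exp (-(p / 2)) ^ Z := by gcongr
      _ = _ := by rw [← exp_nat_mul, ← exp_add]; congr 1; ring

end

/-! ### The failure probability of the attack on the median estimator -/

section

lemma nested_union_le {X₁ X₂ X₃ X₄ : Type*} [Finite X₁] [MeasurableSpace X₁]
    [DiscreteMeasurableSpace X₁] [Finite X₂] [MeasurableSpace X₂] [DiscreteMeasurableSpace X₂]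
    [Finite X₃] [MeasurableSpace X₃] [DiscreteMeasurableSpace X₃] [Finite X₄] [MeasurableSpace X₄]
    [DiscreteMeasurableSpace X₄] {μ₁ : Measure X₁} {μ₂ : Measure X₂} {μ₃ : Measure X₃}
    {μ₄ : Measure X₄} [IsProbabilityMeasure μ₁] [IsProbabilityMeasure μ₂] [IsProbabilityMeasure μ₃]
    [IsProbabilityMeasure μ₄] {B₁ : Set X₁} {B₂ : X₁ → Set X₂} {B₃ : X₁ → X₂ → Set X₃}
    {B₄ : X₁ → X₂ → X₃ → Set X₄} {δ₁ δ₂ δ₃ δ₄ : ℝ} (h₂ : 0 ≤ δ₂) (h₃ : 0 ≤ δ₃) (h₄ : 0 ≤ δ₄)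
    (hB₁ : μ₁.real B₁ ≤ δ₁) (hB₂ : ∀ x ∉ B₁, μ₂.real (B₂ x) ≤ δ₂)
    (hB₃ : ∀ x ∉ B₁, ∀ y ∉ B₂ x, μ₃.real (B₃ x y) ≤ δ₃)
    (hB₄ : ∀ x ∉ B₁, ∀ y ∉ B₂ x, ∀ z ∉ B₃ x y, μ₄.real (B₄ x y z) ≤ δ₄) :
    (μ₁.prod (μ₂.prod (μ₃.prod μ₄))).real {p | p.1 ∈ B₁ ∨ p.2.1 ∈ B₂ p.1 ∨ p.2.2.1 ∈ B₃ p.1 p.2.1 ∨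
      p.2.2.2 ∈ B₄ p.1 p.2.1 p.2.2.1} ≤ δ₁ + (δ₂ + (δ₃ + δ₄)) := by
  have d1 : DiscreteMeasurableSpace (X₃ × X₄) := MeasurableSingletonClass.toDiscreteMeasurableSpace
  have d2 : DiscreteMeasurableSpace (X₂ × X₃ × X₄) :=
    MeasurableSingletonClass.toDiscreteMeasurableSpace
  refine (prod_real_le B₁ (by positivity) fun x hx => ?_).trans (add_le_add hB₁ le_rfl)
  refine le_trans ?_ (add_le_add (hB₂ x hx) le_rfl)
  refine le_trans (measureReal_mono (s₂ := {p : X₂ × X₃ × X₄ | p.1 ∈ B₂ x ∨ p.2.1 ∈ B₃ x p.1 ∨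
    p.2.2 ∈ B₄ x p.1 p.2.1}) (fun p hp => ?_) (measure_ne_top _ _))
    (prod_real_le (B₂ x) (by positivity) fun y hy => ?_)
  · exact hp.resolve_left hx
  refine le_trans ?_ (add_le_add (hB₃ x hx y hy) le_rfl)
  refine le_trans (measureReal_mono (s₂ := {p : X₃ × X₄ | p.1 ∈ B₃ x y ∨
    p.2 ∈ B₄ x y p.1}) (fun p hp => ?_) (measure_ne_top _ _))
    (prod_real_le (B₃ x y) (by positivity) fun z hz => ?_)
  · exact hp.resolve_left hy
  refine le_trans (measureReal_mono (fun p hp => ?_)) (hB₄ x hx y hy z hz)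
  exact hp.resolve_left hz

variable {G N : Type} [Fintype G] [Fintype N] {Q Z : ℕ}

/-- The columns of the different sorts of keys of the attack are independent. -/
lemma mp_medianKeys (hb : 1 ≤ b) {e : Option (MedianKey G N Q Z) → Fin n} (he : e.Injective) :
    MeasurePreserving (fun (ω : Fin n → Col ℓ b) => (ω (e none), roundCols ω e,
        (fun i => ω (e (some (.inr (.inl i))))), fun i => ω (e (some (.inr (.inr i))))))
      (Measure.pi fun _ => colLaw kind ℓ b) ((colLaw kind ℓ b).prod ((Measure.pi fun _ : Fin Q =>
        (colLaw kind ℓ b ^⊗ (Option G)).prod (colLaw kind ℓ b ^⊗ N)).prod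
          ((colLaw kind ℓ b ^⊗ N).prod (colLaw kind ℓ b ^⊗ (Fin Z))))) := by
  classical
  have := prob_colLaw kind ℓ hb
  have h1 : MeasurePreserving (fun (ω : MedianKey G N Q Z → Col ℓ b) =>
      ((fun q => ((fun o => ω (.inl (q, .inl o))), fun i => ω (.inl (q, .inr i)))),
        (fun i => ω (.inr (.inl i))), fun i => ω (.inr (.inr i))))
      (Measure.pi fun _ => colLaw kind ℓ b) ((Measure.pi fun _ : Fin Q =>
        (colLaw kind ℓ b ^⊗ (Option G)).prod (colLaw kind ℓ b ^⊗ N)).prod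
          ((colLaw kind ℓ b ^⊗ N).prod (colLaw kind ℓ b ^⊗ (Fin Z)))) := by
    have hc : Countable (Round[ℓ, b, G, N]) := inferInstance
    have hs : MeasurableSingletonClass (Round[ℓ, b, G, N]) := inferInstance
    have hc' : Countable (Fin Q → Round[ℓ, b, G, N]) := inferInstance
    have hs' : MeasurableSingletonClass (Fin Q → Round[ℓ, b, G, N]) :=
      Pi.instMeasurableSingletonClass
    refine mp_of_singleton _ fun y => ?_
    have hpre : (fun (ω : MedianKey G N Q Z → Col ℓ b) =>
      ((fun q => ((fun o => ω (.inl (q, .inl o))), fun i => ω (.inl (q, .inr i)))),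
        (fun i => ω (.inr (.inl i))), fun i => ω (.inr (.inr i)))) ⁻¹' {y} =
        {Sum.elim (fun p => Sum.elim (y.1 p.1).1 (y.1 p.1).2 p.2) (Sum.elim y.2.1 y.2.2)} := by
      ext ω
      simp only [Set.mem_preimage, Set.mem_singleton_iff, Prod.ext_iff, funext_iff, Sum.forall,
        Prod.forall, Sum.elim_inl, Sum.elim_inr]
    rw [hpre, Measure.pi_singleton]
    obtain ⟨y1, y2, y3⟩ := y
    rw [← Set.singleton_prod_singleton, ← Set.singleton_prod_singleton, Measure.prod_prod,
      Measure.prod_prod, Measure.pi_singleton, Measure.pi_singleton, Measure.pi_singleton]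
    simp only [Fintype.prod_sum_type, Fintype.prod_prod_type, Sum.elim_inl, Sum.elim_inr]
    congr 1
    refine prod_congr rfl fun q _ => ?_
    rw [← Prod.mk.eta (p := y1 q), ← Set.singleton_prod_singleton, Measure.prod_prod,
      Measure.pi_singleton, Measure.pi_singleton]
  exact ((MeasurePreserving.id _).prod h1).comp (mp_keys (kind := kind) hb he)

lemma card_filter_coe {α : Type*} (S : Finset α) (P : α → Prop) [DecidablePred P] :
    #{t : S | P t} = #(S.filter P) := by
  rw [card_filter, card_filter, ← sum_coe_sort S]

/-- The attack on the median estimator fails only if some heavy part is not estimated accurately, the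
collected noise is not of the expected order, the final noise is large, or almost all keys of weight
zero have a vanishing estimate. -/
lemma exists_failure_of_reported_median {a H A₀ k' : ℕ} {β : ℝ} {M : Estimator n ℓ b}
    (hk' : ♯(Option G) = k') (hM : IsMedianEstimator k' M) (ω : Fin n → Col ℓ b)
    {e : Option (MedianKey G N Q Z) → Fin n} (he : e.Injective)
    (ha : 8 * ♯N + 4 ≤ a) (hH : 2 * a + 2 ≤ H) (hA₀ : (A₀ : ℝ) + ℓ ≤ β * Q / 4)
    (hacc : ∀ q : Fin Q, Accurate ω (embedVec e (medianHeavy a H q)))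
    (hcard : |(#(supp (ω (e none))) : ℝ) - ℓ| < 1 / 100 * ℓ)
    {I : ℕ} (hI : 2 * (12 * Q + 17 * ℓ) < I)
    (hfail : false ∉ (fullBits (ofCols ω) (M.respond (ofCols ω)) (e none)
      (fun bits => medianQuery a H A₀ e bits) (Q + I)).drop Q)
    (hcoll : ¬ NoiseFails β ℓ Q (medianCollected (medianRep a H (♯N + 1) (ω (e none)))
      (ω (e none)) (roundCols ω e)))
    (hnoise : ¬ ∃ t ∈ supp (ω (e none)), (ℓ : ℝ) ≤ |(((ω (e none) t : ℤ) *
      noiseSum (fun i => ω (e (some (.inr (.inl i))))) t : ℤ) : ℝ)|) :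
    ∃ i < I, #{ζ : Fin Z | medianOn (supp (ω (e (some (.inr (.inr ζ))))))
      (fun t => (ω (e (some (.inr (.inr ζ)))) t : ℝ) * finalSketch (ω (e none)) (A₀ + (i : ℕ) / 2)
        (fun q => medianRep a H (♯N + 1) (ω (e none)) (roundCols ω e q))
        (roundCols ω e) (fun i => ω (e (some (.inr (.inl i))))) t) ≠ 0} < k' := by
  classical
  subst hk'
  set κ := ω (e none) with hκ
  set y := roundCols ω e with hy
  set z : N → Col ℓ b := fun i => ω (e (some (.inr (.inl i)))) with hz
  set rep : Round[ℓ, b, G, N] → Bool := medianRep a H (♯N + 1) κ with hrep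
  set v : List Bool → Fin n → ℝ := fun bits => medianQuery a H A₀ e bits with hv
  set g := runBit (ofCols ω) M (e none) v with hg
  -- the answers to the collection rounds
  have hbit : ∀ q : Fin Q, g q = rep (y q) := by
    intro q
    rw [hg, runBit_eq, ← hg]
    have h1 : v ((List.range q).map g) = embedVec e fun o => medianHeavy a H q o + medianNoise q o := by
      simp only [hv, medianQuery, List.length_map, List.length_range, q.2, if_true]
    rw [h1]
    have h2 := mem_collection_iff hM ω he q ha hH (hacc q)
    by_cases h3 : rep (y q) = true
    · rw [h3, decide_eq_true_iff]
      exact h2.2 h3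
    · rw [Bool.not_eq_true] at h3
      rw [h3, decide_eq_false_iff_not]
      intro h4
      have := h2.1 h4
      rw [← hrep, ← hy, h3] at this
      exact Bool.false_ne_true this
  -- the oriented noise
  set W : Bucket ℓ b → ℤ := fun t => (κ t : ℤ) * (noiseSum z t +
    ∑ q, if rep (y q) then noiseSum (y q).2 t else 0) with hW
  set cl : Bucket ℓ b → ℤ := fun t => ∑ q, if rep (y q) then (κ t : ℤ) * noiseSum (y q).2 t else 0
    with hcl
  have hWcl : ∀ t, W t = (κ t : ℤ) * noiseSum z t + cl t := fun t => by
    simp only [hW, hcl, mul_add, mul_sum, mul_ite, mul_zero]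
  rw [NoiseFails, not_or, not_le, not_le] at hcoll
  have hc1 : (#{t ∈ supp κ | (cl t : ℝ) ≤ β * Q / 4} : ℝ) < 1 / 4 * ℓ := by
    rw [← card_filter_coe]
    exact hcoll.1
  have hc2 : (#{t ∈ supp κ | (12 * Q + 16 * ℓ : ℝ) ≤ cl t} : ℝ) < 1 / 4 * ℓ := by
    rw [← card_filter_coe]
    exact hcoll.2
  push Not at hnoise
  have hNlow := (abs_lt.1 hcard).1
  have hlow : 2 * #{t ∈ supp κ | (W t : ℝ) < A₀} < #(supp κ) := by
    have h1 : #{t ∈ supp κ | (W t : ℝ) < A₀} ≤ #{t ∈ supp κ | (cl t : ℝ) ≤ β * Q / 4} := by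
      refine card_le_card (monotone_filter_right _ fun t ht h => ?_)
      have h2 := (abs_lt.1 (hnoise t ht)).1
      rw [hWcl, Int.cast_add] at h
      linarith
    have h2 : (#{t ∈ supp κ | (W t : ℝ) < A₀} : ℝ) ≤
        #{t ∈ supp κ | (cl t : ℝ) ≤ β * Q / 4} := mod_cast h1
    have h3 : 2 * (#{t ∈ supp κ | (W t : ℝ) < A₀} : ℝ) < #(supp κ) := by linarith
    exact_mod_cast h3
  have hhigh : 2 * #{t ∈ supp κ | (12 * Q + 17 * ℓ : ℝ) < W t} < #(supp κ) := by
    have h1 : #{t ∈ supp κ | (12 * Q + 17 * ℓ : ℝ) < W t} ≤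
        #{t ∈ supp κ | (12 * Q + 16 * ℓ : ℝ) ≤ cl t} := by
      refine card_le_card (monotone_filter_right _ fun t ht h => ?_)
      have h2 := (abs_lt.1 (hnoise t ht)).2
      rw [hWcl, Int.cast_add] at h
      linarith
    have h2 : (#{t ∈ supp κ | (12 * Q + 17 * ℓ : ℝ) < W t} : ℝ) ≤
        #{t ∈ supp κ | (12 * Q + 16 * ℓ : ℝ) ≤ cl t} := mod_cast h1
    have h3 : 2 * (#{t ∈ supp κ | (12 * Q + 17 * ℓ : ℝ) < W t} : ℝ) < #(supp κ) := by linarith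
    exact_mod_cast h3
  have hA : (supp κ).Nonempty := card_pos.1 (by omega)
  have hm1 := le_medianOn hA hlow
  have hm2 := medianOn_le hA hhigh
  obtain ⟨p, hp⟩ := exists_medianOn_eq hA W
  have hp1 : 2 * (A₀ : ℤ) ≤ p := by
    have : ((2 * A₀ : ℤ) : ℝ) ≤ p := by push_cast; linarith
    exact_mod_cast this
  have hp2 : p ≤ 2 * (12 * Q + 17 * ℓ) := by
    have : (p : ℝ) ≤ ((2 * (12 * Q + 17 * ℓ) : ℤ) : ℝ) := by push_cast; linarith
    exact_mod_cast this
  obtain ⟨i, hi⟩ : ∃ i : ℕ, p = 2 * A₀ + i := ⟨(p - 2 * A₀).toNat, by omega⟩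
  refine ⟨i, by omega, ?_⟩
  have hx : (A₀ : ℝ) + (i : ℕ) / 2 = medianOn (supp κ) fun t => (W t : ℝ) := by
    have : (p : ℝ) = 2 * A₀ + i := by rw [hi]; push_cast; ring
    linarith
  have hbit' := runBit_of_false_notMem hfail (m := Q + i) (by omega) (by omega)
  rw [← hg, hg, runBit_eq, ← hg, decide_eq_true_iff] at hbit'
  have hquery : v ((List.range (Q + i)).map g) =
      embedVec e (medianFinal (A₀ + (i : ℕ) / 2) fun q => rep (y q)) := by
    have h1 : ¬ Q + i < Q := by omega
    simp only [hv, medianQuery, List.length_map, List.length_range, h1, if_false,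
      Nat.add_sub_cancel_left]
    congr 2
    funext q
    rw [getD_map_range (lt_of_lt_of_le q.2 (Nat.le_add_right _ _)), hbit q]
  rw [hquery] at hbit'
  exact card_lt_of_mem_final hM ω he (fun q => rep (y q)) rfl hA hx hbit'

end

section

variable {G N : Type} [Fintype G] [Fintype N] {Q Z : ℕ}

lemma not_accurate_medianHeavy_le (hb : 1 ≤ b)
    (e : Option (MedianKey G N Q Z) → Fin n) (a H : ℕ) (q : Fin Q)
    (hG : 3 * (♯(Option G) + 1) ≤ 2 * b) : (colLaw kind ℓ b ^⊗ (Fin n)).real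
      {ω | ¬ Accurate ω (embedVec e (medianHeavy a H q))} ≤ n * (6 * exp (-(ℓ / 44))) := by
  classical
  refine not_accurate_le kind hb _
    (D := univ.image fun o : Option (Option G) => e (o.map fun g => .inl (q, .inl g)))
    (fun j hj => ?_) ?_
  · rw [embedVec]
    refine sum_eq_zero fun o _ => ?_
    rw [ite_eq_right_iff]
    intro ho
    subst ho
    rcases o with _ | ⟨p, g | i⟩ | o
    · exact absurd (mem_image_of_mem _ (mem_univ none)) hj
    · by_cases hp : (p : ℕ) = q
      · obtain rfl : p = q := Fin.ext hp
        exact absurd (mem_image_of_mem _ (mem_univ (some g))) hj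
      · cases g <;> simp [medianHeavy, hp]
    · rfl
    · rfl
  · have h1 := card_image_le (s := (univ : Finset (Option (Option G))))
      (f := fun o => e (o.map fun g => .inl (q, .inl g)))
    rw [card_univ, Fintype.card_option] at h1
    omega

lemma isHeavyHitter_medianQuery {a H A₀ k s : ℕ} {e : Option (MedianKey G N Q Z) → Fin n}
    (he : e.Injective) (hN : ♯N = s) (hk : 1 ≤ k) (hA : 1 ≤ A₀)
    (hlt : (Q + 1) * s < k * A₀ ^ 2) (bits : List Bool) (hbits : Q ≤ bits.length) :
    IsHeavyHitter k (medianQuery a H A₀ e bits) (e none) := by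
  classical
  have hA' : (1 : ℝ) ≤ A₀ := mod_cast hA
  obtain ⟨x, hx⟩ : ∃ x : ℝ, x = A₀ + (bits.length - Q : ℕ) / 2 := ⟨_, rfl⟩
  have hAx : (A₀ : ℝ) ≤ x := by
    have : (0 : ℝ) ≤ ((bits.length - Q : ℕ) : ℝ) := Nat.cast_nonneg _
    linarith
  have h1 : ¬ bits.length < Q := by omega
  rw [medianQuery, if_neg h1, ← hx]
  have hxx : x ≤ |x| := le_abs_self x
  refine isHeavyHitter_embedVec he _ none (fun o => ?_) hk ?_
  · rcases o with _ | ⟨p, g | i⟩ | i | i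
    · exact le_rfl
    · simp only [medianFinal, abs_zero]; exact abs_nonneg _
    · simp only [medianFinal]
      split_ifs
      · rw [abs_neg, abs_one]; linarith
      · rw [abs_zero]; exact abs_nonneg _
    · simp only [medianFinal]
      rw [abs_neg, abs_one]; linarith
    · simp only [medianFinal, abs_zero]; exact abs_nonneg _
  · have h3 : (univ.erase (none : Option (MedianKey G N Q Z))) =
        univ.map Function.Embedding.some := by
      ext o; cases o <;> simp
    rw [h3, sum_map]
    simp only [Function.Embedding.some_apply, medianFinal, Fintype.sum_prod_type,
      Fintype.sum_sum_type, sum_const, card_univ, hN, nsmul_eq_mul, ne_eq, OfNat.ofNat_ne_zero,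
      not_false_eq_true, zero_pow, mul_zero, add_zero, zero_add, even_two, Even.neg_pow, one_pow,
      mul_one]
    have h4 : ∑ q : Fin Q, (s : ℝ) * (if bits.getD q false = true then (-1 : ℝ) else 0) ^ 2 ≤
        Q * s := by
      refine (sum_le_sum (g := fun _ => (s : ℝ)) fun q _ => ?_).trans (by simp)
      refine mul_le_of_le_one_right (by positivity) ?_
      split_ifs <;> norm_num
    calc _ ≤ (Q * s + s : ℝ) := add_le_add h4 le_rfl
      _ = (Q + 1) * s := by ring
      _ < k * (A₀ : ℝ) ^ 2 := mod_cast hlt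
      _ ≤ _ := by gcongr

/-- The numbers of rounds of the attack on the median estimator. -/
lemma median_rounds {β κ : ℝ} (hβ : 0 < β) (hβ1 : β ≤ 1) :
    ∃ C : ℝ, 0 < C ∧ ∀ ℓ : ℕ, 1 ≤ ℓ → ∃ Q A₀ : ℕ,
      12800 * ℓ ≤ Q * β ^ 2 ∧ (A₀ : ℝ) + ℓ ≤ β * Q / 4 ∧ 1 ≤ A₀ ∧ (Q + 1) * κ * ℓ < (A₀ : ℝ) ^ 2 ∧
      ((Q + (2 * (12 * Q + 17 * ℓ) + 1) : ℕ) : ℝ) ≤ C * ℓ := by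
  obtain ⟨D, hD⟩ : ∃ D, D = 12800 / β ^ 2 + 512 * |κ| / β ^ 2 + 1 := ⟨_, rfl⟩
  have hD0 : 0 < D := by rw [hD]; positivity
  have hDβ : D * β ^ 2 = 12800 + 512 * |κ| + β ^ 2 := by rw [hD]; field_simp
  refine ⟨25 * (D + 1) + 35, by positivity, fun ℓ hℓ => ?_⟩
  have hℓ' : (1 : ℝ) ≤ ℓ := mod_cast hℓ
  obtain ⟨Q, hQ1, hQ2⟩ : ∃ Q : ℕ, D * ℓ ≤ Q ∧ (Q : ℝ) < D * ℓ + 1 :=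
    ⟨_, Nat.le_ceil _, Nat.ceil_lt_add_one (by positivity)⟩
  have hκℓ : 0 ≤ |κ| * ℓ := by positivity
  have hQ3 : (12800 + 512 * |κ|) * ℓ ≤ Q * β ^ 2 := by
    have h1 := mul_le_mul_of_nonneg_right hQ1 (sq_nonneg β)
    have h2 : D * ℓ * β ^ 2 = (12800 + 512 * |κ| + β ^ 2) * ℓ := by rw [← hDβ]; ring
    have h3 : 0 ≤ β ^ 2 * ℓ := by positivity
    linarith
  have h12 : 12800 * (ℓ : ℝ) ≤ Q * β ^ 2 := by linarith
  have hQβ : 12800 * (ℓ : ℝ) ≤ Q * β := by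
    have h1 : (Q : ℝ) * β ^ 2 ≤ Q * β := by
      refine mul_le_mul_of_nonneg_left ?_ (by positivity); nlinarith
    linarith
  have hQ1' : (1 : ℝ) ≤ Q := by
    have : (Q : ℝ) * β ≤ Q := mul_le_of_le_one_right (by positivity) hβ1
    linarith
  obtain ⟨A₀, hA1, hA2⟩ : ∃ A₀ : ℕ, (A₀ : ℝ) ≤ β * Q / 4 - ℓ ∧ β * Q / 4 - ℓ < A₀ + 1 :=
    ⟨_, Nat.floor_le (by linarith), Nat.lt_floor_add_one _⟩
  have hA3 : β * Q / 8 ≤ A₀ := by linarith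
  refine ⟨Q, A₀, h12, by linarith, ?_, ?_, ?_⟩
  · have : (0 : ℝ) < A₀ := by linarith
    exact_mod_cast this
  · have h2 : (β * Q / 8) ^ 2 ≤ (A₀ : ℝ) ^ 2 := pow_le_pow_left₀ (by positivity) hA3 2
    refine lt_of_lt_of_le ?_ h2
    have h3 : 128 * (|κ| * ℓ) < Q * β ^ 2 := by linarith
    have h4 := mul_lt_mul_of_pos_left h3 (by linarith : (0 : ℝ) < Q)
    have h5 : (Q + 1) * κ * ℓ ≤ (2 * Q) * (|κ| * ℓ) := by
      have h6 : κ * ℓ ≤ |κ| * ℓ := by gcongr; exact le_abs_self κ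
      have h7 : (Q + 1) * (|κ| * ℓ) ≤ (2 * Q) * (|κ| * ℓ) := by gcongr; linarith
      have h8 : (Q + 1) * (κ * ℓ) ≤ (Q + 1) * (|κ| * ℓ) := by gcongr
      linarith
    calc _ ≤ (2 * Q) * (|κ| * ℓ) := h5
      _ = Q * (128 * (|κ| * ℓ)) / 64 := by ring
      _ < Q * (Q * β ^ 2) / 64 := by linarith
      _ = _ := by ring
  · push_cast
    linarith

end

section

/-- The noise of the last phase exceeds `ℓ` in a bucket, or leaves few of the keys typical for one of
the queries of the last phase, only with small probability. -/
lemma final_noise_le {s Q I : ℕ} {G N : Type} [Fintype N] (hb : 1 ≤ b)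
    (hs : 1 ≤ s) (hN : ♯N = b * s) (hs' : s ≤ ℓ) (hsℓ : (ℓ : ℝ) ≤ 10 ^ 10 * s)
    (h1 : 2 * exp (-((1 / 100 : ℝ) ^ 2 / 4 * ℓ)) ≤ 1 / 100) {κ : Col ℓ b}
    (hκ : Admissible kind (supp κ)) (hcard : (#(supp κ) : ℝ) ≤ 2 * ℓ)
    (x : ℕ → ℝ) (S : Fin Q → Bool) (y : Fin Q → Round[ℓ, b, G, N]) : (colLaw kind ℓ b ^⊗ N).real
      {z | (∃ t ∈ supp κ, (ℓ : ℝ) ≤ |(((κ t : ℤ) * noiseSum z t : ℤ) : ℝ)|) ∨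
        ∃ i < I, (colLaw kind ℓ b).real (typicalCols kind (finalSketch κ (x i) S y z)) < 1 / 2} ≤
      2 * ℓ * (2 * exp (-(ℓ / 4))) + I * (4 * exp (-√ℓ)) := by
  have := prob_colLaw kind ℓ hb
  refine (measureReal_union_le _ _).trans (add_le_add ?_ ?_)
  · refine (noise_large_le kind hb hN hs' hκ).trans ?_
    gcongr
  · refine le_of_le_of_eq (union_bound _ (range I) (fun i => {z | (colLaw kind ℓ b).real
      (typicalCols kind (finalSketch κ (x i) S y z)) < 1 / 2}) (fun z ⟨i, hi, h⟩ =>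
        ⟨i, mem_range.2 hi, h⟩) fun i _ => ?_) (by rw [card_range])
    have h := typicalCols_tail kind hb hs hN hsℓ (hs.trans hs') h1
      fun t => x i * (κ t : ℝ) - ((∑ q, if S q then noiseSum (y q).2 t else 0 : ℤ) : ℝ)
    refine le_trans (le_of_eq ?_) h
    congr 1
    ext z
    have : finalSketch κ (x i) S y z = fun t => x i * (κ t : ℝ) -
        ((∑ q, if S q then noiseSum (y q).2 t else 0 : ℤ) : ℝ) - noiseSum z t := by
      funext t
      rw [finalSketch, Int.cast_add]
      ring
    rw [Set.mem_ofPred_eq, Set.mem_ofPred_eq, this]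

/-- The probability that the watched key is reported throughout the last phase, by conditioning on the
phases in turn. -/
lemma median_reported_le {s Q I Z a H A₀ k' : ℕ} {G N : Type} [Fintype G]
    [Fintype N] {M : Estimator n ℓ b} {β p δ : ℝ} (hb : 1 ≤ b) (hs : 1 ≤ s)
    (hN : ♯N = b * s) (hs' : s ≤ ℓ) (hsℓ : (ℓ : ℝ) ≤ 10 ^ 10 * s)
    (h1 : 2 * exp (-((1 / 100 : ℝ) ^ 2 / 4 * ℓ)) ≤ 1 / 100)
    (hk' : ♯(Option G) = k') (hkb : 3 * (k' + 1) ≤ 2 * b) (hM : IsMedianEstimator k' M)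
    {e : Option (MedianKey G N Q Z) → Fin n} (he : e.Injective)
    (ha : 8 * ♯N + 4 ≤ a) (hH : 2 * a + 2 ≤ H)
    (hA₀ : (A₀ : ℝ) + ℓ ≤ β * Q / 4) (hI : 2 * (12 * Q + 17 * ℓ) < I) (hδ : 0 ≤ δ)
    (hcoll : ∀ κ : Col ℓ b, Admissible kind (supp κ) →
      |(#(supp κ) : ℝ) - ℓ| ≤ 1 / 100 * ℓ →
      (Measure.pi fun _ : Fin Q => (colLaw kind ℓ b ^⊗ (Option G)).prod (colLaw kind ℓ b ^⊗ N)).real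
      {x | NoiseFails β ℓ Q (medianCollected (medianRep a H (♯N + 1) κ) κ x)} ≤ δ)
    (hp : ∀ c : Bucket ℓ b → ℝ, 1 / 2 ≤ (colLaw kind ℓ b).real (typicalCols kind c) →
      p ≤ (colLaw kind ℓ b).real {κ | medianOn (supp κ) (fun t => (κ t : ℝ) * c t) ≠ 0}) :
    (colLaw kind ℓ b ^⊗ (Fin n)).real
      {ω | false ∉ (fullBits (ofCols ω) (M.respond (ofCols ω)) (e none)
        (fun bits => medianQuery a H A₀ e bits) (Q + I)).drop Q} ≤
      Q * (n * (6 * exp (-(ℓ / 44)))) + (2 * exp (-((1 / 100 : ℝ) ^ 2 / 4 * ℓ)) + (δ +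
          ((2 * ℓ * (2 * exp (-(ℓ / 4))) + I * (4 * exp (-√ℓ))) + I * exp (k' - Z * p / 2)))) := by
  classical
  have := prob_colLaw kind ℓ hb
  -- the exceptional events of the different phases, each given the outcome of the previous ones
  set B₁ : Set (Col ℓ b) := {κ | ¬ Admissible kind (supp κ)} ∪
    {κ | 1 / 100 * (ℓ : ℝ) ≤ |(#(supp κ) : ℝ) - ℓ|} with hB₁
  obtain ⟨B₂, hB₂⟩ : ∃ B₂ : Col ℓ b → Set (Fin Q → Round[ℓ, b, G, N]),
    B₂ = fun κ => {x | NoiseFails β ℓ Q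
      (medianCollected (medianRep a H (♯N + 1) κ) κ x)} := ⟨_, rfl⟩
  obtain ⟨c, hc⟩ : ∃ c : Col ℓ b → (Fin Q → Round[ℓ, b, G, N]) → (N → Col ℓ b) →
    ℕ → Bucket ℓ b → ℝ, c = fun κ y z i => finalSketch κ (A₀ + (i : ℕ) / 2)
      (fun q => medianRep a H (♯N + 1) κ (y q)) y z := ⟨_, rfl⟩
  set B₃ : Col ℓ b → (Fin Q → Round[ℓ, b, G, N]) → Set (N → Col ℓ b) := fun κ y =>
    {z | (∃ t ∈ supp κ, (ℓ : ℝ) ≤ |(((κ t : ℤ) * noiseSum z t : ℤ) : ℝ)|) ∨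
        ∃ i < I, (colLaw kind ℓ b).real (typicalCols kind (c κ y z i)) < 1 / 2} with hB₃
  set B₄ : Col ℓ b → (Fin Q → Round[ℓ, b, G, N]) → (N → Col ℓ b) →
    Set (Fin Z → Col ℓ b) := fun κ y z => {ζ | ∃ i < I, #{j : Fin Z | medianOn (supp (ζ j)) (fun t => (ζ j t : ℝ) * c κ y z i t) ≠ 0} < k'} with hB₄
  have hb₁ : ∀ κ ∉ B₁, Admissible kind (supp κ) ∧
      |(#(supp κ) : ℝ) - ℓ| < 1 / 100 * ℓ := fun κ hκ => by
    simpa only [hB₁, Set.mem_union, Set.mem_ofPred_eq, not_or, not_not, not_le] using hκ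
  have hBP : (colLaw kind ℓ b).real B₁ ≤ 2 * exp (-((1 / 100 : ℝ) ^ 2 / 4 * ℓ)) := by
    refine (measureReal_union_le _ _).trans ?_
    have h0 : (colLaw kind ℓ b).real {κ | ¬ Admissible kind (supp κ)} = 0 := by
      rw [measureReal_def, ae_iff.1 (ae_admissible kind), ENNReal.toReal_zero]
    rw [h0, zero_add]
    exact card_supp_tail kind hb (by norm_num) (by norm_num)
  have hc' : Countable (Fin Q → Round[ℓ, b, G, N]) := inferInstance
  have hs' : MeasurableSingletonClass (Fin Q → Round[ℓ, b, G, N]) := Pi.instMeasurableSingletonClass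
  have d2 : DiscreteMeasurableSpace (Fin Q → Round[ℓ, b, G, N]) :=
    MeasurableSingletonClass.toDiscreteMeasurableSpace
  have hE := nested_union_le (μ₁ := colLaw kind ℓ b)
    (μ₂ := Measure.pi fun _ : Fin Q => (colLaw kind ℓ b ^⊗ (Option G)).prod (colLaw kind ℓ b ^⊗ N))
    (μ₃ := colLaw kind ℓ b ^⊗ N)
    (μ₄ := colLaw kind ℓ b ^⊗ (Fin Z)) (B₁ := B₁) (B₂ := B₂) (B₃ := B₃) (B₄ := B₄)
    hδ (δ₃ := 2 * ℓ * (2 * exp (-(ℓ / 4))) + I * (4 * exp (-√ℓ))) (by positivity)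
    (δ₄ := I * exp (k' - Z * p / 2)) (by positivity) hBP
    (fun κ hκ => by rw [hB₂]; exact hcoll κ (hb₁ κ hκ).1 (hb₁ κ hκ).2.le)
    (fun κ hκ y _ => by
      simp only [hB₃, hc]
      refine final_noise_le kind hb hs hN ‹s ≤ ℓ› hsℓ h1 (hb₁ κ hκ).1 ?_ _ _ _
      have := (abs_lt.1 (hb₁ κ hκ).2).2
      linarith [(Nat.cast_nonneg ℓ : (0 : ℝ) ≤ ℓ)])
    (fun κ _ y _ z hz => by
      simp only [hB₃, Set.mem_ofPred_eq, not_or, not_exists, not_and, not_lt] at hz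
      exact le_of_le_of_eq (union_bound _ (range I) (fun i => {ζ : Fin Z → Col ℓ b | #{j : Fin Z |
        medianOn (supp (ζ j)) (fun t => (ζ j t : ℝ) * c κ y z i t) ≠ 0} < k'})
        (fun ζ ⟨i, hi, h⟩ => ⟨i, mem_range.2 hi, h⟩) fun i hi =>
        few_nonzero_le kind hb _ (hp _ (hz.2 i (mem_range.1 hi))) Z k') (by rw [card_range]))
  have hmp := mp_medianKeys (kind := kind) (ℓ := ℓ) hb he
  have hA : (colLaw kind ℓ b ^⊗ (Fin n)).real
      {ω | ∃ q : Fin Q, ¬ Accurate ω (embedVec e (medianHeavy a H q))} ≤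
      Q * (n * (6 * exp (-(ℓ / 44)))) :=
    le_of_le_of_eq (union_bound _ univ (fun q : Fin Q => {ω | ¬ Accurate ω (embedVec e (medianHeavy a H q))})
      (fun ω ⟨q, hq⟩ => ⟨q, mem_univ q, hq⟩) fun q _ =>
        not_accurate_medianHeavy_le kind hb e a H q (by omega))
          (by rw [card_univ, Fintype.card_fin])
  refine (measureReal_mono (s₂ := {ω | ∃ q : Fin Q, ¬ Accurate ω (embedVec e (medianHeavy a H q))} ∪
    (fun ω : Fin n → Col ℓ b => (ω (e none), roundCols ω e,
        (fun i => ω (e (some (.inr (.inl i))))), fun i => ω (e (some (.inr (.inr i)))))) ⁻¹' _) ?_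
      (measure_ne_top _ _)).trans ((measureReal_union_le _ _).trans (add_le_add hA
      ((hmp.measureReal_preimage (Set.to_countable _).measurableSet.nullMeasurableSet).trans_le hE)))
  intro ω hω
  rw [Set.mem_union, or_iff_not_imp_left]
  intro hacc
  simp only [Set.mem_ofPred_eq, not_exists, not_not] at hacc
  rw [Set.mem_preimage, Set.mem_ofPred_eq]
  by_contra hno
  simp only [not_or] at hno
  obtain ⟨n1, n2, n3, n4⟩ := hno
  rw [hB₂] at n2
  simp only [hB₃, hB₄, hc, Set.mem_ofPred_eq, not_or] at n3 n4
  exact n4 (exists_failure_of_reported_median hk' hM ω he ha hH hA₀ hacc (hb₁ _ n1).2 hI hω n2 n3.1)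

end

/-! ### The attack on the median estimator -/

lemma median_error_le {C : ℝ} {Q I : ℕ} {x : ℝ} (hℓ : 1 ≤ ℓ) (hn : (n : ℝ) ≤ exp (ℓ / 100))
    (hQ : (Q : ℝ) ≤ C * ℓ) (hI : (I : ℝ) ≤ C * ℓ) (hx : x ≤ -√ℓ) :
    Q * (n * (6 * exp (-(ℓ / 44)))) + (2 * exp (-((1 / 100 : ℝ) ^ 2 / 4 * ℓ)) +
      (2 * exp (-ℓ) + ((2 * ℓ * (2 * exp (-(ℓ / 4))) + I * (4 * exp (-√ℓ))) +
        I * exp x))) ≤ (11 * C + 8) * (ℓ : ℝ) ^ 1 * exp (-(1 / 40000) * √ℓ) := by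
  have hℓ' : (1 : ℝ) ≤ ℓ := mod_cast hℓ
  have hC0 : 0 ≤ C * ℓ := (Nat.cast_nonneg _).trans hQ
  have hsℓ : √ℓ ≤ ℓ := sqrt_le_iff.2 ⟨by linarith, by nlinarith⟩
  have hs0 := sqrt_nonneg (ℓ : ℝ)
  obtain ⟨E, hE⟩ : ∃ E, E = exp (-(1 / 40000) * √ℓ) := ⟨_, rfl⟩
  have hE0 : 0 ≤ E := by rw [hE]; positivity
  have key : ∀ y : ℝ, y ≤ -(1 / 40000) * √ℓ → exp y ≤ E := fun y hy => by bound
  have f1 : (n : ℝ) * (6 * exp (-(ℓ / 44))) ≤ 6 * E := by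
    have : exp (ℓ / 100) * exp (-(ℓ / 44)) ≤ E := by
      rw [← exp_add]
      exact key _ (by linarith)
    have h2 : (n : ℝ) * exp (-(ℓ / 44)) ≤ exp (ℓ / 100) * exp (-(ℓ / 44)) := by gcongr
    linarith
  have g1 : (Q : ℝ) * (n * (6 * exp (-(ℓ / 44)))) ≤ C * ℓ * (6 * E) := by gcongr
  have g2 : exp (-((1 / 100 : ℝ) ^ 2 / 4 * ℓ)) ≤ ℓ * E :=
    (key _ (by linarith)).trans (le_mul_of_one_le_left hE0 hℓ')
  have g3 : exp (-(ℓ : ℝ)) ≤ ℓ * E := (key _ (by linarith)).trans (le_mul_of_one_le_left hE0 hℓ')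
  have g4 : 2 * (ℓ : ℝ) * (2 * exp (-(ℓ / 4))) ≤ 2 * ℓ * (2 * E) := by bound
  have g5 : (I : ℝ) * (4 * exp (-√ℓ)) ≤ C * ℓ * (4 * E) := by gcongr; exact key _ (by linarith)
  have g6 : (I : ℝ) * exp x ≤ C * ℓ * E := by gcongr; exact key _ (by linarith)
  rw [pow_one, ← hE]
  linarith

lemma median_attack_of_zero {kind : SketchKind} {k : ℕ} {δ : ℝ} (hδ : 0 ≤ δ) (hb : 1 ≤ b)
    (hk : 1 ≤ k) (hn : 1 ≤ n) {M : Estimator n ℓ b} (hM : IsMedianEstimator 0 M) :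
    AdmitsAttack (measurementLaw kind n ℓ b) id M.respond k 1 (1 - δ) := by
  refine admitsAttack_of_cols hb M ⟨0, hn⟩ (fun _ => basisVec ⟨0, hn⟩) (Q₀ := 0) hδ
    (fun _ _ => isHeavyHitter_basisVec _ hk) (le_trans (le_of_eq ?_) hδ)
  convert measureReal_empty (μ := colLaw kind ℓ b ^⊗ (Fin n))
  refine Set.eq_empty_of_forall_notMem fun ω hω => ?_
  have h1 := runBit_of_false_notMem hω le_rfl one_pos
  rw [runBit_eq, decide_eq_true_iff, card_eq_zero.1 ((hM _ _).1.trans (Nat.zero_min n))] at h1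
  exact notMem_empty _ h1

lemma zero_keys_exponent {p : ℝ} {k' : ℕ} (hp : 0 < p) (hb : 1 ≤ b) (hkb : k' ≤ b) (hℓ : 1 ≤ ℓ)
    (h1 : 4 / p + 1 ≤ √ℓ) : (k' : ℝ) - ((b * ℓ ^ 2 : ℕ) : ℝ) * (p / √ℓ) / 2 ≤ -√ℓ := by
  have hℓ' : (1 : ℝ) ≤ ℓ := mod_cast hℓ
  have hb' : (1 : ℝ) ≤ b := mod_cast hb
  obtain ⟨q, hq⟩ : ∃ q, q = √ℓ := ⟨_, rfl⟩
  have hqq : q * q = ℓ := by rw [hq]; exact mul_self_sqrt (by linarith)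
  rw [← hq] at h1 ⊢
  have hp4 : 0 < 4 / p := by positivity
  have hq1 : 1 ≤ q := by linarith
  have hpq : 4 ≤ p * q := by
    have := mul_le_mul_of_nonneg_left (by linarith : 4 / p ≤ q) hp.le
    rwa [mul_div_cancel₀ _ hp.ne'] at this
  have hkb' : (k' : ℝ) ≤ b := mod_cast (hkb)
  have h2 : ((b * ℓ ^ 2 : ℕ) : ℝ) * (p / q) / 2 = b * (q ^ 2 * (p * q) / 2) := by grind
  rw [h2]
  have h3 : 2 * q ^ 2 ≤ q ^ 2 * (p * q) / 2 := by nlinarith [sq_nonneg q]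
  have h4 : q + 1 ≤ q ^ 2 * (p * q) / 2 := by nlinarith
  have h5 : (b : ℝ) * (q + 1) ≤ b * (q ^ 2 * (p * q) / 2) := by gcongr
  nlinarith

lemma exists_medianKeys {G N : Type} [Fintype G] [Fintype N] {s k' Q : ℕ} {C : ℝ} (hb : 1 ≤ b)
    (hℓ : 1 ≤ ℓ) (hG : ♯(Option G) = k') (hkb : k' ≤ b) (hN : ♯N = b * s)
    (hs : s ≤ ℓ) (hQ : (Q : ℝ) ≤ C * ℓ) (hC : 0 < C) (hn : (2 * C + 3) * (b * (ℓ : ℝ) ^ 3) ≤ n) :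
    ∃ e : Option (MedianKey G N Q (b * ℓ ^ 2)) → Fin n, e.Injective := by
  have hℓ' : (1 : ℝ) ≤ ℓ := mod_cast hℓ
  have hb' : (1 : ℝ) ≤ b := mod_cast hb
  have hsb : (s : ℝ) ≤ ℓ := mod_cast hs
  have hkb' : (k' : ℝ) ≤ b := mod_cast hkb
  have hℓ3 : (ℓ : ℝ) ≤ (ℓ : ℝ) ^ 3 := le_self_pow₀ hℓ' (by norm_num)
  have hℓ23 : (ℓ : ℝ) ^ 2 ≤ (ℓ : ℝ) ^ 3 := pow_le_pow_right₀ hℓ' (by norm_num)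
  have hbℓ : 1 ≤ b * (ℓ : ℝ) ^ 3 := one_le_mul_of_one_le_of_one_le hb' (hℓ'.trans hℓ3)
  have hcard : ♯(Option (MedianKey G N Q (b * ℓ ^ 2))) ≤ ♯(Fin n) := by
    rw [Fintype.card_option, Fintype.card_sum, Fintype.card_prod, Fintype.card_sum,
      Fintype.card_sum, hG, hN]
    simp only [Fintype.card_fin]
    have h1 : ((Q * (k' + b * s) + (b * s + b * ℓ ^ 2) + 1 : ℕ) : ℝ) ≤ n := by
      push_cast
      have h2 : (b : ℝ) * s ≤ b * ℓ := by gcongr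
      have h3 : (k' : ℝ) + b * s ≤ 2 * (b * ℓ) := by nlinarith
      have h4 : (Q : ℝ) * (k' + b * s) ≤ C * ℓ * (2 * (b * ℓ)) := by gcongr
      have h5 : C * ℓ * (2 * (b * ℓ)) ≤ 2 * C * (b * (ℓ : ℝ) ^ 3) := by
        calc C * ℓ * (2 * (b * ℓ)) = 2 * C * (b * (ℓ : ℝ) ^ 2) := by ring
          _ ≤ _ := by gcongr
      have h6 : (b : ℝ) * ℓ ≤ b * (ℓ : ℝ) ^ 3 := by gcongr
      have h7 : (b : ℝ) * (ℓ : ℝ) ^ 2 ≤ b * (ℓ : ℝ) ^ 3 := by gcongr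
      linarith
    exact_mod_cast h1
  obtain ⟨f⟩ := Function.Embedding.nonempty_of_card_le hcard
  exact ⟨f, f.injective⟩

theorem median_attack (κ c : ℝ) : ∃ (C : ℝ) (ℓ₀ : ℕ), 0 < C ∧
    ∀ (kind : SketchKind) (n ℓ b k k' : ℕ) (M : Estimator n ℓ b),
      ℓ₀ ≤ ℓ → 1 ≤ b → 1 ≤ k → (b : ℝ) ≤ κ * k → 3 * k' ≤ b →
      C * b * (ℓ : ℝ) ^ 3 ≤ n → C * log n ≤ ℓ → IsMedianEstimator k' M → ∃ Q : ℕ, (Q : ℝ) ≤ C * ℓ ∧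
        AdmitsAttack (measurementLaw kind n ℓ b) id M.respond k Q (1 - (ℓ : ℝ) ^ (-c)) := by
  obtain ⟨β, ℓ₁, hβ, hβ1, hcoll⟩ := exists_median_collection
  obtain ⟨p, ℓ₂, hp, hflip⟩ := exists_medianOn_ne_zero
  obtain ⟨C, hC, hrounds⟩ := median_rounds (κ := κ) hβ hβ1
  obtain ⟨ℓ₃, hℓ₃, hsq⟩ := exists_le_sqrt (4 / p + 1)
  have hev : ∀ᶠ ℓ : ℕ in Filter.atTop, ℓ₁ ≤ ℓ ∧ ℓ₂ ≤ ℓ ∧ ℓ₃ ≤ ℓ ∧ 10 ^ 10 ≤ ℓ ∧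
      (11 * C + 8) * (ℓ : ℝ) ^ 1 * exp (-(1 / 40000) * √ℓ) ≤ (ℓ : ℝ) ^ (-c) :=
    (Filter.eventually_ge_atTop _).and ((Filter.eventually_ge_atTop _).and
      ((Filter.eventually_ge_atTop _).and ((Filter.eventually_ge_atTop _).and
        (eventually_mul_exp_le _ _ c 1 (by norm_num)))))
  obtain ⟨ℓ₀, hℓ₀⟩ := Filter.eventually_atTop.1 hev
  refine ⟨2 * C + 103, ℓ₀, by linarith, ?_⟩
  intro kind n ℓ b k k' M hℓ hb hk hκ hk' hn hlog hM
  obtain ⟨l1, l2, l3, l4, l5⟩ := hℓ₀ ℓ hℓ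
  have hℓ1 : 1 ≤ ℓ := hℓ₃.trans l3
  have hℓ' : (1 : ℝ) ≤ ℓ := mod_cast hℓ1
  have hb' : (1 : ℝ) ≤ b := mod_cast hb
  have hℓ3 : (ℓ : ℝ) ≤ (ℓ : ℝ) ^ 3 := le_self_pow₀ hℓ' (by norm_num)
  have hbℓ : 1 ≤ b * (ℓ : ℝ) ^ 3 := one_le_mul_of_one_le_of_one_le hb' (hℓ'.trans hℓ3)
  have hn1 : (1 : ℝ) ≤ n := by nlinarith
  rcases Nat.eq_zero_or_pos k' with rfl | hk'0
  · refine ⟨1, by push_cast; nlinarith, ?_⟩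
    exact median_attack_of_zero (by positivity) hb hk (mod_cast hn1) hM
  obtain ⟨Q, A₀, hQ, hA₀, hA1, hheavy, htot⟩ := hrounds ℓ hℓ1
  obtain ⟨I, hI⟩ : ∃ I, I = 2 * (12 * Q + 17 * ℓ) + 1 := ⟨_, rfl⟩
  rw [← hI] at htot
  push_cast at htot
  obtain ⟨s, hs⟩ : ∃ s, s = noiseRate ℓ := ⟨_, rfl⟩
  have hs1 : 1 ≤ s ∧ s ≤ ℓ ∧ ℓ ≤ 10 ^ 10 * s := by rw [hs]; unfold noiseRate; omega
  obtain ⟨hs1, hs2, hs3⟩ := hs1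
  obtain ⟨j, hj⟩ : ∃ j, j = b * (ℓ / 10 ^ 10) := ⟨_, rfl⟩
  have hN : ♯(Bool × Fin j) = b * s := by
    rw [Fintype.card_prod, Fintype.card_bool, Fintype.card_fin, hs, hj, noiseRate]; ring
  have hG : ♯(Option (Fin (k' - 1))) = k' := by
    rw [Fintype.card_option, Fintype.card_fin]; omega
  have hsb : (s : ℝ) ≤ ℓ := mod_cast hs2
  refine ⟨Q + I, by push_cast; nlinarith, ?_⟩
  obtain ⟨e, he⟩ := exists_medianKeys (n := n) (G := Fin (k' - 1)) hb hℓ1 hG (by omega) hN hs2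
    (by linarith : (Q : ℝ) ≤ C * ℓ) hC (by linarith)
  obtain ⟨a, ha⟩ : ∃ a, a = 8 * (b * s) + 4 := ⟨_, rfl⟩
  refine admitsAttack_of_cols hb M (e none) (fun bits => medianQuery a (2 * a + 2) A₀ e bits)
    (Q₀ := Q) (by positivity) (fun bits hbits => ?_) ?_
  · refine isHeavyHitter_medianQuery he hN hk hA1 ?_ bits hbits
    have h1 : (((Q + 1) * (b * s) : ℕ) : ℝ) < ((k * A₀ ^ 2 : ℕ) : ℝ) := by
      push_cast
      calc ((Q : ℝ) + 1) * (b * s) ≤ (Q + 1) * ((κ * k) * ℓ) := by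
            gcongr
            exact (by linarith : (0 : ℝ) ≤ b).trans hκ
        _ = k * ((Q + 1) * κ * ℓ) := by ring
        _ < k * (A₀ : ℝ) ^ 2 := by gcongr
    exact_mod_cast h1
  have hexp : 2 * exp (-((1 / 100 : ℝ) ^ 2 / 4 * ℓ)) ≤ 1 / 100 := by
    have h1 : (10 : ℝ) ^ 10 ≤ ℓ := mod_cast l4
    have h2 := add_one_le_exp ((1 / 100 : ℝ) ^ 2 / 4 * ℓ)
    have h3 : (200 : ℝ) ≤ exp ((1 / 100 : ℝ) ^ 2 / 4 * ℓ) := by linarith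
    rw [exp_neg]
    have h4 := inv_anti₀ (by norm_num) h3
    linarith
  refine (median_reported_le kind hb hs1 hN hs2 (mod_cast hs3) hexp hG (by omega) hM he
    (by rw [hN]; omega) le_rfl hA₀ (by omega) (by positivity) (fun κ₀ h1 h2 => ?_)
    fun c₀ h => hflip kind c₀ l2 hb h).trans ((median_error_le (C := C) hℓ1 ?_ ?_ ?_ ?_).trans l5)
  · refine hcoll kind l1 hb (by omega) (by omega) ?_ (by rwa [hG]) ((Fintype.card_fin _).trans hj) h1
      h2 hQ
    rw [hN, ← hs]
    push_cast
    exact lt_add_one _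
  · have h1 : 0 ≤ log n := log_nonneg hn1
    have h2 : 100 * log n ≤ ℓ := by nlinarith
    calc (n : ℝ) = exp (log n) := (exp_log (by linarith)).symm
      _ ≤ _ := exp_le_exp.2 (by linarith)
  · linarith
  · linarith
  · exact zero_keys_exponent hp hb (by omega) hℓ1 (hsq ℓ l3)

end SketchAttack

end

theorem mainTheorem2 :
    -- the median estimator
    (∀ κ c : ℝ, 0 < c → ∃ (C : ℝ) (ℓ₀ : ℕ), 0 < C ∧
      ∀ (kind : SketchAttack.SketchKind) (n ℓ b k k' : ℕ) (M : SketchAttack.Estimator n ℓ b),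
        ℓ₀ ≤ ℓ → 1 ≤ b → 1 ≤ k → (b : ℝ) ≤ κ * k → 3 * k' ≤ b →
        C * b * (ℓ : ℝ) ^ 3 ≤ n → C * Real.log n ≤ ℓ →
        SketchAttack.IsMedianEstimator k' M →
        ∃ Q : ℕ, (Q : ℝ) ≤ C * ℓ ∧
          SketchAttack.AdmitsAttack (SketchAttack.measurementLaw kind n ℓ b) id M.respond k Q
            (1 - (ℓ : ℝ) ^ (-c))) ∧
    -- the basic threshold sign-alignment estimator
    (∀ τ κ c : ℝ, 1 / 2 < τ → τ < 1 → 0 < c → ∃ (C : ℝ) (ℓ₀ : ℕ), 0 < C ∧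
      ∀ (kind : SketchAttack.SketchKind) (n ℓ b k : ℕ),
        ℓ₀ ≤ ℓ → 1 ≤ b → 1 ≤ k → (b : ℝ) ≤ κ * k → C * b * (ℓ : ℝ) ^ 3 ≤ n →
        ∃ Q : ℕ, (Q : ℝ) ≤ C * ℓ ∧
          SketchAttack.AdmitsAttack (SketchAttack.measurementLaw kind n ℓ b) id
            (SketchAttack.basicThresholdEstimator n ℓ b τ).respond k Q (1 - (ℓ : ℝ) ^ (-c))) ∧
    -- the robust threshold sign-alignment estimator
    (∀ C₁ C₂ τ c : ℝ, 0 < C₁ → 0 < C₂ → 1 / 2 < τ → τ < 1 → 0 < c →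
      ∃ (C : ℝ) (ℓ₀ : ℕ), 0 < C ∧
      ∀ (kind : SketchAttack.SketchKind) (n ℓ b k L m : ℕ),
        ℓ₀ ≤ ℓ → 1 ≤ b → 1 ≤ k → ℓ ≤ n → 1 ≤ L → L ≤ m →
        ∃ Q : ℕ, (Q : ℝ) ≤ C * (ℓ : ℝ) ^ 2 ∧
          SketchAttack.AdmitsAttack (SketchAttack.robustLaw kind n ℓ b) Prod.fst
            (SketchAttack.robustRespond (SketchAttack.robustParams C₁ C₂ τ n ℓ b L m)) k Q
            (1 - (ℓ : ℝ) ^ (-c))) := by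
  refine ⟨?_, ?_, ?_⟩
  · intro κ c _
    exact SketchAttack.median_attack κ c
  · intro τ κ c hτ hτ1 _
    exact SketchAttack.basic_attack τ κ c hτ hτ1
  · intro C₁ C₂ τ c hC₁ hC₂ hτ _ _
    exact SketchAttack.robust_attack C₁ C₂ τ c hC₁ hC₂ (by linarith)
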